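/- Let $p:\mathbb C\to\mathbb R$ be a subharmonic, nonharmonic polynomial. For $\tau\in\mathbb R$ put \[ \bar Z_{\tau p,z}=\frac{\partial}{\partial\bar z}+\tau\frac{\partial p}{\partial\bar z},\quad Z_{\tau p,z}=\frac{\partial}{\partial z}-\tau\frac{\partial p}{\partial z},\quad \bar W_{\tau p,w}=\frac{\partial}{\partial\bar w}-\tau\frac{\partial p}{\partial\bar w},\quad W_{\tau p,w}=\frac{\partial}{\partial w}+\tau\frac{\partial p}{\partial w}, \] and let $\Box_{\tau p}=-\bar Z_{\tau p}Z_{\tau p}=Z_{\tau p}^*Z_{\tau p}$, realized as a nonnegative self-adjoint operator on $L^2(\mathbb C)$ (with $Z_{\tau p}$ the closure of its restriction to $C_c^\infty(\mathbb C)$). Let $H_{\tau p}(s,z,w)$, $s>0$, be the continuous integral kernel of the heat semigroup $e^{-s\Box_{\tau p}}$ with respect to Lebesgue measure $dA$; it exists and is $C^\infty$ in $(\tau,s,z,w)\in\mathbb R\times(0,\infty)\times\mathbb C\times\mathbb C$. Set \[ T(w,z)=-2\,\mathrm{Im}\Big(\sum_{j\ge1}\frac1{j!}\frac{\partial^jp(z)}{\partial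 z^j}(w-z)^j\Big),\qquad M_{\tau p}^{z,w}=\frac{\partial}{\partial\tau}-iT(w,z), \] \[ r(w,\xi,z)=2\,\mathrm{Im}\Big(\sum_{j,k\ge1}\frac1{j!\,k!}\frac{\partial^{j+k}p(\xi)}{\partial\xi^j\partial\bar\xi^k}(w-\xi)^j\,\overline{(z-\xi)}^{\,k}\Big). \] For a finite (possibly empty) word $\beta$ in the two letters $\bar Z_{\tau p},Z_{\tau p}$ let $X^\beta$ be the corresponding product, of order $|\beta|$, and let $U^\beta=(-1)^{|\beta|}(X^\beta)^\sharp$, where $\sharp$ is the distributional (bilinear) adjoint; that is, $U^\beta$ is the product in reverse order of the operators $-\bar Z_{\tau p}^\sharp=\bar W_{\tau p}$ and $-Z_{\tau p}^\sharp=W_{\tau p}$. Then for all $\tau\in\mathbb R$, all integers $n\ge1$, all words $\alpha,\beta$, all $s>0$ and all $z,w\in\mathbb C$, the integral below converges absolutely for every $\varepsilon>0$, the limit exists, and \[ \lim_{\varepsilon\to0^+}\int_{\mathbb C}H_{\tau p}(s,z,\xi)\,U^\alpha_wX^\beta_\xi\,(M_{\tau p}^{\xi,w})^nH_{\tau p}(\varepsilon,\xi,w)\,dA(\xi)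 =(-1)^{|\beta|}\,U^\alpha_w\Big[\,\big(r(w,\xi,z)^n\,U^\beta_\xi H_{\tau p}(s,z,\xi)\big)\big|_{\xi=w}\Big], \] where on the right $\xi=w$ is substituted first and $U^\alpha_w$ is then applied to the resulting function of $w$. (Since $r(w,w,z)=0$ and $n\ge1$, the value of the limit is in fact $0$.) -/

import Mathlib

open MeasureTheory Filter Topology ComplexConjugate
open scoped ContDiff Nat InnerProductSpace

noncomputable section

namespace WeightedHeat

/-! ### The weight -/

/-- `p : ℂ → ℝ` is a real polynomial in the real coordinates of the plane. -/
def IsRealPolynomial (p : ℂ → ℝ) : Prop :=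
  ∃ P : MvPolynomial (Fin 2) ℝ, ∀ z : ℂ, p z = MvPolynomial.eval ![z.re, z.im] P

/-- Subharmonicity of a real-valued function on the plane, by the sub-mean value inequality. -/
def IsSubharmonic (u : ℂ → ℝ) : Prop :=
  UpperSemicontinuous u ∧ ∀ (c : ℂ) (R : ℝ), 0 < R → u c ≤ Real.circleAverage u c R

/-! ### Wirtinger derivatives, Taylor coefficients, twists -/

/-- `∂f/∂z = (∂f/∂x - i ∂f/∂y) / 2`. -/
def dz (f : ℂ → ℂ) (z : ℂ) : ℂ :=
  (1 / 2) * (fderiv ℝ f z 1 - Complex.I * fderiv ℝ f z Complex.I)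

/-- `∂f/∂z̄ = (∂f/∂x + i ∂f/∂y) / 2`. -/
def dzbar (f : ℂ → ℂ) (z : ℂ) : ℂ :=
  (1 / 2) * (fderiv ℝ f z 1 + Complex.I * fderiv ℝ f z Complex.I)

/-- The weight as a complex-valued function. -/
def toC (p : ℂ → ℝ) : ℂ → ℂ := fun z => (p z : ℂ)

/-- `(1 / (j! k!)) ∂^{j+k} p(z) / ∂z^j ∂z̄^k`. -/
def taylorCoeff (p : ℂ → ℝ) (j k : ℕ) (z : ℂ) : ℂ :=
  (1 / ((j ! : ℂ) * (k ! : ℂ))) * (dz^[j] (dzbar^[k] (toC p))) z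

/-- `T(w,z) = -2 Im (∑_{j ≥ 1} (1/j!) ∂^j p(z)/∂z^j (w-z)^j)`; only finitely many terms are nonzero
for a polynomial `p`. -/
def twist (p : ℂ → ℝ) (w z : ℂ) : ℝ :=
  -2 * (∑' j : ℕ, taylorCoeff p (j + 1) 0 z * (w - z) ^ (j + 1)).im

/-- `r(w,ξ,z) = 2 Im (∑_{j,k ≥ 1} a_{jk}(ξ) (w-ξ)^j conj(z-ξ)^k)`, where `a_{jk}` is
`taylorCoeff p j k`; only finitely many terms are nonzero for a polynomial `p`. -/
def twistError (p : ℂ → ℝ) (w ξ z : ℂ) : ℝ :=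
  2 * (∑' j : ℕ, ∑' k : ℕ,
    taylorCoeff p (j + 1) (k + 1) ξ * (w - ξ) ^ (j + 1) * conj (z - ξ) ^ (k + 1)).im

/-! ### The first order operators -/

/-- `Z̄ = ∂/∂z̄ + τ ∂p/∂z̄`. -/
def opZbar (p : ℂ → ℝ) (τ : ℝ) (f : ℂ → ℂ) (z : ℂ) : ℂ :=
  dzbar f z + τ * dzbar (toC p) z * f z

/-- `Z = ∂/∂z - τ ∂p/∂z`. -/
def opZ (p : ℂ → ℝ) (τ : ℝ) (f : ℂ → ℂ) (z : ℂ) : ℂ :=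
  dz f z - τ * dz (toC p) z * f z

/-- `W̄ = ∂/∂w̄ - τ ∂p/∂w̄`, the operator with coefficients conjugate to those of `Z`. -/
def opWbar (p : ℂ → ℝ) (τ : ℝ) (f : ℂ → ℂ) (w : ℂ) : ℂ :=
  dzbar f w - τ * dzbar (toC p) w * f w

/-- `W = ∂/∂w + τ ∂p/∂w`, the operator with coefficients conjugate to those of `Z̄`. -/
def opW (p : ℂ → ℝ) (τ : ℝ) (f : ℂ → ℂ) (w : ℂ) : ℂ :=
  dz f w + τ * dz (toC p) w * f w

/-- The two letters from which the operators `X^β` are built. -/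
inductive Letter
  | Zbar
  | Z

/-- The operator `X` given by a letter: `Z̄` or `Z`. -/
def Letter.X (p : ℂ → ℝ) (τ : ℝ) : Letter → (ℂ → ℂ) → (ℂ → ℂ)
  | .Zbar => opZbar p τ
  | .Z => opZ p τ

/-- The operator `U = -X♯`, where `X♯` is the distributional (bilinear) adjoint of `X`:
`Z̄♯ = -W̄` and `Z♯ = -W`. -/
def Letter.U (p : ℂ → ℝ) (τ : ℝ) : Letter → (ℂ → ℂ) → (ℂ → ℂ)
  | .Zbar => opWbar p τ
  | .Z => opW p τ

/-- `X^β = X₁ X₂ ⋯ X_k` for the word `β = [X₁, …, X_k]`. -/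
def opX (p : ℂ → ℝ) (τ : ℝ) (β : List Letter) (f : ℂ → ℂ) : ℂ → ℂ :=
  β.foldr (fun L g => L.X p τ g) f

/-- `U^β = (-1)^{|β|} (X^β)♯ = U_k ⋯ U₂ U₁` for the word `β = [X₁, …, X_k]`, with `U_i = -X_i♯`. -/
def opU (p : ℂ → ℝ) (τ : ℝ) (β : List Letter) (f : ℂ → ℂ) : ℂ → ℂ :=
  β.foldl (fun g L => L.U p τ g) f

/-- The twisted parameter derivative `M^{z,w} = ∂/∂τ - i T(w,z)`, acting on functions of
`(τ, z, w)`. -/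
def opM (p : ℂ → ℝ) (F : ℝ → ℂ → ℂ → ℂ) : ℝ → ℂ → ℂ → ℂ :=
  fun τ z w => deriv (fun t => F t z w) τ - Complex.I * twist p w z * F τ z w

/-! ### The heat semigroup and the heat kernel -/

/-- `L²(ℂ)` with respect to Lebesgue measure. -/
abbrev L2 : Type := Lp ℂ 2 (volume : Measure ℂ)

/-- The Hilbert space `L²(ℂ) ⊕ L²(ℂ)`. -/
abbrev L2Pair : Type := WithLp 2 (L2 × L2)

/-- The graph of the closed operator `Z` on `L²(ℂ)`: the closure of
`{(ψ, Z ψ) : ψ ∈ C_c^∞(ℂ)}`. -/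
def graphZ (p : ℂ → ℝ) (τ : ℝ) : Submodule ℂ L2Pair :=
  (Submodule.span ℂ {g : L2Pair | ∃ ψ : ℂ → ℂ, ContDiff ℝ ∞ ψ ∧ HasCompactSupport ψ ∧
    g.fst =ᵐ[volume] ψ ∧ g.snd =ᵐ[volume] opZ p τ ψ}).topologicalClosure

instance (p : ℂ → ℝ) (τ : ℝ) : (graphZ p τ).HasOrthogonalProjection := by
  unfold graphZ
  infer_instance

/-- The resolvent `(1 + □)⁻¹` of the self-adjoint operator `□ = -Z̄ Z = Z* Z` on `L²(ℂ)`.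
It maps `f` to the first component of the orthogonal projection of `(f, 0)` to the graph of `Z`;
`boxResolvent_eq_iff` shows that this is the inverse of `1 + Z* Z`. -/
def boxResolvent (p : ℂ → ℝ) (τ : ℝ) : L2 →L[ℂ] L2 :=
  (WithLp.fstL 2 ℂ L2 L2) ∘L (graphZ p τ).starProjection ∘L
    (WithLp.prodContinuousLinearEquiv 2 ℂ L2 L2).symm.toContinuousLinearMap ∘L
      ContinuousLinearMap.inl ℂ L2 L2

/-- `u = (1 + □)⁻¹ f` iff `u` is in the domain of `Z`, `v = Z u` is in the domain of the Hilbert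
space adjoint `Z*`, and `Z* v = f - u`. -/
theorem boxResolvent_eq_iff (p : ℂ → ℝ) (τ : ℝ) (f u : L2) :
    boxResolvent p τ f = u ↔ ∃ v : L2, WithLp.toLp 2 (u, v) ∈ graphZ p τ ∧
      ∀ g ∈ graphZ p τ, ⟪g.snd, v⟫_ℂ = ⟪g.fst, f - u⟫_ℂ := by
  have hR : boxResolvent p τ f
      = ((graphZ p τ).starProjection (WithLp.toLp 2 (f, (0 : L2)))).fst := rfl
  rw [hR]
  constructor
  · intro h
    refine ⟨((graphZ p τ).starProjection (WithLp.toLp 2 (f, (0 : L2)))).snd, ?_, ?_⟩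
    · rw [← h]
      exact Submodule.starProjection_apply_mem _ _
    · intro g hg
      have key := Submodule.starProjection_inner_eq_zero (K := graphZ p τ)
        (WithLp.toLp 2 (f, (0 : L2))) g hg
      rw [inner_eq_zero_symm, WithLp.prod_inner_apply] at key
      simp only [WithLp.ofLp_sub, Prod.fst_sub, Prod.snd_sub, zero_sub, inner_neg_right] at key
      rw [← h]
      exact (add_neg_eq_zero.mp key).symm
  · rintro ⟨v, hv, hv'⟩
    have : (graphZ p τ).starProjection (WithLp.toLp 2 (f, (0 : L2))) = WithLp.toLp 2 (u, v) := by
      apply Submodule.eq_starProjection_of_mem_of_inner_eq_zero hv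
      intro g hg
      rw [inner_eq_zero_symm, WithLp.prod_inner_apply]
      simp only [WithLp.ofLp_sub, Prod.fst_sub, Prod.snd_sub, zero_sub, inner_neg_right]
      exact add_neg_eq_zero.mpr (hv' g hg).symm
    simp [this]

/-- For a self-adjoint operator `A ≥ 0` with resolvent `R = (1 + A)⁻¹` on a Hilbert space, the
operator `e^{-sA}`, `s > 0`, by the spectral theorem (continuous functional calculus of `R`). The
spectral parameter `λ ≥ 0` of `A` corresponds to `x = 1 / (1 + λ)` for `R`, so that
`e^{-sλ} = exp (s (1 - 1 / x))`, extended continuously by `0` to `x = 0`. -/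
def expOfResolvent {H : Type*} [NormedAddCommGroup H] [InnerProductSpace ℂ H] [CompleteSpace H]
    (R : H →L[ℂ] H) (s : ℝ) : H →L[ℂ] H :=
  cfc (fun x : ℝ => if 0 < x then Real.exp (s * (1 - 1 / x)) else 0) R

/-- The heat operator `e^{-s□}` on `L²(ℂ)`, for `s > 0`. -/
def heatOp (p : ℂ → ℝ) (τ s : ℝ) : L2 →L[ℂ] L2 :=
  expOfResolvent (boxResolvent p τ) s

/-- `K` is the (continuous) integral kernel of the heat semigroup `e^{-s□}`, `s > 0`:
`e^{-s□} f (z) = ∫ K(s,z,w) f(w) dA(w)`. This determines `K` on `s > 0`. -/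
structure IsHeatKernel (p : ℂ → ℝ) (τ : ℝ) (K : ℝ → ℂ → ℂ → ℂ) : Prop where
  continuousOn : ContinuousOn (fun q : ℝ × ℂ × ℂ => K q.1 q.2.1 q.2.2) {q | 0 < q.1}
  integrable : ∀ s : ℝ, 0 < s → ∀ (f : L2) (z : ℂ), Integrable (fun w => K s z w * f w)
  represents : ∀ s : ℝ, 0 < s → ∀ f : L2,
    heatOp p τ s f =ᵐ[volume] fun z => ∫ w, K s z w * f w

/-- The heat kernel `H_{τp}(s,z,w)`; only its values for `s > 0` matter. -/
def heatKernel (p : ℂ → ℝ) (τ : ℝ) : ℝ → ℂ → ℂ → ℂ :=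
  Classical.epsilon (IsHeatKernel p τ)

/-- The integrand `H(s,z,ξ) U^α_w X^β_ξ (M^{ξ,w})^n H(ε,ξ,w)`, as a function of `ξ`. -/
def limitIntegrand (p : ℂ → ℝ) (τ : ℝ) (n : ℕ) (α β : List Letter) (s : ℝ) (z w : ℂ) (ε : ℝ)
    (ξ : ℂ) : ℂ :=
  heatKernel p τ s z ξ *
    opU p τ α (fun w' =>
      opX p τ β (fun ξ' => ((opM p)^[n] (fun t ζ η => heatKernel p t ε ζ η)) τ ξ' w') ξ) w

/-- The function `[r(w,ξ,z)^n U^β_ξ H(s,z,ξ)]` of `w` and `ξ`. -/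
def limitBracket (p : ℂ → ℝ) (τ : ℝ) (n : ℕ) (β : List Letter) (s : ℝ) (z w ξ : ℂ) : ℂ :=
  (twistError p w ξ z : ℂ) ^ n * opU p τ β (fun ξ' => heatKernel p τ s z ξ') ξ

end WeightedHeat

end

/-!
The limit is `0`, because the kernels `M^n H(ε, ξ, w)`, `n ≥ 1`, tend to zero in a strong sense as
`ε → 0`: if `H(ε, ξ, w)` tends to the Dirac kernel smoothly in `(τ, w)`, then `∂/∂τ` annihilates the
limit, which does not depend on `τ`, and `T(w, ξ)` annihilates it since it vanishes on the diagonal.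
The right-hand side is `0` as well, since `r(w, w, z) = 0`. Given the convergence, the operators
`X^β` are moved to the Schwartz function `H(s, z, ·)` by parts, and `U^α` acts on the parameter `w`
(`HasTrace.opM`, `HasTrace.tendsto_integral`).

The work is in the regularity of the heat kernel: it is smooth in `(τ, s, z, w)` for `s > 0`, of
temperate growth with all its derivatives in `(τ, z, w)`, a Schwartz function in each point
(`isKernelFamily_heatKernel`), and its integrals against Schwartz functions are smooth in `(τ, w)`
uniformly as `s → 0` (`exists_path`). No pointwise estimates for the kernel are needed. The
operators are treated through the orthogonal projections `P` onto the graphs of `Z` as follows.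

* The resolvent `R = (1 + □)⁻¹` is the compression of `P` to the first summand. With the reflection
  `J : (u, v) ↦ (u, -v)`, the compression of the `n`-th power of `V = (2 P - 1) J` is the Chebyshev
  polynomial `T_n(2 R - 1)` (`compress_pow`). Hence `(1 + □)ʲ exp (-s □)` is a series in the powers
  of the contraction `V`, the coefficients of which are Fourier coefficients of an explicit
  function on the circle. They decrease faster than any power of `n` for `s > 0`; for very
  negative `j` they decrease as fast as needed uniformly in `s ∈ [0, 1]`.
* The commutator of `P` with the weight `(1 + η² |z|²)^(1/2)` is bounded, and `P` is differentiable
  in `τ` at the cost of powers of the weight, because `∂p/∂z` is a polynomial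
  (`WeightedProjections.Pw_compat`, `WeightedProjections.hasDerivAt_Pw`). So `Vⁿ` acts in weighted
  spaces, is smooth in `τ`, and has bounds that are polynomial in `n`; summing the series, one
  finds that the heat operators act in weighted spaces, smoothly in `τ`
  (`exists_weighted_heatPow`).
* Differentiability in `z` and `w` comes from the comparison of `1 + □` with `1 - ∂²/∂z∂z̄`: an
  operator `(1 + □)ʲ exp (-s □)` applied to a symbol times `g` is a combination of similar operators
  applied to symbols times `S g`, with Fourier multipliers `S` of arbitrarily negative order
  (`exists_rep`). The multipliers have kernels with values in `L²`, so that every term has a kernel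
  with derivatives in a weighted space (`exists_smoothForm`). Since the weights on the left are
  arbitrary, the kernel decreases rapidly.
-/

set_option linter.unusedSectionVars false

namespace WeightedHeat

/-! ### Operators acting in a scale of weighted spaces -/

section Scale

variable {B : Type} [NormedRing B] [NormedAlgebra ℝ B] {ι : Type}

/-- A family of operators `A ν τ` together with its conjugates `A ν τ a`, to be thought of as
`m⁻ᵃ (A ν τ) mᵃ` for a weight `m`, the norms growing at most like a power of `g ν`, uniformly
in `τ`. -/
def ScaleBounded (m : B) (g : ι → ℝ) (A : ι → ℝ → ℕ → B) : Prop :=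
  (∀ ν τ a, A ν τ a * m = m * A ν τ (a + 1)) ∧
    ∀ a, ∃ C : ℝ, ∃ N : ℕ, 0 ≤ C ∧ ∀ ν τ, ‖A ν τ a‖ ≤ C * g ν ^ N

/-- `A'` is the derivative of `A` in `τ`, in the sense of operators that lose `r` weights. -/
def HasScaleDeriv (m : B) (r : ℕ) (A A' : ι → ℝ → ℕ → B) : Prop :=
  ∀ ν τ a, HasDerivAt (fun t => m ^ r * A ν t (a + r)) (A' ν τ a) τ

/-- `j` times differentiable in `τ`, each derivative losing a finite number of weights, and with
norms of the derivatives growing at most like a power of `g ν`. -/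
def ScaleSmooth (m : B) (g : ι → ℝ) : ℕ → (ι → ℝ → ℕ → B) → Prop
  | 0, A => ScaleBounded m g A
  | j + 1, A => ScaleBounded m g A ∧ ∃ r A', HasScaleDeriv m r A A' ∧ ScaleSmooth m g j A'

variable {m : B} {g : ι → ℝ}

lemma mul_pow_compat {A : ℕ → B} (h : ∀ a, A a * m = m * A (a + 1)) (r a : ℕ) :
    A a * m ^ r = m ^ r * A (a + r) := by
  induction r with
  | zero => simp
  | succ r ih => rw [pow_succ, ← mul_assoc, ih, mul_assoc, h, mul_assoc, add_assoc]

lemma ScaleSmooth.bounded {j : ℕ} {A : ι → ℝ → ℕ → B} (h : ScaleSmooth m g j A) :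
    ScaleBounded m g A := by
  cases j with
  | zero => exact h
  | succ j => exact h.1

lemma ScaleSmooth.of_succ {j : ℕ} : ∀ {A : ι → ℝ → ℕ → B}, ScaleSmooth m g (j + 1) A →
    ScaleSmooth m g j A := by
  induction j with
  | zero => intro A h; exact h.1
  | succ j ih =>
    rintro A ⟨h, r, A', h1, h2⟩
    exact ⟨h, r, A', h1, ih h2⟩

lemma ScaleBounded.mul (hg : ∀ ν, 1 ≤ g ν) {A A' : ι → ℝ → ℕ → B} (h : ScaleBounded m g A)
    (h' : ScaleBounded m g A') : ScaleBounded m g (fun ν τ a => A ν τ a * A' ν τ a) := by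
  refine ⟨fun ν τ a => ?_, fun a => ?_⟩
  · rw [mul_assoc, h'.1, ← mul_assoc, h.1, mul_assoc]
  · obtain ⟨C, N, hC, hN⟩ := h.2 a
    obtain ⟨C', N', hC', hN'⟩ := h'.2 a
    refine ⟨C * C', N + N', by positivity, fun ν τ => ?_⟩
    have := hg ν
    calc _ ≤ ‖A ν τ a‖ * ‖A' ν τ a‖ := norm_mul_le _ _
      _ ≤ (C * g ν ^ N) * (C' * g ν ^ N') :=
        mul_le_mul (hN ν τ) (hN' ν τ) (norm_nonneg _) (by positivity)
      _ = _ := by ring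

lemma ScaleBounded.add (hg : ∀ ν, 1 ≤ g ν) {A A' : ι → ℝ → ℕ → B} (h : ScaleBounded m g A)
    (h' : ScaleBounded m g A') : ScaleBounded m g (fun ν τ a => A ν τ a + A' ν τ a) := by
  refine ⟨fun ν τ a => ?_, fun a => ?_⟩
  · rw [add_mul, h'.1, h.1, mul_add]
  · obtain ⟨C, N, hC, hN⟩ := h.2 a
    obtain ⟨C', N', hC', hN'⟩ := h'.2 a
    refine ⟨C + C', N + N', by positivity, fun ν τ => ?_⟩
    have h1 := hg ν
    have e1 : g ν ^ N ≤ g ν ^ (N + N') := pow_le_pow_right₀ h1 (by omega)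
    have e2 : g ν ^ N' ≤ g ν ^ (N + N') := pow_le_pow_right₀ h1 (by omega)
    calc _ ≤ ‖A ν τ a‖ + ‖A' ν τ a‖ := norm_add_le _ _
      _ ≤ C * g ν ^ N + C' * g ν ^ N' := add_le_add (hN ν τ) (hN' ν τ)
      _ ≤ C * g ν ^ (N + N') + C' * g ν ^ (N + N') := by gcongr
      _ = _ := by ring

lemma ScaleBounded.const {c : B} (hc : c * m = m * c) :
    ScaleBounded m g (fun (_ : ι) _ _ => c) :=
  ⟨fun _ _ _ => hc, fun _ => ⟨‖c‖, 0, norm_nonneg _, fun _ _ => by simp⟩⟩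

lemma ScaleBounded.shift (e : ℕ) {A : ι → ℝ → ℕ → B} (h : ScaleBounded m g A) :
    ScaleBounded m g (fun ν τ a => A ν τ (a + e)) :=
  ⟨fun ν τ a => by rw [h.1]; congr 2; omega, fun a => h.2 (a + e)⟩

lemma ScaleSmooth.const {c : B} (hc : c * m = m * c) (j : ℕ) :
    ScaleSmooth m g j (fun (_ : ι) _ _ => c) := by
  induction j generalizing c with
  | zero => exact ScaleBounded.const hc
  | succ j ih =>
    refine ⟨ScaleBounded.const hc, 0, fun _ _ _ => 0, fun ν τ a => ?_, ih (by simp)⟩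
    exact hasDerivAt_const _ _

lemma ScaleSmooth.shift (e : ℕ) {j : ℕ} {A : ι → ℝ → ℕ → B} (h : ScaleSmooth m g j A) :
    ScaleSmooth m g j (fun ν τ a => A ν τ (a + e)) := by
  induction j generalizing A with
  | zero => exact ScaleBounded.shift e h
  | succ j ih =>
    obtain ⟨h0, r, A', h1, h2⟩ := h
    refine ⟨h0.shift e, r, _, fun ν τ a => ?_, ih h2⟩
    have := h1 ν τ (a + e)
    rwa [add_right_comm] at this

lemma HasScaleDeriv.raise {r : ℕ} {A A' : ι → ℝ → ℕ → B} (h : HasScaleDeriv m r A A') (e : ℕ) :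
    HasScaleDeriv m (e + r) A (fun ν τ a => m ^ e * A' ν τ (a + e)) := by
  intro ν τ a
  have := (h ν τ (a + e)).const_mul (m ^ e)
  simpa only [← mul_assoc, ← pow_add, add_assoc] using this

lemma ScaleBounded.const_mul {c : B} (hc : c * m = m * c) {A : ι → ℝ → ℕ → B}
    (h : ScaleBounded m g A) : ScaleBounded m g (fun ν τ a => c * A ν τ a) := by
  refine ⟨fun ν τ a => by rw [mul_assoc, h.1, ← mul_assoc, hc, mul_assoc], fun a => ?_⟩
  obtain ⟨C, N, hC, hN⟩ := h.2 a
  refine ⟨‖c‖ * C, N, by positivity, fun ν τ => (norm_mul_le _ _).trans ?_⟩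
  rw [mul_assoc]
  exact mul_le_mul_of_nonneg_left (hN ν τ) (norm_nonneg _)

lemma ScaleSmooth.const_mul {c : B} (hc : c * m = m * c) {j : ℕ} {A : ι → ℝ → ℕ → B}
    (h : ScaleSmooth m g j A) : ScaleSmooth m g j (fun ν τ a => c * A ν τ a) := by
  induction j generalizing A with
  | zero => exact ScaleBounded.const_mul hc h
  | succ j ih =>
    obtain ⟨h0, r, D, h1, h2⟩ := h
    refine ⟨h0.const_mul hc, r, _, fun ν τ a => ?_, ih h2⟩
    have hc' : ∀ x : B, m ^ r * (c * x) = c * (m ^ r * x) := fun x => by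
      rw [← mul_assoc, ← mul_assoc, (Commute.pow_right hc r).eq]
    simpa only [hc'] using (h1 ν τ a).const_mul c

lemma ScaleSmooth.add (hg : ∀ ν, 1 ≤ g ν) {j : ℕ} {A A' : ι → ℝ → ℕ → B}
    (h : ScaleSmooth m g j A) (h' : ScaleSmooth m g j A') :
    ScaleSmooth m g j (fun ν τ a => A ν τ a + A' ν τ a) := by
  induction j generalizing A A' with
  | zero => exact ScaleBounded.add hg h h'
  | succ j ih =>
    obtain ⟨h0, r, D, h1, h2⟩ := h
    obtain ⟨h0', r', D', h1', h2'⟩ := h'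
    have hm : ∀ e : ℕ, m ^ e * m = m * m ^ e := fun e => (Commute.pow_self m e).eq
    have key : ScaleSmooth m g j
        (fun ν τ a => m ^ r' * D ν τ (a + r') + m ^ r * D' ν τ (a + r)) :=
      ih ((h2.shift r').const_mul (hm r')) ((h2'.shift r).const_mul (hm r))
    refine ⟨h0.add hg h0', r' + r, _, fun ν τ a => ?_, key⟩
    have e1 := h1.raise r' ν τ a
    have e2 := h1'.raise r ν τ a
    rw [add_comm r r'] at e2
    simpa only [mul_add] using e1.fun_add e2

lemma ScaleSmooth.mul (hg : ∀ ν, 1 ≤ g ν) {j : ℕ} {A A' : ι → ℝ → ℕ → B}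
    (h : ScaleSmooth m g j A) (h' : ScaleSmooth m g j A') :
    ScaleSmooth m g j (fun ν τ a => A ν τ a * A' ν τ a) := by
  induction j generalizing A A' with
  | zero => exact ScaleBounded.mul hg h h'
  | succ j ih =>
    have hA := h.of_succ
    have hA' := h'.of_succ
    obtain ⟨h0, r, D, h1, h2⟩ := h
    obtain ⟨h0', r', D', h1', h2'⟩ := h'
    have hm : ∀ e : ℕ, m ^ e * m = m * m ^ e := fun e => (Commute.pow_self m e).eq
    refine ⟨h0.mul hg h0', r + r', _, fun ν τ a => ?_,
      (ih h2 ((hA'.shift (r + r')).const_mul (hm r'))).add hg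
        (ih ((hA.shift r).const_mul (hm r)) (h2'.shift r))⟩
    have e1 := (h1 ν τ a).fun_mul (h1' ν τ (a + r))
    refine (e1.congr_deriv ?_).congr_of_eventuallyEq (Eventually.of_forall fun t => ?_)
    · simp only [add_assoc]
    · simp only [mul_assoc, ← mul_assoc (A ν t (a + r)), mul_pow_compat (h0.1 ν t) r' (a + r)]
      rw [pow_add]
      simp only [mul_assoc, add_assoc]

/-- Sums over antidiagonals turn families indexed by pairs into families indexed by `ℕ`. -/
lemma ScaleSmooth.sum_antidiagonal {j : ℕ} {A : ℕ × ℕ → ℝ → ℕ → B}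
    (h : ScaleSmooth m (fun q => (q.1 + q.2 + 1 : ℝ)) j A) :
    ScaleSmooth m (fun n : ℕ => (n + 1 : ℝ)) j
      (fun n τ a => ∑ q ∈ Finset.HasAntidiagonal.antidiagonal n, A q τ a) := by
  have base : ∀ A : ℕ × ℕ → ℝ → ℕ → B, ScaleBounded m (fun q => (q.1 + q.2 + 1 : ℝ)) A →
      ScaleBounded m (fun n : ℕ => (n + 1 : ℝ))
      (fun n τ a => ∑ q ∈ Finset.HasAntidiagonal.antidiagonal n, A q τ a) := by
    intro A h
    refine ⟨fun n τ a => ?_, fun a => ?_⟩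
    · simp only [Finset.sum_mul, Finset.mul_sum, h.1]
    · obtain ⟨C, N, hC, hN⟩ := h.2 a
      refine ⟨C, N + 1, hC, fun n τ => ?_⟩
      calc _ ≤ ∑ q ∈ Finset.HasAntidiagonal.antidiagonal n, ‖A q τ a‖ := norm_sum_le _ _
        _ ≤ ∑ q ∈ Finset.HasAntidiagonal.antidiagonal n, C * (n + 1 : ℝ) ^ N := by
          refine Finset.sum_le_sum fun q hq => (hN q τ).trans_eq ?_
          rw [← Finset.HasAntidiagonal.mem_antidiagonal.1 hq]
          push_cast
          rfl
        _ = _ := by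
          rw [Finset.sum_const, Finset.Nat.card_antidiagonal, nsmul_eq_mul]
          push_cast
          ring
  induction j generalizing A with
  | zero => exact base A h
  | succ j ih =>
    obtain ⟨h0, r, D, h1, h2⟩ := h
    refine ⟨base A h0, r, _, fun n τ a => ?_, ih h2⟩
    simp only [Finset.mul_sum]
    exact HasDerivAt.fun_sum fun q _ => h1 q τ a

lemma ScaleSmooth.reindex {κ : Type} {g' : κ → ℝ} (hg : ∀ ν, 1 ≤ g ν) (f : κ → ι)
    (hf : ∀ k, g (f k) ≤ g' k) {j : ℕ} {A : ι → ℝ → ℕ → B} (h : ScaleSmooth m g j A) :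
    ScaleSmooth m g' j (fun k => A (f k)) := by
  have base : ∀ A : ι → ℝ → ℕ → B, ScaleBounded m g A → ScaleBounded m g' (fun k => A (f k)) := by
    intro A h
    refine ⟨fun k => h.1 (f k), fun a => ?_⟩
    obtain ⟨C, N, hC, hN⟩ := h.2 a
    refine ⟨C, N, hC, fun k τ => (hN _ _).trans ?_⟩
    have := hg (f k)
    have := hf k
    gcongr
  induction j generalizing A with
  | zero => exact base A h
  | succ j ih =>
    obtain ⟨h0, r, D, h1, h2⟩ := h
    exact ⟨base A h0, r, _, fun k τ a => h1 (f k) τ a, ih h2⟩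

/-- After enough weights have been spent, a scale smooth family is of class `C^j` in the norm
topology, with bounds that are uniform in `τ`. -/
lemma ScaleSmooth.contDiff {j : ℕ} {A : ι → ℝ → ℕ → B} (hg : ∀ ν, 1 ≤ g ν)
    (h : ScaleSmooth m g (j + 1) A) :
    ∃ M : ℕ, ∀ a, (∀ ν, ContDiff ℝ j (fun τ => m ^ M * A ν τ (a + M))) ∧
      ∃ C : ℝ, ∃ N : ℕ, 0 ≤ C ∧ ∀ i ≤ j, ∀ ν τ,
        ‖iteratedFDeriv ℝ i (fun τ => m ^ M * A ν τ (a + M)) τ‖ ≤ C * g ν ^ N := by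
  have bd : ∀ {A : ι → ℝ → ℕ → B}, ScaleBounded m g A → ∀ M a, ∃ C : ℝ, ∃ N : ℕ, 0 ≤ C ∧ ∀ ν τ,
      ‖m ^ M * A ν τ (a + M)‖ ≤ C * g ν ^ N := by
    intro A h0 M a
    obtain ⟨C, N, hC, hN⟩ := h0.2 (a + M)
    refine ⟨‖m ^ M‖ * C, N, by positivity, fun ν τ => (norm_mul_le _ _).trans ?_⟩
    rw [mul_assoc]
    exact mul_le_mul_of_nonneg_left (hN ν τ) (norm_nonneg _)
  induction j generalizing A with
  | zero =>
    obtain ⟨h0, r, D, h1, h2⟩ := h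
    refine ⟨r, fun a => ⟨fun ν => ?_, ?_⟩⟩
    · rw [Nat.cast_zero, contDiff_zero, continuous_iff_continuousAt]
      exact fun τ => (h1 ν τ a).continuousAt
    · obtain ⟨C, N, hC, hN⟩ := bd h0 r a
      refine ⟨C, N, hC, fun i hi ν τ => ?_⟩
      obtain rfl : i = 0 := by omega
      simpa using hN ν τ
  | succ j ih =>
    obtain ⟨h0, r, D, h1, h2⟩ := h
    obtain ⟨M, hM⟩ := ih h2
    refine ⟨M + r, fun a => ?_⟩
    obtain ⟨hs, C, N, hC, hN⟩ := hM a
    have hd : ∀ ν τ, HasDerivAt (fun τ => m ^ (M + r) * A ν τ (a + (M + r)))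
        (m ^ M * D ν τ (a + M)) τ := fun ν τ => (HasScaleDeriv.raise h1 M) ν τ a
    have hd' : ∀ ν, deriv (fun τ => m ^ (M + r) * A ν τ (a + (M + r)))
        = fun τ => m ^ M * D ν τ (a + M) := fun ν => funext fun τ => (hd ν τ).deriv
    refine ⟨fun ν => ?_, ?_⟩
    · rw [Nat.cast_succ, contDiff_succ_iff_deriv]
      refine ⟨fun τ => (hd ν τ).differentiableAt, by simp, ?_⟩
      rw [hd']
      exact hs ν
    · obtain ⟨C', N', hC', hN'⟩ := bd h0 (M + r) a
      refine ⟨C + C', N + N', by positivity, fun i hi ν τ => ?_⟩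
      have hg1 := hg ν
      have e1 : g ν ^ N ≤ g ν ^ (N + N') := pow_le_pow_right₀ hg1 (by omega)
      have e2 : g ν ^ N' ≤ g ν ^ (N + N') := pow_le_pow_right₀ hg1 (by omega)
      have e3 : 0 ≤ g ν ^ (N + N') := by positivity
      rcases i with _ | i
      · rw [norm_iteratedFDeriv_zero]
        nlinarith [hN' ν τ, mul_le_mul_of_nonneg_left e2 hC']
      · rw [norm_iteratedFDeriv_eq_norm_iteratedDeriv, iteratedDeriv_succ', hd',
          ← norm_iteratedFDeriv_eq_norm_iteratedDeriv]
        nlinarith [hN i (by omega) ν τ, mul_le_mul_of_nonneg_left e1 hC]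

end Scale

/-! ### Projections onto the graphs of a family of operators, in weighted spaces -/

section Projections

/-- The algebraic properties of the orthogonal projections `P τ` onto the graphs of the operators
`Z = Z_τ`, as operators on the graph space `H ⊕ H`. Here `m` is a bounded multiplication operator,
`m⁻¹` being the weight, which grows at infinity; `W` is the commutator of `Z` with `m⁻¹`, and `b` is
`mᵈ` times the derivative of `-Z` in `τ`, for a `d` that makes it bounded. The operators `W` and `b`
map the first component to the second and vanish on the second one. The involution `J` is
`(u, v) ↦ (u, -v)`. The fields `range_one` and `range_d` say that `(u, v) ↦ (m u, m v - m² W u)`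
preserves the graphs, and that `(u, v) ↦ (mᵈ u, mᵈ v - d mᵈ⁺¹ W u - (τ - σ) b u)` maps the graph for
`σ` into the graph for `τ`. The bounds `norm_W` and `norm_dW` are achieved by a weight that varies
slowly. -/
structure WeightedProjections (B : Type) [NormedRing B] [StarRing B] [NormedAlgebra ℝ B] where
  (m W b J : B) (d : ℕ) (P : ℝ → B)
  m_inj : ∀ x y : B, m * x = m * y → x = y
  star_m : star m = m
  W_m : W * m = m * W
  b_m : b * m = m * b
  J_m : J * m = m * J
  W_W : W * W = 0
  star_P : ∀ τ, star (P τ) = P τ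
  norm_P : ∀ τ, ‖P τ‖ ≤ 1
  norm_one_sub_P : ∀ τ, ‖1 - P τ‖ ≤ 1
  norm_V : ∀ τ, ‖(2 * P τ - 1) * J‖ ≤ 1
  norm_W : ‖m * W‖ ≤ 1 / 4
  norm_dW : d * ‖m * W‖ ≤ 1 / 4
  range_one : ∀ τ, P τ * (m * (1 - m * W)) * P τ = m * (1 - m * W) * P τ
  range_d : ∀ τ σ, P τ * ((m ^ d - (τ - σ) • b) * (1 - (d : ℝ) • (m * W))) * P σ
    = (m ^ d - (τ - σ) • b) * (1 - (d : ℝ) • (m * W)) * P σ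

variable {B : Type} [NormedRing B] [StarRing B] [NormedAlgebra ℝ B]

/-- If `M (1 - U)` preserves the range of the projection `P`, and `M (1 - U')` its kernel, then `P`
and `M` commute up to the given factors. -/
lemma projection_weight {P M U U' : B}
    (h1 : P * (M * (1 - U)) * P = M * (1 - U) * P)
    (h2 : P * (M * (1 - U')) * P = P * (M * (1 - U'))) :
    P * M * (1 - (U * P + U' * (1 - P))) = M * (1 - U) * P := by
  linear_combination (norm := noncomm_ring) h1 - h2

lemma one_sub_projection_weight {P M U U' : B}
    (h : P * M * (1 - (U * P + U' * (1 - P))) = M * (1 - U) * P) :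
    (1 - P) * M * (1 - (U * P + U' * (1 - P))) = M * (1 - U') * (1 - P) := by
  linear_combination (norm := noncomm_ring) -h

namespace WeightedProjections

variable (S : WeightedProjections B)

/-- The commutator of `m⁻¹` with the projection, as an expression in the projection. -/
def comm (X : B) : B := X * star S.W * (1 - X) - (1 - X) * S.W * X

/-- The conjugates `m⁻ᵃ (P τ) mᵃ` of the projection. -/
def Pw (τ : ℝ) : ℕ → B
  | 0 => S.P τ
  | a + 1 => Pw τ a + S.comm (Pw τ a) * S.m

lemma star_W_m : star S.W * S.m = S.m * star S.W := by
  have := congrArg star S.W_m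
  simpa [S.star_m] using this.symm

lemma star_b_m : star S.b * S.m = S.m * star S.b := by
  have := congrArg star S.b_m
  simpa [S.star_m] using this.symm

lemma comm_compat {X Y : B} (h : X * S.m = S.m * Y) :
    S.comm X * S.m = S.m * S.comm Y := by
  have h' : (1 - X) * S.m = S.m * (1 - Y) := by
    linear_combination (norm := noncomm_ring) -h
  unfold comm
  calc _ = X * star S.W * ((1 - X) * S.m) - (1 - X) * S.W * (X * S.m) := by noncomm_ring
    _ = X * (star S.W * S.m) * (1 - Y) - (1 - X) * (S.W * S.m) * Y := by
      rw [h, h']; noncomm_ring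
    _ = (X * S.m) * star S.W * (1 - Y) - ((1 - X) * S.m) * S.W * Y := by
      rw [S.W_m, S.star_W_m]; noncomm_ring
    _ = _ := by rw [h, h']; noncomm_ring

lemma star_mul_self_W : star S.W * star S.W = 0 := by rw [← star_mul, S.W_W, star_zero]

variable [CompleteSpace B] [NormedStarGroup B] [StarModule ℝ B]

lemma isUnit_one_sub (τ : ℝ) {c : ℝ} (hc0 : 0 ≤ c) (hc : c * ‖S.m * S.W‖ ≤ 1 / 4) :
    IsUnit (1 - ((c • (S.m * S.W)) * S.P τ + (c • (S.m * star S.W)) * (1 - S.P τ))) := by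
  apply isUnit_one_sub_of_norm_lt_one
  have e : ‖S.m * star S.W‖ = ‖S.m * S.W‖ := by
    rw [← S.star_W_m, ← norm_star, star_mul, star_star, S.star_m]
  have h1 : ‖c • (S.m * S.W)‖ ≤ 1 / 4 := by rwa [norm_smul, Real.norm_of_nonneg hc0]
  have h2 : ‖c • (S.m * star S.W)‖ ≤ 1 / 4 := by rwa [norm_smul, Real.norm_of_nonneg hc0, e]
  calc _ ≤ ‖(c • (S.m * S.W)) * S.P τ‖ + ‖(c • (S.m * star S.W)) * (1 - S.P τ)‖ :=
        norm_add_le _ _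
    _ ≤ 1 / 4 * 1 + 1 / 4 * 1 := by
      refine add_le_add ((norm_mul_le _ _).trans ?_) ((norm_mul_le _ _).trans ?_)
      · exact mul_le_mul h1 (S.norm_P τ) (norm_nonneg _) (by norm_num)
      · exact mul_le_mul h2 (S.norm_one_sub_P τ) (norm_nonneg _) (by norm_num)
    _ < 1 := by norm_num

/-- Passing to adjoints in an invariance property of the range of a projection. -/
lemma star_range {P M U : B} (hP : star P = P) (hM : star M = M)
    (hU : star U * M = M * star U)
    (h1 : P * (M * (1 - U)) * P = M * (1 - U) * P) :
    P * (M * (1 - star U)) * P = P * (M * (1 - star U)) := by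
  have := congrArg star h1
  simp only [star_mul, star_sub, star_one, hP, hM] at this
  have e : (1 - star U) * M = M * (1 - star U) := by
    linear_combination (norm := noncomm_ring) -hU
  rw [e, ← mul_assoc] at this
  exact this

/-- The projections commute with the weight up to a bounded operator: `m⁻¹ P m = P + [m⁻¹, P] m`,
with `[m⁻¹, P] = comm P`. Both sides are compared after multiplication with an invertible operator
close to `1`. -/
lemma P_mul_m (τ : ℝ) : S.P τ * S.m = S.m * S.Pw τ 1 := by
  have hu := S.isUnit_one_sub τ zero_le_one (by simpa using S.norm_W)
  simp only [one_smul] at hu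
  have hU : star (S.m * S.W) = S.m * star S.W := by rw [star_mul, S.star_m, S.star_W_m]
  have h2 := star_range (S.star_P τ) S.star_m (by
    rw [hU, mul_assoc, S.star_W_m]) (S.range_one τ)
  rw [hU] at h2
  have k1 := projection_weight (S.range_one τ) h2
  have k2 := one_sub_projection_weight k1
  refine hu.mul_right_cancel ?_
  rw [k1]
  have key : S.Pw τ 1 * (1 - (S.m * S.W * S.P τ + S.m * star S.W * (1 - S.P τ)))
      = (1 - S.m * S.W) * S.P τ := by
    have e0 : S.Pw τ 1 = S.P τ + S.comm (S.P τ) * S.m := rfl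
    have e1 : S.comm (S.P τ) * S.m * (1 - (S.m * S.W * S.P τ + S.m * star S.W * (1 - S.P τ)))
        = S.P τ * (S.m * star S.W) * (1 - S.P τ) - (1 - S.P τ) * (S.m * S.W) * S.P τ := by
      unfold comm
      calc _ = S.P τ * star S.W * ((1 - S.P τ) * S.m *
              (1 - (S.m * S.W * S.P τ + S.m * star S.W * (1 - S.P τ))))
            - (1 - S.P τ) * S.W * (S.P τ * S.m *
              (1 - (S.m * S.W * S.P τ + S.m * star S.W * (1 - S.P τ)))) := by noncomm_ring
        _ = S.P τ * ((star S.W * S.m) * (1 - S.m * star S.W)) * (1 - S.P τ)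
            - (1 - S.P τ) * ((S.W * S.m) * (1 - S.m * S.W)) * S.P τ := by
          rw [k1, k2]; noncomm_ring
        _ = _ := by
          have f1 : star S.W * S.m * (1 - S.m * star S.W) = S.m * star S.W := by
            have : S.m * star S.W * (S.m * star S.W) = 0 := by
              calc _ = S.m * (star S.W * S.m) * star S.W := by noncomm_ring
                _ = S.m * S.m * (star S.W * star S.W) := by rw [S.star_W_m]; noncomm_ring
                _ = 0 := by rw [S.star_mul_self_W, mul_zero]
            rw [S.star_W_m, mul_sub, this, mul_one, sub_zero]
          have f2 : S.W * S.m * (1 - S.m * S.W) = S.m * S.W := by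
            have : S.m * S.W * (S.m * S.W) = 0 := by
              calc _ = S.m * (S.W * S.m) * S.W := by noncomm_ring
                _ = S.m * S.m * (S.W * S.W) := by rw [S.W_m]; noncomm_ring
                _ = 0 := by rw [S.W_W, mul_zero]
            rw [S.W_m, mul_sub, this, mul_one, sub_zero]
          rw [f1, f2]
    rw [e0, add_mul, e1]
    noncomm_ring
  rw [mul_assoc S.m (S.Pw τ 1), key, mul_assoc]

lemma Pw_compat (τ : ℝ) (a : ℕ) : S.Pw τ a * S.m = S.m * S.Pw τ (a + 1) := by
  induction a with
  | zero => exact S.P_mul_m τ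
  | succ a ih =>
    have e : S.Pw τ (a + 2) = S.Pw τ (a + 1) + S.comm (S.Pw τ (a + 1)) * S.m := rfl
    rw [e, mul_add, ← mul_assoc, ← S.comm_compat ih, ← ih, ← add_mul]
    rfl

lemma m_pow_inj (k : ℕ) {x y : B} (h : S.m ^ k * x = S.m ^ k * y) : x = y := by
  induction k with
  | zero => simpa using h
  | succ k ih => exact ih (S.m_inj _ _ (by simpa only [pow_succ', mul_assoc] using h))

/-- The first half of the derivative of the projections, which comes from the fact that the range
of `P σ` is mapped to the range of `P τ`. -/
lemma one_sub_mul_Pw (τ σ : ℝ) :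
    (1 - S.P τ) * S.P σ * S.m ^ S.d = (τ - σ) • ((1 - S.P τ) * S.b * S.Pw σ S.d) := by
  have hu := S.isUnit_one_sub σ (Nat.cast_nonneg S.d) S.norm_dW
  have hU : star ((S.d : ℝ) • (S.m * S.W)) = (S.d : ℝ) • (S.m * star S.W) := by
    rw [star_smul, star_mul, S.star_m, S.star_W_m]; simp
  have hWk : star S.W * S.m ^ S.d = S.m ^ S.d * star S.W :=
    (Commute.pow_right (show Commute (star S.W) S.m from S.star_W_m) _).eq
  have r : S.P σ * (S.m ^ S.d * (1 - (S.d : ℝ) • (S.m * S.W))) * S.P σ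
      = S.m ^ S.d * (1 - (S.d : ℝ) • (S.m * S.W)) * S.P σ := by simpa using S.range_d σ σ
  have h2 := star_range (S.star_P σ) (by simp [S.star_m]) (by
    rw [hU, smul_mul_assoc, mul_smul_comm, mul_assoc, hWk, ← mul_assoc, ← mul_assoc,
      (Commute.pow_self S.m S.d).eq]) r
  rw [hU] at h2
  have k1 := projection_weight r h2
  have pc : S.P σ * S.m ^ S.d = S.m ^ S.d * S.Pw σ S.d := by
    simpa [Pw] using mul_pow_compat (S.Pw_compat σ) S.d 0
  have k3 : S.Pw σ S.d * (1 - ((S.d : ℝ) • (S.m * S.W) * S.P σ +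
      (S.d : ℝ) • (S.m * star S.W) * (1 - S.P σ))) = (1 - (S.d : ℝ) • (S.m * S.W)) * S.P σ := by
    apply S.m_pow_inj S.d
    rw [← mul_assoc, ← pc, k1, mul_assoc]
  have k4 : (1 - S.P τ) * (S.m ^ S.d - (τ - σ) • S.b) * S.Pw σ S.d = 0 := by
    refine hu.mul_right_cancel ?_
    rw [mul_assoc, k3, zero_mul, ← mul_assoc]
    have hr := S.range_d τ σ
    generalize S.m ^ S.d - (τ - σ) • S.b = X at hr ⊢
    generalize 1 - (S.d : ℝ) • (S.m * S.W) = U at hr ⊢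
    linear_combination (norm := noncomm_ring) -hr
  rw [mul_assoc, pc, ← mul_assoc, ← sub_eq_zero, ← k4, mul_sub, sub_mul _ _ (S.Pw σ S.d),
    mul_smul_comm, smul_mul_assoc]

/-- A resolvent identity for the projections onto the graphs. In
`P τ - P σ = P τ (1 - P σ) - (1 - P τ) P σ` the second term is given by `one_sub_mul_Pw`, and the
first one is the adjoint of the second one with `τ` and `σ` exchanged. -/
lemma sub_mul_pow (τ σ : ℝ) : (S.P τ - S.P σ) * S.m ^ S.d = (τ - σ) •
    (-(S.P τ * star S.b * (1 - S.Pw σ S.d) + (1 - S.P τ) * S.b * S.Pw σ S.d)) := by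
  have pc : ∀ σ, S.P σ * S.m ^ S.d = S.m ^ S.d * S.Pw σ S.d := fun σ => by
    simpa [Pw] using mul_pow_compat (S.Pw_compat σ) S.d 0
  have hA := S.one_sub_mul_Pw τ σ
  have hB := congrArg star (S.one_sub_mul_Pw σ τ)
  simp only [star_mul, star_smul, star_pow, star_sub, star_one, S.star_m, S.star_P,
    star_trivial] at hB
  have hbk : star S.b * S.m ^ S.d = S.m ^ S.d * star S.b :=
    (Commute.pow_right (show Commute (star S.b) S.m from S.star_b_m) _).eq
  have pcs : star (S.Pw τ S.d) * S.m ^ S.d = S.m ^ S.d * S.P τ := by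
    have := congrArg star (pc τ)
    simp only [star_mul, star_pow, S.star_m, S.star_P] at this
    exact this.symm
  have h3 : S.P τ * (1 - S.P σ) * S.m ^ S.d
      = (σ - τ) • (S.P τ * star S.b * (1 - S.Pw σ S.d)) := by
    apply S.m_pow_inj S.d
    have c1 : (1 - S.P σ) * S.m ^ S.d = S.m ^ S.d * (1 - S.Pw σ S.d) := by
      rw [sub_mul, pc, mul_sub, one_mul, mul_one]
    calc _ = S.m ^ S.d * (S.P τ * (1 - S.P σ)) * S.m ^ S.d := by noncomm_ring
      _ = (σ - τ) • (star (S.Pw τ S.d) * star S.b * ((1 - S.P σ) * S.m ^ S.d)) := by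
        rw [hB, smul_mul_assoc]; noncomm_ring
      _ = (σ - τ) • (star (S.Pw τ S.d) * (star S.b * S.m ^ S.d) * (1 - S.Pw σ S.d)) := by
        rw [c1]; noncomm_ring
      _ = (σ - τ) • ((star (S.Pw τ S.d) * S.m ^ S.d) * star S.b * (1 - S.Pw σ S.d)) := by
        rw [hbk]; noncomm_ring
      _ = _ := by rw [pcs, mul_smul_comm]; noncomm_ring
  calc _ = S.P τ * (1 - S.P σ) * S.m ^ S.d - (1 - S.P τ) * S.P σ * S.m ^ S.d := by noncomm_ring
    _ = _ := by
      rw [h3, hA, ← neg_sub τ σ, neg_smul, smul_neg, smul_add]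
      abel

lemma sub_Pw (τ σ : ℝ) (a : ℕ) :
    S.m ^ S.d * (S.Pw τ (a + S.d) - S.Pw σ (a + S.d)) = (τ - σ) •
      (-(S.Pw τ a * star S.b * (1 - S.Pw σ (a + S.d))
        + (1 - S.Pw τ a) * S.b * S.Pw σ (a + S.d))) := by
  apply S.m_pow_inj a
  have pc : ∀ σ a e, S.Pw σ e * S.m ^ a = S.m ^ a * S.Pw σ (e + a) := fun σ a e =>
    mul_pow_compat (S.Pw_compat σ) a e
  have pc0 : ∀ σ a, S.P σ * S.m ^ a = S.m ^ a * S.Pw σ a := fun σ a => by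
    simpa [Pw] using pc σ a 0
  have hb : S.b * S.m ^ a = S.m ^ a * S.b :=
    (Commute.pow_right (show Commute S.b S.m from S.b_m) _).eq
  have hb' : star S.b * S.m ^ a = S.m ^ a * star S.b :=
    (Commute.pow_right (show Commute (star S.b) S.m from S.star_b_m) _).eq
  have h := congrArg (· * S.m ^ a) (S.sub_mul_pow τ σ)
  have l : S.m ^ a * (S.m ^ S.d * (S.Pw τ (a + S.d) - S.Pw σ (a + S.d)))
      = (S.P τ - S.P σ) * S.m ^ S.d * S.m ^ a := by
    rw [← mul_assoc, ← pow_add, mul_assoc _ (S.m ^ S.d), ← pow_add, add_comm S.d a, mul_sub,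
      ← pc0, ← pc0, sub_mul]
  rw [l, h, smul_mul_assoc, mul_smul_comm]
  congr 1
  have s1 : (1 - S.Pw σ S.d) * S.m ^ a = S.m ^ a * (1 - S.Pw σ (a + S.d)) := by
    rw [sub_mul, pc, mul_sub, one_mul, mul_one, add_comm a]
  have s2 : (1 - S.P τ) * S.m ^ a = S.m ^ a * (1 - S.Pw τ a) := by
    rw [sub_mul, pc0, mul_sub, one_mul, mul_one]
  have s3 : S.Pw σ S.d * S.m ^ a = S.m ^ a * S.Pw σ (a + S.d) := by rw [pc, add_comm]
  calc _ = -(S.P τ * star S.b * ((1 - S.Pw σ S.d) * S.m ^ a)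
          + (1 - S.P τ) * S.b * (S.Pw σ S.d * S.m ^ a)) := by noncomm_ring
    _ = -(S.P τ * (star S.b * S.m ^ a) * (1 - S.Pw σ (a + S.d))
          + (1 - S.P τ) * (S.b * S.m ^ a) * S.Pw σ (a + S.d)) := by
        rw [s1, s3]; noncomm_ring
    _ = -((S.P τ * S.m ^ a) * star S.b * (1 - S.Pw σ (a + S.d))
          + ((1 - S.P τ) * S.m ^ a) * S.b * S.Pw σ (a + S.d)) := by
        rw [hb, hb']; noncomm_ring
    _ = _ := by rw [pc0, s2]; noncomm_ring

end WeightedProjections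
end Projections

/-! ### Powers of a product of two reflections -/

section Powers

open Finset.HasAntidiagonal (antidiagonal)

lemma hasDerivAt_of_sub_eq_smul {E : Type} [NormedAddCommGroup E] [NormedSpace ℝ E]
    {f G : ℝ → E} {x : ℝ} (h : ∀ t, f t - f x = (t - x) • G t) (hG : ContinuousAt G x) :
    HasDerivAt f (G x) x := by
  rw [hasDerivAt_iff_tendsto_slope]
  refine (hG.tendsto.mono_left nhdsWithin_le_nhds).congr' ?_
  filter_upwards [self_mem_nhdsWithin] with t ht
  rw [slope_def_module, h, smul_smul, inv_mul_cancel₀ (sub_ne_zero.2 ht), one_smul]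

lemma hasDerivAt_mul_sub {B : Type} [NormedRing B] [NormedAlgebra ℝ B] {p q : ℝ → B} {x : ℝ}
    {q' : B} (hp : ContinuousAt p x) (hq : HasDerivAt q q' x) :
    HasDerivAt (fun t => p t * (q t - q x)) (p x * q') x := by
  rw [hasDerivAt_iff_tendsto_slope] at hq ⊢
  refine ((hp.tendsto.mono_left nhdsWithin_le_nhds).mul hq).congr fun t => ?_
  simp [slope_def_module]

lemma pow_succ_sub_pow_succ {B : Type} [Ring B] (X Y : B) (n : ℕ) :
    X ^ (n + 1) - Y ^ (n + 1) = ∑ q ∈ antidiagonal n, X ^ q.1 * (X - Y) * Y ^ q.2 := by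
  induction n with
  | zero => simp
  | succ n ih =>
    rw [Finset.Nat.sum_antidiagonal_succ]
    have : ∑ x ∈ antidiagonal n, X ^ (x.1 + 1) * (X - Y) * Y ^ x.2
        = X * ∑ x ∈ antidiagonal n, X ^ x.1 * (X - Y) * Y ^ x.2 := by
      rw [Finset.mul_sum]
      exact Finset.sum_congr rfl fun q _ => by rw [pow_succ']; noncomm_ring
    rw [this, ← ih, pow_succ' X (n + 1), pow_succ' Y (n + 1)]
    noncomm_ring

variable {B : Type} [NormedRing B] [NormedAlgebra ℝ B] {m : B}

lemma pow_compat {X Y : B} (h : X * m = m * Y) (n : ℕ) : X ^ n * m = m * Y ^ n := by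
  have : SemiconjBy m Y X := h.symm
  exact (this.pow_right n).symm

/-- Conjugates of powers of a bounded operator grow at most polynomially when its commutators with
the weight are bounded. -/
lemma ScaleBounded.pow {V F : ℝ → ℕ → B} {CF : ℕ → ℝ} (hc : ∀ τ a, V τ a * m = m * V τ (a + 1))
    (h0 : ∀ τ, ‖V τ 0‖ ≤ 1) (hF : ∀ τ a, V τ (a + 1) = V τ a + F τ a * m)
    (hCF : ∀ τ a, ‖F τ a‖ ≤ CF a) :
    ScaleBounded m (fun n : ℕ => (n + 1 : ℝ)) (fun n τ a => V τ a ^ n) := by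
  refine ⟨fun n τ a => pow_compat (hc τ a) n, fun a => ?_⟩
  induction a with
  | zero =>
    refine ⟨max ‖(1 : B)‖ 1, 0, by positivity, fun n τ => ?_⟩
    rcases n with _ | n
    · simp
    · calc _ ≤ ‖V τ 0‖ ^ (n + 1) := norm_pow_le' _ (by omega)
        _ ≤ 1 := pow_le_one₀ (norm_nonneg _) (h0 τ)
        _ ≤ _ := by simp
  | succ a ih =>
    obtain ⟨C, N, hC, hN⟩ := ih
    have hCF0 : 0 ≤ CF a := (norm_nonneg _).trans (hCF 0 a)
    refine ⟨C + C * CF a * C * ‖m‖ + ‖(1 : B)‖, N + N + 1, by positivity, fun n τ => ?_⟩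
    rcases n with _ | n
    · simp only [pow_zero, CharP.cast_eq_zero, zero_add, one_pow, mul_one]
      have : 0 ≤ C * CF a * C * ‖m‖ := by positivity
      linarith
    · -- telescoping: each of the `n + 1` summands contains one commutator `F τ a`
      have e : V τ (a + 1) ^ (n + 1) = V τ a ^ (n + 1)
          + (∑ q ∈ antidiagonal n, V τ a ^ q.1 * F τ a * V τ a ^ q.2) * m := by
        have := pow_succ_sub_pow_succ (V τ a) (V τ (a + 1)) n
        rw [sub_eq_iff_eq_add] at this
        rw [this, add_right_comm, Finset.sum_mul, ← Finset.sum_add_distrib]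
        refine right_eq_add.2 (Finset.sum_eq_zero fun q _ => ?_)
        rw [mul_assoc _ (V τ a ^ q.2) m, pow_compat (hc τ a), hF]
        noncomm_ring
      have hs : ‖∑ q ∈ antidiagonal n, V τ a ^ q.1 * F τ a * V τ a ^ q.2‖
          ≤ (n + 1) * (C * CF a * C * ((n + 1 : ℝ) ^ (N + N))) := by
        refine (norm_sum_le_of_le (n := fun _ => C * CF a * C * ((n + 1 : ℝ) ^ (N + N)))
          _ fun q hq => ?_).trans ?_
        · have h1 : (q.1 : ℝ) ≤ n := by
            exact_mod_cast Finset.HasAntidiagonal.antidiagonal.fst_le hq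
          have h2 : (q.2 : ℝ) ≤ n := by
            exact_mod_cast Finset.HasAntidiagonal.antidiagonal.snd_le hq
          calc _ ≤ ‖V τ a ^ q.1‖ * ‖F τ a‖ * ‖V τ a ^ q.2‖ := norm_mul₃_le
            _ ≤ (C * (q.1 + 1 : ℝ) ^ N) * CF a * (C * (q.2 + 1 : ℝ) ^ N) :=
              mul_le_mul (mul_le_mul (hN _ _) (hCF _ _) (norm_nonneg _) (by positivity))
                (hN _ _) (norm_nonneg _) (by positivity)
            _ ≤ (C * (n + 1 : ℝ) ^ N) * CF a * (C * (n + 1 : ℝ) ^ N) := by gcongr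
            _ = _ := by rw [pow_add]; ring
        · rw [Finset.sum_const, Finset.Nat.card_antidiagonal, nsmul_eq_mul]
          push_cast
          exact le_rfl
      push_cast
      have b1 : ((n : ℝ) + 1) ^ N ≤ (n + 1 : ℝ) ^ (N + N + 1) :=
        pow_le_pow_right₀ (by linarith [n.cast_nonneg (α := ℝ)]) (by omega)
      have b2 : (n + 1 : ℝ) ≤ n + 1 + 1 := by linarith
      calc _ ≤ ‖V τ a ^ (n + 1)‖ + ‖_‖ * ‖m‖ := by
            rw [e]; exact (norm_add_le _ _).trans (by gcongr; exact norm_mul_le _ _)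
        _ ≤ C * (n + 1 + 1 : ℝ) ^ N + (n + 1) * (C * CF a * C * ((n + 1 : ℝ) ^ (N + N))) * ‖m‖ := by
            have := hN (n + 1) τ
            push_cast at this
            gcongr
        _ = C * (n + 1 + 1 : ℝ) ^ N + C * CF a * C * ‖m‖ * (n + 1 : ℝ) ^ (N + N + 1) := by ring
        _ ≤ C * (n + 1 + 1 : ℝ) ^ (N + N + 1)
              + C * CF a * C * ‖m‖ * (n + 1 + 1 : ℝ) ^ (N + N + 1) := by
            gcongr
            · linarith
            · omega
        _ ≤ _ := by
            have : 0 ≤ ‖(1 : B)‖ * (n + 1 + 1 : ℝ) ^ (N + N + 1) := by positivity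
            linarith

lemma ScaleSmooth.of_succ_index {j : ℕ} {A : ℕ → ℝ → ℕ → B} {c : B} (hc : c * m = m * c)
    (h0 : ∀ τ a, A 0 τ a = c)
    (h : ScaleSmooth m (fun n : ℕ => (n + 1 : ℝ)) j (fun n => A (n + 1))) :
    ScaleSmooth m (fun n : ℕ => (n + 1 : ℝ)) j A := by
  have base : ∀ {A : ℕ → ℝ → ℕ → B} {c : B}, c * m = m * c → (∀ τ a, A 0 τ a = c) →
      ScaleBounded m (fun n : ℕ => (n + 1 : ℝ)) (fun n => A (n + 1)) →
      ScaleBounded m (fun n : ℕ => (n + 1 : ℝ)) A := by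
    intro A c hc h0 h
    refine ⟨fun n τ a => ?_, fun a => ?_⟩
    · rcases n with _ | n
      · rw [h0, h0, hc]
      · exact h.1 n τ a
    · obtain ⟨C, N, hC, hN⟩ := h.2 a
      refine ⟨C + ‖c‖, N, by positivity, fun n τ => ?_⟩
      rcases n with _ | n
      · rw [h0]; simp [hC]
      · have h1 : (n + 1 : ℝ) ^ N ≤ (n + 1 + 1 : ℝ) ^ N := by gcongr; linarith
        have h2 : 0 ≤ ‖c‖ * (n + 1 + 1 : ℝ) ^ N := by positivity
        push_cast
        calc _ ≤ _ := hN n τ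
          _ ≤ C * (n + 1 + 1 : ℝ) ^ N := by gcongr
          _ ≤ _ := by linarith
  induction j generalizing A c with
  | zero => exact base hc h0 h
  | succ j ih =>
    obtain ⟨hb, r, D, h1, h2⟩ := h
    refine ⟨base hc h0 hb, r, fun n => n.casesOn (fun _ _ => 0) D, fun n τ a => ?_,
      ih (c := 0) (by simp) (fun _ _ => rfl) h2⟩
    rcases n with _ | n
    · simp only [h0]
      exact hasDerivAt_const _ _
    · exact h1 n τ a

/-- Powers of a family that is smooth in the scale are smooth in the scale, with polynomial growth
in the exponent. -/
lemma ScaleSmooth.pow {V : ℝ → ℕ → B}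
    (hV : ∀ j, ScaleSmooth m (fun _ : ℕ × ℕ => (1 : ℝ)) j (fun _ => V))
    (hb : ScaleBounded m (fun n : ℕ => (n + 1 : ℝ)) (fun n τ a => V τ a ^ n)) (j : ℕ) :
    ScaleSmooth m (fun n : ℕ => (n + 1 : ℝ)) j (fun n τ a => V τ a ^ n) := by
  induction j with
  | zero => exact hb
  | succ j ih =>
    obtain ⟨hV0, r, D, hD, hDs⟩ := hV (j + 1)
    have hc := hV0.1 (0, 0)
    have hm : m ^ r * m = m * m ^ r := (Commute.pow_self m r).eq
    have hpair : ∀ q : ℕ × ℕ, (1 : ℝ) ≤ q.1 + q.2 + 1 := fun q => by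
      have : (0 : ℝ) ≤ (q.1 : ℝ) + q.2 := by positivity
      linarith
    have hn : ∀ n : ℕ, (1 : ℝ) ≤ n + 1 := fun n => by linarith [n.cast_nonneg (α := ℝ)]
    -- `D` does not depend on its index
    have hD' : ∀ τ a, HasDerivAt (fun t => m ^ r * V t (a + r)) (D (0, 0) τ a) τ :=
      fun τ a => hD (0, 0) τ a
    have s1 : ScaleSmooth m (fun q : ℕ × ℕ => (q.1 + q.2 + 1 : ℝ)) j
        (fun q τ a => m ^ r * V τ (a + r) ^ q.1) :=
      ((ih.reindex hn Prod.fst (fun q => by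
        have : (0 : ℝ) ≤ q.2 := by positivity
        linarith)).shift r).const_mul hm
    have s2 : ScaleSmooth m (fun q : ℕ × ℕ => (q.1 + q.2 + 1 : ℝ)) j
        (fun _ τ a => D (0, 0) τ (a + r)) :=
      (hDs.reindex (fun _ => le_rfl) (fun _ => (0, 0)) hpair).shift r
    have s3 : ScaleSmooth m (fun q : ℕ × ℕ => (q.1 + q.2 + 1 : ℝ)) j
        (fun q τ a => V τ (a + (r + r)) ^ q.2) :=
      (ih.reindex hn Prod.snd (fun q => by
        have : (0 : ℝ) ≤ q.1 := by positivity
        linarith)).shift (r + r)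
    have key := ((s1.mul hpair s2).mul hpair s3).sum_antidiagonal
    have hcont : ∀ σ a i, ContinuousAt (fun t => m ^ r * V t (a + r) ^ i) σ := by
      intro σ a i
      rcases i with _ | i
      · simpa using continuousAt_const
      obtain ⟨C, N, hC, hN⟩ := hb.2 a
      have hq := (hD' σ a).continuousAt
      rw [ContinuousAt, tendsto_iff_norm_sub_tendsto_zero] at hq ⊢
      have e : ∀ t, m ^ r * V t (a + r) ^ (i + 1) - m ^ r * V σ (a + r) ^ (i + 1)
          = ∑ q ∈ antidiagonal i, V t a ^ q.1 * (m ^ r * V t (a + r) - m ^ r * V σ (a + r))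
            * V σ (a + r) ^ q.2 := by
        intro t
        rw [← mul_sub, pow_succ_sub_pow_succ, Finset.mul_sum]
        refine Finset.sum_congr rfl fun q _ => ?_
        have hp : m ^ r * V t (a + r) ^ q.1 = V t a ^ q.1 * m ^ r :=
          (pow_compat (mul_pow_compat (hc t) r a) q.1).symm
        calc _ = m ^ r * V t (a + r) ^ q.1 * (V t (a + r) - V σ (a + r)) * V σ (a + r) ^ q.2 := by
              noncomm_ring
          _ = _ := by rw [hp]; noncomm_ring
      have hz : Tendsto (fun t => ∑ q ∈ antidiagonal i, (C * (q.1 + 1 : ℝ) ^ N)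
          * ‖m ^ r * V t (a + r) - m ^ r * V σ (a + r)‖ * ‖V σ (a + r) ^ q.2‖) (𝓝 σ) (𝓝 0) := by
        rw [show (0 : ℝ) = ∑ q ∈ antidiagonal i, (C * (q.1 + 1 : ℝ) ^ N) * 0
          * ‖V σ (a + r) ^ q.2‖ by simp]
        exact tendsto_finsetSum _ fun q _ => (hq.const_mul _).mul_const _
      refine squeeze_zero (fun _ => norm_nonneg _) (fun t => ?_) hz
      rw [e]
      refine (norm_sum_le _ _).trans (Finset.sum_le_sum fun q _ => (norm_mul₃_le).trans ?_)
      gcongr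
      exact hN q.1 t
    refine ScaleSmooth.of_succ_index (c := 1) (by simp) (by simp)
      ⟨⟨fun n => hb.1 (n + 1), fun a => ?_⟩, r + r, _, fun n σ a => ?_, key⟩
    · obtain ⟨C, N, hC, hN⟩ := hb.2 a
      refine ⟨C * 2 ^ N, N, by positivity, fun n τ => (hN (n + 1) τ).trans ?_⟩
      rw [mul_assoc, ← mul_pow]
      push_cast
      gcongr
      linarith [n.cast_nonneg (α := ℝ)]
    · have e : (fun t => m ^ (r + r) * V t (a + (r + r)) ^ (n + 1)) = fun t =>
          (∑ q ∈ antidiagonal n, m ^ r * V t (a + r) ^ q.1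
            * (m ^ r * V t (a + r + r) - m ^ r * V σ (a + r + r)) * V σ (a + (r + r)) ^ q.2)
          + m ^ (r + r) * V σ (a + (r + r)) ^ (n + 1) := by
        funext t
        rw [← sub_eq_iff_eq_add, ← mul_sub, pow_succ_sub_pow_succ, Finset.mul_sum]
        refine Finset.sum_congr rfl fun q _ => ?_
        have hp : m ^ r * V t (a + (r + r)) ^ q.1 = V t (a + r) ^ q.1 * m ^ r := by
          rw [← add_assoc]
          exact (pow_compat (mul_pow_compat (hc t) r (a + r)) q.1).symm
        calc _ = m ^ r * (m ^ r * V t (a + (r + r)) ^ q.1)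
              * (V t (a + (r + r)) - V σ (a + (r + r))) * V σ (a + (r + r)) ^ q.2 := by
              rw [pow_add]; noncomm_ring
          _ = _ := by rw [hp, add_assoc]; noncomm_ring
      rw [e]
      refine HasDerivAt.add_const _ (HasDerivAt.fun_sum fun q _ => ?_)
      exact (hasDerivAt_mul_sub (hcont σ a q.1) (hD' σ (a + r))).mul_const _

end Powers

/-! ### Smoothness of the reflections and their powers -/

namespace WeightedProjections

variable {B : Type} [NormedRing B] [StarRing B] [NormedAlgebra ℝ B] (S : WeightedProjections B)
  [CompleteSpace B] [NormedStarGroup B] [StarModule ℝ B]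

lemma norm_comm_le {X : B} {C : ℝ} (h : ‖X‖ ≤ C) : ‖S.comm X‖ ≤
    C * ‖star S.W‖ * (‖(1 : B)‖ + C) + (‖(1 : B)‖ + C) * ‖S.W‖ * C := by
  have hC : 0 ≤ C := (norm_nonneg _).trans h
  have h1 : ‖1 - X‖ ≤ ‖(1 : B)‖ + C := (norm_sub_le _ _).trans (by gcongr)
  unfold comm
  refine (norm_sub_le _ _).trans (add_le_add ?_ ?_)
  · exact norm_mul₃_le.trans (by gcongr)
  · exact norm_mul₃_le.trans (by gcongr)

lemma exists_norm_Pw_le (a : ℕ) : ∃ C : ℝ, 0 ≤ C ∧ ∀ τ, ‖S.Pw τ a‖ ≤ C := by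
  induction a with
  | zero => exact ⟨1, zero_le_one, S.norm_P⟩
  | succ a ih =>
    obtain ⟨C, hC, h⟩ := ih
    refine ⟨C + (C * ‖star S.W‖ * (‖(1 : B)‖ + C) + (‖(1 : B)‖ + C) * ‖S.W‖ * C) * ‖S.m‖,
      by positivity, fun τ => ?_⟩
    refine (norm_add_le _ _).trans (add_le_add (h τ) ((norm_mul_le _ _).trans ?_))
    gcongr
    exact S.norm_comm_le (h τ)

lemma scaleBounded_Pw {ι : Type} {g : ι → ℝ} : ScaleBounded S.m g (fun _ => S.Pw) := by
  refine ⟨fun _ => S.Pw_compat, fun a => ?_⟩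
  obtain ⟨C, hC, h⟩ := S.exists_norm_Pw_le a
  exact ⟨C, 0, hC, fun _ τ => by simpa using h τ⟩

/-- The projections onto the graphs are differentiable in `τ`, with a loss of weights. -/
lemma hasDerivAt_Pw (σ : ℝ) (a : ℕ) :
    HasDerivAt (fun t => S.m ^ (S.d + S.d) * S.Pw t (a + (S.d + S.d)))
      (-(S.m ^ S.d * S.Pw σ (a + S.d) * star S.b * (1 - S.Pw σ (a + (S.d + S.d)))
        + (S.m ^ S.d - S.m ^ S.d * S.Pw σ (a + S.d)) * S.b * S.Pw σ (a + (S.d + S.d)))) σ := by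
  have hcont : ContinuousAt (fun t => S.m ^ S.d * S.Pw t (a + S.d)) σ := by
    obtain ⟨C, hC, h⟩ := S.exists_norm_Pw_le a
    rw [ContinuousAt, tendsto_iff_norm_sub_tendsto_zero]
    set C' := C * ‖star S.b‖ * ‖1 - S.Pw σ (a + S.d)‖
      + (‖(1 : B)‖ + C) * ‖S.b‖ * ‖S.Pw σ (a + S.d)‖
    have hz : Tendsto (fun t => |t - σ| * C') (𝓝 σ) (𝓝 0) := by
      have : Tendsto (fun t => |t - σ| * C') (𝓝 σ) (𝓝 (|σ - σ| * C')) :=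
        Continuous.tendsto (by fun_prop) σ
      simpa using this
    refine squeeze_zero (fun _ => norm_nonneg _) (fun t => ?_) hz
    rw [← mul_sub, S.sub_Pw, norm_smul, Real.norm_eq_abs, norm_neg]
    gcongr
    refine (norm_add_le _ _).trans (add_le_add ?_ ?_)
    · exact norm_mul₃_le.trans (by gcongr; exact h t)
    · refine norm_mul₃_le.trans ?_
      gcongr
      exact (norm_sub_le _ _).trans (by gcongr; exact h t)
  refine hasDerivAt_of_sub_eq_smul (G := fun t =>
    (-(S.m ^ S.d * S.Pw t (a + S.d) * star S.b * (1 - S.Pw σ (a + (S.d + S.d)))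
      + (S.m ^ S.d - S.m ^ S.d * S.Pw t (a + S.d)) * S.b * S.Pw σ (a + (S.d + S.d)))))
    (fun t => ?_) ?_
  · rw [← mul_sub, pow_add, mul_assoc, ← add_assoc, S.sub_Pw, mul_smul_comm]
    congr 1
    noncomm_ring
  · exact (((hcont.mul_const _).mul_const _).add
      (((continuousAt_const.sub hcont).mul_const _).mul_const _)).neg

/-- The projections onto the graphs depend smoothly on `τ`, in the scale of weighted spaces. -/
lemma scaleSmooth_Pw {ι : Type} {g : ι → ℝ} (hg : ∀ ν, 1 ≤ g ν) (j : ℕ) :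
    ScaleSmooth S.m g j (fun _ => S.Pw) := by
  induction j with
  | zero => exact S.scaleBounded_Pw
  | succ j ih =>
    have hm : ∀ k, S.m ^ k * S.m = S.m * S.m ^ k := fun k => (Commute.pow_self S.m k).eq
    have cst : ∀ {c : B}, c * S.m = S.m * c → ScaleSmooth S.m g j (fun _ _ _ => c) :=
      fun hc => ScaleSmooth.const hc j
    have neg : ∀ {A : ι → ℝ → ℕ → B}, ScaleSmooth S.m g j A →
        ScaleSmooth S.m g j (fun ν τ a => -1 * A ν τ a) := fun h => h.const_mul (by simp)
    have s1 := (ih.shift S.d).const_mul (hm S.d)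
    have s2 := ih.shift (S.d + S.d)
    have k1 := (s1.mul hg (cst S.star_b_m)).mul hg ((cst (c := 1) (by simp)).add hg (neg s2))
    have k2 := (((cst (hm S.d)).add hg (neg s1)).mul hg (cst S.b_m)).mul hg s2
    refine ⟨S.scaleBounded_Pw, S.d + S.d, _, fun _ σ a => ?_, neg (k1.add hg k2)⟩
    refine (S.hasDerivAt_Pw σ a).congr_deriv ?_
    noncomm_ring

/-- The conjugates of the product of the reflections `2 P - 1` and `J`. -/
def V (τ : ℝ) (a : ℕ) : B := (2 * S.Pw τ a - 1) * S.J

lemma scaleSmooth_V {ι : Type} {g : ι → ℝ} (hg : ∀ ν, 1 ≤ g ν) (j : ℕ) :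
    ScaleSmooth S.m g j (fun _ => S.V) := by
  have h := (((S.scaleSmooth_Pw hg j).const_mul (c := (2 : B))
    (Commute.ofNat_left 2 S.m).eq).add hg (ScaleSmooth.const (c := (-1 : B)) (by simp) j)).mul hg
      (ScaleSmooth.const S.J_m j)
  have e : (fun (_ : ι) => S.V) = fun _ τ a => (2 * S.Pw τ a + -1) * S.J := by
    funext _ τ a
    rw [V, sub_eq_add_neg]
  rw [e]
  exact h

/-- The powers of `V` are smooth in `τ` in the scale, with polynomial growth in the exponent. Without
weights they are bounded by `1`, as powers of a contraction. -/
lemma scaleSmooth_V_pow (j : ℕ) :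
    ScaleSmooth S.m (fun n : ℕ => (n + 1 : ℝ)) j (fun n τ a => S.V τ a ^ n) := by
  refine ScaleSmooth.pow (fun j => S.scaleSmooth_V (fun _ => le_rfl) j) ?_ j
  choose C hC using fun a => S.exists_norm_Pw_le a
  refine ScaleBounded.pow (F := fun τ a => 2 * S.comm (S.Pw τ a) * S.J) (CF := fun a =>
      ‖(2 : B)‖ * (C a * ‖star S.W‖ * (‖(1 : B)‖ + C a) + (‖(1 : B)‖ + C a) * ‖S.W‖ * C a) * ‖S.J‖)
    ((S.scaleSmooth_V (fun _ : Unit => le_rfl (a := (1 : ℝ))) 0).1 ()) S.norm_V (fun τ a => ?_)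
    (fun τ a => ?_)
  · rw [V, V, mul_assoc _ S.J S.m, S.J_m, Pw]
    noncomm_ring
  · refine norm_mul₃_le.trans ?_
    gcongr
    exact S.norm_comm_le ((hC a).2 τ)

end WeightedProjections

/-! ### Chebyshev expansions of the heat multipliers -/

section Chebyshev

/-- `(1 + u²)ʲ uᵏ exp (-s u²)`; the spectral parameter is `u²`. -/
noncomputable def gauss (j : ℤ) (k : ℕ) (s u : ℝ) : ℝ :=
  (1 + u ^ 2) ^ j * u ^ k * Real.exp (-(s * u ^ 2))

/-- `((1 + i u) / (1 - i u))ⁿ`. -/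
noncomputable def cayleyPow (n : ℤ) (u : ℝ) : ℂ :=
  Complex.exp ((2 * n * Real.arctan u : ℝ) * Complex.I)

/-- Fourier coefficients on the circle, in the coordinate `u = tan (θ / 2)`. -/
noncomputable def gaussCoeff (j : ℤ) (k : ℕ) (s : ℝ) (n : ℤ) : ℂ :=
  ∫ u, (gauss j k s u : ℂ) * cayleyPow n u

/-- The functions `gauss j k s`, `s ∈ S`, have a common integrable bound. -/
def GaussBounded (S : Set ℝ) (j : ℤ) (k : ℕ) : Prop :=
  ∃ C : ℝ, ∀ s ∈ S, ∀ u, |gauss j k s u| ≤ C * (1 + u ^ 2)⁻¹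

lemma one_add_sq_pos (u : ℝ) : 0 < 1 + u ^ 2 := by positivity

lemma one_le_one_add_sq (u : ℝ) : 1 ≤ 1 + u ^ 2 := by nlinarith [sq_nonneg u]

lemma abs_pow_le_one_add_sq (k : ℕ) (u : ℝ) : |u| ^ k ≤ (1 + u ^ 2) ^ ((k + 1) / 2) := by
  have h1 : |u| ≤ 1 + u ^ 2 := by nlinarith [sq_nonneg (|u| - 1), sq_abs u, abs_nonneg u]
  have h2 : |u| ^ 2 ≤ 1 + u ^ 2 := by rw [sq_abs]; linarith
  obtain ⟨e, rfl | rfl⟩ := Nat.even_or_odd' k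
  · rw [show (2 * e + 1) / 2 = e by omega, pow_mul]
    exact pow_le_pow_left₀ (by positivity) h2 e
  · rw [show (2 * e + 1 + 1) / 2 = e + 1 by omega, pow_succ, pow_succ, pow_mul]
    exact mul_le_mul (pow_le_pow_left₀ (by positivity) h2 e) h1 (abs_nonneg _)
      (by have := one_add_sq_pos u; positivity)

lemma gaussBounded_of_le {j : ℤ} {k : ℕ} (h : 2 * j + k ≤ -2) :
    GaussBounded (Set.Ici 0) j k := by
  refine ⟨1, fun s hs u => ?_⟩
  have hp := one_add_sq_pos u
  have he : Real.exp (-(s * u ^ 2)) ≤ 1 :=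
    Real.exp_le_one_iff.2 (neg_nonpos.2 (mul_nonneg hs (sq_nonneg u)))
  rw [gauss, abs_mul, abs_mul, abs_of_pos (zpow_pos hp j), abs_pow, Real.abs_exp, one_mul,
    ← zpow_neg_one]
  calc _ ≤ (1 + u ^ 2) ^ j * (1 + u ^ 2) ^ ((k + 1) / 2) * 1 := by
        gcongr
        exact abs_pow_le_one_add_sq k u
    _ = (1 + u ^ 2) ^ (j + ((k + 1) / 2 : ℕ)) := by
        rw [mul_one, zpow_add₀ hp.ne', zpow_natCast]
    _ ≤ _ := zpow_le_zpow_right₀ (one_le_one_add_sq u) (by omega)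

lemma gaussBounded_of_pos {s₀ : ℝ} (hs₀ : 0 < s₀) (j : ℤ) (k : ℕ) :
    GaussBounded (Set.Ici s₀) j k := by
  set N : ℕ := j.natAbs + (k + 1) / 2 + 1
  refine ⟨Real.exp s₀ * N ! / s₀ ^ N, fun s hs u => ?_⟩
  have hp := one_add_sq_pos u
  have he : Real.exp (-(s * u ^ 2)) ≤ Real.exp (-(s₀ * u ^ 2)) := by
    have : s₀ ≤ s := hs
    gcongr
  rw [gauss, abs_mul, abs_mul, abs_of_pos (zpow_pos hp j), abs_pow, Real.abs_exp]
  have h1 : (1 + u ^ 2) ^ j * (1 + u ^ 2) ^ ((k + 1) / 2) ≤ (1 + u ^ 2) ^ N * (1 + u ^ 2)⁻¹ := by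
    rw [← zpow_natCast (1 + u ^ 2) ((k + 1) / 2), ← zpow_natCast (1 + u ^ 2) N, ← zpow_neg_one,
      ← zpow_add₀ hp.ne', ← zpow_add₀ hp.ne']
    exact zpow_le_zpow_right₀ (one_le_one_add_sq u) (by omega)
  have h2 := Real.pow_div_factorial_le_exp (s₀ * (1 + u ^ 2)) (by positivity) N
  have h3 : (1 + u ^ 2) ^ N * Real.exp (-(s₀ * u ^ 2)) ≤ Real.exp s₀ * N ! / s₀ ^ N := by
    rw [div_le_iff₀ (by positivity), mul_pow] at h2
    have e : Real.exp (-(s₀ * u ^ 2)) = Real.exp s₀ * (Real.exp (s₀ * (1 + u ^ 2)))⁻¹ := by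
      rw [← Real.exp_neg, ← Real.exp_add]; ring_nf
    rw [e, le_div_iff₀ (by positivity)]
    calc _ = Real.exp s₀ * (s₀ ^ N * (1 + u ^ 2) ^ N) * (Real.exp (s₀ * (1 + u ^ 2)))⁻¹ := by ring
      _ ≤ Real.exp s₀ * (Real.exp (s₀ * (1 + u ^ 2)) * N !)
          * (Real.exp (s₀ * (1 + u ^ 2)))⁻¹ := by gcongr
      _ = _ := by field_simp
  calc _ ≤ (1 + u ^ 2) ^ j * (1 + u ^ 2) ^ ((k + 1) / 2) * Real.exp (-(s₀ * u ^ 2)) := by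
        gcongr
        exact abs_pow_le_one_add_sq k u
    _ ≤ (1 + u ^ 2) ^ N * (1 + u ^ 2)⁻¹ * Real.exp (-(s₀ * u ^ 2)) := by gcongr
    _ = ((1 + u ^ 2) ^ N * Real.exp (-(s₀ * u ^ 2))) * (1 + u ^ 2)⁻¹ := by ring
    _ ≤ _ := by gcongr

lemma continuous_gauss (j : ℤ) (k : ℕ) (s : ℝ) : Continuous (gauss j k s) := by
  unfold gauss
  have : Continuous fun u : ℝ => (1 + u ^ 2) ^ j :=
    Continuous.zpow₀ (by fun_prop) j (fun u => Or.inl (one_add_sq_pos u).ne')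
  fun_prop

lemma continuous_cayleyPow (n : ℤ) : Continuous (cayleyPow n) := by
  unfold cayleyPow
  have := Real.continuous_arctan
  fun_prop

lemma norm_cayleyPow (n : ℤ) (u : ℝ) : ‖cayleyPow n u‖ = 1 := Complex.norm_exp_ofReal_mul_I _

lemma norm_gauss_mul_cayleyPow (j : ℤ) (k : ℕ) (s : ℝ) (n : ℤ) (u : ℝ) :
    ‖(gauss j k s u : ℂ) * cayleyPow n u‖ = |gauss j k s u| := by
  rw [norm_mul, norm_cayleyPow, mul_one, Complex.norm_real, Real.norm_eq_abs]

lemma GaussBounded.integrable {S : Set ℝ} {j : ℤ} {k : ℕ} (h : GaussBounded S j k) {s : ℝ}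
    (hs : s ∈ S) (n : ℤ) : Integrable (fun u => (gauss j k s u : ℂ) * cayleyPow n u) := by
  obtain ⟨C, hC⟩ := h
  refine (integrable_inv_one_add_sq.const_mul C).mono' ?_ (Eventually.of_forall fun u => ?_)
  · exact ((Complex.continuous_ofReal.comp (continuous_gauss j k s)).mul
      (continuous_cayleyPow n)).aestronglyMeasurable
  · rw [norm_gauss_mul_cayleyPow]
    exact hC s hs u

lemma GaussBounded.norm_gaussCoeff_le {S : Set ℝ} {j : ℤ} {k : ℕ} (h : GaussBounded S j k) :
    ∃ C : ℝ, 0 ≤ C ∧ ∀ s ∈ S, ∀ n, ‖gaussCoeff j k s n‖ ≤ C := by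
  obtain ⟨C, hC⟩ := h
  refine ⟨|C| * Real.pi, by positivity, fun s hs n => ?_⟩
  rw [← integral_univ_inv_one_add_sq, ← integral_const_mul]
  refine norm_integral_le_of_norm_le (integrable_inv_one_add_sq.const_mul _)
    (Eventually.of_forall fun u => ?_)
  rw [norm_gauss_mul_cayleyPow]
  have := one_add_sq_pos u
  exact (hC s hs u).trans (by gcongr; exact le_abs_self C)

lemma hasDerivAt_gauss (j : ℤ) (k : ℕ) (s u : ℝ) : HasDerivAt (gauss j k s)
    (2 * j * gauss (j - 1) (k + 1) s u + k * gauss j (k - 1) s u - 2 * s * gauss j (k + 1) s u)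
    u := by
  have hp := one_add_sq_pos u
  have h1 : HasDerivAt (fun u : ℝ => (1 + u ^ 2) ^ j) (j * (1 + u ^ 2) ^ (j - 1) * (2 * u)) u := by
    have := (hasDerivAt_zpow j (1 + u ^ 2) (Or.inl hp.ne')).comp u
      (((hasDerivAt_pow 2 u).const_add 1))
    refine this.congr_deriv ?_
    simp
  have h2 : HasDerivAt (fun u : ℝ => Real.exp (-(s * u ^ 2)))
      (Real.exp (-(s * u ^ 2)) * (-(s * (2 * u)))) u := by
    have := (((hasDerivAt_pow 2 u).const_mul s).neg).exp
    simpa using this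
  refine ((h1.fun_mul (hasDerivAt_pow k u)).fun_mul h2).congr_deriv ?_
  simp only [gauss]
  ring

lemma hasDerivAt_cayleyPow (n : ℤ) (u : ℝ) : HasDerivAt (cayleyPow n)
    (cayleyPow n u * ((2 * n * (1 + u ^ 2)⁻¹ : ℝ) * Complex.I)) u := by
  have h := ((((Real.hasDerivAt_arctan' u).const_mul (2 * n : ℝ)).ofReal_comp).mul_const
    Complex.I).cexp
  refine (show HasDerivAt (fun u => Complex.exp ((2 * n * Real.arctan u : ℝ) * Complex.I)) _ u
    from h).congr_deriv ?_
  simp [cayleyPow]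

/-- Integration by parts: the logarithmic derivative of `((1 + i u) / (1 - i u))ⁿ` is
`2 n i / (1 + u²)`. -/
lemma gaussCoeff_by_parts {S : Set ℝ} {j : ℤ} {k : ℕ} {s : ℝ} (hs : s ∈ S) (n : ℤ)
    (h0 : GaussBounded S (j + 1) k) (h1 : GaussBounded S j k) (h2 : GaussBounded S j (k + 1))
    (h3 : k ≠ 0 → GaussBounded S (j + 1) (k - 1)) (h4 : GaussBounded S (j + 1) (k + 1)) :
    2 * n * Complex.I * gaussCoeff j k s n =
      -(2 * (j + 1) * gaussCoeff j (k + 1) s n + k * gaussCoeff (j + 1) (k - 1) s n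
        - 2 * s * gaussCoeff (j + 1) (k + 1) s n) := by
  have i3 : Integrable (fun u => (k : ℂ) * ((gauss (j + 1) (k - 1) s u : ℂ) * cayleyPow n u)) := by
    rcases eq_or_ne k 0 with rfl | hk
    · simp
    · exact ((h3 hk).integrable hs n).const_mul _
  have i2 := (h2.integrable hs n).const_mul (2 * (j + 1) : ℂ)
  have i4 := (h4.integrable hs n).const_mul (2 * s : ℂ)
  have i23 : Integrable (fun u => (2 * (j + 1) : ℂ) * ((gauss j (k + 1) s u : ℂ) * cayleyPow n u)
      + (k : ℂ) * ((gauss (j + 1) (k - 1) s u : ℂ) * cayleyPow n u)) := i2.add i3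
  have i1 := (h1.integrable hs n).const_mul (2 * n * Complex.I : ℂ)
  have e1 : ∀ u, ((gauss (j + 1) k s u : ℝ) : ℂ)
      * (cayleyPow n u * ((2 * n * (1 + u ^ 2)⁻¹ : ℝ) * Complex.I))
      = 2 * n * Complex.I * ((gauss j k s u : ℂ) * cayleyPow n u) := by
    intro u
    have hp := (one_add_sq_pos u).ne'
    have : gauss (j + 1) k s u * (1 + u ^ 2)⁻¹ = gauss j k s u := by
      simp only [gauss, zpow_add₀ hp, zpow_one]
      field_simp
    rw [← this]
    push_cast
    ring
  have e2 : ∀ u, ((2 * (j + 1 : ℤ) * gauss (j + 1 - 1) (k + 1) s u + k * gauss (j + 1) (k - 1) s u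
      - 2 * s * gauss (j + 1) (k + 1) s u : ℝ) : ℂ) * cayleyPow n u
      = 2 * (j + 1) * ((gauss j (k + 1) s u : ℂ) * cayleyPow n u)
        + k * ((gauss (j + 1) (k - 1) s u : ℂ) * cayleyPow n u)
        - 2 * s * ((gauss (j + 1) (k + 1) s u : ℂ) * cayleyPow n u) := by
    intro u
    rw [add_sub_cancel_right]
    push_cast
    ring
  have key := integral_mul_deriv_eq_deriv_mul_of_integrable
    (u := fun u => (gauss (j + 1) k s u : ℂ)) (v := cayleyPow n)
    (fun u _ => (hasDerivAt_gauss (j + 1) k s u).ofReal_comp)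
    (fun u _ => hasDerivAt_cayleyPow n u)
    (i1.congr (Eventually.of_forall fun u => (e1 u).symm))
    ((i23.sub i4).congr (Eventually.of_forall fun u => (e2 u).symm))
    (h0.integrable hs n)
  simp only [e1, e2] at key
  rw [integral_const_mul, integral_sub i23 i4, integral_add i2 i3, integral_const_mul,
    integral_const_mul, integral_const_mul] at key
  exact key

/-- Integrating by parts `K` times. Every step raises the order `2 j + k` by at most `3`. -/
lemma norm_gaussCoeff_mul_pow_le {S : Set ℝ} {s₁ : ℝ} (hS : ∀ s ∈ S, |s| ≤ s₁) {e : ℤ}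
    (hD : ∀ (j : ℤ) (k : ℕ), 2 * j + k ≤ e → GaussBounded S j k) (K : ℕ) :
    ∀ (j : ℤ) (k : ℕ), 2 * j + k + 3 * K ≤ e →
      ∃ C : ℝ, 0 ≤ C ∧ ∀ s ∈ S, ∀ n : ℕ, (n : ℝ) ^ K * ‖gaussCoeff j k s n‖ ≤ C := by
  induction K with
  | zero =>
    intro j k h
    obtain ⟨C, hC, hC'⟩ := (hD j k (by simpa using h)).norm_gaussCoeff_le
    exact ⟨C, hC, fun s hs n => by simpa using hC' s hs n⟩
  | succ K ih =>
    intro j k h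
    push_cast at h
    obtain ⟨C1, hC1, h1⟩ := ih j (k + 1) (by push_cast; linarith)
    obtain ⟨C3, hC3, h3⟩ := ih (j + 1) (k + 1) (by push_cast; linarith)
    obtain ⟨C2, hC2, h2⟩ : ∃ C : ℝ, 0 ≤ C ∧ ∀ s ∈ S, ∀ n : ℕ,
        (n : ℝ) ^ K * (k * ‖gaussCoeff (j + 1) (k - 1) s n‖) ≤ C := by
      rcases k with _ | k
      · exact ⟨0, le_rfl, by simp⟩
      · obtain ⟨C, hC, h⟩ := ih (j + 1) k (by push_cast at h ⊢; linarith)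
        refine ⟨(k + 1 : ℕ) * C, by positivity, fun s hs n => ?_⟩
        rw [mul_left_comm]
        exact mul_le_mul_of_nonneg_left (h s hs n) (by positivity)
    refine ⟨2 * |(j + 1 : ℝ)| * C1 + C2 + 2 * |s₁| * C3, by positivity, fun s hs n => ?_⟩
    have key := gaussCoeff_by_parts (j := j) (k := k) hs n (hD _ _ (by linarith))
      (hD _ _ (by linarith)) (hD _ _ (by push_cast; linarith))
      (fun hk => hD _ _ (by
        have : ((k - 1 : ℕ) : ℤ) ≤ k := by omega
        linarith)) (hD _ _ (by push_cast; linarith))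
    have hs1 : |s| ≤ |s₁| := (hS s hs).trans (le_abs_self _)
    have n1 : 2 * (n : ℝ) * ‖gaussCoeff j k s n‖ ≤ 2 * |(j + 1 : ℝ)| * ‖gaussCoeff j (k + 1) s n‖
        + k * ‖gaussCoeff (j + 1) (k - 1) s n‖
        + 2 * |s₁| * ‖gaussCoeff (j + 1) (k + 1) s n‖ := by
      have := congrArg norm key
      rw [norm_neg] at this
      have l : ‖2 * ((n : ℤ) : ℂ) * Complex.I * gaussCoeff j k s n‖
          = 2 * (n : ℝ) * ‖gaussCoeff j k s n‖ := by simp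
      rw [l] at this
      rw [this]
      refine (norm_sub_le _ _).trans (add_le_add ((norm_add_le _ _).trans (add_le_add ?_ ?_)) ?_)
      · rw [norm_mul, norm_mul]
        have : ‖((j : ℂ) + 1)‖ = |(j + 1 : ℝ)| := by
          rw [← Real.norm_eq_abs, ← Complex.norm_real]; push_cast; rfl
        rw [this]; simp
      · simp
      · rw [norm_mul, norm_mul, Complex.norm_real, Real.norm_eq_abs]
        simp only [Complex.norm_ofNat]
        gcongr
    have hn : (0 : ℝ) ≤ (n : ℝ) ^ K := by positivity
    have a1 := mul_le_mul_of_nonneg_left n1 hn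
    have a2 := mul_le_mul_of_nonneg_left (h1 s hs n) (by positivity : 0 ≤ 2 * |(j + 1 : ℝ)|)
    have a3 := mul_le_mul_of_nonneg_left (h3 s hs n) (by positivity : 0 ≤ 2 * |s₁|)
    have a4 := h2 s hs n
    have a5 : 0 ≤ (n : ℝ) ^ (K + 1) * ‖gaussCoeff j k s n‖ := by positivity
    rw [pow_succ] at a5 ⊢
    nlinarith

lemma GaussBounded.mono {S S' : Set ℝ} {j : ℤ} {k : ℕ} (h : GaussBounded S j k) (hS : S' ⊆ S) :
    GaussBounded S' j k := by
  obtain ⟨C, hC⟩ := h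
  exact ⟨C, fun s hs => hC s (hS hs)⟩

/-- The coefficients of `heatMult j s` in Chebyshev polynomials of `2x - 1`, for `k = 0`; for even
`k = 2i`, those of its `i`-th derivative in `s`, up to sign. The index `j - 1` contains the Jacobian
of `θ = 2 arctan u`. -/
noncomputable def heatCoeff (j : ℤ) (k : ℕ) (s : ℝ) (n : ℕ) : ℝ :=
  (if n = 0 then 1 else 2) / Real.pi * (gaussCoeff (j - 1) k s n).re

/-- The function `x⁻ʲ exp (s (1 - 1 / x))` of the resolvent variable `x = (1 + λ)⁻¹`, that is,
`(1 + λ)ʲ exp (-s λ)`, with the value `0` for `x ≤ 0`. -/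
noncomputable def heatMult (j : ℤ) (s x : ℝ) : ℝ :=
  if 0 < x then x ^ (-j) * Real.exp (s * (1 - 1 / x)) else 0

lemma abs_heatCoeff_le_norm (j : ℤ) (k : ℕ) (s : ℝ) (n : ℕ) :
    |heatCoeff j k s n| ≤ ‖gaussCoeff (j - 1) k s n‖ := by
  rw [heatCoeff, abs_mul]
  have h1 : |(if n = 0 then (1 : ℝ) else 2) / Real.pi| ≤ 1 := by
    rw [abs_div, abs_of_pos Real.pi_pos, div_le_one Real.pi_pos]
    have := Real.two_le_pi
    split_ifs <;> simp <;> linarith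
  calc _ ≤ 1 * ‖gaussCoeff (j - 1) k s n‖ := by
        gcongr
        exact Complex.abs_re_le_norm _
    _ = _ := one_mul _

lemma norm_gaussCoeff_le_div {S : Set ℝ} {s₁ : ℝ} (hS : ∀ s ∈ S, |s| ≤ s₁) {e : ℤ}
    (hD : ∀ (j : ℤ) (k : ℕ), 2 * j + k ≤ e → GaussBounded S j k) (K : ℕ)
    (j : ℤ) (k : ℕ) (h : 2 * j + k + 3 * K ≤ e) :
    ∃ C : ℝ, 0 ≤ C ∧ ∀ s ∈ S, ∀ n : ℕ, ‖gaussCoeff j k s n‖ ≤ C / ((n : ℝ) + 1) ^ K := by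
  obtain ⟨C1, hC1, h1⟩ := norm_gaussCoeff_mul_pow_le hS hD 0 j k (by push_cast; linarith)
  obtain ⟨C2, hC2, h2⟩ := norm_gaussCoeff_mul_pow_le hS hD K j k h
  refine ⟨2 ^ K * (C1 + C2), by positivity, fun s hs n => ?_⟩
  rw [le_div_iff₀ (by positivity)]
  have hn : ((n : ℝ) + 1) ^ K ≤ 2 ^ K * (1 + (n : ℝ) ^ K) := by
    rcases Nat.eq_zero_or_pos n with rfl | hn
    · have : (1 : ℝ) ≤ 2 ^ K := one_le_pow₀ (by norm_num)
      have h0 : (0 : ℝ) ≤ (0 : ℝ) ^ K := by positivity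
      simp only [Nat.cast_zero, zero_add, one_pow]
      nlinarith
    · have : (1 : ℝ) ≤ n := by exact_mod_cast hn
      calc ((n : ℝ) + 1) ^ K ≤ (2 * n) ^ K := by gcongr; linarith
        _ = 2 ^ K * (n : ℝ) ^ K := mul_pow _ _ _
        _ ≤ _ := by gcongr; linarith
  have a1 := h1 s hs n
  have a2 := h2 s hs n
  rw [pow_zero, one_mul] at a1
  calc _ ≤ ‖gaussCoeff j k s n‖ * (2 ^ K * (1 + (n : ℝ) ^ K)) := by gcongr
    _ = 2 ^ K * (‖gaussCoeff j k s n‖ + (n : ℝ) ^ K * ‖gaussCoeff j k s n‖) := by ring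
    _ ≤ _ := by gcongr

lemma norm_gaussCoeff_le_of_pos {s₀ : ℝ} (hs₀ : 0 < s₀) (s₁ : ℝ) (j : ℤ) (k K : ℕ) :
    ∃ C : ℝ, 0 ≤ C ∧ ∀ s ∈ Set.Icc s₀ s₁, ∀ n : ℕ,
      ‖gaussCoeff j k s n‖ ≤ C / ((n : ℝ) + 1) ^ K :=
  norm_gaussCoeff_le_div (s₁ := s₁)
    (fun s hs => by rw [abs_of_pos (hs₀.trans_le hs.1)]; exact hs.2) (e := 2 * j + k + 3 * K)
    (fun j k _ => (gaussBounded_of_pos hs₀ j k).mono fun _ h => h.1) K j k le_rfl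

lemma norm_gaussCoeff_le_of_le {j : ℤ} {k K : ℕ} (h : 2 * j + k + 3 * K ≤ -2) :
    ∃ C : ℝ, 0 ≤ C ∧ ∀ s ∈ Set.Icc (0 : ℝ) 1, ∀ n : ℕ,
      ‖gaussCoeff j k s n‖ ≤ C / ((n : ℝ) + 1) ^ K :=
  norm_gaussCoeff_le_div (s₁ := 1) (fun s hs => by rw [abs_of_nonneg hs.1]; exact hs.2) (e := -2)
    (fun j k h => (gaussBounded_of_le h).mono fun _ h => h.1) K j k h

lemma abs_heatCoeff_le_of_pos {s₀ : ℝ} (hs₀ : 0 < s₀) (s₁ : ℝ) (j : ℤ) (k K : ℕ) :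
    ∃ C : ℝ, 0 ≤ C ∧ ∀ s ∈ Set.Icc s₀ s₁, ∀ n : ℕ,
      |heatCoeff j k s n| ≤ C / ((n : ℝ) + 1) ^ K := by
  obtain ⟨C, hC, h⟩ := norm_gaussCoeff_le_of_pos hs₀ s₁ (j - 1) k K
  exact ⟨C, hC, fun s hs n => (abs_heatCoeff_le_norm j k s n).trans (h s hs n)⟩

lemma abs_heatCoeff_le_of_le {j : ℤ} {k K : ℕ} (h : 2 * (j - 1) + k + 3 * K ≤ -2) :
    ∃ C : ℝ, 0 ≤ C ∧ ∀ s ∈ Set.Icc (0 : ℝ) 1, ∀ n : ℕ,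
      |heatCoeff j k s n| ≤ C / ((n : ℝ) + 1) ^ K := by
  obtain ⟨C, hC, h⟩ := norm_gaussCoeff_le_of_le h
  exact ⟨C, hC, fun s hs n => (abs_heatCoeff_le_norm j k s n).trans (h s hs n)⟩

lemma hasDerivAt_gauss_param (j : ℤ) (k : ℕ) (s u : ℝ) :
    HasDerivAt (fun s => gauss j k s u) (-gauss j (k + 2) s u) s := by
  have h : HasDerivAt (fun s : ℝ => Real.exp (-(s * u ^ 2)))
      (Real.exp (-(s * u ^ 2)) * (-(1 * u ^ 2))) s :=
    (((hasDerivAt_id s).mul_const (u ^ 2)).neg).exp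
  refine (h.const_mul ((1 + u ^ 2) ^ j * u ^ k)).congr_deriv ?_
  simp only [gauss]
  ring

/-- The derivative in `s` multiplies the integrand with `-u²`. -/
lemma hasDerivAt_gaussCoeff {s : ℝ} (hs : 0 < s) (j : ℤ) (k : ℕ) (n : ℤ) :
    HasDerivAt (fun s => gaussCoeff j k s n) (-gaussCoeff j (k + 2) s n) s := by
  have hs2 : 0 < s / 2 := by linarith
  obtain ⟨C, hC⟩ := gaussBounded_of_pos hs2 j (k + 2)
  have key := (hasDerivAt_integral_of_dominated_loc_of_deriv_le (𝕜 := ℝ) (μ := volume)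
    (F := fun s u => (gauss j k s u : ℂ) * cayleyPow n u)
    (F' := fun s u => ((-gauss j (k + 2) s u : ℝ) : ℂ) * cayleyPow n u) (x₀ := s)
    (s := Set.Ici (s / 2))
    (bound := fun u => C * (1 + u ^ 2)⁻¹) (Ici_mem_nhds (by linarith))
    (Eventually.of_forall fun s => ((Complex.continuous_ofReal.comp (continuous_gauss j k s)).mul
      (continuous_cayleyPow n)).aestronglyMeasurable)
    ((gaussBounded_of_pos hs j k).integrable (Set.mem_Ici.2 le_rfl) n)
    (((Complex.continuous_ofReal.comp (continuous_gauss j (k + 2) s).neg).mul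
      (continuous_cayleyPow n)).aestronglyMeasurable)
    (Eventually.of_forall fun u t ht => ?_) (integrable_inv_one_add_sq.const_mul C)
    (Eventually.of_forall fun u t _ =>
      (hasDerivAt_gauss_param j k t u).ofReal_comp.mul_const _)).2
  · refine key.congr_deriv ?_
    rw [gaussCoeff, ← integral_neg]
    congr 1
    ext u
    push_cast
    ring
  · rw [Complex.ofReal_neg, neg_mul, norm_neg, norm_gauss_mul_cayleyPow]
    exact hC t ht u

lemma hasDerivAt_heatCoeff {s : ℝ} (hs : 0 < s) (j : ℤ) (k n : ℕ) :
    HasDerivAt (fun s => heatCoeff j k s n) (-heatCoeff j (k + 2) s n) s := by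
  have h := ((Complex.reCLM.hasFDerivAt.comp_hasDerivAt s
    (hasDerivAt_gaussCoeff hs (j - 1) k n)).const_mul ((if n = 0 then 1 else 2) / Real.pi))
  refine h.congr_deriv ?_
  simp [heatCoeff]

lemma continuousOn_heatCoeff {j : ℤ} {k : ℕ} (h : 2 * (j - 1) + k ≤ -2) (n : ℕ) :
    ContinuousOn (fun s => heatCoeff j k s n) (Set.Ici 0) := by
  obtain ⟨C, hC⟩ := gaussBounded_of_le h
  have : ContinuousOn (fun s => gaussCoeff (j - 1) k s n) (Set.Ici 0) := by
    refine continuousOn_of_dominated (bound := fun u => C * (1 + u ^ 2)⁻¹)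
      (fun s _ => ((Complex.continuous_ofReal.comp (continuous_gauss (j - 1) k s)).mul
        (continuous_cayleyPow n)).aestronglyMeasurable)
      (fun s hs => Eventually.of_forall fun u => ?_) (integrable_inv_one_add_sq.const_mul C)
      (Eventually.of_forall fun u => ?_)
    · rw [norm_gauss_mul_cayleyPow]
      exact hC s hs u
    · unfold gauss
      fun_prop
  exact continuousOn_const.mul (Complex.continuous_re.comp_continuousOn this)

lemma heatMult_inv_one_add_sq (j : ℤ) (s u : ℝ) :
    heatMult j s (1 + u ^ 2)⁻¹ = gauss j 0 s u := by
  have hp := one_add_sq_pos u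
  rw [heatMult, if_pos (inv_pos.2 hp), gauss, inv_zpow', neg_neg, one_div, inv_inv, pow_zero,
    mul_one]
  congr 2
  ring

lemma GaussBounded.abs_heatMult_le {S : Set ℝ} {j : ℤ} (h : GaussBounded S j 0) :
    ∃ C : ℝ, 0 ≤ C ∧ ∀ s ∈ S, ∀ x ∈ Set.Icc (0 : ℝ) 1, |heatMult j s x| ≤ C * x := by
  obtain ⟨C, hC⟩ := h
  refine ⟨|C|, abs_nonneg C, fun s hs x hx => ?_⟩
  rcases hx.1.eq_or_lt with rfl | h0
  · simp [heatMult]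
  · have : 0 ≤ x⁻¹ - 1 := by
      rw [sub_nonneg]; exact (one_le_inv₀ h0).2 hx.2
    have e : (1 + (Real.sqrt (x⁻¹ - 1)) ^ 2)⁻¹ = x := by
      rw [Real.sq_sqrt this]; simp
    rw [← e, heatMult_inv_one_add_sq]
    exact (hC s hs _).trans (mul_le_mul_of_nonneg_right (le_abs_self C) (by positivity))

lemma GaussBounded.continuousOn_heatMult {S : Set ℝ} {j : ℤ} (h : GaussBounded S j 0) {s : ℝ}
    (hs : s ∈ S) : ContinuousOn (heatMult j s) (Set.Icc 0 1) := by
  obtain ⟨C, hC, hb⟩ := h.abs_heatMult_le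
  intro x hx
  rcases hx.1.eq_or_lt with rfl | h0
  · have h0 : heatMult j s 0 = 0 := by simp [heatMult]
    rw [ContinuousWithinAt, h0]
    refine squeeze_zero_norm' (a := fun x => C * x) ?_ ?_
    · filter_upwards [self_mem_nhdsWithin] with y hy using hb s hs y hy
    · have : Continuous fun x : ℝ => C * x := by fun_prop
      simpa using (this.tendsto 0).mono_left nhdsWithin_le_nhds
  · apply ContinuousAt.continuousWithinAt
    have h1 : ContinuousAt (fun x : ℝ => x ^ (-j) * Real.exp (s * (1 - 1 / x))) x := by
      have := continuousAt_zpow₀ x (-j) (Or.inl h0.ne')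
      have h2 : ContinuousAt (fun x : ℝ => 1 / x) x :=
        continuousAt_const.div continuousAt_id h0.ne'
      fun_prop
    refine h1.congr ?_
    filter_upwards [lt_mem_nhds h0] with y hy
    rw [heatMult, if_pos hy]

lemma gaussCoeff_neg (j : ℤ) (s : ℝ) (n : ℤ) : gaussCoeff j 0 s (-n) = gaussCoeff j 0 s n := by
  rw [gaussCoeff, ← integral_neg_eq_self]
  simp [gaussCoeff, gauss, cayleyPow, Real.arctan_neg]

lemma image_two_mul_arctan : (fun u => 2 * Real.arctan u) '' Set.univ
    = Set.Ioo (-Real.pi) Real.pi := by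
  rw [show (fun u => 2 * Real.arctan u) = (fun t => 2 * t) ∘ Real.arctan from rfl, Set.image_comp,
    Set.image_univ, Real.range_arctan, Set.image_mul_left_Ioo (by norm_num)]
  congr 1 <;> ring

lemma integral_circle_eq (g : ℝ → ℂ) : ∫ θ in (-Real.pi)..Real.pi, g θ
    = ∫ u, ((2 * (1 + u ^ 2)⁻¹ : ℝ) : ℂ) * g (2 * Real.arctan u) := by
  rw [intervalIntegral.integral_of_le (by linarith [Real.pi_pos]), integral_Ioc_eq_integral_Ioo,
    ← image_two_mul_arctan, integral_image_eq_integral_abs_deriv_smul MeasurableSet.univ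
      (fun u _ => ((Real.hasDerivAt_arctan' u).const_mul 2).hasDerivWithinAt)
      (fun u _ v _ h => Real.arctan_injective (by simpa using h)), setIntegral_univ]
  congr 1
  ext u
  have := one_add_sq_pos u
  rw [abs_of_pos (by positivity), Complex.real_smul]

/-- The function `heatMult j s ((1 + cos θ) / 2)` on the circle. -/
noncomputable def circleMult (j : ℤ) (s : ℝ) (θ : AddCircle (2 * Real.pi)) : ℂ :=
  (heatMult j s ((1 + Real.Angle.cos θ) / 2) : ℝ)

lemma circleMult_two_mul_arctan (j : ℤ) (s u : ℝ) :
    circleMult j s ((2 * Real.arctan u : ℝ) : AddCircle (2 * Real.pi)) = (gauss j 0 s u : ℝ) := by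
  rw [circleMult]
  have h : Real.Angle.cos ((2 * Real.arctan u : ℝ) : AddCircle (2 * Real.pi))
      = Real.cos (2 * Real.arctan u) := Real.Angle.cos_coe _
  rw [h, Real.cos_two_mul, Real.cos_sq_arctan, ← heatMult_inv_one_add_sq]
  congr 2
  rw [one_div]
  ring

lemma fourierCoeff_circleMult [Fact (0 < 2 * Real.pi)] (j : ℤ) (s : ℝ) (n : ℤ) :
    fourierCoeff (circleMult j s) n = (1 / Real.pi : ℝ) * gaussCoeff (j - 1) 0 s n := by
  rw [fourierCoeff_eq_intervalIntegral _ n (-Real.pi),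
    show -Real.pi + 2 * Real.pi = Real.pi by ring, integral_circle_eq, ← gaussCoeff_neg,
    gaussCoeff, Complex.real_smul, ← integral_const_mul, ← integral_const_mul]
  congr 1
  ext u
  rw [circleMult_two_mul_arctan, fourier_coe_apply, smul_eq_mul, cayleyPow]
  have hp := (one_add_sq_pos u).ne'
  have h1 : gauss (j - 1) 0 s u = (1 + u ^ 2)⁻¹ * gauss j 0 s u := by
    simp only [gauss, zpow_sub₀ hp, zpow_one]
    field_simp
  have h2 : 2 * (Real.pi : ℂ) * Complex.I * ((-n : ℤ) : ℂ) * ((2 * Real.arctan u : ℝ) : ℂ)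
      / ((2 * Real.pi : ℝ) : ℂ) = ((2 * (-n : ℤ) * Real.arctan u : ℝ) : ℂ) * Complex.I := by
    have : (Real.pi : ℂ) ≠ 0 := by exact_mod_cast Real.pi_ne_zero
    push_cast
    field_simp
  rw [h1, h2]
  have : (Real.pi : ℂ) ≠ 0 := by exact_mod_cast Real.pi_ne_zero
  push_cast
  field_simp

lemma summable_const_div_pow (C : ℝ) {K : ℕ} (hK : 2 ≤ K) :
    Summable (fun n : ℕ => C / ((n : ℝ) + 1) ^ K) := by
  have := ((summable_nat_add_iff 1).2 (Real.summable_one_div_nat_pow.2 hK)).mul_left C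
  refine this.congr fun n => ?_
  push_cast
  ring

/-- The Chebyshev expansion of `heatMult j s`: the Fourier series of the function
`heatMult j s ((1 + cos θ) / 2)`. -/
lemma hasSum_heatCoeff {j : ℤ} {s : ℝ} (h : 0 < s ∨ j ≤ -3 ∧ s ∈ Set.Icc (0 : ℝ) 1) {x : ℝ}
    (hx : x ∈ Set.Icc (0 : ℝ) 1) :
    HasSum (fun n : ℕ => heatCoeff j 0 s n * (Polynomial.Chebyshev.T ℝ n).eval (2 * x - 1))
      (heatMult j s x) := by
  have : Fact (0 < 2 * Real.pi) := ⟨Real.two_pi_pos⟩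
  obtain ⟨C, hC, hb⟩ : ∃ C : ℝ, 0 ≤ C ∧ ∀ n : ℕ,
      ‖gaussCoeff (j - 1) 0 s n‖ ≤ C / ((n : ℝ) + 1) ^ 2 := by
    rcases h with h | ⟨h, hs⟩
    · obtain ⟨C, hC, h'⟩ := norm_gaussCoeff_le_of_pos h s (j - 1) 0 2
      exact ⟨C, hC, h' s ⟨le_rfl, le_rfl⟩⟩
    · obtain ⟨C, hC, h'⟩ := norm_gaussCoeff_le_of_le (j := j - 1) (k := 0) (K := 2)
        (by push_cast; linarith)
      exact ⟨C, hC, h' s hs⟩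
  have hcont : ContinuousOn (heatMult j s) (Set.Icc 0 1) := by
    rcases h with h | ⟨h, hs⟩
    · exact (gaussBounded_of_pos h j 0).continuousOn_heatMult (Set.mem_Ici.2 le_rfl)
    · exact (gaussBounded_of_le (by push_cast; linarith)).continuousOn_heatMult hs.1
  have hf : Continuous (circleMult j s) := by
    refine Complex.continuous_ofReal.comp (hcont.comp_continuous ?_ fun θ => ?_)
    · have : Continuous (fun θ : AddCircle (2 * Real.pi) => Real.Angle.cos θ) :=
        Real.Angle.continuous_cos
      fun_prop
    · have hr : ∃ t : ℝ, Real.Angle.cos θ = Real.cos t := by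
        obtain ⟨t, rfl⟩ := QuotientAddGroup.mk_surjective θ
        exact ⟨t, rfl⟩
      obtain ⟨t, ht⟩ := hr
      rw [ht]
      constructor <;> linarith [Real.neg_one_le_cos t, Real.cos_le_one t]
  have hsumN : Summable fun n : ℕ => (1 / Real.pi : ℝ) * gaussCoeff (j - 1) 0 s n :=
    (Summable.of_norm_bounded (summable_const_div_pow C le_rfl) hb).mul_left _
  have hsum : Summable (fourierCoeff (circleMult j s)) := by
    refine Summable.of_nat_of_neg ?_ ?_
    · simpa only [fourierCoeff_circleMult] using hsumN
    · simpa only [fourierCoeff_circleMult, gaussCoeff_neg] using hsumN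
  -- evaluation at `θ`, where the terms `n` and `-n` add up to the Chebyshev polynomial `T_n`
  set θ := Real.arccos (2 * x - 1) with hθ
  have hcos : Real.cos θ = 2 * x - 1 :=
    Real.cos_arccos (by linarith [hx.1]) (by linarith [hx.2])
  have key := (has_pointwise_sum_fourier_series_of_summable (f := ⟨circleMult j s, hf⟩) hsum
    (θ : AddCircle (2 * Real.pi))).nat_add_neg
  have hval : circleMult j s (θ : AddCircle (2 * Real.pi)) = (heatMult j s x : ℝ) := by
    have h : Real.Angle.cos (θ : AddCircle (2 * Real.pi)) = Real.cos θ := Real.Angle.cos_coe _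
    rw [circleMult, h, hcos]
    congr 2
    ring
  have hterm : ∀ n : ℤ, fourierCoeff (circleMult j s) n • fourier n (θ : AddCircle (2 * Real.pi))
      = (1 / Real.pi : ℝ) * gaussCoeff (j - 1) 0 s n * Complex.exp ((n * θ : ℂ) * Complex.I) := by
    intro n
    rw [fourierCoeff_circleMult, fourier_coe_apply, smul_eq_mul]
    congr 2
    have : (Real.pi : ℂ) ≠ 0 := by exact_mod_cast Real.pi_ne_zero
    push_cast
    field_simp
  simp only [ContinuousMap.coe_mk, hterm, hval] at key
  have key2 := key.sub (hasSum_ite_eq 0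
    ((1 / Real.pi : ℝ) * gaussCoeff (j - 1) 0 s 0 * Complex.exp (((0 : ℤ) * θ : ℂ) * Complex.I)))
  rw [add_sub_cancel_right] at key2
  have key3 := Complex.hasSum_re key2
  rw [Complex.ofReal_re] at key3
  refine key3.congr_fun fun n => ?_
  have hT : (Polynomial.Chebyshev.T ℝ n).eval (2 * x - 1) = Real.cos (n * θ) := by
    rw [← hcos, Polynomial.Chebyshev.T_real_cos]
    simp
  rw [hT, heatCoeff, gaussCoeff_neg]
  rcases eq_or_ne n 0 with rfl | hn
  · simp
  · rw [if_neg hn, if_neg hn, sub_zero, ← mul_add]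
    have : Complex.exp (((n : ℤ) * θ : ℂ) * Complex.I)
        + Complex.exp (((-n : ℤ) * θ : ℂ) * Complex.I) = ((2 * Real.cos (n * θ) : ℝ) : ℂ) := by
      push_cast
      rw [Complex.two_cos]
      congr 2
      ring
    rw [this, Complex.re_mul_ofReal, Complex.re_ofReal_mul]
    ring

end Chebyshev

/-! ### Smooth dependence of Chebyshev series on their parameters -/

section HeatSeries

variable {F : Type*} [NormedAddCommGroup F] [NormedSpace ℝ F]

/-- The functions `T n` are of class `C^r`, with derivatives that are bounded uniformly in the
variable and polynomially in `n`. -/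
def PolyBounded (r : ℕ) (T : ℕ → ℝ → F) : Prop :=
  (∀ n, ContDiff ℝ r (T n)) ∧ ∃ (C : ℝ) (N : ℕ), 0 ≤ C ∧ ∀ i ≤ r, ∀ n τ,
    ‖iteratedFDeriv ℝ i (T n) τ‖ ≤ C * ((n : ℝ) + 1) ^ N

lemma PolyBounded.norm_le {r : ℕ} {T : ℕ → ℝ → F} (h : PolyBounded r T) :
    ∃ (C : ℝ) (N : ℕ), 0 ≤ C ∧ ∀ n τ, ‖T n τ‖ ≤ C * ((n : ℝ) + 1) ^ N := by
  obtain ⟨C, N, hC, hb⟩ := h.2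
  exact ⟨C, N, hC, fun n τ => by simpa using hb 0 (Nat.zero_le _) n τ⟩

lemma PolyBounded.of_succ {r : ℕ} {T : ℕ → ℝ → F} (h : PolyBounded (r + 1) T) :
    PolyBounded r T := by
  obtain ⟨C, N, hC, hb⟩ := h.2
  exact ⟨fun n => (h.1 n).of_le (by norm_cast; omega), C, N, hC, fun i hi => hb i (by omega)⟩

lemma PolyBounded.derivative {r : ℕ} {T : ℕ → ℝ → F} (h : PolyBounded (r + 1) T) :
    PolyBounded r (fun n => deriv (T n)) := by
  obtain ⟨C, N, hC, hb⟩ := h.2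
  refine ⟨fun n => ?_, C, N, hC, fun i hi n τ => ?_⟩
  · have := h.1 n
    rw [Nat.cast_succ, contDiff_succ_iff_deriv] at this
    exact this.2.2
  · have := hb (i + 1) (by omega) n τ
    rwa [norm_iteratedFDeriv_eq_norm_iteratedDeriv, iteratedDeriv_succ',
      ← norm_iteratedFDeriv_eq_norm_iteratedDeriv] at this

lemma PolyBounded.norm_smul_le {r : ℕ} {T : ℕ → ℝ → F} (h : PolyBounded r T) {s₀ : ℝ}
    (hs₀ : 0 < s₀) (s₁ : ℝ) (j : ℤ) (k : ℕ) : ∃ C : ℝ, 0 ≤ C ∧ ∀ s ∈ Set.Icc s₀ s₁, ∀ n τ,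
      |heatCoeff j k s n| * ‖T n τ‖ ≤ C / ((n : ℝ) + 1) ^ 2 := by
  obtain ⟨C, N, hC, hb⟩ := h.norm_le
  obtain ⟨C', hC', hb'⟩ := abs_heatCoeff_le_of_pos hs₀ s₁ j k (N + 2)
  refine ⟨C' * C, by positivity, fun s hs n τ => ?_⟩
  calc _ ≤ C' / ((n : ℝ) + 1) ^ (N + 2) * (C * ((n : ℝ) + 1) ^ N) := by
        gcongr
        exacts [hb' s hs n, hb n τ]
    _ = _ := by field_simp; ring

variable [CompleteSpace F]

lemma PolyBounded.summable {r : ℕ} {T : ℕ → ℝ → F} (h : PolyBounded r T) {s : ℝ}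
    (hs : 0 < s) (j : ℤ) (k : ℕ) (τ : ℝ) : Summable (fun n => heatCoeff j k s n • T n τ) := by
  obtain ⟨C, hC, hb⟩ := h.norm_smul_le hs s j k
  exact Summable.of_norm_bounded (summable_const_div_pow C le_rfl) fun n => by
    rw [norm_smul]; exact hb s ⟨le_rfl, le_rfl⟩ n τ

lemma isOpen_strip (s₀ s₁ : ℝ) : IsOpen {q : ℝ × ℝ | s₀ < q.2 ∧ q.2 < s₁} :=
  (isOpen_lt continuous_const continuous_snd).inter (isOpen_lt continuous_snd continuous_const)

/-- Termwise differentiation, in `τ` and in `s`: for `s > 0` the coefficients decrease faster than any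
power of `n`. -/
lemma PolyBounded.hasFDerivAt_tsum {r : ℕ} {T : ℕ → ℝ → F} (h : PolyBounded (r + 1) T) (j : ℤ)
    (k : ℕ) {q : ℝ × ℝ} (hq : 0 < q.2) :
    HasFDerivAt (fun q : ℝ × ℝ => ∑' n, heatCoeff j k q.2 n • T n q.1)
      ((ContinuousLinearMap.smulRightL ℝ (ℝ × ℝ) F (ContinuousLinearMap.fst ℝ ℝ ℝ))
          (∑' n, heatCoeff j k q.2 n • deriv (T n) q.1)
        - (ContinuousLinearMap.smulRightL ℝ (ℝ × ℝ) F (ContinuousLinearMap.snd ℝ ℝ ℝ))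
          (∑' n, heatCoeff j (k + 2) q.2 n • T n q.1)) q := by
  have hs₀ : 0 < q.2 / 2 := by linarith
  obtain ⟨C, hC, hb⟩ := h.derivative.norm_smul_le hs₀ (q.2 * 2) j k
  obtain ⟨C', hC', hb'⟩ := h.norm_smul_le hs₀ (q.2 * 2) j (k + 2)
  set L1 := ContinuousLinearMap.smulRightL ℝ (ℝ × ℝ) F (ContinuousLinearMap.fst ℝ ℝ ℝ)
  set L2 := ContinuousLinearMap.smulRightL ℝ (ℝ × ℝ) F (ContinuousLinearMap.snd ℝ ℝ ℝ)
  have key := hasFDerivAt_tsum_of_isPreconnected (𝕜 := ℝ)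
    (u := fun n : ℕ => ‖L1‖ * (C / ((n : ℝ) + 1) ^ 2) + ‖L2‖ * (C' / ((n : ℝ) + 1) ^ 2))
    (f := fun n (q : ℝ × ℝ) => heatCoeff j k q.2 n • T n q.1)
    (f' := fun n (q : ℝ × ℝ) => L1 (heatCoeff j k q.2 n • deriv (T n) q.1)
      - L2 (heatCoeff j (k + 2) q.2 n • T n q.1))
    (s := {p : ℝ × ℝ | q.2 / 2 < p.2 ∧ p.2 < q.2 * 2}) (x₀ := q) (x := q)
    (((summable_const_div_pow C le_rfl).mul_left _).add
      ((summable_const_div_pow C' le_rfl).mul_left _))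
    (isOpen_strip _ _) ?_ ?_ ?_ ?_ (h.summable hq j k q.1) ?_
  · refine key.congr_fderiv ?_
    rw [L1.map_tsum (h.derivative.summable hq j k q.1), L2.map_tsum (h.summable hq j (k + 2) q.1)]
    exact ((L1.summable (h.derivative.summable hq j k q.1)).tsum_sub
      (L2.summable (h.summable hq j (k + 2) q.1)))
  · have : Convex ℝ {p : ℝ × ℝ | q.2 / 2 < p.2 ∧ p.2 < q.2 * 2} :=
      (convex_Ioo (q.2 / 2) (q.2 * 2)).linear_preimage (LinearMap.snd ℝ ℝ ℝ)
    exact this.isPreconnected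
  · intro n p hp
    have h1 : HasFDerivAt (fun q : ℝ × ℝ => T n q.1)
        ((ContinuousLinearMap.toSpanSingleton ℝ (deriv (T n) p.1)).comp
          (ContinuousLinearMap.fst ℝ ℝ ℝ)) p := by
      have hd : HasDerivAt (T n) (deriv (T n) p.1) p.1 :=
        ((h.1 n).differentiable (by simp) p.1).hasDerivAt
      exact hd.hasFDerivAt.comp p hasFDerivAt_fst
    have h2 : HasFDerivAt (fun q : ℝ × ℝ => heatCoeff j k q.2 n)
        ((ContinuousLinearMap.toSpanSingleton ℝ (-heatCoeff j (k + 2) p.2 n)).comp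
          (ContinuousLinearMap.snd ℝ ℝ ℝ)) p :=
      (hasDerivAt_heatCoeff (hs₀.trans hp.1) j k n).hasFDerivAt.comp p hasFDerivAt_snd
    refine (h2.smul h1).congr_fderiv ?_
    ext
    · simp [L1, L2]
    · simp [L1, L2]
  · intro n p hp
    refine (norm_sub_le _ _).trans (add_le_add ?_ ?_)
    · refine (L1.le_opNorm _).trans ?_
      gcongr
      rw [norm_smul]
      exact hb p.2 ⟨hp.1.le, hp.2.le⟩ n p.1
    · refine (L2.le_opNorm _).trans ?_
      gcongr
      rw [norm_smul]
      exact hb' p.2 ⟨hp.1.le, hp.2.le⟩ n p.1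
  · exact ⟨by linarith, by linarith⟩
  · exact ⟨by linarith, by linarith⟩

lemma PolyBounded.contDiffOn_tsum {r : ℕ} (j : ℤ) : ∀ {T : ℕ → ℝ → F} (_ : PolyBounded r T) (k : ℕ),
    ContDiffOn ℝ r (fun q : ℝ × ℝ => ∑' n, heatCoeff j k q.2 n • T n q.1) {q | 0 < q.2} := by
  have ho : IsOpen {q : ℝ × ℝ | 0 < q.2} := isOpen_lt continuous_const continuous_snd
  induction r with
  | zero =>
    intro T h k
    rw [Nat.cast_zero, contDiffOn_zero]
    intro q hq
    have hq' : 0 < q.2 := hq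
    obtain ⟨C, hC, hb⟩ := h.norm_smul_le (half_pos hq') (q.2 * 2) j k
    have : ContinuousOn (fun q : ℝ × ℝ => ∑' n, heatCoeff j k q.2 n • T n q.1)
        {p : ℝ × ℝ | q.2 / 2 < p.2 ∧ p.2 < q.2 * 2} := by
      refine continuousOn_tsum (fun n => ?_) (summable_const_div_pow C le_rfl) fun n p hp => ?_
      · refine ContinuousOn.smul (fun p hp => ?_) ?_
        · have : 0 < p.2 := (half_pos hq').trans hp.1
          exact ((hasDerivAt_heatCoeff this j k n).continuousAt.comp
            continuous_snd.continuousAt).continuousWithinAt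
        · exact ((h.1 n).continuous.comp continuous_fst).continuousOn
      · rw [norm_smul]
        exact hb p.2 ⟨hp.1.le, hp.2.le⟩ n p.1
    exact (this.continuousAt ((isOpen_strip _ _).mem_nhds
      ⟨by linarith, by linarith⟩)).continuousWithinAt
  | succ r ih =>
    intro T h k
    rw [Nat.cast_succ, contDiffOn_succ_iff_fderiv_of_isOpen ho]
    refine ⟨fun q hq => (h.hasFDerivAt_tsum j k hq).differentiableAt.differentiableWithinAt,
      by simp, ?_⟩
    refine ContDiffOn.congr ?_ fun q hq => (h.hasFDerivAt_tsum j k hq).fderiv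
    exact ((ContinuousLinearMap.smulRightL ℝ (ℝ × ℝ) F
        (ContinuousLinearMap.fst ℝ ℝ ℝ)).contDiff.comp_contDiffOn (ih h.derivative k)).sub
      ((ContinuousLinearMap.smulRightL ℝ (ℝ × ℝ) F
        (ContinuousLinearMap.snd ℝ ℝ ℝ)).contDiff.comp_contDiffOn (ih h.of_succ (k + 2)))

lemma PolyBounded.exists_norm_iteratedFDeriv_tsum_le {r : ℕ} {T : ℕ → ℝ → F}
    (h : PolyBounded r T) {s : ℝ} (hs : 0 < s) (j : ℤ) :
    ContDiff ℝ r (fun τ => ∑' n, heatCoeff j 0 s n • T n τ) ∧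
      ∃ C, 0 ≤ C ∧ ∀ i ≤ r, ∀ τ,
        ‖iteratedFDeriv ℝ i (fun τ => ∑' n, heatCoeff j 0 s n • T n τ) τ‖ ≤ C := by
  obtain ⟨C, N, hC, hb⟩ := h.2
  obtain ⟨C', hC', hb'⟩ := abs_heatCoeff_le_of_pos hs s j 0 (N + 2)
  have hsum := summable_const_div_pow (C' * C) (le_refl 2)
  have hcd : ∀ n, ContDiff ℝ ((r : ℕ∞) : WithTop ℕ∞) (fun τ => heatCoeff j 0 s n • T n τ) :=
    fun n => by exact_mod_cast (h.1 n).const_smul (heatCoeff j 0 s n)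
  have hbd : ∀ (i n : ℕ) (τ : ℝ), ((i : ℕ∞) : WithTop ℕ∞) ≤ ((r : ℕ∞) : WithTop ℕ∞) →
      ‖iteratedFDeriv ℝ i (fun τ => heatCoeff j 0 s n • T n τ) τ‖
        ≤ C' * C / ((n : ℝ) + 1) ^ 2 := by
    intro i n τ hi
    have hi' : i ≤ r := by exact_mod_cast hi
    have e := iteratedFDeriv_const_smul_apply (x := τ) (a := heatCoeff j 0 s n)
      (((h.1 n).of_le (by exact_mod_cast hi')).contDiffAt (x := τ) (n := (i : WithTop ℕ∞)))
    have e' : iteratedFDeriv ℝ i (fun τ => heatCoeff j 0 s n • T n τ) τ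
        = heatCoeff j 0 s n • iteratedFDeriv ℝ i (T n) τ := e
    rw [e', norm_smul, Real.norm_eq_abs]
    calc _ ≤ C' / ((n : ℝ) + 1) ^ (N + 2) * (C * ((n : ℝ) + 1) ^ N) := by
          gcongr
          exacts [hb' s ⟨le_rfl, le_rfl⟩ n, hb i hi' n τ]
      _ = _ := by field_simp; ring
  refine ⟨?_, ∑' n : ℕ, C' * C / ((n : ℝ) + 1) ^ 2, tsum_nonneg fun n => by positivity,
    fun i hi τ => ?_⟩
  · exact_mod_cast contDiff_tsum (N := (r : ℕ∞)) hcd (fun _ _ => hsum)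
      (fun k n τ hk => hbd k n τ (by exact_mod_cast hk))
  · have hi' : ((i : ℕ∞) : WithTop ℕ∞) ≤ ((r : ℕ∞) : WithTop ℕ∞) := by exact_mod_cast hi
    rw [iteratedFDeriv_tsum_apply (N := (r : ℕ∞)) hcd (fun _ _ => hsum)
      (fun k n τ hk => hbd k n τ (by exact_mod_cast hk)) (by exact_mod_cast hi)]
    exact tsum_of_norm_bounded hsum.hasSum fun n => hbd i n τ hi'

/-- Multiplication of a fixed vector with a real function on `[0, 1]`. -/
noncomputable def smulPath (a : C(Set.Icc (0 : ℝ) 1, ℝ)) : F →L[ℝ] C(Set.Icc (0 : ℝ) 1, F) :=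
  LinearMap.mkContinuous
    { toFun := fun v => ⟨fun s => a s • v, by fun_prop⟩
      map_add' := fun v w => by ext; simp
      map_smul' := fun c v => by ext; simp [smul_comm c] } ‖a‖ fun v => by
    refine (ContinuousMap.norm_le _ (by positivity)).2 fun s => ?_
    simp only [LinearMap.coe_mk, AddHom.coe_mk, ContinuousMap.coe_mk, norm_smul]
    gcongr
    exact a.norm_coe_le_norm s

lemma norm_smulPath_le (a : C(Set.Icc (0 : ℝ) 1, ℝ)) : ‖(smulPath a : F →L[ℝ] _)‖ ≤ ‖a‖ :=
  LinearMap.mkContinuous_norm_le _ (norm_nonneg _) _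

/-- For sufficiently negative `j` the coefficients decrease uniformly in `s ∈ [0, 1]`, so that the
series converges up to `s = 0`, in the space of continuous functions of `s`. -/
lemma PolyBounded.exists_contDiff_path {r : ℕ} {T : ℕ → ℝ → F} (h : PolyBounded r T) :
    ∃ j₀ : ℤ, ∀ j ≤ j₀, ∃ G : ℝ → C(Set.Icc (0 : ℝ) 1, F), ContDiff ℝ r G ∧
      ∀ (τ : ℝ) (s : Set.Icc (0 : ℝ) 1), HasSum (fun n => heatCoeff j 0 s n • T n τ) (G τ s) := by
  obtain ⟨C, N, hC, hb⟩ := h.2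
  refine ⟨-(3 * (N + 2 : ℕ)), fun j hj => ?_⟩
  have hj1 : 2 * (j - 1) + (0 : ℕ) + 3 * (N + 2 : ℕ) ≤ -2 := by push_cast at hj ⊢; omega
  obtain ⟨C', hC', hb'⟩ := abs_heatCoeff_le_of_le hj1
  have hcont : ∀ n, ContinuousOn (fun s => heatCoeff j 0 s n) (Set.Ici 0) :=
    continuousOn_heatCoeff (by push_cast at hj1 ⊢; omega)
  let a : ℕ → C(Set.Icc (0 : ℝ) 1, ℝ) := fun n => ⟨fun s => heatCoeff j 0 s n,
    (hcont n).comp_continuous continuous_subtype_val fun s => s.2.1⟩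
  have ha : ∀ n, ‖a n‖ ≤ C' / ((n : ℝ) + 1) ^ (N + 2) := fun n =>
    (ContinuousMap.norm_le _ (by positivity)).2 fun s => hb' s s.2 n
  have hbd : ∀ i ≤ r, ∀ n τ, ‖iteratedFDeriv ℝ i (fun τ => smulPath (a n) (T n τ)) τ‖
      ≤ C' * C / ((n : ℝ) + 1) ^ 2 := by
    intro i hi n τ
    have := (smulPath (F := F) (a n)).norm_iteratedFDeriv_comp_left (x := τ) (h.1 n).contDiffAt
      (show ((i : ℕ) : WithTop ℕ∞) ≤ r by exact_mod_cast hi)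
    refine this.trans ?_
    calc _ ≤ C' / ((n : ℝ) + 1) ^ (N + 2) * (C * ((n : ℝ) + 1) ^ N) := by
          gcongr
          exacts [(norm_smulPath_le _).trans (ha n), hb i hi n τ]
      _ = _ := by field_simp; ring
  refine ⟨fun τ => ∑' n, smulPath (a n) (T n τ), ?_, fun τ s => ?_⟩
  · exact contDiff_tsum (N := (r : ℕ∞)) (fun n => by
        exact_mod_cast (smulPath (F := F) (a n)).contDiff.comp (h.1 n))
      (fun k _ => summable_const_div_pow (C' * C) le_rfl)
      (fun k n τ hk => hbd k (by exact_mod_cast hk) n τ)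
  · have hsum : Summable fun n => smulPath (a n) (T n τ) :=
      Summable.of_norm_bounded (summable_const_div_pow (C' * C) le_rfl) fun n => by
        simpa using hbd 0 (Nat.zero_le _) n τ
    have key := hsum.hasSum.map (ContinuousMap.evalCLM ℝ s : C(Set.Icc (0 : ℝ) 1, F) →L[ℝ] F)
      (ContinuousLinearMap.continuous _)
    exact key

end HeatSeries

/-! ### Functions of a compressed projection -/

section Compression

variable {H : Type} [NormedAddCommGroup H] [InnerProductSpace ℂ H] [CompleteSpace H]

/-- The inclusion of the first summand. -/
noncomputable def inlL : H →L[ℂ] WithLp 2 (H × H) :=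
  (WithLp.prodContinuousLinearEquiv 2 ℂ H H).symm.toContinuousLinearMap ∘L
    ContinuousLinearMap.inl ℂ H H

lemma inlL_apply (x : H) : inlL x = WithLp.toLp 2 (x, (0 : H)) := rfl

/-- The compression of an operator on `H ⊕ H` to the first summand. -/
noncomputable def compress : (WithLp 2 (H × H) →L[ℂ] WithLp 2 (H × H)) →L[ℂ] (H →L[ℂ] H) :=
  (ContinuousLinearMap.compL ℂ H (WithLp 2 (H × H)) H (WithLp.fstL 2 ℂ H H)) ∘L
    ((ContinuousLinearMap.compL ℂ H (WithLp 2 (H × H)) (WithLp 2 (H × H))).flip inlL)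

lemma compress_apply (T : WithLp 2 (H × H) →L[ℂ] WithLp 2 (H × H)) (x : H) :
    compress T x = (T (inlL x)).fst := rfl

/-- The reflection `(u, v) ↦ (u, -v)`. -/
noncomputable def reflectFst : WithLp 2 (H × H) →L[ℂ] WithLp 2 (H × H) :=
  2 * (inlL ∘L WithLp.fstL 2 ℂ H H) - 1

lemma reflectFst_apply (x : WithLp 2 (H × H)) :
    reflectFst x = WithLp.toLp 2 (x.fst, -x.snd) := by
  have : reflectFst x = (2 : ℂ) • inlL x.fst - x := by
    rw [two_smul]
    simp [reflectFst, two_mul]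
  rw [this, inlL_apply]
  apply (WithLp.equiv 2 (H × H)).injective
  ext
  · simp [two_smul]
  · simp

lemma reflectFst_mul_self : reflectFst (H := H) * reflectFst = 1 := by
  ext x : 1
  change reflectFst (reflectFst x) = x
  rw [reflectFst_apply, reflectFst_apply]
  simp
  rfl

lemma reflectFst_inlL (x : H) : reflectFst (inlL x) = inlL x := by
  rw [reflectFst_apply, inlL_apply]; simp

variable (G : Submodule ℂ (WithLp 2 (H × H))) [G.HasOrthogonalProjection]

lemma reflection_mul_self {A : Type*} [Ring A] {P : A} (h : P * P = P) :
    (2 * P - 1) * (2 * P - 1) = 1 := by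
  have : (2 * P - 1) * (2 * P - 1) = 1 + 4 * (P * P - P) := by noncomm_ring
  rw [this, h]; simp

/-- The compressions of the powers of a product of two reflections are Chebyshev polynomials: for
`V = (2 P - 1) J`, the operator `V + V⁻¹` acts on the first summand as twice the compression of
`2 P - 1`, which gives the recurrence of the Chebyshev polynomials. -/
lemma compress_pow {P : WithLp 2 (H × H) →L[ℂ] WithLp 2 (H × H)} (hP : P * P = P) (n : ℕ) :
    compress (((2 * P - 1) * reflectFst) ^ n)
      = Polynomial.aeval (2 * compress P - 1) (Polynomial.Chebyshev.T ℝ n) := by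
  set V := (2 * P - 1) * reflectFst
  have hV : V * (reflectFst * (2 * P - 1)) = 1 := by
    rw [mul_assoc (2 * P - 1), ← mul_assoc reflectFst reflectFst, reflectFst_mul_self, one_mul,
      reflection_mul_self hP]
  have h2 : ∀ x : H, (V + reflectFst * (2 * P - 1) : WithLp 2 (H × H) →L[ℂ] _) (inlL x)
      = inlL (2 • (2 * compress P - 1) x) := by
    intro x
    have e1 : V (inlL x) = (2 * P - 1) (inlL x) := by
      change (2 * P - 1) (reflectFst (inlL x)) = _
      rw [reflectFst_inlL]
    have e2 : ((2 * P - 1) (inlL x)).fst = (2 * compress P - 1) x := by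
      simp [two_mul, compress_apply, inlL_apply]
    rw [add_apply, e1, mul_apply_eq_comp, reflectFst_apply,
      ← e2]
    generalize (2 * P - 1 : WithLp 2 (H × H) →L[ℂ] _) (inlL x) = y
    rw [inlL_apply]
    apply (WithLp.equiv 2 (H × H)).injective
    ext
    · simp [two_smul]
    · simp
  have hrec : ∀ n, compress (V ^ (n + 2))
      = compress (V ^ (n + 1)) * (2 * (2 * compress P - 1)) - compress (V ^ n) := by
    intro n
    rw [eq_sub_iff_add_eq, ← map_add]
    have : V ^ (n + 2) + V ^ n = V ^ (n + 1) * (V + reflectFst * (2 * P - 1)) := by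
      rw [mul_add, ← pow_succ, pow_succ V n, mul_assoc, hV, mul_one]
    rw [this]
    ext x
    rw [compress_apply, mul_apply_eq_comp, h2, mul_apply_eq_comp,
      compress_apply]
    simp [two_mul, two_smul]
  suffices h : compress (V ^ n)
        = Polynomial.aeval (2 * compress P - 1) (Polynomial.Chebyshev.T ℝ n) ∧
      compress (V ^ (n + 1))
        = Polynomial.aeval (2 * compress P - 1) (Polynomial.Chebyshev.T ℝ (n + 1 : ℕ)) from h.1
  induction n with
  | zero =>
    constructor
    · ext x; simp [compress_apply, inlL_apply]
    · ext x
      have e1 : V (inlL x) = (2 * P - 1) (inlL x) := by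
        change (2 * P - 1) (reflectFst (inlL x)) = _
        rw [reflectFst_inlL]
      simp only [zero_add, pow_one, compress_apply, e1]
      simp [two_mul, compress_apply, inlL_apply]
  | succ n ih =>
    refine ⟨ih.2, ?_⟩
    rw [hrec, ih.1, ih.2]
    have : Polynomial.Chebyshev.T ℝ ((n + 1 + 1 : ℕ) : ℤ)
        = 2 * Polynomial.X * Polynomial.Chebyshev.T ℝ ((n + 1 : ℕ) : ℤ)
          - Polynomial.Chebyshev.T ℝ (n : ℤ) := by
      have := Polynomial.Chebyshev.T_add_two ℝ (n : ℤ)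
      push_cast
      rw [← this]
      congr 1
    rw [this, mul_comm (2 * Polynomial.X), map_sub, map_mul, map_mul, Polynomial.aeval_X,
      map_ofNat]

lemma compress_starProjection_nonneg : 0 ≤ compress G.starProjection := by
  rw [ContinuousLinearMap.nonneg_iff_isPositive]
  have h : ∀ x y : H, ⟪compress G.starProjection x, y⟫_ℂ
      = ⟪G.starProjection (inlL x), inlL y⟫_ℂ := by
    intro x y
    rw [WithLp.prod_inner_apply]
    simp [inlL_apply, compress_apply]
  refine ⟨fun x y => ?_, fun x => ?_⟩
  · have h' := h y x
    have := G.inner_starProjection_left_eq_right (inlL x) (inlL y)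
    rw [ContinuousLinearMap.coe_coe, h, this, ← inner_conj_symm, ← h, inner_conj_symm]
  · rw [ContinuousLinearMap.reApplyInnerSelf_apply, h]
    exact G.re_inner_starProjection_nonneg (inlL x)

lemma norm_compress_starProjection_le : ‖compress G.starProjection‖ ≤ 1 := by
  refine ContinuousLinearMap.opNorm_le_bound _ zero_le_one fun x => ?_
  have h1 : ‖inlL x‖ = ‖x‖ := by
    rw [inlL_apply]
    simp
  have h2 : ∀ y : WithLp 2 (H × H), ‖y.fst‖ ≤ ‖y‖ := by
    intro y
    rw [WithLp.prod_norm_eq_of_L2]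
    exact Real.le_sqrt_of_sq_le (by nlinarith [sq_nonneg ‖y.snd‖])
  rw [one_mul, ← h1]
  exact (h2 _).trans (G.norm_starProjection_apply_le _)

lemma spectrum_compress_subset :
    spectrum ℝ (compress G.starProjection) ⊆ Set.Icc 0 1 := by
  intro x hx
  refine ⟨spectrum_nonneg_of_nonneg (compress_starProjection_nonneg G) hx, ?_⟩
  have h1 := spectrum.norm_le_norm_mul_of_mem hx
  have h2 : ‖(1 : H →L[ℂ] H)‖ ≤ 1 := ContinuousLinearMap.norm_id_le
  have h3 := norm_compress_starProjection_le G
  calc x ≤ ‖x‖ := Real.le_norm_self x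
    _ ≤ _ := h1
    _ ≤ 1 * 1 := mul_le_mul h3 h2 (norm_nonneg _) zero_le_one
    _ = 1 := one_mul 1

/-- The operator `(1 + A)ʲ exp (-s A)`, where `A` has the resolvent `R = (1 + A)⁻¹`. -/
noncomputable def heatPow (j : ℤ) (s : ℝ) (R : H →L[ℂ] H) : H →L[ℂ] H := cfc (heatMult j s) R

/-- The parameters for which `heatMult j s` is continuous on `[0, 1]`. For `s = 0` the function is
`x⁻ʲ`, so that `j` has to be negative: `heatMult 0 0` jumps at `x = 0`. -/
def Admissible (j : ℤ) (s : ℝ) : Prop := 0 < s ∨ j ≤ -1 ∧ 0 ≤ s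

lemma Admissible.continuousOn {j : ℤ} {s : ℝ} (h : Admissible j s) :
    ContinuousOn (heatMult j s) (Set.Icc 0 1) := by
  rcases h with h | ⟨h, hs⟩
  · exact (gaussBounded_of_pos h j 0).continuousOn_heatMult (Set.mem_Ici.2 le_rfl)
  · exact (gaussBounded_of_le (by push_cast; linarith)).continuousOn_heatMult hs

lemma expOfResolvent_eq_heatPow (R : H →L[ℂ] H) (s : ℝ) : expOfResolvent R s = heatPow 0 s R := by
  rw [expOfResolvent, heatPow]
  congr 1
  ext x
  simp [heatMult]

lemma isSelfAdjoint_compress : IsSelfAdjoint (compress G.starProjection) :=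
  (compress_starProjection_nonneg G).isSelfAdjoint

/-- A factor of the resolvent lowers the exponent: `(1 + A)ʲ⁺¹ exp (-s A) (1 + A)⁻¹`. -/
lemma heatPow_succ_mul {j : ℤ} {s : ℝ} (h : Admissible (j + 1) s) :
    heatPow (j + 1) s (compress G.starProjection) * compress G.starProjection
      = heatPow j s (compress G.starProjection) := by
  have hsa := isSelfAdjoint_compress G
  conv_lhs => rw [← cfc_id' ℝ (compress G.starProjection) hsa]
  rw [cfc_id' ℝ (compress G.starProjection) hsa, heatPow]
  nth_rw 2 [← cfc_id' ℝ (compress G.starProjection) hsa]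
  rw [← cfc_mul _ _ _ (h.continuousOn.mono (spectrum_compress_subset G)), heatPow]
  refine cfc_congr fun x _ => ?_
  simp only [heatMult]
  split_ifs with hx
  · rw [neg_add, zpow_add₀ hx.ne', zpow_neg_one]
    field_simp
  · simp

lemma heatPow_neg_zero (n : ℕ) :
    heatPow (-(n + 1 : ℕ)) 0 (compress G.starProjection) = compress G.starProjection ^ (n + 1) := by
  have hsa := isSelfAdjoint_compress G
  rw [← cfc_pow_id (R := ℝ) (compress G.starProjection) (n + 1) hsa, heatPow]
  refine cfc_congr fun x hx => ?_
  have h0 : 0 ≤ x := (spectrum_compress_subset G hx).1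
  simp only [heatMult]
  split_ifs with h
  · rw [neg_neg, zpow_natCast]; simp
  · have : x = 0 := le_antisymm (not_lt.1 h) h0
    simp [this]

lemma isSelfAdjoint_heatPow (j : ℤ) (s : ℝ) (R : H →L[ℂ] H) : IsSelfAdjoint (heatPow j s R) :=
  IsSelfAdjoint.cfc

/-- The Chebyshev expansion of `(1 + A)ʲ exp (-s A)` in terms of the projection onto the graph, with
convergence in norm. -/
lemma hasSum_heatPow {j : ℤ} {s : ℝ} (h : 0 < s ∨ j ≤ -3 ∧ s ∈ Set.Icc (0 : ℝ) 1) :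
    HasSum (fun n => heatCoeff j 0 s n • compress (((2 * G.starProjection - 1) * reflectFst) ^ n))
      (heatPow j s (compress G.starProjection)) := by
  have hsa := isSelfAdjoint_compress G
  obtain ⟨C, hC, hb⟩ : ∃ C : ℝ, 0 ≤ C ∧ ∀ n : ℕ,
      |heatCoeff j 0 s n| ≤ C / ((n : ℝ) + 1) ^ 2 := by
    rcases h with h | ⟨h, hs⟩
    · obtain ⟨C, hC, h'⟩ := abs_heatCoeff_le_of_pos h s j 0 2
      exact ⟨C, hC, h' s ⟨le_rfl, le_rfl⟩⟩
    · obtain ⟨C, hC, h'⟩ := abs_heatCoeff_le_of_le (j := j) (k := 0) (K := 2)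
        (by push_cast; linarith)
      exact ⟨C, hC, h' s hs⟩
  have hsub := spectrum_compress_subset G
  have hunif : TendstoUniformlyOn (fun (t : Finset ℕ) (x : ℝ) => ∑ n ∈ t,
      heatCoeff j 0 s n * (Polynomial.Chebyshev.T ℝ n).eval (2 * x - 1)) (heatMult j s) atTop
      (spectrum ℝ (compress G.starProjection)) := by
    have := tendstoUniformlyOn_tsum (s := spectrum ℝ (compress G.starProjection))
      (f := fun n (x : ℝ) => heatCoeff j 0 s n * (Polynomial.Chebyshev.T ℝ n).eval (2 * x - 1))
      (summable_const_div_pow C le_rfl) (fun n x hx => by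
        rw [Real.norm_eq_abs, abs_mul]
        have hT := Polynomial.Chebyshev.abs_eval_T_real_le_one (n : ℤ) (x := 2 * x - 1)
          (abs_le.2 ⟨by linarith [(hsub hx).1], by linarith [(hsub hx).2]⟩)
        calc _ ≤ |heatCoeff j 0 s n| * 1 := by gcongr
          _ ≤ _ := by rw [mul_one]; exact hb n)
    exact this.congr_right fun x hx => (hasSum_heatCoeff h (hsub hx)).tsum_eq
  have hpoly : ∀ n : ℕ, cfc (fun x : ℝ => (Polynomial.Chebyshev.T ℝ n).eval (2 * x - 1))
      (compress G.starProjection)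
      = compress (((2 * G.starProjection - 1) * reflectFst) ^ n) := by
    intro n
    rw [compress_pow (G.isIdempotentElem_starProjection).eq]
    have e : (2 * compress G.starProjection - 1 : H →L[ℂ] H)
        = Polynomial.aeval (compress G.starProjection) (2 * Polynomial.X - 1 : Polynomial ℝ) := by
      rw [map_sub, map_mul, Polynomial.aeval_X, map_one, map_ofNat]
    rw [e, ← Polynomial.aeval_comp, ← cfc_polynomial _ _ hsa]
    congr 1
    ext x
    simp
  have key := tendsto_cfc_fun (a := compress G.starProjection) hunif
    (Eventually.of_forall fun t => by fun_prop)
  rw [HasSum, SummationFilter.unconditional_filter]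
  refine key.congr fun t => ?_
  rw [← Finset.sum_fn]
  have := cfc_sum (R := ℝ) (fun (n : ℕ) x => heatCoeff j 0 s n
    * (Polynomial.Chebyshev.T ℝ n).eval (2 * x - 1)) (compress G.starProjection) t
    (fun n _ => by fun_prop)
  rw [this]
  refine Finset.sum_congr rfl fun n _ => ?_
  rw [← hpoly n]
  exact cfc_smul (heatCoeff j 0 s n) _ _ (by fun_prop)

/-- Conjugates of the operators `(1 + A)ʲ exp (-s A)` with powers of the weight `μ⁻¹`, and their
smoothness in `τ`, which is gained at the cost of `M` more powers of the weight. The second part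
extends this to `s = 0`, for sufficiently negative `j`. Both follow from the Chebyshev expansion,
whose coefficients decrease faster than the weighted norms of the powers of `V` grow. -/
theorem exists_weighted_heatPow {S : WeightedProjections (WithLp 2 (H × H) →L[ℂ] WithLp 2 (H × H))}
    {Γ : ℝ → Submodule ℂ (WithLp 2 (H × H))} [∀ τ, (Γ τ).HasOrthogonalProjection]
    (hP : ∀ τ, S.P τ = (Γ τ).starProjection) (hJ : S.J = reflectFst) {μ : H →L[ℂ] H}
    (hμ : ∀ x, S.m (inlL x) = inlL (μ x)) (hμ' : ∀ x, (S.m x).fst = μ x.fst) (r : ℕ) :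
    ∃ M : ℕ, ∀ a : ℕ,
      (∀ j : ℤ, ∃ B : ℝ × ℝ → (H →L[ℂ] H), ContDiffOn ℝ r B {q | 0 < q.2} ∧
        (∀ s, 0 < s → ContDiff ℝ r (fun τ => B (τ, s)) ∧ ∃ C, 0 ≤ C ∧ ∀ i ≤ r, ∀ τ,
          ‖iteratedFDeriv ℝ i (fun τ => B (τ, s)) τ‖ ≤ C) ∧
        ∀ τ s, 0 < s → heatPow j s (compress (Γ τ).starProjection) * μ ^ (a + M)
          = μ ^ a * B (τ, s)) ∧
      ∃ j₀ : ℤ, ∀ j ≤ j₀, ∃ B : ℝ → C(Set.Icc (0 : ℝ) 1, H →L[ℂ] H), ContDiff ℝ r B ∧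
        ∀ τ (s : Set.Icc (0 : ℝ) 1),
          heatPow j s (compress (Γ τ).starProjection) * μ ^ (a + M) = μ ^ a * B τ s := by
  obtain ⟨M, hM⟩ := ScaleSmooth.contDiff (fun n => by simp) (S.scaleSmooth_V_pow (r + 1))
  refine ⟨M, fun a => ?_⟩
  obtain ⟨h1, C, N, hC, h2⟩ := hM a
  set T : ℕ → ℝ → (H →L[ℂ] H) := fun n τ => compress (S.m ^ M * S.V τ (a + M) ^ n) with hT
  set L : (WithLp 2 (H × H) →L[ℂ] WithLp 2 (H × H)) →L[ℝ] (H →L[ℂ] H) :=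
    compress.restrictScalars ℝ
  have hpb : PolyBounded r T := by
    refine ⟨fun n => L.contDiff.comp (h1 n), ‖L‖ * C, N, by positivity, fun i hi n τ => ?_⟩
    refine (L.norm_iteratedFDeriv_comp_left (x := τ) (h1 n).contDiffAt
      (show ((i : ℕ) : WithTop ℕ∞) ≤ r by exact_mod_cast hi)).trans ?_
    rw [mul_assoc]
    gcongr
    exact h2 i hi n τ
  have hpow : ∀ k x, (S.m ^ k) (inlL x) = inlL ((μ ^ k) x) := by
    intro k
    induction k with
    | zero => intro x; rfl
    | succ k ih => intro x; rw [pow_succ, pow_succ, mul_apply_eq_comp, hμ, ih]; rfl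
  have hpow' : ∀ k x, ((S.m ^ k) x).fst = (μ ^ k) x.fst := by
    intro k
    induction k with
    | zero => intro x; rfl
    | succ k ih => intro x; rw [pow_succ, pow_succ, mul_apply_eq_comp, ih, hμ']; rfl
  have hterm : ∀ τ n, compress (((2 * (Γ τ).starProjection - 1) * reflectFst) ^ n) * μ ^ (a + M)
      = μ ^ a * T n τ := by
    intro τ n
    have hV : S.V τ 0 = (2 * (Γ τ).starProjection - 1) * reflectFst := by
      rw [WeightedProjections.V, WeightedProjections.Pw, hP, hJ]
    have hc := mul_pow_compat ((S.scaleSmooth_V_pow 0).bounded.1 n τ) (a + M) 0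
    rw [zero_add] at hc
    rw [← hV]
    ext x
    have e1 : (compress (S.V τ 0 ^ n) * μ ^ (a + M)) x
        = ((S.V τ 0 ^ n * S.m ^ (a + M)) (inlL x)).fst := by
      rw [mul_apply_eq_comp, mul_apply_eq_comp, hpow, compress_apply]
    rw [e1, hc, pow_add, mul_assoc, mul_apply_eq_comp, hpow']
    rfl
  have hsumμ : ∀ {j s τ}, (0 < s ∨ j ≤ -3 ∧ s ∈ Set.Icc (0 : ℝ) 1) →
      ∀ {b : H →L[ℂ] H}, HasSum (fun n => heatCoeff j 0 s n • T n τ) b →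
      heatPow j s (compress (Γ τ).starProjection) * μ ^ (a + M) = μ ^ a * b := by
    intro j s τ h b hb
    have l := (hasSum_heatPow (Γ τ) h).mul_right (μ ^ (a + M))
    have r := hb.mul_left (μ ^ a)
    simp only [smul_mul_assoc, hterm] at l
    simp only [mul_smul_comm] at r
    exact l.unique r
  constructor
  · intro j
    refine ⟨fun q => ∑' n, heatCoeff j 0 q.2 n • T n q.1, hpb.contDiffOn_tsum j 0,
      fun s hs => hpb.exists_norm_iteratedFDeriv_tsum_le hs j,
      fun τ s hs => hsumμ (Or.inl hs) (hpb.summable hs j 0 τ).hasSum⟩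
  · obtain ⟨j₀, hj₀⟩ := hpb.exists_contDiff_path
    refine ⟨min j₀ (-3), fun j hj => ?_⟩
    obtain ⟨B, hB, hB'⟩ := hj₀ j (hj.trans (min_le_left _ _))
    exact ⟨B, hB, fun τ s => hsumμ (Or.inr ⟨hj.trans (min_le_right _ _), s.2⟩) (hB' τ s)⟩

end Compression

/-! ### Wirtinger derivatives -/

section Wirtinger

/-- The real linear map `v ↦ a v + b v̄`. -/
noncomputable def wirt (a b : ℂ) : ℂ →L[ℝ] ℂ :=
  a • ContinuousLinearMap.id ℝ ℂ + b • (Complex.conjCLE : ℂ →L[ℝ] ℂ)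

lemma wirt_apply (a b v : ℂ) : wirt a b v = a * v + b * conj v := rfl

/-- `f` is differentiable at `z`, with `∂f/∂z = a` and `∂f/∂z̄ = b`. -/
def HasWirt (f : ℂ → ℂ) (a b z : ℂ) : Prop := HasFDerivAt f (wirt a b) z

variable {f g : ℂ → ℂ} {a b a' b' z : ℂ}

lemma HasWirt.dz (h : HasWirt f a b z) : dz f z = a := by
  rw [WeightedHeat.dz, HasFDerivAt.fderiv h, wirt_apply, wirt_apply]
  simp only [map_one, Complex.conj_I]
  linear_combination (1 / 2) * (-a + b) * Complex.I_mul_I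

lemma HasWirt.dzbar (h : HasWirt f a b z) : dzbar f z = b := by
  rw [WeightedHeat.dzbar, HasFDerivAt.fderiv h, wirt_apply, wirt_apply]
  simp only [map_one, Complex.conj_I]
  linear_combination (1 / 2) * (a - b) * Complex.I_mul_I

lemma hasWirt_of_differentiableAt (h : DifferentiableAt ℝ f z) :
    HasWirt f (dz f z) (dzbar f z) z := by
  refine h.hasFDerivAt.congr_fderiv ?_
  ext v
  have hv : v = v.re • (1 : ℂ) + v.im • Complex.I := by simp [Complex.re_add_im]
  rw [wirt_apply, dz, dzbar]
  conv_lhs => rw [hv, map_add, map_smul, map_smul, Complex.real_smul, Complex.real_smul]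
  conv_rhs => rw [← Complex.re_add_im v]
  simp only [map_add, map_mul, Complex.conj_ofReal, Complex.conj_I]
  linear_combination ((v.im : ℂ) * fderiv ℝ f z Complex.I) * Complex.I_mul_I

lemma HasWirt.add (hf : HasWirt f a b z) (hg : HasWirt g a' b' z) :
    HasWirt (fun z => f z + g z) (a + a') (b + b') z := by
  refine (HasFDerivAt.fun_add hf hg).congr_fderiv ?_
  ext v; simp only [add_apply, wirt_apply]; ring

lemma HasWirt.sub (hf : HasWirt f a b z) (hg : HasWirt g a' b' z) :
    HasWirt (fun z => f z - g z) (a - a') (b - b') z := by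
  refine (HasFDerivAt.fun_sub hf hg).congr_fderiv ?_
  ext v; simp only [sub_apply, wirt_apply]; ring

lemma HasWirt.mul (hf : HasWirt f a b z) (hg : HasWirt g a' b' z) :
    HasWirt (fun z => f z * g z) (a * g z + f z * a') (b * g z + f z * b') z := by
  refine (HasFDerivAt.fun_mul hf hg).congr_fderiv ?_
  ext v
  simp only [add_apply, smul_apply, wirt_apply, smul_eq_mul]
  ring

lemma hasWirt_const (c : ℂ) : HasWirt (fun _ => c) 0 0 z := by
  refine (hasFDerivAt_const c z).congr_fderiv ?_
  ext v; simp [wirt_apply]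

lemma HasWirt.const_mul (c : ℂ) (hf : HasWirt f a b z) :
    HasWirt (fun z => c * f z) (c * a) (c * b) z := by
  simpa using (hasWirt_const c).mul hf

lemma hasWirt_id : HasWirt (fun z => z) 1 0 z := by
  refine (hasFDerivAt_id z).congr_fderiv ?_
  ext v; simp [wirt_apply]

lemma HasWirt.conj (hf : HasWirt f a b z) :
    HasWirt (fun z => conj (f z)) (conj b) (conj a) z := by
  refine ((Complex.conjCLE : ℂ →L[ℝ] ℂ).hasFDerivAt.comp z hf).congr_fderiv ?_
  ext v
  change conj (wirt a b v) = _
  simp only [wirt_apply, map_add, map_mul, Complex.conj_conj]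
  ring

lemma HasWirt.pow (hf : HasWirt f a b z) (n : ℕ) :
    HasWirt (fun z => f z ^ n) (n * f z ^ (n - 1) * a) (n * f z ^ (n - 1) * b) z := by
  refine (HasFDerivAt.pow hf n).congr_fderiv ?_
  ext v
  simp only [smul_apply, wirt_apply, smul_eq_mul, nsmul_eq_mul]
  ring

lemma HasWirt.inv (hf : HasWirt f a b z) (h0 : f z ≠ 0) :
    HasWirt (fun z => (f z)⁻¹) (-a / f z ^ 2) (-b / f z ^ 2) z := by
  refine ((hasDerivAt_inv h0).comp_hasFDerivAt_of_eq z hf rfl).congr_fderiv ?_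
  ext v
  simp only [smul_apply, wirt_apply, smul_eq_mul]
  field_simp
  ring

end Wirtinger

/-! ### Symbols -/

section Symbols

variable {η : ℝ}

/-- The square of the weight, `1 + η² |z|²`. The small constant `η` makes the weight vary slowly. -/
noncomputable def wt (η : ℝ) (z : ℂ) : ℝ := 1 + η ^ 2 * ‖z‖ ^ 2

lemma wt_pos (η : ℝ) (z : ℂ) : 0 < wt η z := by unfold wt; positivity

lemma one_le_wt (η : ℝ) (z : ℂ) : 1 ≤ wt η z := by
  unfold wt; nlinarith [mul_nonneg (sq_nonneg η) (sq_nonneg ‖z‖)]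

lemma ofReal_wt (η : ℝ) (z : ℂ) : (wt η z : ℂ) = 1 + η ^ 2 * (z * conj z) := by
  rw [wt, Complex.mul_conj, Complex.normSq_eq_norm_sq]; push_cast; rfl

lemma hasWirt_wt (η : ℝ) (z : ℂ) :
    HasWirt (fun z => (wt η z : ℂ)) (η ^ 2 * conj z) (η ^ 2 * z) z := by
  have h := (hasWirt_const 1).add
    ((hasWirt_id (z := z)).mul (hasWirt_id (z := z)).conj |>.const_mul ((η : ℂ) ^ 2))
  simp only [← ofReal_wt] at h
  simpa using h

lemma hasWirt_wt_inv (η : ℝ) (z : ℂ) : HasWirt (fun z => (wt η z : ℂ)⁻¹)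
    (-(η ^ 2 * conj z * ((wt η z : ℂ)⁻¹) ^ 2)) (-(η ^ 2 * z * ((wt η z : ℂ)⁻¹) ^ 2)) z := by
  have h0 : (wt η z : ℂ) ≠ 0 := by exact_mod_cast (wt_pos η z).ne'
  have h := (hasWirt_wt η z).inv h0
  have e : ∀ x : ℂ, -x / (wt η z : ℂ) ^ 2 = -(x * ((wt η z : ℂ)⁻¹) ^ 2) := fun x => by
    rw [inv_pow, neg_div, div_eq_mul_inv]
  rwa [e, e] at h

/-- The monomials `zᵃ z̄ᵇ (1 + η² |z|²)⁻ᶜ`. -/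
noncomputable def symMon (η : ℝ) (a b c : ℕ) (z : ℂ) : ℂ :=
  z ^ a * conj z ^ b * ((wt η z : ℂ)⁻¹) ^ c

/-- Symbols of order `k`: linear combinations of the functions `zᵃ z̄ᵇ (1 + η² |z|²)⁻ᶜ` with
`a + b - 2c ≤ k`. For `η = 0` these are the polynomials in `z` and `z̄`. -/
noncomputable def Sym (η : ℝ) (k : ℤ) : Submodule ℂ (ℂ → ℂ) :=
  Submodule.span ℂ {q | ∃ a b c : ℕ, (a : ℤ) + b - 2 * c ≤ k ∧ q = symMon η a b c}

lemma symMon_mem {k : ℤ} {a b c : ℕ} (h : (a : ℤ) + b - 2 * c ≤ k) : symMon η a b c ∈ Sym η k :=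
  Submodule.subset_span ⟨a, b, c, h, rfl⟩

lemma Sym_mono {k l : ℤ} (h : k ≤ l) : Sym η k ≤ Sym η l := by
  refine Submodule.span_mono ?_
  rintro q ⟨a, b, c, hk, rfl⟩
  exact ⟨a, b, c, hk.trans h, rfl⟩

lemma symMon_mul (a b c a' b' c' : ℕ) :
    symMon η a b c * symMon η a' b' c' = symMon η (a + a') (b + b') (c + c') := by
  ext z; simp only [Pi.mul_apply, symMon, pow_add]; ring

lemma Sym_mul {k l : ℤ} {q r : ℂ → ℂ} (hq : q ∈ Sym η k) (hr : r ∈ Sym η l) :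
    q * r ∈ Sym η (k + l) := by
  induction hq using Submodule.span_induction with
  | mem q hq =>
    obtain ⟨a, b, c, hk, rfl⟩ := hq
    induction hr using Submodule.span_induction with
    | mem r hr =>
      obtain ⟨a', b', c', hl, rfl⟩ := hr
      rw [symMon_mul]
      exact symMon_mem (by push_cast; linarith)
    | zero => simp
    | add r r' _ _ h h' => rw [mul_add]; exact add_mem h h'
    | smul x r _ h => rw [mul_smul_comm]; exact Submodule.smul_mem _ _ h
  | zero => simp
  | add q q' _ _ h h' => rw [add_mul]; exact add_mem h h'
  | smul x q _ h => rw [smul_mul_assoc]; exact Submodule.smul_mem _ _ h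

lemma one_mem_Sym : (1 : ℂ → ℂ) ∈ Sym η 0 := by
  have : (1 : ℂ → ℂ) = symMon η 0 0 0 := by ext z; simp [symMon]
  rw [this]; exact symMon_mem (by simp)

lemma const_mem_Sym (c : ℂ) : (fun _ => c) ∈ Sym η 0 := by
  have : (fun _ => c) = c • (1 : ℂ → ℂ) := by ext z; simp
  rw [this]; exact Submodule.smul_mem _ _ one_mem_Sym

lemma id_mem_Sym : (fun z => z) ∈ Sym η 1 := by
  have : (fun z : ℂ => z) = symMon η 1 0 0 := by ext z; simp [symMon]
  rw [this]; exact symMon_mem (by simp)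

lemma conj_mem_Sym : (fun z => conj z) ∈ Sym η 1 := by
  have : (fun z : ℂ => conj z) = symMon η 0 1 0 := by ext z; simp [symMon]
  rw [this]; exact symMon_mem (by simp)

lemma wt_inv_pow_mem_Sym (N : ℕ) : (fun z => ((wt η z : ℂ)⁻¹) ^ N) ∈ Sym η (-(2 * N)) := by
  have : (fun z => ((wt η z : ℂ)⁻¹) ^ N) = symMon η 0 0 N := by ext z; simp [symMon]
  rw [this]; exact symMon_mem (by simp)

lemma wt_pow_mem_Sym (N : ℕ) : (fun z => (wt η z : ℂ) ^ N) ∈ Sym η (2 * N) := by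
  induction N with
  | zero => simpa using const_mem_Sym 1
  | succ N ih =>
    have h : (fun z => (wt η z : ℂ)) ∈ Sym η 2 := by
      have : (fun z => (wt η z : ℂ)) = (1 : ℂ → ℂ) + ((η : ℂ) ^ 2) • symMon η 1 1 0 := by
        ext z; simp [symMon, ofReal_wt]
      rw [this]
      exact add_mem (Sym_mono (by norm_num) one_mem_Sym)
        (Submodule.smul_mem _ _ (symMon_mem (by norm_num)))
    have e : (fun z => (wt η z : ℂ) ^ (N + 1))
        = (fun z => (wt η z : ℂ) ^ N) * fun z => (wt η z : ℂ) := by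
      ext z; simp [pow_succ]
    rw [e]
    exact Sym_mono (by push_cast; linarith) (Sym_mul ih h)

lemma hasWirt_symMon (a b c : ℕ) (z : ℂ) : HasWirt (symMon η a b c)
    ((a : ℂ) * symMon η (a - 1) b c z - c * η ^ 2 * symMon η a (b + 1) (c + 1) z)
    ((b : ℂ) * symMon η a (b - 1) c z - c * η ^ 2 * symMon η (a + 1) b (c + 1) z) z := by
  have h := (((hasWirt_id (z := z)).pow a).mul (((hasWirt_id (z := z)).conj).pow b)).mul
    ((hasWirt_wt_inv η z).pow c)
  have e : ∀ x : ℂ, (c : ℂ) * x ^ (c - 1) * x ^ 2 = c * x ^ (c + 1) := by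
    intro x
    rcases c with _ | c
    · simp
    · rw [Nat.add_sub_cancel, mul_assoc, ← pow_add]
  refine HasFDerivAt.congr_fderiv (show HasFDerivAt (symMon η a b c) _ z from h) ?_
  have e' := e ((wt η z : ℂ)⁻¹)
  congr 1
  · simp only [symMon, map_zero, mul_zero, add_zero, mul_one]
    linear_combination (-(η : ℂ) ^ 2 * z ^ a * conj z ^ b * conj z) * e'
  · simp only [symMon, map_one, mul_zero, zero_add, mul_one, zero_mul]
    linear_combination (-(η : ℂ) ^ 2 * z ^ a * conj z ^ b * z) * e'

lemma hasTemperateGrowth_conj : Function.HasTemperateGrowth (fun z : ℂ => conj z) :=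
  (Complex.conjCLE : ℂ →L[ℝ] ℂ).hasTemperateGrowth

lemma hasTemperateGrowth_symMon (a b c : ℕ) : (symMon η a b c).HasTemperateGrowth := by
  have h : Function.HasTemperateGrowth (fun z => (wt η z : ℂ)⁻¹) := by
    have h1 := (Function.hasTemperateGrowth_one_add_norm_sq_rpow ℂ (-1)).comp
      ((η • ContinuousLinearMap.id ℝ ℂ).hasTemperateGrowth)
    convert Complex.ofRealCLM.hasTemperateGrowth.comp h1 using 1
    ext z
    simp [wt, mul_pow, Real.rpow_neg_one]
  exact ((Function.HasTemperateGrowth.id'.pow a).mul (hasTemperateGrowth_conj.pow b)).mul (h.pow c)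

lemma hasTemperateGrowth_of_mem_Sym {k : ℤ} {q : ℂ → ℂ} (hq : q ∈ Sym η k) :
    q.HasTemperateGrowth := by
  induction hq using Submodule.span_induction with
  | mem q hq => obtain ⟨a, b, c, -, rfl⟩ := hq; exact hasTemperateGrowth_symMon a b c
  | zero => exact Function.HasTemperateGrowth.zero
  | add q q' _ _ h h' => exact h.add h'
  | smul x q _ h => exact (Function.HasTemperateGrowth.const x).mul h

lemma contDiff_of_mem_Sym {k : ℤ} {q : ℂ → ℂ} (hq : q ∈ Sym η k) : ContDiff ℝ ∞ q :=
  (hasTemperateGrowth_of_mem_Sym hq).1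

lemma hasWirt_of_mem_Sym {k : ℤ} {q : ℂ → ℂ} (hq : q ∈ Sym η k) (z : ℂ) :
    HasWirt q (dz q z) (dzbar q z) z :=
  hasWirt_of_differentiableAt ((contDiff_of_mem_Sym hq).differentiable (by simp) z)

lemma dz_dzbar_mem_Sym {k : ℤ} {q : ℂ → ℂ} (hq : q ∈ Sym η k) :
    dz q ∈ Sym η k ∧ dzbar q ∈ Sym η k := by
  induction hq using Submodule.span_induction with
  | mem q hq =>
    obtain ⟨a, b, c, hk, rfl⟩ := hq
    have e1 : dz (symMon η a b c) = (a : ℂ) • symMon η (a - 1) b c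
        - ((c : ℂ) * η ^ 2) • symMon η a (b + 1) (c + 1) := by
      ext z; rw [(hasWirt_symMon a b c z).dz]; rfl
    have e2 : dzbar (symMon η a b c) = (b : ℂ) • symMon η a (b - 1) c
        - ((c : ℂ) * η ^ 2) • symMon η (a + 1) b (c + 1) := by
      ext z; rw [(hasWirt_symMon a b c z).dzbar]; rfl
    rw [e1, e2]
    refine ⟨sub_mem (Submodule.smul_mem _ _ (symMon_mem ?_))
      (Submodule.smul_mem _ _ (symMon_mem ?_)), sub_mem (Submodule.smul_mem _ _ (symMon_mem ?_))
      (Submodule.smul_mem _ _ (symMon_mem ?_))⟩ <;> push_cast <;> omega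
  | zero =>
    have e1 : dz (0 : ℂ → ℂ) = 0 := by ext z; exact (hasWirt_const 0).dz
    have e2 : dzbar (0 : ℂ → ℂ) = 0 := by ext z; exact (hasWirt_const 0).dzbar
    rw [e1, e2]; exact ⟨zero_mem _, zero_mem _⟩
  | add q q' hq hq' h h' =>
    have e1 : dz (q + q') = dz q + dz q' := by
      ext z; exact ((hasWirt_of_mem_Sym hq z).add (hasWirt_of_mem_Sym hq' z)).dz
    have e2 : dzbar (q + q') = dzbar q + dzbar q' := by
      ext z; exact ((hasWirt_of_mem_Sym hq z).add (hasWirt_of_mem_Sym hq' z)).dzbar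
    rw [e1, e2]; exact ⟨add_mem h.1 h'.1, add_mem h.2 h'.2⟩
  | smul x q hq h =>
    have e1 : dz (x • q) = x • dz q := by
      ext z; exact ((hasWirt_of_mem_Sym hq z).const_mul x).dz
    have e2 : dzbar (x • q) = x • dzbar q := by
      ext z; exact ((hasWirt_of_mem_Sym hq z).const_mul x).dzbar
    rw [e1, e2]; exact ⟨Submodule.smul_mem _ _ h.1, Submodule.smul_mem _ _ h.2⟩

lemma conj_comp_mem_Sym {k : ℤ} {q : ℂ → ℂ} (hq : q ∈ Sym η k) :
    (fun z => conj (q z)) ∈ Sym η k := by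
  induction hq using Submodule.span_induction with
  | mem q hq =>
    obtain ⟨a, b, c, hk, rfl⟩ := hq
    have : (fun z => conj (symMon η a b c z)) = symMon η b a c := by
      ext z
      simp only [symMon, map_mul, map_pow, map_inv₀, Complex.conj_ofReal, Complex.conj_conj]
      ring
    rw [this]; exact symMon_mem (by linarith)
  | zero =>
    have : (fun z => conj ((0 : ℂ → ℂ) z)) = 0 := by ext z; simp
    rw [this]; exact zero_mem _
  | add q q' _ _ h h' =>
    have : (fun z => conj ((q + q') z)) = (fun z => conj (q z)) + fun z => conj (q' z) := by
      ext z; simp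
    rw [this]; exact add_mem h h'
  | smul x q _ h =>
    have : (fun z => conj ((x • q) z)) = conj x • fun z => conj (q z) := by ext z; simp
    rw [this]; exact Submodule.smul_mem _ _ h

/-- A symbol of order `k` is bounded by the `k`-th power of the weight. -/
lemma exists_norm_le_of_mem_Sym (hη : 0 < η) {k : ℤ} {q : ℂ → ℂ} (hq : q ∈ Sym η k) :
    ∃ C : ℝ, 0 ≤ C ∧ ∀ z, ‖q z‖ ≤ C * Real.sqrt (wt η z) ^ k := by
  induction hq using Submodule.span_induction with
  | mem q hq =>
    obtain ⟨a, b, c, hk, rfl⟩ := hq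
    refine ⟨(η⁻¹) ^ (a + b), by positivity, fun z => ?_⟩
    have hw := wt_pos η z
    have hs : 0 < Real.sqrt (wt η z) := Real.sqrt_pos.2 hw
    have hs1 : 1 ≤ Real.sqrt (wt η z) := Real.one_le_sqrt.2 (one_le_wt η z)
    have hz : ‖z‖ ≤ η⁻¹ * Real.sqrt (wt η z) := by
      rw [inv_mul_eq_div, le_div_iff₀ hη]
      refine Real.le_sqrt_of_sq_le ?_
      rw [wt]; nlinarith
    have e : ‖symMon η a b c z‖ = ‖z‖ ^ (a + b) * (Real.sqrt (wt η z) ^ (2 * c))⁻¹ := by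
      rw [symMon, norm_mul, norm_mul, norm_pow, norm_pow, norm_pow, norm_inv, RCLike.norm_conj,
        Complex.norm_real, Real.norm_of_nonneg hw.le, pow_add, pow_mul, Real.sq_sqrt hw.le, inv_pow]
    rw [e]
    calc _ ≤ (η⁻¹ * Real.sqrt (wt η z)) ^ (a + b) * (Real.sqrt (wt η z) ^ (2 * c))⁻¹ := by gcongr
      _ = (η⁻¹) ^ (a + b) * Real.sqrt (wt η z) ^ ((a : ℤ) + b - 2 * c) := by
        rw [mul_pow, mul_assoc, zpow_sub₀ hs.ne', ← Nat.cast_add, zpow_natCast, div_eq_mul_inv]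
        norm_cast
      _ ≤ _ := by gcongr
  | zero => exact ⟨0, le_rfl, by simp⟩
  | add q q' _ _ h h' =>
    obtain ⟨C, hC, h⟩ := h
    obtain ⟨C', hC', h'⟩ := h'
    exact ⟨C + C', by positivity, fun z => by
      rw [add_mul]; exact (norm_add_le _ _).trans (add_le_add (h z) (h' z))⟩
  | smul x q _ h =>
    obtain ⟨C, hC, h⟩ := h
    exact ⟨‖x‖ * C, by positivity, fun z => by
      rw [Pi.smul_apply, norm_smul, mul_assoc]; gcongr; exact h z⟩

/-- Polynomials are symbols. -/
lemma exists_mem_Sym_of_isRealPolynomial {p : ℂ → ℝ} (hp : IsRealPolynomial p) :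
    ∃ d : ℕ, ∀ η, toC p ∈ Sym η d := by
  obtain ⟨P, hP⟩ := hp
  have hre : ∀ η, (fun z : ℂ => (z.re : ℂ)) ∈ Sym η 1 := fun η => by
    have : (fun z : ℂ => (z.re : ℂ)) = (1 / 2 : ℂ) • ((fun z => z) + fun z => conj z) := by
      ext z; simp [Complex.re_eq_add_conj]; ring
    rw [this]; exact Submodule.smul_mem _ _ (add_mem id_mem_Sym conj_mem_Sym)
  have him : ∀ η, (fun z : ℂ => (z.im : ℂ)) ∈ Sym η 1 := fun η => by
    have : (fun z : ℂ => (z.im : ℂ))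
        = (1 / (2 * Complex.I) : ℂ) • ((fun z => z) - fun z => conj z) := by
      ext z; simp only [Complex.im_eq_sub_conj, Pi.smul_apply, Pi.sub_apply, smul_eq_mul]; ring
    rw [this]; exact Submodule.smul_mem _ _ (sub_mem id_mem_Sym conj_mem_Sym)
  have : toC p = fun z => ((MvPolynomial.eval ![z.re, z.im] P : ℝ) : ℂ) := by
    ext z; simp [toC, hP]
  rw [this]
  clear this hP
  induction P using MvPolynomial.induction_on with
  | C a => exact ⟨0, fun η => by simpa using const_mem_Sym (a : ℂ)⟩
  | add P Q hP hQ =>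
    obtain ⟨d, hd⟩ := hP
    obtain ⟨e, he⟩ := hQ
    refine ⟨max d e, fun η => ?_⟩
    simp only [map_add, Complex.ofReal_add]
    exact add_mem (Sym_mono (by simp) (hd η)) (Sym_mono (by simp) (he η))
  | mul_X P i hP =>
    obtain ⟨d, hd⟩ := hP
    refine ⟨d + 1, fun η => ?_⟩
    simp only [map_mul, MvPolynomial.eval_X, Complex.ofReal_mul]
    push_cast
    fin_cases i
    · exact Sym_mul (hd η) (hre η)
    · exact Sym_mul (hd η) (him η)

end Symbols

/-! ### Multiplication operators -/

section Multiplication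

open BoundedContinuousFunction

lemma memLp_bcf_mul (q : ℂ →ᵇ ℂ) (f : L2) : MemLp (fun z => q z * f z) 2 volume :=
  (Lp.memLp f).of_le_mul (c := ‖q‖)
    (q.continuous.aestronglyMeasurable.mul (Lp.aestronglyMeasurable f))
    (Eventually.of_forall fun z => by
      rw [norm_mul]; gcongr; exact q.norm_coe_le_norm z)

/-- Multiplication with a bounded continuous function, as an operator on `L²(ℂ)`. -/
noncomputable def mulOp (q : ℂ →ᵇ ℂ) : L2 →L[ℂ] L2 :=
  LinearMap.mkContinuous
    { toFun := fun f => (memLp_bcf_mul q f).toLp _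
      map_add' := fun f g => by
        apply Lp.ext
        filter_upwards [(memLp_bcf_mul q (f + g)).coeFn_toLp, (memLp_bcf_mul q f).coeFn_toLp,
          (memLp_bcf_mul q g).coeFn_toLp, Lp.coeFn_add f g,
          Lp.coeFn_add ((memLp_bcf_mul q f).toLp _) ((memLp_bcf_mul q g).toLp _)]
          with z h1 h2 h3 h4 h5
        rw [h1, h5, Pi.add_apply, h2, h3, h4, Pi.add_apply, mul_add]
      map_smul' := fun c f => by
        apply Lp.ext
        filter_upwards [(memLp_bcf_mul q (c • f)).coeFn_toLp, (memLp_bcf_mul q f).coeFn_toLp,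
          Lp.coeFn_smul c f, Lp.coeFn_smul c ((memLp_bcf_mul q f).toLp _)] with z h1 h2 h3 h4
        rw [h1, RingHom.id_apply, h4, Pi.smul_apply, h2, h3, Pi.smul_apply, smul_eq_mul,
          smul_eq_mul]
        ring } ‖q‖ fun f => by
    refine Lp.norm_le_mul_norm_of_ae_le_mul ?_
    filter_upwards [(memLp_bcf_mul q f).coeFn_toLp] with z hz
    simp only [LinearMap.coe_mk, AddHom.coe_mk]
    rw [hz, norm_mul]
    gcongr
    exact q.norm_coe_le_norm z

lemma coeFn_mulOp (q : ℂ →ᵇ ℂ) (f : L2) : mulOp q f =ᵐ[volume] fun z => q z * f z :=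
  (memLp_bcf_mul q f).coeFn_toLp

lemma norm_mulOp_le (q : ℂ →ᵇ ℂ) : ‖mulOp q‖ ≤ ‖q‖ :=
  LinearMap.mkContinuous_norm_le _ (norm_nonneg _) _

lemma mulOp_mul (q r : ℂ →ᵇ ℂ) : mulOp (q * r) = mulOp q * mulOp r := by
  ext1 f
  apply Lp.ext
  rw [mul_apply_eq_comp]
  filter_upwards [coeFn_mulOp (q * r) f, coeFn_mulOp q (mulOp r f), coeFn_mulOp r f] with z h1 h2 h3
  rw [h1, h2, h3, BoundedContinuousFunction.mul_apply, mul_assoc]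

lemma mulOp_one : mulOp 1 = 1 := by
  ext1 f
  apply Lp.ext
  filter_upwards [coeFn_mulOp 1 f] with z h1
  rw [h1]; simp

lemma mulOp_pow (q : ℂ →ᵇ ℂ) (n : ℕ) : mulOp (q ^ n) = mulOp q ^ n := by
  induction n with
  | zero => simp [mulOp_one]
  | succ n ih => rw [pow_succ, pow_succ, mulOp_mul, ih]

lemma inner_mulOp_left (q : ℂ →ᵇ ℂ) (f g : L2) :
    ⟪mulOp q f, g⟫_ℂ = ⟪f, mulOp (star q) g⟫_ℂ := by
  rw [MeasureTheory.L2.inner_def, MeasureTheory.L2.inner_def]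
  refine integral_congr_ae ?_
  filter_upwards [coeFn_mulOp q f, coeFn_mulOp (star q) g] with z h1 h2
  rw [h1, h2]
  simp only [RCLike.inner_apply, map_mul, BoundedContinuousFunction.star_apply]
  change _ * (conj (q z) * _) = conj (q z) * _ * _
  ring

lemma star_mulOp (q : ℂ →ᵇ ℂ) : star (mulOp q) = mulOp (star q) := by
  symm
  rw [ContinuousLinearMap.star_eq_adjoint, ContinuousLinearMap.eq_adjoint_iff]
  intro f g
  rw [inner_mulOp_left, star_star]

lemma mulOp_injective {q : ℂ →ᵇ ℂ} (hq : ∀ z, q z ≠ 0) : Function.Injective (mulOp q) := by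
  intro f g h
  apply Lp.ext
  filter_upwards [coeFn_mulOp q f, coeFn_mulOp q g] with z h1 h2
  have : mulOp q f z = mulOp q g z := by rw [h]
  rw [h1, h2] at this
  exact mul_left_cancel₀ (hq z) this

variable {H : Type} [NormedAddCommGroup H] [InnerProductSpace ℂ H] [CompleteSpace H]

/-- The inclusion of the second summand. -/
noncomputable def inrL : H →L[ℂ] WithLp 2 (H × H) :=
  (WithLp.prodContinuousLinearEquiv 2 ℂ H H).symm.toContinuousLinearMap ∘L
    ContinuousLinearMap.inr ℂ H H

/-- The operator `(u, v) ↦ (A u, A v)`. -/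
noncomputable def diagOp (A : H →L[ℂ] H) : WithLp 2 (H × H) →L[ℂ] WithLp 2 (H × H) :=
  inlL ∘L A ∘L WithLp.fstL 2 ℂ H H + inrL ∘L A ∘L WithLp.sndL 2 ℂ H H

/-- The operator `(u, v) ↦ (0, A u)`. -/
noncomputable def lowerOp (A : H →L[ℂ] H) : WithLp 2 (H × H) →L[ℂ] WithLp 2 (H × H) :=
  inrL ∘L A ∘L WithLp.fstL 2 ℂ H H

lemma pair_ext {x y : WithLp 2 (H × H)} (h1 : x.fst = y.fst) (h2 : x.snd = y.snd) : x = y := by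
  apply (WithLp.equiv 2 (H × H)).injective
  exact Prod.ext h1 h2

@[simp] lemma diagOp_fst (A : H →L[ℂ] H) (x : WithLp 2 (H × H)) :
    (diagOp A x).fst = A x.fst := by
  change A x.fst + 0 = _; rw [add_zero]

@[simp] lemma diagOp_snd (A : H →L[ℂ] H) (x : WithLp 2 (H × H)) :
    (diagOp A x).snd = A x.snd := by
  change 0 + A x.snd = _; rw [zero_add]

@[simp] lemma lowerOp_fst (A : H →L[ℂ] H) (x : WithLp 2 (H × H)) : (lowerOp A x).fst = 0 := rfl

@[simp] lemma lowerOp_snd (A : H →L[ℂ] H) (x : WithLp 2 (H × H)) :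
    (lowerOp A x).snd = A x.fst := rfl

lemma diagOp_mul_lowerOp (A B : H →L[ℂ] H) : diagOp A * lowerOp B = lowerOp (A * B) := by
  ext1 x; exact pair_ext (by simp [mul_apply_eq_comp]) (by simp [mul_apply_eq_comp])

lemma lowerOp_mul_diagOp (A B : H →L[ℂ] H) : lowerOp A * diagOp B = lowerOp (A * B) := by
  ext1 x; exact pair_ext (by simp [mul_apply_eq_comp]) (by simp [mul_apply_eq_comp])

lemma lowerOp_mul_lowerOp (A B : H →L[ℂ] H) : lowerOp A * lowerOp B = 0 := by
  ext1 x; exact pair_ext (by simp [mul_apply_eq_comp]) (by simp [mul_apply_eq_comp])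

lemma diagOp_pow (A : H →L[ℂ] H) (n : ℕ) : diagOp A ^ n = diagOp (A ^ n) := by
  induction n with
  | zero => ext1 x; exact pair_ext (by simp) (by simp)
  | succ n ih =>
    ext1 x
    rw [pow_succ, ih]
    exact pair_ext (by simp [mul_apply_eq_comp, pow_succ]) (by simp [mul_apply_eq_comp, pow_succ])

lemma star_diagOp {A : H →L[ℂ] H} (hA : star A = A) : star (diagOp A) = diagOp A := by
  have hA' : IsSelfAdjoint A := hA
  rw [ContinuousLinearMap.isSelfAdjoint_iff_isSymmetric] at hA'
  suffices IsSelfAdjoint (diagOp A) from this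
  rw [ContinuousLinearMap.isSelfAdjoint_iff_isSymmetric]
  intro x y
  rw [WithLp.prod_inner_apply, WithLp.prod_inner_apply]
  have h1 := hA' x.fst y.fst
  have h2 := hA' x.snd y.snd
  simp only [ContinuousLinearMap.coe_coe] at h1 h2
  exact congrArg₂ (· + ·) (by simpa using h1) (by simpa using h2)

lemma norm_lowerOp_le (A : H →L[ℂ] H) : ‖lowerOp A‖ ≤ ‖A‖ := by
  refine ContinuousLinearMap.opNorm_le_bound _ (norm_nonneg _) fun x => ?_
  have h1 : ‖lowerOp A x‖ = ‖A x.fst‖ := by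
    rw [WithLp.prod_norm_eq_of_L2]; simp
  have h2 : ‖x.fst‖ ≤ ‖x‖ := by
    rw [WithLp.prod_norm_eq_of_L2]
    exact Real.le_sqrt_of_sq_le (by nlinarith [sq_nonneg ‖x.snd‖])
  rw [h1]
  exact (A.le_opNorm _).trans (by gcongr)

lemma reflectFst_mul_diagOp (A : H →L[ℂ] H) : reflectFst * diagOp A = diagOp A * reflectFst := by
  ext1 x
  exact pair_ext (by simp [mul_apply_eq_comp, reflectFst_apply])
    (by simp [mul_apply_eq_comp, reflectFst_apply])

lemma norm_reflectFst_apply (x : WithLp 2 (H × H)) : ‖reflectFst x‖ = ‖x‖ := by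
  rw [reflectFst_apply, WithLp.prod_norm_eq_of_L2, WithLp.prod_norm_eq_of_L2]
  simp

/-- A product of two reflections has norm at most one. -/
lemma norm_reflection_mul_reflectFst_le (G : Submodule ℂ (WithLp 2 (H × H)))
    [G.HasOrthogonalProjection] : ‖(2 * G.starProjection - 1) * reflectFst‖ ≤ 1 := by
  refine ContinuousLinearMap.opNorm_le_bound _ zero_le_one fun x => ?_
  have h : ∀ y, (2 * G.starProjection - 1 : WithLp 2 (H × H) →L[ℂ] _) y = G.reflection y := by
    intro y
    rw [Submodule.reflection_apply, two_smul]
    simp [two_mul]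
  rw [mul_apply_eq_comp, h, LinearIsometryEquiv.norm_map, norm_reflectFst_apply, one_mul]

end Multiplication

/-! ### The weight operators -/

section Weights

/-- A bounded continuous function, from a bound. -/
noncomputable def bcf (q : ℂ → ℂ) (hq : Continuous q) (C : ℝ) (h : ∀ z, ‖q z‖ ≤ C) :
    BoundedContinuousFunction ℂ ℂ :=
  BoundedContinuousFunction.ofNormedAddCommGroup q hq C h

lemma HasWirt.ofReal_comp {f : ℂ → ℝ} {a z : ℂ} {g : ℝ → ℝ} {g' : ℝ}
    (hf : HasWirt (fun z => (f z : ℂ)) a (conj a) z) (hg : HasDerivAt g g' (f z)) :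
    HasWirt (fun z => (g (f z) : ℂ)) (g' * a) (g' * conj a) z := by
  have h1 : HasFDerivAt f (Complex.reCLM ∘L wirt a (conj a)) z :=
    Complex.reCLM.hasFDerivAt.comp z hf
  refine (Complex.ofRealCLM.hasFDerivAt.comp z (hg.comp_hasFDerivAt z h1)).congr_fderiv ?_
  ext v
  have h2 : (((wirt a (conj a)) v).re : ℂ) = wirt a (conj a) v := by
    apply Complex.conj_eq_iff_re.1
    simp only [wirt_apply, map_add, map_mul, Complex.conj_conj]
    ring
  simp only [ContinuousLinearMap.comp_apply, smul_apply, Complex.ofRealCLM_apply, smul_eq_mul,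
    Complex.ofReal_mul, Complex.reCLM_apply, h2]
  simp only [wirt_apply]
  ring

/-- The inverse `(1 + η² |z|²)^(-1/2)` of the weight. -/
noncomputable def mu (η : ℝ) (z : ℂ) : ℝ := (Real.sqrt (wt η z))⁻¹

variable {η : ℝ}

lemma mu_pos (η : ℝ) (z : ℂ) : 0 < mu η z := inv_pos.2 (Real.sqrt_pos.2 (wt_pos η z))

lemma mu_le_one (η : ℝ) (z : ℂ) : mu η z ≤ 1 :=
  inv_le_one_of_one_le₀ (Real.one_le_sqrt.2 (one_le_wt η z))

lemma mu_sq (η : ℝ) (z : ℂ) : mu η z ^ 2 = (wt η z)⁻¹ := by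
  rw [mu, inv_pow, Real.sq_sqrt (wt_pos η z).le]

lemma sqrt_wt_zpow (η : ℝ) (z : ℂ) (k : ℤ) : Real.sqrt (wt η z) ^ k = mu η z ^ (-k) := by
  rw [mu, inv_zpow', neg_neg]

lemma contDiff_wt (η : ℝ) : ContDiff ℝ ∞ (wt η) := by
  unfold wt
  exact contDiff_const.add (contDiff_const.mul (contDiff_norm_sq ℝ))

lemma contDiff_mu (η : ℝ) : ContDiff ℝ ∞ (fun z => (mu η z : ℂ)) := by
  refine Complex.ofRealCLM.contDiff.comp (ContDiff.inv ?_ fun z =>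
    (Real.sqrt_pos.2 (wt_pos η z)).ne')
  exact (contDiff_wt η).sqrt fun z => (wt_pos η z).ne'

lemma hasWirt_mu (η : ℝ) (z : ℂ) : HasWirt (fun z => (mu η z : ℂ))
    (-(η ^ 2 * conj z * mu η z ^ 3 / 2)) (-(η ^ 2 * z * mu η z ^ 3 / 2)) z := by
  have hs := Real.sqrt_pos.2 (wt_pos η z)
  have h := HasWirt.ofReal_comp (a := η ^ 2 * conj z) (f := wt η) (z := z) (by
    simpa using hasWirt_wt η z) ((Real.hasDerivAt_sqrt (wt_pos η z).ne').inv hs.ne')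
  have e : -(1 / (2 * Real.sqrt (wt η z))) / Real.sqrt (wt η z) ^ 2 = -(mu η z ^ 3 / 2) := by
    rw [mu]; field_simp
  rw [e] at h
  refine HasFDerivAt.congr_fderiv (show HasFDerivAt (fun z => (mu η z : ℂ)) _ z from h) ?_
  congr 1
  · push_cast; ring
  · push_cast; simp only [map_mul, map_pow, Complex.conj_ofReal, Complex.conj_conj]; ring

lemma norm_mul_mu_le (_hη : 0 < η) (z : ℂ) : η * ‖z‖ * mu η z ≤ 1 := by
  rw [mu, ← div_eq_mul_inv, div_le_one (Real.sqrt_pos.2 (wt_pos η z))]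
  refine Real.le_sqrt_of_sq_le ?_
  rw [wt]; nlinarith

/-- The operator of multiplication with `mu η`. -/
noncomputable def muB (η : ℝ) : BoundedContinuousFunction ℂ ℂ :=
  bcf (fun z => (mu η z : ℂ)) (contDiff_mu η).continuous 1 fun z => by
    rw [Complex.norm_real, Real.norm_of_nonneg (mu_pos η z).le]; exact mu_le_one η z

lemma muB_apply (η : ℝ) (z : ℂ) : muB η z = (mu η z : ℂ) := rfl

/-- The derivative of the weight, `η² z̄ (1 + η² |z|²)^(-1/2) / 2`. -/
noncomputable def dwB (hη : 0 < η) : BoundedContinuousFunction ℂ ℂ :=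
  bcf (fun z => η ^ 2 * conj z * mu η z / 2)
    (by have := (contDiff_mu η).continuous; have := Complex.continuous_conj; fun_prop) η fun z => by
    have h := norm_mul_mu_le hη z
    rw [norm_div, norm_mul, norm_mul, norm_pow, RCLike.norm_conj, Complex.norm_real,
      Complex.norm_real, Real.norm_of_nonneg (mu_pos η z).le, Real.norm_of_nonneg hη.le,
      Complex.norm_ofNat]
    nlinarith

lemma dwB_apply (hη : 0 < η) (z : ℂ) : dwB hη z = η ^ 2 * conj z * mu η z / 2 := rfl

lemma norm_muB_mul_dwB_le (hη : 0 < η) : ‖muB η * dwB hη‖ ≤ η / 4 := by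
  refine (BoundedContinuousFunction.norm_le (by positivity)).2 fun z => ?_
  rw [BoundedContinuousFunction.mul_apply, muB_apply, dwB_apply, norm_mul, norm_div, norm_mul,
    norm_mul, norm_pow, RCLike.norm_conj, Complex.norm_real, Complex.norm_real,
    Real.norm_of_nonneg (mu_pos η z).le, Real.norm_of_nonneg hη.le, Complex.norm_ofNat]
  have h : 2 * (η * ‖z‖) * mu η z ^ 2 ≤ 1 := by
    rw [mu_sq, ← div_eq_mul_inv, div_le_one (wt_pos η z), wt]
    nlinarith [sq_nonneg (η * ‖z‖ - 1)]
  nlinarith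

end Weights

/-! ### The graphs of the operators `Z` in weighted spaces -/

section Graph

variable {p : ℂ → ℝ} {η : ℝ} {d : ℕ}

/-- `ψ` is a test function, and `g` is the pair `(ψ, Z ψ)`. -/
def IsGraphPoint (p : ℂ → ℝ) (τ : ℝ) (g : L2Pair) (ψ : ℂ → ℂ) : Prop :=
  ContDiff ℝ ∞ ψ ∧ HasCompactSupport ψ ∧ g.fst =ᵐ[volume] ψ ∧ g.snd =ᵐ[volume] opZ p τ ψ

lemma IsGraphPoint.mem {τ : ℝ} {g : L2Pair} {ψ : ℂ → ℂ} (h : IsGraphPoint p τ g ψ) :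
    g ∈ graphZ p τ :=
  Submodule.le_topologicalClosure _ (Submodule.subset_span ⟨ψ, h⟩)

lemma isClosed_graphZ (p : ℂ → ℝ) (τ : ℝ) : IsClosed (graphZ p τ : Set L2Pair) :=
  Submodule.isClosed_topologicalClosure _

/-- A closed subspace contains the graph if it contains the points given by test functions. -/
lemma graphZ_le {τ : ℝ} {K : Submodule ℂ L2Pair} (hK : IsClosed (K : Set L2Pair))
    (h : ∀ g ψ, IsGraphPoint p τ g ψ → g ∈ K) : graphZ p τ ≤ K := by
  refine Submodule.topologicalClosure_minimal _ (Submodule.span_le.2 ?_) hK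
  rintro g ⟨ψ, hψ⟩
  exact h g ψ hψ

lemma map_mem_graphZ {τ σ : ℝ} (T : L2Pair →L[ℂ] L2Pair)
    (h : ∀ g ψ, IsGraphPoint p σ g ψ → T g ∈ graphZ p τ) {x : L2Pair} (hx : x ∈ graphZ p σ) :
    T x ∈ graphZ p τ := by
  have : graphZ p σ ≤ (graphZ p τ).comap T.toLinearMap :=
    graphZ_le ((isClosed_graphZ p τ).preimage T.continuous) h
  exact this hx

/-- An operator maps the graph for `σ` to the graph for `τ` if it does so for test functions. -/
lemma starProjection_mul_mul {τ σ : ℝ} {T : L2Pair →L[ℂ] L2Pair}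
    (h : ∀ g ψ, IsGraphPoint p σ g ψ → T g ∈ graphZ p τ) :
    (graphZ p τ).starProjection * T * (graphZ p σ).starProjection
      = T * (graphZ p σ).starProjection := by
  ext1 x
  exact (graphZ p τ).starProjection_eq_self_iff.2
    (map_mem_graphZ T h ((graphZ p σ).starProjection_apply_mem x))

lemma hasWirt_contDiff {ψ : ℂ → ℂ} (h : ContDiff ℝ ∞ ψ) (z : ℂ) :
    HasWirt ψ (dz ψ z) (dzbar ψ z) z :=
  hasWirt_of_differentiableAt (h.differentiable (by simp) z)

lemma opZ_mu_pow_mul (τ : ℝ) (k : ℕ) {ψ : ℂ → ℂ} (h : ContDiff ℝ ∞ ψ) (z : ℂ) :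
    opZ p τ (fun z => (mu η z : ℂ) ^ k * ψ z) z
      = mu η z ^ k * opZ p τ ψ z
        - k * (mu η z : ℂ) ^ (k + 1) * (η ^ 2 * conj z * mu η z / 2) * ψ z := by
  rw [opZ, opZ, (((hasWirt_mu η z).pow k).mul (hasWirt_contDiff h z)).dz]
  rcases k with _ | k
  · simp
  · rw [Nat.add_sub_cancel]
    push_cast
    ring

lemma exists_bound_dz (hη : 0 < η) (hp : toC p ∈ Sym η d) :
    ∃ C, ∀ z, ‖dz (toC p) z * (mu η z : ℂ) ^ d‖ ≤ C := by
  obtain ⟨C, hC, h⟩ := exists_norm_le_of_mem_Sym hη (dz_dzbar_mem_Sym hp).1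
  refine ⟨C, fun z => ?_⟩
  rw [norm_mul, norm_pow, Complex.norm_real, Real.norm_of_nonneg (mu_pos η z).le]
  have hm := mu_pos η z
  calc _ ≤ C * Real.sqrt (wt η z) ^ (d : ℤ) * mu η z ^ d := by gcongr; exact h z
    _ = C := by
      rw [sqrt_wt_zpow, zpow_neg, zpow_natCast]
      field_simp

/-- The function `∂p/∂z (1 + η² |z|²)^(-d/2)`. -/
noncomputable def dpB (hη : 0 < η) (hp : toC p ∈ Sym η d) : BoundedContinuousFunction ℂ ℂ :=
  bcf (fun z => dz (toC p) z * (mu η z : ℂ) ^ d)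
    ((contDiff_of_mem_Sym (dz_dzbar_mem_Sym hp).1).continuous.mul
      ((contDiff_mu η).continuous.pow d)) _ (exists_bound_dz hη hp).choose_spec

lemma dpB_apply (hη : 0 < η) (hp : toC p ∈ Sym η d) (z : ℂ) :
    dpB hη hp z = dz (toC p) z * (mu η z : ℂ) ^ d := rfl

lemma star_muB : star (muB η) = muB η := by
  ext z
  change conj (mu η z : ℂ) = mu η z
  exact Complex.conj_ofReal _

lemma coeFn_mulOp_muB_pow (k : ℕ) (f : L2) :
    (mulOp (muB η) ^ k) f =ᵐ[volume] fun z => (mu η z : ℂ) ^ k * f z := by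
  rw [← mulOp_pow]
  filter_upwards [coeFn_mulOp (muB η ^ k) f] with z h
  rw [h, BoundedContinuousFunction.pow_apply, muB_apply]

/-- Multiplication of a test function `ψ` with the inverse weight `μ`, on the level of the graph:
`Z (μ ψ) = μ Z ψ - μ² W ψ`, since the derivative of `μ` is `-μ² W`. -/
lemma lower_range_one_apply (hη : 0 < η) {τ : ℝ} {g : L2Pair} {ψ : ℂ → ℂ}
    (h : IsGraphPoint p τ g ψ) :
    (diagOp (mulOp (muB η)) * (1 - diagOp (mulOp (muB η)) * lowerOp (mulOp (dwB hη)))) g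
      ∈ graphZ p τ := by
  obtain ⟨h1, h2, h3, h4⟩ := h
  refine IsGraphPoint.mem (ψ := fun z => (mu η z : ℂ) ^ 1 * ψ z) ⟨?_, ?_, ?_, ?_⟩
  · exact ((contDiff_mu η).pow 1).mul h1
  · exact h2.mul_left
  · rw [mul_apply_eq_comp, diagOp_fst]
    have e : ((1 - diagOp (mulOp (muB η)) * lowerOp (mulOp (dwB hη)) : L2Pair →L[ℂ] L2Pair) g).fst
        = g.fst := by simp [mul_apply_eq_comp]
    rw [e]
    filter_upwards [coeFn_mulOp (muB η) g.fst, h3] with z e1 e2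
    rw [e1, e2, muB_apply, pow_one]
  · rw [mul_apply_eq_comp, diagOp_snd]
    have e : ((1 - diagOp (mulOp (muB η)) * lowerOp (mulOp (dwB hη)) : L2Pair →L[ℂ] L2Pair) g).snd
        = g.snd - mulOp (muB η) (mulOp (dwB hη) g.fst) := by simp [mul_apply_eq_comp]
    rw [e, map_sub]
    filter_upwards [Lp.coeFn_sub (mulOp (muB η) g.snd)
        (mulOp (muB η) (mulOp (muB η) (mulOp (dwB hη) g.fst))),
      coeFn_mulOp (muB η) g.snd, coeFn_mulOp (muB η) (mulOp (muB η) (mulOp (dwB hη) g.fst)),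
      coeFn_mulOp (muB η) (mulOp (dwB hη) g.fst), coeFn_mulOp (dwB hη) g.fst, h3, h4]
      with z e1 e2 e3 e4 e5 e6 e7
    rw [e1, Pi.sub_apply, e2, e3, e4, e5, e6, e7, opZ_mu_pow_mul τ 1 h1, muB_apply, dwB_apply]
    push_cast
    ring

/-- Multiplication of a test function with `μᵈ`, on the level of the graphs for `σ` and `τ`. -/
lemma lower_range_d_apply (hη : 0 < η) (hp : toC p ∈ Sym η d) {τ σ : ℝ} {g : L2Pair}
    {ψ : ℂ → ℂ} (h : IsGraphPoint p σ g ψ) :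
    ((diagOp (mulOp (muB η)) ^ d - (τ - σ) • lowerOp (mulOp (dpB hη hp)))
      * (1 - (d : ℝ) • (diagOp (mulOp (muB η)) * lowerOp (mulOp (dwB hη))))) g ∈ graphZ p τ := by
  obtain ⟨h1, h2, h3, h4⟩ := h
  set y := (1 - (d : ℝ) • (diagOp (mulOp (muB η)) * lowerOp (mulOp (dwB hη)))
    : L2Pair →L[ℂ] L2Pair) g with hy
  have ey1 : y.fst = g.fst := by simp [hy, mul_apply_eq_comp]
  have ey2 : y.snd = g.snd - (d : ℝ) • mulOp (muB η) (mulOp (dwB hη) g.fst) := by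
    simp [hy, mul_apply_eq_comp]
  rw [mul_apply_eq_comp, ← hy, diagOp_pow]
  refine IsGraphPoint.mem (ψ := fun z => (mu η z : ℂ) ^ d * ψ z) ⟨?_, ?_, ?_, ?_⟩
  · exact ((contDiff_mu η).pow d).mul h1
  · exact h2.mul_left
  · have e : ((diagOp (mulOp (muB η) ^ d) - (τ - σ) • lowerOp (mulOp (dpB hη hp))
        : L2Pair →L[ℂ] L2Pair) y).fst = (mulOp (muB η) ^ d) y.fst := by simp
    rw [e, ey1]
    filter_upwards [coeFn_mulOp_muB_pow (η := η) d g.fst, h3] with z e1 e2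
    rw [e1, e2]
  · have e : ((diagOp (mulOp (muB η) ^ d) - (τ - σ) • lowerOp (mulOp (dpB hη hp))
        : L2Pair →L[ℂ] L2Pair) y).snd
        = (mulOp (muB η) ^ d) y.snd - (τ - σ) • mulOp (dpB hη hp) y.fst := by simp
    rw [e, ey1, ey2, map_sub]
    have hs : (mulOp (muB η) ^ d) ((d : ℝ) • mulOp (muB η) (mulOp (dwB hη) g.fst))
        = (d : ℝ) • (mulOp (muB η) ^ d) (mulOp (muB η) (mulOp (dwB hη) g.fst)) := by
      exact map_smul ((mulOp (muB η) ^ d).restrictScalars ℝ) _ _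
    rw [hs]
    set A := (mulOp (muB η) ^ d) g.snd
    set B := (mulOp (muB η) ^ d) (mulOp (muB η) (mulOp (dwB hη) g.fst))
    set D := mulOp (dpB hη hp) g.fst
    filter_upwards [Lp.coeFn_sub (A - (d : ℝ) • B) ((τ - σ) • D), Lp.coeFn_sub A ((d : ℝ) • B),
      Lp.coeFn_smul (d : ℝ) B, Lp.coeFn_smul (τ - σ) D, coeFn_mulOp_muB_pow (η := η) d g.snd,
      coeFn_mulOp_muB_pow (η := η) d (mulOp (muB η) (mulOp (dwB hη) g.fst)),
      coeFn_mulOp (dpB hη hp) g.fst,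
      coeFn_mulOp (muB η) (mulOp (dwB hη) g.fst), coeFn_mulOp (dwB hη) g.fst, h3, h4]
      with z a1 a2 a3 a4 a5 a6 a7 a8 a9 a10 a11
    rw [a1, Pi.sub_apply, a2, Pi.sub_apply, a3, a4, Pi.smul_apply, Pi.smul_apply, a5, a6, a7, a8,
      a9, a10, a11, opZ_mu_pow_mul τ d h1, muB_apply, dwB_apply, dpB_apply, opZ, opZ,
      Complex.real_smul, Complex.real_smul]
    push_cast
    ring

/-- The projections onto the graphs of the operators `Z`, with the weight `(1 + η² |z|²)^(1/2)`. The
conditions on `η` make the commutators with the weight small. -/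
noncomputable def weightedGraphs (hη : 0 < η) (hp : toC p ∈ Sym η d) (h1 : η ≤ 1)
    (h2 : d * η ≤ 1) : WeightedProjections (L2Pair →L[ℂ] L2Pair) where
  m := diagOp (mulOp (muB η))
  W := lowerOp (mulOp (dwB hη))
  b := lowerOp (mulOp (dpB hη hp))
  J := reflectFst
  d := d
  P := fun τ => (graphZ p τ).starProjection
  m_inj := by
    intro x y h
    have hinj : Function.Injective (mulOp (muB η)) := mulOp_injective fun z => by
      rw [muB_apply]; exact_mod_cast (mu_pos η z).ne'
    ext1 v
    have hv : diagOp (mulOp (muB η)) (x v) = diagOp (mulOp (muB η)) (y v) :=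
      DFunLike.congr_fun h v
    refine pair_ext (hinj ?_) (hinj ?_)
    · rw [← diagOp_fst, hv, diagOp_fst]
    · rw [← diagOp_snd, hv, diagOp_snd]
  star_m := star_diagOp (by rw [star_mulOp, star_muB])
  W_m := by
    rw [diagOp_mul_lowerOp, lowerOp_mul_diagOp, ← mulOp_mul, ← mulOp_mul, mul_comm]
  b_m := by
    rw [diagOp_mul_lowerOp, lowerOp_mul_diagOp, ← mulOp_mul, ← mulOp_mul, mul_comm]
  J_m := reflectFst_mul_diagOp _
  W_W := lowerOp_mul_lowerOp _ _
  star_P := fun τ => isSelfAdjoint_starProjection (graphZ p τ)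
  norm_P := fun τ => (graphZ p τ).starProjection_norm_le
  norm_one_sub_P := fun τ => by
    have h := (graphZ p τ).starProjection_orthogonal'
    have : (1 : L2Pair →L[ℂ] L2Pair) - (graphZ p τ).starProjection
        = (graphZ p τ)ᗮ.starProjection := h.symm
    rw [this]
    exact (graphZ p τ)ᗮ.starProjection_norm_le
  norm_V := fun τ => norm_reflection_mul_reflectFst_le _
  norm_W := by
    rw [diagOp_mul_lowerOp, ← mulOp_mul]
    refine (norm_lowerOp_le _).trans ((norm_mulOp_le _).trans
      ((norm_muB_mul_dwB_le hη).trans (by linarith)))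
  norm_dW := by
    rw [diagOp_mul_lowerOp, ← mulOp_mul]
    have := (norm_lowerOp_le (mulOp (muB η * dwB hη))).trans
      ((norm_mulOp_le _).trans (norm_muB_mul_dwB_le hη))
    calc _ ≤ (d : ℝ) * (η / 4) := by gcongr
      _ ≤ 1 / 4 := by linarith
  range_one := fun τ => starProjection_mul_mul fun g ψ h => lower_range_one_apply hη h
  range_d := fun τ σ => by
    rw [← mul_assoc]
    have := starProjection_mul_mul (τ := τ) (σ := σ)
      fun g ψ h => lower_range_d_apply hη hp (τ := τ) (σ := σ) h
    rw [← mul_assoc] at this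
    exact this

lemma compress_graphZ (p : ℂ → ℝ) (τ : ℝ) :
    compress (graphZ p τ).starProjection = boxResolvent p τ := rfl

end Graph

/-! ### Schwartz functions in the domain of the operators -/

section Schwartz

open SchwartzMap LineDeriv

/-- `∂/∂z` on Schwartz functions. -/
noncomputable def dzS (f : 𝓢(ℂ, ℂ)) : 𝓢(ℂ, ℂ) :=
  (1 / 2 : ℂ) • (∂_{(1 : ℂ)} f - Complex.I • ∂_{Complex.I} f)

/-- `∂/∂z̄` on Schwartz functions. -/
noncomputable def dzbarS (f : 𝓢(ℂ, ℂ)) : 𝓢(ℂ, ℂ) :=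
  (1 / 2 : ℂ) • (∂_{(1 : ℂ)} f + Complex.I • ∂_{Complex.I} f)

lemma dzS_apply (f : 𝓢(ℂ, ℂ)) (z : ℂ) : dzS f z = dz f z := by
  simp [dzS, dz, lineDerivOp_apply_eq_fderiv]

lemma dzbarS_apply (f : 𝓢(ℂ, ℂ)) (z : ℂ) : dzbarS f z = dzbar f z := by
  simp [dzbarS, dzbar, lineDerivOp_apply_eq_fderiv]
  ring

lemma hasWirt_schwartz (f : 𝓢(ℂ, ℂ)) (z : ℂ) : HasWirt f (dz f z) (dzbar f z) z :=
  hasWirt_of_differentiableAt f.differentiableAt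

/-- Complex conjugation of Schwartz functions. -/
noncomputable def conjS (f : 𝓢(ℂ, ℂ)) : 𝓢(ℂ, ℂ) :=
  f.postcompCLM (Complex.conjCLE : ℂ →L[ℝ] ℂ)

lemma conjS_apply (f : 𝓢(ℂ, ℂ)) (z : ℂ) : conjS f z = conj (f z) := rfl

lemma integral_mul_dzbarS (f g : 𝓢(ℂ, ℂ)) : ∫ z, f z * dzbarS g z = -∫ z, dzbarS f z * g z := by
  have h1 := integral_mul_lineDerivOp_right_eq_neg_left f g (1 : ℂ) (μ := volume)
  have h2 := integral_mul_lineDerivOp_right_eq_neg_left f g Complex.I (μ := volume)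
  have i : ∀ f g : 𝓢(ℂ, ℂ), Integrable fun z => f z * g z := fun f g =>
    (smulLeftCLM ℂ (f : ℂ → ℂ) g).integrable.congr (Eventually.of_forall fun z => by
      simp [smulLeftCLM_apply_apply f.hasTemperateGrowth])
  have e1 : ∀ z, f z * dzbarS g z
      = (1 / 2) * (f z * ∂_{(1 : ℂ)} g z + Complex.I * (f z * ∂_{Complex.I} g z)) := fun z => by
    simp [dzbarS]; ring
  have e2 : ∀ z, dzbarS f z * g z
      = (1 / 2) * (∂_{(1 : ℂ)} f z * g z + Complex.I * (∂_{Complex.I} f z * g z)) := fun z => by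
    simp [dzbarS]; ring
  simp only [e1, e2, integral_const_mul]
  rw [integral_add (i _ _) ((i _ _).const_mul _), integral_add (i _ _) ((i _ _).const_mul _),
    integral_const_mul, integral_const_mul, h1, h2]
  ring

/-- Multiplication of a Schwartz function with a symbol. -/
noncomputable def symS (q : ℂ → ℂ) (f : 𝓢(ℂ, ℂ)) : 𝓢(ℂ, ℂ) := smulLeftCLM ℂ q f

lemma symS_apply {η : ℝ} {k : ℤ} {q : ℂ → ℂ} (hq : q ∈ Sym η k) (f : 𝓢(ℂ, ℂ)) (z : ℂ) :
    symS q f z = q z * f z := by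
  rw [symS, smulLeftCLM_apply_apply (hasTemperateGrowth_of_mem_Sym hq), smul_eq_mul]

variable {p : ℂ → ℝ} {η : ℝ} {d : ℕ}

/-- The inclusion of the Schwartz space in `L²`. -/
noncomputable def toL2 : 𝓢(ℂ, ℂ) →L[ℂ] L2 := toLpCLM ℂ ℂ 2 volume

lemma coeFn_toL2 (f : 𝓢(ℂ, ℂ)) : toL2 f =ᵐ[volume] f := f.coeFn_toLp 2 volume

lemma inner_toL2 (f g : 𝓢(ℂ, ℂ)) : ⟪toL2 f, toL2 g⟫_ℂ = ∫ z, g z * conj (f z) :=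
  inner_toL2_toL2_eq f g volume

/-- The operator `Z` on Schwartz functions. -/
noncomputable def opZS (p : ℂ → ℝ) (τ : ℝ) (f : 𝓢(ℂ, ℂ)) : 𝓢(ℂ, ℂ) :=
  dzS f - (τ : ℂ) • symS (dz (toC p)) f

/-- The operator `Z̄` on Schwartz functions. -/
noncomputable def opZbarS (p : ℂ → ℝ) (τ : ℝ) (f : 𝓢(ℂ, ℂ)) : 𝓢(ℂ, ℂ) :=
  dzbarS f + (τ : ℂ) • symS (dzbar (toC p)) f

lemma opZS_apply (hp : toC p ∈ Sym η d) (τ : ℝ) (f : 𝓢(ℂ, ℂ)) (z : ℂ) :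
    opZS p τ f z = opZ p τ f z := by
  rw [opZS, sub_apply, smul_apply, dzS_apply,
    symS_apply (dz_dzbar_mem_Sym hp).1, opZ, smul_eq_mul, mul_assoc]

lemma opZbarS_apply (hp : toC p ∈ Sym η d) (τ : ℝ) (f : 𝓢(ℂ, ℂ)) (z : ℂ) :
    opZbarS p τ f z = opZbar p τ f z := by
  rw [opZbarS, add_apply, smul_apply, dzbarS_apply,
    symS_apply (dz_dzbar_mem_Sym hp).2, opZbar, smul_eq_mul, mul_assoc]

lemma conj_dz_toC (hp : toC p ∈ Sym η d) (z : ℂ) : conj (dz (toC p) z) = dzbar (toC p) z := by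
  have h := (hasWirt_of_mem_Sym hp z).conj
  have e : (fun z => conj (toC p z)) = toC p := by ext z; exact Complex.conj_ofReal _
  rw [e] at h
  exact h.dzbar.symm

lemma conjS_dzS (f : 𝓢(ℂ, ℂ)) : conjS (dzS f) = dzbarS (conjS f) := by
  ext z
  rw [conjS_apply, dzS_apply, dzbarS_apply]
  exact ((hasWirt_schwartz f z).conj).dzbar.symm

lemma inner_opZS (hp : toC p ∈ Sym η d) (τ : ℝ) (f g : 𝓢(ℂ, ℂ)) :
    ⟪toL2 (opZS p τ f), toL2 g⟫_ℂ = -⟪toL2 f, toL2 (opZbarS p τ g)⟫_ℂ := by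
  rw [inner_toL2, inner_toL2]
  have i : ∀ f g : 𝓢(ℂ, ℂ), Integrable fun z => f z * g z := fun f g =>
    (smulLeftCLM ℂ (f : ℂ → ℂ) g).integrable.congr (Eventually.of_forall fun z => by
      simp [smulLeftCLM_apply_apply f.hasTemperateGrowth])
  have e1 : ∀ z, g z * conj (opZS p τ f z)
      = dzbarS (conjS f) z * g z - τ * (symS (dzbar (toC p)) (conjS f) z * g z) := by
    intro z
    rw [← conjS_dzS, conjS_apply, symS_apply (dz_dzbar_mem_Sym hp).2, conjS_apply, opZS,
      sub_apply, smul_apply, symS_apply (dz_dzbar_mem_Sym hp).1,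
      map_sub, smul_eq_mul, map_mul, map_mul, Complex.conj_ofReal, conj_dz_toC hp]
    ring
  have e2 : ∀ z, opZbarS p τ g z * conj (f z)
      = conjS f z * dzbarS g z + τ * (symS (dzbar (toC p)) (conjS f) z * g z) := by
    intro z
    rw [symS_apply (dz_dzbar_mem_Sym hp).2, conjS_apply, opZbarS,
      add_apply, smul_apply, symS_apply (dz_dzbar_mem_Sym hp).2,
      smul_eq_mul]
    ring
  simp only [e1, e2]
  rw [integral_sub (i _ _) ((i _ _).const_mul _), integral_add (i _ _) ((i _ _).const_mul _),
    integral_mul_dzbarS]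
  ring

/-! #### Cutoffs -/

/-- A smooth function of compact support, equal to `1` near the origin. -/
noncomputable def bump : ContDiffBump (0 : ℂ) := ⟨1, 2, zero_lt_one, one_lt_two⟩

/-- The cutoff functions `χ (z / (n + 1))`. -/
noncomputable def cutoff (n : ℕ) (z : ℂ) : ℂ := (bump (((n : ℝ) + 1)⁻¹ • z) : ℝ)

lemma contDiff_cutoff (n : ℕ) : ContDiff ℝ ∞ (cutoff n) :=
  Complex.ofRealCLM.contDiff.comp (bump.contDiff.comp (contDiff_const_smul _))

lemma hasCompactSupport_cutoff (n : ℕ) : HasCompactSupport (cutoff n) := by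
  have h : HasCompactSupport fun z : ℂ => bump (((n : ℝ) + 1)⁻¹ • z) :=
    bump.hasCompactSupport.comp_smul (by positivity)
  exact h.comp_left Complex.ofReal_zero

lemma norm_cutoff_le (n : ℕ) (z : ℂ) : ‖cutoff n z‖ ≤ 1 := by
  rw [cutoff, Complex.norm_real, Real.norm_of_nonneg bump.nonneg]
  exact bump.le_one

lemma tendsto_cutoff (z : ℂ) : Tendsto (fun n => cutoff n z) atTop (𝓝 1) := by
  have h0 : Tendsto (fun n : ℕ => ((n : ℝ) + 1)⁻¹ • z) atTop (𝓝 0) := by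
    have := (tendsto_one_div_add_atTop_nhds_zero_nat (𝕜 := ℝ)).smul_const z
    simpa using this
  have h1 : (fun y : ℂ => ((bump y : ℝ) : ℂ)) =ᶠ[𝓝 0] fun _ => 1 := by
    filter_upwards [bump.eventuallyEq_one] with y hy
    rw [hy]; simp
  exact (tendsto_const_nhds.congr' h1.symm).comp h0

lemma exists_dz_cutoff_le : ∃ C : ℝ, 0 ≤ C ∧ ∀ n z, ‖dz (cutoff n) z‖ ≤ C * ((n : ℝ) + 1)⁻¹ := by
  set χ : ℂ → ℂ := fun y => ((bump y : ℝ) : ℂ) with hχ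
  have hχ1 : ContDiff ℝ ∞ χ := Complex.ofRealCLM.contDiff.comp bump.contDiff
  have hχ2 : HasCompactSupport χ := bump.hasCompactSupport.comp_left Complex.ofReal_zero
  set f := hχ2.toSchwartzMap hχ1
  obtain ⟨C, hC⟩ : ∃ C, ∀ z, ‖dz χ z‖ ≤ C := by
    refine ⟨SchwartzMap.seminorm ℂ 0 0 (dzS f), fun z => ?_⟩
    have := norm_le_seminorm ℂ (dzS f) z
    rw [dzS_apply] at this
    exact this
  refine ⟨C, (norm_nonneg _).trans (hC 0), fun n z => ?_⟩
  set c : ℝ := ((n : ℝ) + 1)⁻¹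
  have h : HasWirt (cutoff n) (c * dz χ (c • z)) (c * dzbar χ (c • z)) z := by
    have h1 := hasWirt_contDiff hχ1 (c • z)
    have h2 : HasFDerivAt (fun z : ℂ => c • z) (c • ContinuousLinearMap.id ℝ ℂ) z :=
      (hasFDerivAt_id z).const_smul c
    refine (HasFDerivAt.comp z h1 h2).congr_fderiv ?_
    ext v
    simp only [ContinuousLinearMap.comp_apply, smul_apply, wirt_apply, ContinuousLinearMap.id_apply,
      Complex.real_smul, map_mul, Complex.conj_ofReal]
    ring
  rw [h.dz, norm_mul, Complex.norm_real, Real.norm_of_nonneg (by positivity), mul_comm]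
  gcongr
  exact hC _

lemma tendsto_inner_cutoff (u v : L2) {w : ℕ → L2}
    (hw : ∀ n, w n =ᵐ[volume] fun z => cutoff n z * v z) :
    Tendsto (fun n => ⟪u, w n⟫_ℂ) atTop (𝓝 ⟪u, v⟫_ℂ) := by
  simp only [MeasureTheory.L2.inner_def]
  refine tendsto_integral_of_dominated_convergence (fun z => ‖⟪u z, v z⟫_ℂ‖)
    (fun n => (MeasureTheory.L2.integrable_inner u (w n)).aestronglyMeasurable)
    (MeasureTheory.L2.integrable_inner u v).norm (fun n => ?_) ?_
  · filter_upwards [hw n] with z hz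
    rw [hz, RCLike.inner_apply, RCLike.inner_apply, norm_mul, norm_mul, norm_mul]
    have := norm_cutoff_le n z
    calc _ ≤ 1 * ‖v z‖ * ‖conj (u z)‖ := by gcongr
      _ = _ := by ring
  · filter_upwards [ae_all_iff.2 hw] with z hz
    simp only [hz]
    have := (tendsto_cutoff z).mul_const (v z)
    rw [one_mul] at this
    exact (Continuous.inner continuous_const continuous_id).tendsto _ |>.comp this

/-- Schwartz functions are in the domain of the closure of `Z`. By duality, it is enough to
approximate them weakly with test functions; these are products with cutoff functions. -/
lemma toLp_mem_graphZ (hp : toC p ∈ Sym η d) (τ : ℝ) (f : 𝓢(ℂ, ℂ)) :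
    WithLp.toLp 2 (toL2 f, toL2 (opZS p τ f)) ∈ graphZ p τ := by
  rw [← (graphZ p τ).orthogonal_orthogonal, Submodule.mem_orthogonal]
  intro y hy
  rw [Submodule.mem_orthogonal'] at hy
  have hmem : ∀ u : L2, ∀ n, MemLp (fun z => cutoff n z * u z) 2 volume := fun u n =>
    memLp_bcf_mul (bcf (cutoff n) (contDiff_cutoff n).continuous 1 (norm_cutoff_le n)) u
  obtain ⟨C, hC, hdz⟩ := exists_dz_cutoff_le
  have hcdz : ∀ n, Continuous (dz (cutoff n)) := fun n => by
    have : dz (cutoff n) =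
        dzS ((hasCompactSupport_cutoff n).toSchwartzMap (contDiff_cutoff n)) := by
      ext z; rw [dzS_apply]; rfl
    rw [this]; exact SchwartzMap.continuous _
  set D : ℕ → L2 := fun n => mulOp (bcf (dz (cutoff n)) (hcdz n) _ (hdz n)) (toL2 f) with hD
  have hD0 : Tendsto D atTop (𝓝 0) := by
    refine squeeze_zero_norm (a := fun n : ℕ => C * ((n : ℝ) + 1)⁻¹ * ‖toL2 f‖)
      (fun n => ?_) ?_
    · refine ((mulOp _).le_opNorm _).trans ?_
      gcongr
      refine (norm_mulOp_le _).trans ((BoundedContinuousFunction.norm_le (by positivity)).2 (hdz n))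
    · have := ((tendsto_one_div_add_atTop_nhds_zero_nat (𝕜 := ℝ)).const_mul C).mul_const
        ‖toL2 f‖
      simpa using this
  have hzero : ∀ n, ⟪y.fst, (hmem (toL2 f) n).toLp⟫_ℂ
      + (⟪y.snd, (hmem (toL2 (opZS p τ f)) n).toLp⟫_ℂ + ⟪y.snd, D n⟫_ℂ) = 0 := by
    intro n
    have hg : IsGraphPoint p τ (WithLp.toLp 2 ((hmem (toL2 f) n).toLp,
        (hmem (toL2 (opZS p τ f)) n).toLp + D n)) (fun z => cutoff n z * f z) := by
      refine ⟨(contDiff_cutoff n).mul (f.smooth ⊤), (hasCompactSupport_cutoff n).mul_right, ?_, ?_⟩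
      · filter_upwards [(hmem (toL2 f) n).coeFn_toLp, coeFn_toL2 f] with z h1 h2
        change (hmem (toL2 f) n).toLp _ z = _
        rw [h1, h2]
      · filter_upwards [(hmem (toL2 (opZS p τ f)) n).coeFn_toLp, coeFn_toL2 (opZS p τ f),
          coeFn_toL2 f, coeFn_mulOp (bcf (dz (cutoff n)) (hcdz n) _ (hdz n)) (toL2 f),
          Lp.coeFn_add ((hmem (toL2 (opZS p τ f)) n).toLp _) (D n)] with z h1 h2 h3 h4 h5
        change ((hmem (toL2 (opZS p τ f)) n).toLp _ + D n : L2) z = _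
        rw [h5, Pi.add_apply, h1, h2, hD, h4, h3, opZS_apply hp, opZ, opZ,
          ((hasWirt_contDiff (contDiff_cutoff n) z).mul (hasWirt_schwartz f z)).dz]
        change _ + dz (cutoff n) z * f z = _
        ring
    have := hy _ hg.mem
    rw [WithLp.prod_inner_apply] at this
    simpa [inner_add_right] using this
  have hlim : Tendsto (fun n => ⟪y.fst, (hmem (toL2 f) n).toLp⟫_ℂ
      + (⟪y.snd, (hmem (toL2 (opZS p τ f)) n).toLp⟫_ℂ + ⟪y.snd, D n⟫_ℂ)) atTop
      (𝓝 (⟪y.fst, toL2 f⟫_ℂ + (⟪y.snd, toL2 (opZS p τ f)⟫_ℂ + ⟪y.snd, (0 : L2)⟫_ℂ))) :=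
    (tendsto_inner_cutoff _ _ fun n => (hmem _ n).coeFn_toLp).add
      ((tendsto_inner_cutoff _ _ fun n => (hmem _ n).coeFn_toLp).add (tendsto_const_nhds.inner hD0))
  simp only [hzero, inner_zero_right, add_zero] at hlim
  rw [WithLp.prod_inner_apply]
  exact (tendsto_nhds_unique tendsto_const_nhds hlim).symm

/-- The operator `1 + □ = 1 - Z̄ Z` on Schwartz functions. -/
noncomputable def oneAddBoxS (p : ℂ → ℝ) (τ : ℝ) (f : 𝓢(ℂ, ℂ)) : 𝓢(ℂ, ℂ) :=
  f - opZbarS p τ (opZS p τ f)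

/-- The resolvent inverts `1 + □` on Schwartz functions. -/
lemma boxResolvent_oneAddBoxS (hp : toC p ∈ Sym η d) (τ : ℝ) (f : 𝓢(ℂ, ℂ)) :
    boxResolvent p τ (toL2 (oneAddBoxS p τ f)) = toL2 f := by
  rw [boxResolvent_eq_iff]
  refine ⟨toL2 (opZS p τ f), toLp_mem_graphZ hp τ f, ?_⟩
  have hsub : toL2 (oneAddBoxS p τ f) - toL2 f
      = -toL2 (opZbarS p τ (opZS p τ f)) := by
    rw [oneAddBoxS, map_sub]
    abel
  rw [hsub]
  set v : L2 := toL2 (opZS p τ f)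
  set b : L2 := toL2 (opZbarS p τ (opZS p τ f))
  have key : graphZ p τ ≤ (Submodule.span ℂ {(WithLp.toLp 2 (b, v) : L2Pair)})ᗮ := by
    refine graphZ_le (Submodule.isClosed_orthogonal _) fun g ψ hψ => ?_
    obtain ⟨h1, h2, h3, h4⟩ := hψ
    rw [Submodule.mem_orthogonal_singleton_iff_inner_left, WithLp.prod_inner_apply]
    set g' := h2.toSchwartzMap h1
    have e1 : g.fst = toL2 g' := Lp.ext (h3.trans (coeFn_toL2 g').symm)
    have e2 : g.snd = toL2 (opZS p τ g') := by
      refine Lp.ext (h4.trans ?_)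
      filter_upwards [coeFn_toL2 (opZS p τ g')] with z hz
      rw [hz, opZS_apply hp]
      rfl
    have := inner_opZS hp τ g' (opZS p τ f)
    change ⟪g.fst, b⟫_ℂ + ⟪g.snd, v⟫_ℂ = 0
    rw [e1, e2, this]
    exact add_neg_cancel _
  intro g hg
  have := key hg
  rw [Submodule.mem_orthogonal_singleton_iff_inner_left, WithLp.prod_inner_apply] at this
  rw [inner_neg_right]
  exact eq_neg_of_add_eq_zero_right this

end Schwartz

/-! ### Commutation of powers of the resolvent with Fourier multipliers -/

section Rep

open SchwartzMap LineDeriv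

/-- The Fourier multiplier with symbol `σ`. -/
noncomputable def multS (σ : ℂ → ℂ) : 𝓢(ℂ, ℂ) →L[ℂ] 𝓢(ℂ, ℂ) := fourierMultiplierCLM ℂ σ

variable {p : ℂ → ℝ} {η : ℝ} {d : ℕ}

lemma multS_one (g : 𝓢(ℂ, ℂ)) : multS 1 g = g := by
  have : multS 1 = (1 : ℂ) • ContinuousLinearMap.id ℂ 𝓢(ℂ, ℂ) := fourierMultiplierCLM_const 1
  rw [this]; simp

lemma multS_sub {η' : ℝ} {k l : ℤ} {σ σ' : ℂ → ℂ} (h : σ ∈ Sym η k) (h' : σ' ∈ Sym η' l)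
    (g : 𝓢(ℂ, ℂ)) : multS (σ - σ') g = multS σ g - multS σ' g := by
  change FourierTransform.fourierInvCLM ℂ 𝓢(ℂ, ℂ)
    (smulLeftCLM ℂ (σ - σ') (FourierTransform.fourierCLM ℂ 𝓢(ℂ, ℂ) g)) = _
  rw [smulLeftCLM_sub (hasTemperateGrowth_of_mem_Sym h) (hasTemperateGrowth_of_mem_Sym h'),
    sub_apply, map_sub]
  rfl

lemma multS_multS {k l : ℤ} {σ σ' : ℂ → ℂ} (h : σ ∈ Sym η k) (h' : σ' ∈ Sym η l) (g : 𝓢(ℂ, ℂ)) :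
    multS σ (multS σ' g) = multS (σ * σ') g :=
  fourierMultiplierCLM_fourierMultiplierCLM_apply (hasTemperateGrowth_of_mem_Sym h)
    (hasTemperateGrowth_of_mem_Sym h') g

/-- The symbol of `∂/∂z`. -/
noncomputable def dzSym (ζ : ℂ) : ℂ := Real.pi * Complex.I * conj ζ

/-- The symbol of `∂/∂z̄`. -/
noncomputable def dzbarSym (ζ : ℂ) : ℂ := Real.pi * Complex.I * ζ

lemma dzSym_mem : dzSym ∈ Sym η 1 :=
  Submodule.smul_mem _ (Real.pi * Complex.I : ℂ) conj_mem_Sym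

lemma dzbarSym_mem : dzbarSym ∈ Sym η 1 :=
  Submodule.smul_mem _ (Real.pi * Complex.I : ℂ) id_mem_Sym

lemma fourier_lineDeriv (m : ℂ) (f : 𝓢(ℂ, ℂ)) (ζ : ℂ) :
    (FourierTransform.fourier (∂_{m} f) : 𝓢(ℂ, ℂ)) ζ
      = 2 * Real.pi * Complex.I
        * ((inner ℝ ζ m : ℝ) * (FourierTransform.fourier f : 𝓢(ℂ, ℂ)) ζ) := by
  rw [fourier_lineDerivOp_eq, smul_apply, smulLeftCLM_apply_apply (by fun_prop), smul_eq_mul,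
    Complex.real_smul]

lemma dzS_eq (f : 𝓢(ℂ, ℂ)) : dzS f = multS dzSym f := by
  apply (FourierTransform.fourierCLE ℂ 𝓢(ℂ, ℂ)).injective
  ext ζ
  change FourierTransform.fourier (dzS f) ζ = FourierTransform.fourier (multS dzSym f) ζ
  rw [multS, fourierMultiplierCLM_apply, FourierTransform.fourier_fourierInv_eq,
    smulLeftCLM_apply_apply (hasTemperateGrowth_of_mem_Sym (dzSym_mem (η := 1))), dzS,
    FourierTransform.fourier_smul, sub_eq_add_neg, FourierTransform.fourier_add,
    ← neg_one_smul ℂ (Complex.I • _),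
    FourierTransform.fourier_smul, FourierTransform.fourier_smul]
  simp only [smul_apply, add_apply, fourier_lineDeriv, smul_eq_mul, dzSym]
  rw [Complex.inner, Complex.inner]
  apply Complex.ext <;> simp <;> ring

lemma dzbarS_eq (f : 𝓢(ℂ, ℂ)) : dzbarS f = multS dzbarSym f := by
  apply (FourierTransform.fourierCLE ℂ 𝓢(ℂ, ℂ)).injective
  ext ζ
  change FourierTransform.fourier (dzbarS f) ζ = FourierTransform.fourier (multS dzbarSym f) ζ
  rw [multS, fourierMultiplierCLM_apply, FourierTransform.fourier_fourierInv_eq,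
    smulLeftCLM_apply_apply (hasTemperateGrowth_of_mem_Sym (dzbarSym_mem (η := 1))), dzbarS,
    FourierTransform.fourier_smul, FourierTransform.fourier_add,
    FourierTransform.fourier_smul]
  simp only [smul_apply, add_apply, fourier_lineDeriv, smul_eq_mul, dzbarSym]
  rw [Complex.inner, Complex.inner]
  apply Complex.ext <;> simp <;> ring

/-- The symbol of `(1 - ∂²/∂z∂z̄)⁻¹`. -/
noncomputable def invSym (ζ : ℂ) : ℂ := (wt Real.pi ζ : ℂ)⁻¹

lemma invSym_mem : invSym ∈ Sym Real.pi (-2) := by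
  have h := wt_inv_pow_mem_Sym (η := Real.pi) 1
  simp only [pow_one] at h
  exact h

lemma mul_invSym (ζ : ℂ) : invSym ζ - dzbarSym ζ * (dzSym ζ * invSym ζ) = 1 := by
  have h0 : (wt Real.pi ζ : ℂ) ≠ 0 := by exact_mod_cast (wt_pos _ ζ).ne'
  have e : dzbarSym ζ * dzSym ζ = 1 - wt Real.pi ζ := by
    rw [ofReal_wt, dzbarSym, dzSym]
    linear_combination (Real.pi : ℂ) ^ 2 * ζ * conj ζ * Complex.I_mul_I
  rw [← mul_assoc, e, invSym]
  field_simp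
  ring

/-- A term `τˡ A_{j₀ + j} (q · S_σ g)` in the expansion of `A_{j₀} (q₀ g)`, where `A_j` is a power
of the resolvent times a heat operator. -/
structure RepTerm where
  /-- the power of `τ` -/
  l : ℕ
  /-- the increase of the power of the resolvent -/
  j : ℕ
  /-- the function by which the result of the Fourier multiplier is multiplied -/
  q : ℂ → ℂ
  /-- the symbol of the Fourier multiplier -/
  σ : ℂ → ℂ

/-- The value of a term. -/
noncomputable def RepTerm.eval (p : ℂ → ℝ) (τ : ℝ) (j : ℤ) (s : ℝ) (g : 𝓢(ℂ, ℂ)) (t : RepTerm) :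
    L2 :=
  (τ : ℂ) ^ t.l • heatPow (j + t.j) s (boxResolvent p τ) (toL2 (symS t.q (multS t.σ g)))

lemma opZbarS_opZS (hp : toC p ∈ Sym η d) (τ : ℝ) {k : ℤ} {q : ℂ → ℂ} (hq : q ∈ Sym η k)
    (u : 𝓢(ℂ, ℂ)) (z : ℂ) :
    opZbarS p τ (opZS p τ (symS q u)) z
      = dzbar (dz q) z * u z + dz q z * dzbarS u z + dzbar q z * dzS u z + q z * dzbarS (dzS u) z
        - τ * (dzbar (dz (toC p)) z * q z * u z + dz (toC p) z * dzbar q z * u z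
          + dz (toC p) z * q z * dzbarS u z)
        + τ * dzbar (toC p) z * (dz q z * u z + q z * dzS u z - τ * dz (toC p) z * q z * u z) := by
  have hdp := (dz_dzbar_mem_Sym hp).1
  have hdq := (dz_dzbar_mem_Sym hq).1
  have e1 : ∀ z, opZS p τ (symS q u) z
      = dz q z * u z + q z * dzS u z - τ * (dz (toC p) z * (q z * u z)) := by
    intro z
    have h := (hasWirt_of_mem_Sym hq z).mul (hasWirt_schwartz u z)
    have e : (symS q u : ℂ → ℂ) = fun z => q z * u z := funext fun z => symS_apply hq u z
    rw [opZS_apply hp, opZ, e, h.dz, dzS_apply]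
    ring
  have e2 : (opZS p τ (symS q u) : ℂ → ℂ)
      = fun z => dz q z * u z + q z * dzS u z - τ * (dz (toC p) z * (q z * u z)) := funext e1
  rw [opZbarS_apply hp, opZbar, e1, e2]
  have hu := hasWirt_schwartz u z
  have hdu := hasWirt_schwartz (dzS u) z
  have h := (((hasWirt_of_mem_Sym hdq z).mul hu).add ((hasWirt_of_mem_Sym hq z).mul hdu)).sub
    (((hasWirt_of_mem_Sym hdp z).mul ((hasWirt_of_mem_Sym hq z).mul hu)).const_mul (τ : ℂ))
  rw [h.dzbar, dzbarS_apply, dzbarS_apply]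
  ring

/-- The terms that arise from one step. In the first one, `1 - ∂²/∂z∂z̄` is replaced with `1 + □`,
which is absorbed by a power of the resolvent; the others are the differences, in which the
multiplier has gained one order at least. -/
noncomputable def repStep (p : ℂ → ℝ) (t : RepTerm) : List RepTerm :=
  [⟨t.l, t.j + 1, t.q, invSym * t.σ⟩,
    ⟨t.l, t.j, dzbar t.q, dzSym * (invSym * t.σ)⟩,
    ⟨t.l + 1, t.j, dzbar (toC p) * t.q, dzSym * (invSym * t.σ)⟩,
    ⟨t.l, t.j, dz t.q, dzbarSym * (invSym * t.σ)⟩,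
    ⟨t.l + 1, t.j, -(dz (toC p) * t.q), dzbarSym * (invSym * t.σ)⟩,
    ⟨t.l, t.j, dzbar (dz t.q), invSym * t.σ⟩,
    ⟨t.l + 1, t.j, dzbar (toC p) * dz t.q - dz (toC p) * dzbar t.q - dzbar (dz (toC p)) * t.q,
      invSym * t.σ⟩,
    ⟨t.l + 2, t.j, -(dz (toC p) * dzbar (toC p) * t.q), invSym * t.σ⟩]

/-- The multiplier in the term has order at most `-r`, the function has order at most `k`, and the
power of the resolvent has been raised by at most `r`. -/
def RepTerm.IsOrder (η : ℝ) (r : ℕ) (k : ℤ) (t : RepTerm) : Prop :=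
  t.j ≤ r ∧ t.q ∈ Sym η k ∧ t.σ ∈ Sym Real.pi (-(r : ℤ))

/-- One step of the expansion: with `u = (1 - ∂²/∂z∂z̄)⁻¹ S_σ g`, the function `q · S_σ g` differs
from `(1 + □) (q u)` by terms with at most first order derivatives of `u`, multiplied by products and
derivatives of `p` and `q`. -/
lemma eval_eq_repStep (hp : toC p ∈ Sym η d) {k l : ℤ} {t : RepTerm} (hq : t.q ∈ Sym η k)
    (hσ : t.σ ∈ Sym Real.pi l) {τ : ℝ} {j : ℤ} {s : ℝ} (h : Admissible (j + t.j + 1) s)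
    (g : 𝓢(ℂ, ℂ)) : t.eval p τ j s g = ((repStep p t).map (RepTerm.eval p τ j s g)).sum := by
  obtain ⟨tl, tj, q, σ⟩ := t
  simp only at hq hσ h
  have hdp := (dz_dzbar_mem_Sym hp).1
  have hdbp := (dz_dzbar_mem_Sym hp).2
  have hddp := (dz_dzbar_mem_Sym hdp).2
  have hdq := (dz_dzbar_mem_Sym hq).1
  have hdbq := (dz_dzbar_mem_Sym hq).2
  have hddq := (dz_dzbar_mem_Sym hdq).2
  have hiσ := Sym_mul invSym_mem hσ
  set u := multS (invSym * σ) g with hu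
  have eu1 : multS (dzSym * (invSym * σ)) g = dzS u := by
    rw [dzS_eq, multS_multS dzSym_mem hiσ]
  have eu2 : multS (dzbarSym * (invSym * σ)) g = dzbarS u := by
    rw [dzbarS_eq, multS_multS dzbarSym_mem hiσ]
  have eu3 : multS σ g = u - dzbarS (dzS u) := by
    rw [dzbarS_eq, dzS_eq, multS_multS (η := Real.pi) dzbarSym_mem dzSym_mem, hu,
      multS_multS (Sym_mul dzbarSym_mem dzSym_mem) hiσ,
      ← multS_sub hiσ (Sym_mul (Sym_mul dzbarSym_mem dzSym_mem) hiσ)]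
    refine congrArg (fun σ => multS σ g) (funext fun ζ => ?_)
    have := mul_invSym ζ
    simp only [Pi.sub_apply, Pi.mul_apply]
    linear_combination (-(σ ζ)) * this
  have key : symS q (multS σ g) = oneAddBoxS p τ (symS q u)
      + (symS (dzbar q) (dzS u) + (τ : ℂ) • symS (dzbar (toC p) * q) (dzS u)
      + symS (dz q) (dzbarS u) + (τ : ℂ) • symS (-(dz (toC p) * q)) (dzbarS u)
      + symS (dzbar (dz q)) u
      + (τ : ℂ) • symS (dzbar (toC p) * dz q - dz (toC p) * dzbar q - dzbar (dz (toC p)) * q) u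
      + (τ : ℂ) ^ 2 • symS (-(dz (toC p) * dzbar (toC p) * q)) u) := by
    ext z
    have m1 := Sym_mul hdbp hq
    have m2 := Submodule.neg_mem _ (Sym_mul hdp hq)
    have m3 : dzbar (toC p) * dz q - dz (toC p) * dzbar q - dzbar (dz (toC p)) * q
        ∈ Sym η (d + k) :=
      Submodule.sub_mem _ (Submodule.sub_mem _ (Sym_mul hdbp hdq) (Sym_mul hdp hdbq))
        (Sym_mul hddp hq)
    have m4 := Submodule.neg_mem _ (Sym_mul (Sym_mul hdp hdbp) hq)
    simp only [oneAddBoxS, add_apply, sub_apply, smul_apply]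
    rw [opZbarS_opZS hp τ hq, symS_apply hq, symS_apply hq, symS_apply hdbq, symS_apply m1,
      symS_apply hdq, symS_apply m2, symS_apply hddq, symS_apply m3, symS_apply m4, eu3]
    simp only [sub_apply, Pi.mul_apply, Pi.sub_apply, Pi.neg_apply, smul_eq_mul]
    ring
  have hA : ∀ f : L2, heatPow (j + tj) s (boxResolvent p τ) f
      = heatPow (j + tj + 1) s (boxResolvent p τ) (boxResolvent p τ f) := fun f => by
    have := heatPow_succ_mul (G := graphZ p τ) h
    rw [compress_graphZ] at this
    rw [← this]; rfl
  have hA' : heatPow (j + tj) s (boxResolvent p τ) (toL2 (oneAddBoxS p τ (symS q u)))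
      = heatPow (j + tj + 1) s (boxResolvent p τ) (toL2 (symS q u)) := by
    rw [hA, boxResolvent_oneAddBoxS hp]
  simp only [repStep, List.map_cons, List.map_nil, List.sum_cons, List.sum_nil, RepTerm.eval]
  rw [eu1, eu2, key]
  simp only [map_add, map_smul, hA']
  push_cast
  simp only [← add_assoc]
  module

lemma Admissible.anti {i j : ℤ} {s : ℝ} (h : Admissible j s) (hij : i ≤ j) : Admissible i s :=
  h.imp id fun h => ⟨hij.trans h.1, h.2⟩

lemma isOrder_of_mem_repStep (hp : toC p ∈ Sym η d) {r : ℕ} {k : ℤ} {t t' : RepTerm}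
    (h : t.IsOrder η r k) (ht' : t' ∈ repStep p t) : t'.IsOrder η (r + 1) (k + 2 * d) := by
  obtain ⟨hj, hq, hσ⟩ := h
  have hdp := (dz_dzbar_mem_Sym hp).1
  have hdbp := (dz_dzbar_mem_Sym hp).2
  have hddp := (dz_dzbar_mem_Sym hdp).2
  have hdq := (dz_dzbar_mem_Sym hq).1
  have hdbq := (dz_dzbar_mem_Sym hq).2
  have hddq := (dz_dzbar_mem_Sym hdq).2
  have i1 : k ≤ k + 2 * (d : ℤ) := by omega
  have i2 : (d : ℤ) + k ≤ k + 2 * (d : ℤ) := by omega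
  have i3 : (d : ℤ) + d + k ≤ k + 2 * (d : ℤ) := by omega
  have s0 : invSym * t.σ ∈ Sym Real.pi (-((r + 1 : ℕ) : ℤ)) :=
    Sym_mono (by push_cast; omega) (Sym_mul invSym_mem hσ)
  have s1 : dzSym * (invSym * t.σ) ∈ Sym Real.pi (-((r + 1 : ℕ) : ℤ)) :=
    Sym_mono (by push_cast; omega) (Sym_mul dzSym_mem (Sym_mul invSym_mem hσ))
  have s2 : dzbarSym * (invSym * t.σ) ∈ Sym Real.pi (-((r + 1 : ℕ) : ℤ)) :=
    Sym_mono (by push_cast; omega) (Sym_mul dzbarSym_mem (Sym_mul invSym_mem hσ))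
  simp only [repStep, List.mem_cons, List.not_mem_nil, or_false] at ht'
  rcases ht' with rfl | rfl | rfl | rfl | rfl | rfl | rfl | rfl
  · exact ⟨by simpa using hj, Sym_mono i1 hq, s0⟩
  · exact ⟨by simp only; omega, Sym_mono i1 hdbq, s1⟩
  · exact ⟨by simp only; omega, Sym_mono i2 (Sym_mul hdbp hq), s1⟩
  · exact ⟨by simp only; omega, Sym_mono i1 hdq, s2⟩
  · exact ⟨by simp only; omega, Submodule.neg_mem _ (Sym_mono i2 (Sym_mul hdp hq)), s2⟩
  · exact ⟨by simp only; omega, Sym_mono i1 hddq, s0⟩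
  · exact ⟨by simp only; omega, Sym_mono i2 (Submodule.sub_mem _ (Submodule.sub_mem _
      (Sym_mul hdbp hdq) (Sym_mul hdp hdbq)) (Sym_mul hddp hq)), s0⟩
  · exact ⟨by simp only; omega,
      Submodule.neg_mem _ (Sym_mono i3 (Sym_mul (Sym_mul hdp hdbp) hq)), s0⟩

/-- Powers of the resolvent composed with multiplications are combinations of terms that begin
with Fourier multipliers of arbitrarily low order, at the price of higher order symbols. -/
theorem exists_rep (hp : toC p ∈ Sym η d) (r : ℕ) {k : ℤ} {q : ℂ → ℂ} (hq : q ∈ Sym η k) :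
    ∃ L : List RepTerm, (∀ t ∈ L, t.IsOrder η r (k + 2 * d * r)) ∧
      ∀ (τ : ℝ) (j : ℤ) (s : ℝ) (g : 𝓢(ℂ, ℂ)), Admissible (j + r) s →
        heatPow j s (boxResolvent p τ) (toL2 (symS q g))
          = (L.map (RepTerm.eval p τ j s g)).sum := by
  induction r with
  | zero =>
    refine ⟨[⟨0, 0, q, 1⟩], ?_, fun τ j s g _ => ?_⟩
    · simp only [List.mem_singleton, forall_eq]
      exact ⟨le_rfl, by simpa using hq, by simpa using one_mem_Sym⟩
    · simp [RepTerm.eval, multS_one]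
  | succ r ih =>
    obtain ⟨L, hL, h⟩ := ih
    refine ⟨L.flatMap (repStep p), fun t' ht' => ?_, fun τ j s g hs => ?_⟩
    · obtain ⟨t, ht, ht'⟩ := List.mem_flatMap.1 ht'
      have := isOrder_of_mem_repStep hp (hL t ht) ht'
      have e : k + 2 * (d : ℤ) * ((r + 1 : ℕ) : ℤ) = k + 2 * d * r + 2 * d := by push_cast; ring
      rwa [e]
    · rw [h τ j s g (hs.anti (by push_cast; omega))]
      clear h
      induction L with
      | nil => simp
      | cons t L ih =>
        rw [List.map_cons, List.sum_cons, List.flatMap_cons, List.map_append, List.sum_append,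
          ih fun t ht => hL t (List.mem_cons_of_mem _ ht)]
        have ht := hL t List.mem_cons_self
        rw [eval_eq_repStep hp ht.2.1 ht.2.2 (hs.anti (by have := ht.1; push_cast; omega))]

end Rep

/-! ### Functions of polynomial growth with finitely many derivatives -/

section PolyGrowth

variable {D E F G : Type*} [NormedAddCommGroup D] [NormedSpace ℝ D]
  [NormedAddCommGroup E] [NormedSpace ℝ E] [NormedAddCommGroup F] [NormedSpace ℝ F]
  [NormedAddCommGroup G] [NormedSpace ℝ G]

/-- `f` is `ρ` times continuously differentiable, and its derivatives up to order `ρ` are bounded by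
a multiple of `(1 + ‖x‖)ᴺ`. The order `N` may be negative. -/
structure PolyGrowth (ρ : ℕ) (N : ℤ) (f : D → E) : Prop where
  contDiff : ContDiff ℝ ρ f
  bound : ∃ C : ℝ, 0 ≤ C ∧ ∀ i ≤ ρ, ∀ x, ‖iteratedFDeriv ℝ i f x‖ ≤ C * (1 + ‖x‖) ^ N

variable {ρ : ℕ} {N M : ℤ} {f : D → E}

lemma PolyGrowth.mono (h : PolyGrowth ρ N f) (hNM : N ≤ M) : PolyGrowth ρ M f := by
  obtain ⟨C, hC, hb⟩ := h.bound
  refine ⟨h.contDiff, C, hC, fun i hi x => (hb i hi x).trans ?_⟩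
  gcongr
  exact le_add_of_nonneg_right (norm_nonneg x)

lemma PolyGrowth.norm_le (h : PolyGrowth ρ N f) :
    ∃ C : ℝ, 0 ≤ C ∧ ∀ x, ‖f x‖ ≤ C * (1 + ‖x‖) ^ N := by
  obtain ⟨C, hC, hb⟩ := h.bound
  exact ⟨C, hC, fun x => by simpa using hb 0 (Nat.zero_le _) x⟩

lemma PolyGrowth.succ {f' : D → D →L[ℝ] E} (hf : ∀ x, HasFDerivAt f (f' x) x)
    (h : PolyGrowth ρ N f') {C : ℝ} (hC : ∀ x, ‖f x‖ ≤ C * (1 + ‖x‖) ^ N) :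
    PolyGrowth (ρ + 1) N f := by
  have e : fderiv ℝ f = f' := funext fun x => (hf x).fderiv
  obtain ⟨C', hC', hb⟩ := h.bound
  refine ⟨?_, max C C', le_max_of_le_right hC', fun i hi x => ?_⟩
  · exact_mod_cast contDiff_succ_iff_hasFDerivAt.2 ⟨f', h.contDiff, hf⟩
  · rcases i with _ | i
    · rw [norm_iteratedFDeriv_zero]
      refine (hC x).trans ?_
      gcongr
      exact le_max_left _ _
    · rw [← norm_iteratedFDeriv_fderiv, e]
      refine (hb i (by omega) x).trans ?_
      gcongr
      exact le_max_right _ _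

lemma PolyGrowth.const (ρ : ℕ) (c : E) : PolyGrowth ρ 0 (fun _ : D => c) := by
  refine ⟨contDiff_const, ‖c‖, norm_nonneg _, fun i _ x => ?_⟩
  rcases i with _ | i
  · simp
  · simp [iteratedFDeriv_const_of_ne (𝕜 := ℝ) (E := D) (Nat.succ_ne_zero i) c]

lemma PolyGrowth.of_hasFDerivAt_clm (L : D →L[ℝ] E) (ρ : ℕ) : PolyGrowth ρ 1 L := by
  have h0 : ∀ x : D, ‖L x‖ ≤ ‖L‖ * (1 + ‖x‖) ^ (1 : ℤ) := fun x => by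
    rw [zpow_one]
    refine (L.le_opNorm x).trans ?_
    gcongr
    linarith
  rcases ρ with _ | ρ
  · refine ⟨L.contDiff, ‖L‖, norm_nonneg _, fun i hi x => ?_⟩
    obtain rfl : i = 0 := by omega
    rw [norm_iteratedFDeriv_zero]; exact h0 x
  · exact PolyGrowth.succ (fun x => L.hasFDerivAt) ((PolyGrowth.const ρ L).mono zero_le_one) h0

lemma PolyGrowth.bilin (B : E →L[ℝ] F →L[ℝ] G) {g : D → F} (hf : PolyGrowth ρ N f)
    (hg : PolyGrowth ρ M g) : PolyGrowth ρ (N + M) (fun x => B (f x) (g x)) := by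
  obtain ⟨C, hC, hb⟩ := hf.bound
  obtain ⟨C', hC', hb'⟩ := hg.bound
  refine ⟨B.isBoundedBilinearMap.contDiff.comp (hf.contDiff.prodMk hg.contDiff),
    ‖B‖ * (2 ^ ρ * (C * C')), by positivity, fun i hi x => ?_⟩
  refine (B.norm_iteratedFDeriv_le_of_bilinear hf.contDiff hg.contDiff x
    (by exact_mod_cast hi)).trans ?_
  rw [mul_assoc]
  gcongr
  have h0 : (0 : ℝ) < 1 + ‖x‖ := by positivity
  calc _ ≤ ∑ j ∈ Finset.range (i + 1),
        (i.choose j : ℝ) * (C * (1 + ‖x‖) ^ N) * (C' * (1 + ‖x‖) ^ M) := by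
        refine Finset.sum_le_sum fun j hj => ?_
        have := Finset.mem_range.1 hj
        gcongr
        · exact hb j (by omega) x
        · exact hb' (i - j) (by omega) x
    _ = (∑ j ∈ Finset.range (i + 1), (i.choose j : ℝ)) * (C * C') * (1 + ‖x‖) ^ (N + M) := by
        rw [zpow_add₀ h0.ne', Finset.sum_mul, Finset.sum_mul]
        exact Finset.sum_congr rfl fun j _ => by ring
    _ ≤ _ := by
        have : (∑ j ∈ Finset.range (i + 1), (i.choose j : ℝ)) = 2 ^ i := by
          exact_mod_cast Nat.sum_range_choose i
        rw [this]
        gcongr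
        exact one_le_two

lemma PolyGrowth.clm_comp (L : E →L[ℝ] F) (hf : PolyGrowth ρ N f) :
    PolyGrowth ρ N (fun x => L (f x)) := by
  simpa using PolyGrowth.bilin (ContinuousLinearMap.apply ℝ F : E →L[ℝ] (E →L[ℝ] F) →L[ℝ] F)
    hf (PolyGrowth.const ρ L)

lemma PolyGrowth.prodMk {g : D → F} (hf : PolyGrowth ρ N f) (hg : PolyGrowth ρ N g) :
    PolyGrowth ρ N (fun x => (f x, g x)) := by
  obtain ⟨C, hC, hb⟩ := hf.bound
  obtain ⟨C', hC', hb'⟩ := hg.bound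
  refine ⟨hf.contDiff.prodMk hg.contDiff, C + C', by positivity, fun i hi x => ?_⟩
  rw [iteratedFDeriv_prodMk hf.contDiff.contDiffAt hg.contDiff.contDiffAt (by exact_mod_cast hi),
    ContinuousMultilinearMap.opNorm_prod]
  have h0 : (0 : ℝ) ≤ (1 + ‖x‖) ^ N := by positivity
  refine max_le ((hb i hi x).trans ?_) ((hb' i hi x).trans ?_) <;> nlinarith

lemma PolyGrowth.add {g : D → E} (hf : PolyGrowth ρ N f) (hg : PolyGrowth ρ N g) :
    PolyGrowth ρ N (fun x => f x + g x) := by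
  simpa using (hf.prodMk hg).clm_comp
    (ContinuousLinearMap.fst ℝ E E + ContinuousLinearMap.snd ℝ E E)

lemma PolyGrowth.comp_clm {g : E → F} (hg : PolyGrowth ρ N g) (hN : 0 ≤ N) (L : D →L[ℝ] E) :
    PolyGrowth ρ N (fun x => g (L x)) := by
  obtain ⟨C, hC, hb⟩ := hg.bound
  refine ⟨hg.contDiff.comp L.contDiff, (1 + ‖L‖) ^ ρ * (C * (1 + ‖L‖) ^ N), by positivity,
    fun i hi x => ?_⟩
  have e : iteratedFDeriv ℝ i (fun x => g (L x)) x
      = (iteratedFDeriv ℝ i g (L x)).compContinuousLinearMap fun _ => L :=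
    L.iteratedFDeriv_comp_right hg.contDiff x (by exact_mod_cast hi)
  rw [e]
  refine (ContinuousMultilinearMap.norm_compContinuousLinearMap_le _ _).trans ?_
  rw [Finset.prod_const, Finset.card_univ, Fintype.card_fin]
  have h1 : 1 + ‖L x‖ ≤ (1 + ‖L‖) * (1 + ‖x‖) := by
    have := L.le_opNorm x
    nlinarith [norm_nonneg L, norm_nonneg x]
  have h2 : (1 + ‖L x‖) ^ N ≤ (1 + ‖L‖) ^ N * (1 + ‖x‖) ^ N := by
    rw [← mul_zpow]
    exact zpow_le_zpow_left₀ hN (by positivity) h1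
  calc _ ≤ C * ((1 + ‖L‖) ^ N * (1 + ‖x‖) ^ N) * (1 + ‖L‖) ^ ρ := by
        gcongr
        · exact (hb i hi _).trans (by gcongr)
        · calc ‖L‖ ^ i ≤ (1 + ‖L‖) ^ i := by gcongr; linarith
            _ ≤ _ := pow_le_pow_right₀ (by linarith [norm_nonneg L]) hi
    _ = _ := by ring

lemma hasTemperateGrowth_of_polyGrowth (h : ∀ ρ, ∃ N, PolyGrowth ρ N f) :
    f.HasTemperateGrowth := by
  refine ⟨contDiff_infty.2 fun ρ => (h ρ).choose_spec.contDiff, fun n => ?_⟩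
  obtain ⟨N, hN⟩ := h n
  obtain ⟨C, hC, hb⟩ := (hN.mono (le_max_left N 0)).bound
  refine ⟨(max N 0).toNat, C, fun x => (hb n le_rfl x).trans_eq ?_⟩
  congr 1
  rw [← zpow_natCast, Int.toNat_of_nonneg (le_max_right _ _)]

end PolyGrowth

section Sym

variable {η : ℝ}

lemma exists_norm_le_one_add_of_mem_Sym (hη : 0 < η) {k : ℤ} {q : ℂ → ℂ} (hq : q ∈ Sym η k) :
    ∃ C : ℝ, 0 ≤ C ∧ ∀ z, ‖q z‖ ≤ C * (1 + ‖z‖) ^ k := by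
  obtain ⟨C, hC, h⟩ := exists_norm_le_of_mem_Sym hη hq
  -- the weight is comparable to `1 + ‖z‖` from above and below
  have h1 : ∀ z : ℂ, Real.sqrt (wt η z) ≤ (1 + η) * (1 + ‖z‖) := fun z => by
    refine Real.sqrt_le_iff.2 ⟨by positivity, ?_⟩
    rw [wt]
    have := norm_nonneg z
    nlinarith [mul_nonneg hη.le this, sq_nonneg η, mul_nonneg (sq_nonneg η) this]
  have h2 : ∀ z : ℂ, 1 + ‖z‖ ≤ (1 + η⁻¹) * Real.sqrt (wt η z) := fun z => by
    have a1 : 1 ≤ Real.sqrt (wt η z) := Real.one_le_sqrt.2 (one_le_wt η z)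
    have a2 : η * ‖z‖ ≤ Real.sqrt (wt η z) := Real.le_sqrt_of_sq_le (by rw [wt]; nlinarith)
    have a3 : ‖z‖ ≤ η⁻¹ * Real.sqrt (wt η z) := by
      rw [inv_mul_eq_div, le_div_iff₀ hη]; linarith
    linarith
  have hs : ∀ z : ℂ, 0 < Real.sqrt (wt η z) := fun z => Real.sqrt_pos.2 (wt_pos η z)
  rcases le_total 0 k with hk | hk
  · refine ⟨C * (1 + η) ^ k, by positivity, fun z => (h z).trans ?_⟩
    rw [mul_assoc, ← mul_zpow]
    gcongr
    exact zpow_le_zpow_left₀ hk (hs z).le (h1 z)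
  · refine ⟨C * (1 + η⁻¹) ^ (-k), by positivity, fun z => (h z).trans ?_⟩
    rw [mul_assoc]
    gcongr
    have h3 := zpow_le_zpow_left₀ (neg_nonneg.2 hk) (by positivity) (h2 z)
    rw [mul_zpow, zpow_neg, zpow_neg (Real.sqrt _)] at h3
    have p1 : 0 < (1 + ‖z‖) ^ k := by positivity
    have p2 : 0 < Real.sqrt (wt η z) ^ k := zpow_pos (hs z) k
    rw [inv_le_iff_one_le_mul₀ p1] at h3
    calc Real.sqrt (wt η z) ^ k = Real.sqrt (wt η z) ^ k * 1 := (mul_one _).symm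
      _ ≤ Real.sqrt (wt η z) ^ k
          * ((1 + η⁻¹) ^ (-k) * (Real.sqrt (wt η z) ^ k)⁻¹ * (1 + ‖z‖) ^ k) := by gcongr
      _ = _ := by field_simp

lemma polyGrowth_of_mem_Sym (hη : 0 < η) (ρ : ℕ) {k : ℤ} {q : ℂ → ℂ} (hq : q ∈ Sym η k) :
    PolyGrowth ρ k q := by
  induction ρ generalizing q with
  | zero =>
    obtain ⟨C, hC, h⟩ := exists_norm_le_one_add_of_mem_Sym hη hq
    refine ⟨(contDiff_of_mem_Sym hq).of_le (by simp), C, hC, fun i hi x => ?_⟩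
    obtain rfl : i = 0 := by omega
    rw [norm_iteratedFDeriv_zero]; exact h x
  | succ ρ ih =>
    obtain ⟨C, hC, h⟩ := exists_norm_le_one_add_of_mem_Sym hη hq
    refine PolyGrowth.succ (fun z => hasWirt_of_mem_Sym hq z) ?_ h
    have h1 := (ih (dz_dzbar_mem_Sym hq).1).clm_comp
      ((ContinuousLinearMap.lsmul ℝ ℂ : ℂ →L[ℝ] (ℂ →L[ℝ] ℂ) →L[ℝ] (ℂ →L[ℝ] ℂ)).flip
        (ContinuousLinearMap.id ℝ ℂ))
    have h2 := (ih (dz_dzbar_mem_Sym hq).2).clm_comp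
      ((ContinuousLinearMap.lsmul ℝ ℂ : ℂ →L[ℝ] (ℂ →L[ℝ] ℂ) →L[ℝ] (ℂ →L[ℝ] ℂ)).flip
        (Complex.conjCLE : ℂ →L[ℝ] ℂ))
    exact h1.add h2

end Sym

/-! ### Kernels of Fourier multipliers of negative order -/

section Wave

open SchwartzMap

/-- The character `ζ ↦ exp (-2πi ⟨ζ, z⟩)`. -/
noncomputable def wave (z ζ : ℂ) : ℂ :=
  Complex.exp (((-2 * Real.pi * inner ℝ ζ z : ℝ) : ℂ) * Complex.I)

lemma norm_wave (z ζ : ℂ) : ‖wave z ζ‖ = 1 := Complex.norm_exp_ofReal_mul_I _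

lemma continuous_wave : Continuous fun x : ℂ × ℂ => wave x.1 x.2 := by
  unfold wave; fun_prop

lemma wave_add (z h ζ : ℂ) : wave (z + h) ζ = wave z ζ * wave h ζ := by
  rw [wave, wave, wave, ← Complex.exp_add, inner_add_right]
  congr 1; push_cast; ring

lemma norm_exp_sub_le (x : ℝ) :
    ‖Complex.exp ((x : ℂ) * Complex.I) - 1 - (x : ℂ) * Complex.I‖ ≤ 3 * x ^ 2 := by
  have hn : ‖(x : ℂ) * Complex.I‖ = |x| := by simp
  rcases le_total |x| 1 with h | h
  · have := Complex.norm_exp_sub_one_sub_id_le (x := (x : ℂ) * Complex.I) (by rwa [hn])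
    rw [hn, sq_abs] at this
    nlinarith [sq_nonneg x]
  · have h1 : ‖Complex.exp ((x : ℂ) * Complex.I)‖ = 1 := Complex.norm_exp_ofReal_mul_I x
    calc _ ≤ ‖Complex.exp ((x : ℂ) * Complex.I)‖ + ‖(1 : ℂ)‖ + ‖(x : ℂ) * Complex.I‖ :=
          (norm_sub_le _ _).trans (by gcongr; exact norm_sub_le _ _)
      _ = 2 + |x| := by rw [h1, hn, norm_one]; ring
      _ ≤ 3 * x ^ 2 := by rw [← sq_abs x]; nlinarith

lemma memLp_wave {σ : ℂ → ℂ} (hσ : MemLp σ 2 (volume : Measure ℂ)) (z : ℂ) :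
    MemLp (fun ζ => wave z ζ * σ ζ) 2 (volume : Measure ℂ) := by
  refine hσ.of_le_mul (c := 1) ?_ (Eventually.of_forall fun ζ => ?_)
  · exact (continuous_wave.comp
      (by fun_prop : Continuous fun ζ : ℂ => (z, ζ))).aestronglyMeasurable.mul
      hσ.aestronglyMeasurable
  · rw [norm_mul, norm_wave]

/-- The function `ζ ↦ exp (-2πi ⟨ζ, z⟩) σ(ζ)` in `L²`. -/
noncomputable def waveL2 {σ : ℂ → ℂ} (hσ : MemLp σ 2 (volume : Measure ℂ)) (z : ℂ) : L2 :=
  (memLp_wave hσ z).toLp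

lemma coeFn_waveL2 {σ : ℂ → ℂ} (hσ : MemLp σ 2 (volume : Measure ℂ)) (z : ℂ) :
    waveL2 hσ z =ᵐ[volume] fun ζ => wave z ζ * σ ζ := (memLp_wave hσ z).coeFn_toLp

lemma norm_waveL2_le {σ : ℂ → ℂ} (hσ : MemLp σ 2 (volume : Measure ℂ)) (z : ℂ) :
    ‖waveL2 hσ z‖ ≤ ‖hσ.toLp‖ := by
  refine Lp.norm_le_norm_of_ae_le ?_
  filter_upwards [coeFn_waveL2 hσ z, hσ.coeFn_toLp] with ζ h1 h2
  rw [h1, h2, norm_mul, norm_wave, one_mul]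

/-- The symbol `-2πi Re ζ`. -/
noncomputable def reSym (ζ : ℂ) : ℂ := -(2 * Real.pi * Complex.I) * ζ.re

/-- The symbol `-2πi Im ζ`. -/
noncomputable def imSym (ζ : ℂ) : ℂ := -(2 * Real.pi * Complex.I) * ζ.im

lemma reSym_mem {η : ℝ} : reSym ∈ Sym η 1 := by
  have : reSym = (-(Real.pi * Complex.I) : ℂ) • ((fun ζ => ζ) + fun ζ : ℂ => conj ζ) := by
    ext ζ
    simp only [reSym, Pi.smul_apply, Pi.add_apply, smul_eq_mul, Complex.add_conj]
    push_cast; ring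
  rw [this]
  exact Submodule.smul_mem _ _ (Submodule.add_mem _ id_mem_Sym conj_mem_Sym)

lemma imSym_mem {η : ℝ} : imSym ∈ Sym η 1 := by
  have : imSym = (-(Real.pi : ℂ)) • ((fun ζ => ζ) - fun ζ : ℂ => conj ζ) := by
    ext ζ
    simp only [imSym, Pi.smul_apply, Pi.sub_apply, smul_eq_mul, Complex.sub_conj]
    push_cast; ring
  rw [this]
  exact Submodule.smul_mem _ _ (Submodule.sub_mem _ id_mem_Sym conj_mem_Sym)

lemma memLp_of_mem_Sym {σ : ℂ → ℂ} {k : ℤ} (hσ : σ ∈ Sym Real.pi k) (hk : k ≤ -2) :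
    MemLp σ 2 (volume : Measure ℂ) := by
  have hσ' : σ ∈ Sym Real.pi (-2) := Sym_mono hk hσ
  obtain ⟨C, hC, h⟩ := exists_norm_le_of_mem_Sym Real.pi_pos hσ'
  have hc : Continuous σ := (contDiff_of_mem_Sym hσ).continuous
  refine (memLp_two_iff_integrable_sq_norm hc.aestronglyMeasurable).2 ?_
  have hi : Integrable fun ζ : ℂ => C ^ 2 * (1 + ‖ζ‖ ^ 2) ^ (-(4 : ℝ) / 2) :=
    (integrable_rpow_neg_one_add_norm_sq
      (by simp [Complex.finrank_real_complex]; norm_num)).const_mul _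
  refine hi.mono' (hc.norm.pow 2).aestronglyMeasurable (Eventually.of_forall fun ζ => ?_)
  rw [Real.norm_of_nonneg (by positivity)]
  have h1 : 1 + ‖ζ‖ ^ 2 ≤ wt Real.pi ζ := by
    rw [wt]; nlinarith [Real.pi_gt_three, sq_nonneg ‖ζ‖, mul_nonneg (sq_nonneg ‖ζ‖) Real.pi_pos.le]
  have e : (1 + ‖ζ‖ ^ 2) ^ (-(4 : ℝ) / 2) = ((1 + ‖ζ‖ ^ 2) ^ 2)⁻¹ := by
    rw [show -(4 : ℝ) / 2 = -((2 : ℕ) : ℝ) by norm_num, Real.rpow_neg (by positivity),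
      Real.rpow_natCast]
  have e2 : Real.sqrt (wt Real.pi ζ) ^ (-2 : ℤ) = (wt Real.pi ζ)⁻¹ := by
    rw [zpow_neg]; congr 1
    exact_mod_cast Real.sq_sqrt (wt_pos _ ζ).le
  have h2 := h ζ
  rw [e2] at h2
  have hw := wt_pos Real.pi ζ
  calc ‖σ ζ‖ ^ 2 ≤ (C * (wt Real.pi ζ)⁻¹) ^ 2 := by gcongr
    _ ≤ (C * (1 + ‖ζ‖ ^ 2)⁻¹) ^ 2 := by gcongr
    _ = _ := by rw [e, mul_pow, inv_pow]

/-- Differentiation of the wave in `z` multiplies the symbol by the coordinates of `ζ`. The order of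
the symbol has to be such that the second order remainder is in `L²`. -/
lemma hasFDerivAt_waveL2 {k : ℤ} {σ : ℂ → ℂ} (hσ : σ ∈ Sym Real.pi k) (hk : k ≤ -4) (z : ℂ) :
    HasFDerivAt (waveL2 (memLp_of_mem_Sym hσ (by omega)))
      (Complex.reCLM.smulRight
          (waveL2 (memLp_of_mem_Sym (Sym_mul reSym_mem hσ) (by omega)) z)
        + Complex.imCLM.smulRight
          (waveL2 (memLp_of_mem_Sym (Sym_mul imSym_mem hσ) (by omega)) z)) z := by
  set a := waveL2 (memLp_of_mem_Sym (Sym_mul reSym_mem hσ) (by omega)) z with ha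
  set b := waveL2 (memLp_of_mem_Sym (Sym_mul imSym_mem hσ) (by omega)) z with hb
  -- the second order Taylor remainder is controlled by `|ζ|² σ`
  have hv := memLp_of_mem_Sym (Sym_mul (Sym_mul (id_mem_Sym (η := Real.pi)) id_mem_Sym) hσ)
    (by omega)
  set c : L2 := hv.toLp with hc
  have key : ∀ h : ℂ, ‖waveL2 (memLp_of_mem_Sym hσ (by omega)) (z + h)
      - waveL2 (memLp_of_mem_Sym hσ (by omega)) z - (h.re • a + h.im • b)‖
      ≤ (12 * Real.pi ^ 2 * ‖h‖ ^ 2) * ‖c‖ := by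
    intro h
    refine Lp.norm_le_mul_norm_of_ae_le_mul ?_
    set u := waveL2 (memLp_of_mem_Sym hσ (by omega)) (z + h)
    set v := waveL2 (memLp_of_mem_Sym hσ (by omega)) z
    filter_upwards [Lp.coeFn_sub (u - v) (h.re • a + h.im • b), Lp.coeFn_sub u v,
      Lp.coeFn_add (h.re • a) (h.im • b), Lp.coeFn_smul h.re a, Lp.coeFn_smul h.im b,
      coeFn_waveL2 (memLp_of_mem_Sym hσ (by omega)) (z + h),
      coeFn_waveL2 (memLp_of_mem_Sym hσ (by omega)) z,
      coeFn_waveL2 (memLp_of_mem_Sym (Sym_mul reSym_mem hσ) (by omega)) z,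
      coeFn_waveL2 (memLp_of_mem_Sym (Sym_mul imSym_mem hσ) (by omega)) z,
      hv.coeFn_toLp] with ζ e1 e2 e3 e4 e5 e6 e7 e8 e9 e10
    rw [e1, Pi.sub_apply, e2, Pi.sub_apply, e3, Pi.add_apply, e4, e5, Pi.smul_apply, Pi.smul_apply,
      e6, e7, e8, e9, e10, wave_add]
    set x : ℝ := -2 * Real.pi * inner ℝ ζ h with hx
    have ex : (x : ℂ) * Complex.I = h.re * reSym ζ + h.im * imSym ζ := by
      rw [hx, reSym, imSym, Complex.inner]
      simp only [Complex.mul_re, Complex.conj_re, Complex.conj_im]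
      push_cast; ring
    have e : wave z ζ * wave h ζ * σ ζ - wave z ζ * σ ζ
        - (h.re • (wave z ζ * (reSym * σ) ζ) + h.im • (wave z ζ * (imSym * σ) ζ))
        = wave z ζ * σ ζ * (Complex.exp ((x : ℂ) * Complex.I) - 1 - (x : ℂ) * Complex.I) := by
      rw [Complex.real_smul, Complex.real_smul, Pi.mul_apply, Pi.mul_apply, wave.eq_1 h, ← hx]
      linear_combination wave z ζ * σ ζ * ex
    rw [e, norm_mul, norm_mul, norm_wave, one_mul, Pi.mul_apply, Pi.mul_apply, norm_mul, norm_mul]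
    have hx2 : x ^ 2 ≤ 4 * Real.pi ^ 2 * (‖ζ‖ * ‖h‖) ^ 2 := by
      have h1 : (inner ℝ ζ h : ℝ) ^ 2 ≤ (‖ζ‖ * ‖h‖) ^ 2 := by
        rw [← sq_abs]; gcongr; exact abs_real_inner_le_norm ζ h
      rw [hx]; nlinarith [mul_le_mul_of_nonneg_left h1 (sq_nonneg Real.pi)]
    calc _ ≤ ‖σ ζ‖ * (3 * (4 * Real.pi ^ 2 * (‖ζ‖ * ‖h‖) ^ 2)) := by
          gcongr; exact (norm_exp_sub_le x).trans (by gcongr)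
      _ = _ := by ring
  rw [hasFDerivAt_iff_isLittleO_nhds_zero]
  refine (Asymptotics.IsBigO.of_bound (12 * Real.pi ^ 2 * ‖c‖)
    (Eventually.of_forall fun h => ?_)).trans_isLittleO
    (Asymptotics.isLittleO_norm_pow_id one_lt_two)
  refine (key h).trans_eq ?_
  rw [norm_pow, norm_norm]; ring

lemma polyGrowth_waveL2 (ρ : ℕ) {k : ℤ} {σ : ℂ → ℂ} (hσ : σ ∈ Sym Real.pi k)
    (hk : k ≤ -(ρ + 4)) (h2 : MemLp σ 2 (volume : Measure ℂ)) : PolyGrowth ρ 0 (waveL2 h2) := by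
  have hC : ∀ x, ‖waveL2 h2 x‖ ≤ ‖h2.toLp‖ * (1 + ‖x‖) ^ (0 : ℤ) := fun x => by
    rw [zpow_zero, mul_one]; exact norm_waveL2_le h2 x
  induction ρ generalizing σ k with
  | zero =>
    refine ⟨contDiff_zero.2 (continuous_iff_continuousAt.2 fun z =>
      (hasFDerivAt_waveL2 hσ (by push_cast at hk; omega) z).continuousAt), ‖h2.toLp‖,
      norm_nonneg _, fun i hi x => ?_⟩
    obtain rfl : i = 0 := by omega
    rw [norm_iteratedFDeriv_zero]; exact hC x
  | succ ρ ih =>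
    push_cast at hk
    refine PolyGrowth.succ (fun z => hasFDerivAt_waveL2 hσ (by omega) z) ?_ hC
    have h1 := (ih (Sym_mul reSym_mem hσ) (by omega) (memLp_of_mem_Sym (Sym_mul reSym_mem hσ)
      (by omega)) fun x => by rw [zpow_zero, mul_one]; exact norm_waveL2_le _ x).clm_comp
      (ContinuousLinearMap.smulRightL ℝ ℂ L2 Complex.reCLM)
    have h3 := (ih (Sym_mul imSym_mem hσ) (by omega) (memLp_of_mem_Sym (Sym_mul imSym_mem hσ)
      (by omega)) fun x => by rw [zpow_zero, mul_one]; exact norm_waveL2_le _ x).clm_comp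
      (ContinuousLinearMap.smulRightL ℝ ℂ L2 Complex.imCLM)
    exact h1.add h3

/-- The function `k_z` with `(S_σ g) = ∫ g(z) k_z dz`, for the Fourier multiplier `S_σ`. -/
noncomputable def multKer {σ : ℂ → ℂ} (hσ : MemLp σ 2 (volume : Measure ℂ)) (z : ℂ) : L2 :=
  (Lp.fourierTransformₗᵢ ℂ ℂ).symm (waveL2 hσ z)

lemma polyGrowth_multKer (ρ : ℕ) {k : ℤ} {σ : ℂ → ℂ} (hσ : σ ∈ Sym Real.pi k)
    (hk : k ≤ -(ρ + 4)) (h2 : MemLp σ 2 (volume : Measure ℂ)) : PolyGrowth ρ 0 (multKer h2) :=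
  (polyGrowth_waveL2 ρ hσ hk h2).clm_comp
    (((Lp.fourierTransformₗᵢ ℂ ℂ).symm.toContinuousLinearEquiv : L2 →L[ℂ] L2).restrictScalars ℝ)

lemma integrable_inner_mul (u v : L2) : Integrable fun ζ => conj (u ζ) * v ζ :=
  (MeasureTheory.L2.integrable_inner (𝕜 := ℂ) u v).congr (Eventually.of_forall fun ζ => by
    simp [RCLike.inner_apply, mul_comm])

/-- The function `multKer` is the kernel of the Fourier multiplier. -/
lemma inner_multS {k : ℤ} {σ : ℂ → ℂ} (hσ : σ ∈ Sym Real.pi k)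
    (h2 : MemLp σ 2 (volume : Measure ℂ)) (u : L2) (g : 𝓢(ℂ, ℂ)) :
    ⟪u, toL2 (multS σ g)⟫_ℂ = ∫ z, g z * ⟪u, multKer h2 z⟫_ℂ := by
  set U : L2 := Lp.fourierTransformₗᵢ ℂ ℂ u with hU
  have e1 : ⟪u, toL2 (multS σ g)⟫_ℂ
      = ⟪U, toL2 (smulLeftCLM ℂ σ (FourierTransform.fourier g))⟫_ℂ := by
    rw [hU, ← (Lp.fourierTransformₗᵢ ℂ ℂ).inner_map_map u]
    congr 1
    have := SchwartzMap.toLp_fourier_eq (multS σ g)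
    refine this.trans ?_
    rw [multS, fourierMultiplierCLM_apply, FourierTransform.fourier_fourierInv_eq]
    rfl
  have e2 : ∀ z, ⟪u, multKer h2 z⟫_ℂ = ⟪U, waveL2 h2 z⟫_ℂ := fun z => by
    rw [hU, ← (Lp.fourierTransformₗᵢ ℂ ℂ).inner_map_map u, multKer,
      LinearIsometryEquiv.apply_symm_apply]
  have e3 : ∀ z, ⟪U, waveL2 h2 z⟫_ℂ = ∫ ζ, conj (U ζ) * (wave z ζ * σ ζ) := fun z => by
    rw [MeasureTheory.L2.inner_def]
    refine integral_congr_ae ?_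
    filter_upwards [coeFn_waveL2 h2 z] with ζ h
    rw [h, RCLike.inner_apply, mul_comm]
  have e4 : ∀ ζ, (FourierTransform.fourier g : 𝓢(ℂ, ℂ)) ζ = ∫ z, wave z ζ * g z := fun ζ => by
    rw [SchwartzMap.fourier_coe, Real.fourier_eq']
    refine integral_congr_ae (Eventually.of_forall fun z => ?_)
    simp only [smul_eq_mul, wave]
    rw [real_inner_comm]
  have e5 : ⟪U, toL2 (smulLeftCLM ℂ σ (FourierTransform.fourier g))⟫_ℂ
      = ∫ ζ, ∫ z, conj (U ζ) * σ ζ * (wave z ζ * g z) := by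
    rw [MeasureTheory.L2.inner_def]
    refine integral_congr_ae ?_
    filter_upwards [coeFn_toL2 (smulLeftCLM ℂ σ (FourierTransform.fourier g))] with ζ h
    rw [h, RCLike.inner_apply, smulLeftCLM_apply_apply (hasTemperateGrowth_of_mem_Sym hσ), e4,
      integral_const_mul, smul_eq_mul]
    ring
  rw [e1, e5]
  simp only [e2, e3]
  have hint : Integrable (Function.uncurry fun ζ z => conj (U ζ) * σ ζ * (wave z ζ * g z))
      ((volume : Measure ℂ).prod volume) := by
    have h1 : Integrable fun ζ => conj (U ζ) * σ ζ := by
      refine (integrable_inner_mul U h2.toLp).congr ?_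
      filter_upwards [h2.coeFn_toLp] with ζ h
      rw [h]
    have h3 := (h1.mul_prod g.integrable (μ := volume) (ν := volume)).bdd_mul (c := 1)
      (f := fun x : ℂ × ℂ => wave x.2 x.1)
      (continuous_wave.comp continuous_swap).aestronglyMeasurable
      (Eventually.of_forall fun x => (norm_wave _ _).le)
    refine h3.congr (Eventually.of_forall fun x => ?_)
    simp only [Function.uncurry]
    ring
  rw [integral_integral_swap hint]
  refine integral_congr_ae (Eventually.of_forall fun z => ?_)
  simp only
  rw [← integral_const_mul]
  refine integral_congr_ae (Eventually.of_forall fun ζ => ?_)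
  simp only
  ring

end Wave

/-! ### Smooth kernels of the heat operators in weighted spaces -/

section Form

open SchwartzMap

variable {ρ : ℕ}

/-- The bilinear map `⟪u, v⟫` over `ℝ`. -/
noncomputable def innerL : L2 →L[ℝ] L2 →L[ℝ] ℂ :=
  (isBoundedBilinearMap_inner (𝕜 := ℂ) (E := L2)).toContinuousLinearMap

/-- The evaluation of operators as a bilinear map over `ℝ`. -/
noncomputable def applyL : (L2 →L[ℂ] L2) →L[ℝ] L2 →L[ℝ] L2 :=
  ContinuousLinearMap.restrictScalarsL ℂ L2 L2 ℝ ℝ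

/-- The form `X` has the continuous kernel `F`. -/
structure HasKernel (X : 𝓢(ℂ, ℂ) → 𝓢(ℂ, ℂ) → ℂ) (F : ℂ → ℂ → ℂ) : Prop where
  integrable_right : ∀ (g : 𝓢(ℂ, ℂ)) (z : ℂ), Integrable fun w => g w * F z w
  integrable_left : ∀ h g : 𝓢(ℂ, ℂ), Integrable fun z => conj (h z) * ∫ w, g w * F z w
  eq_integral : ∀ h g, X h g = ∫ z, conj (h z) * ∫ w, g w * F z w

lemma HasKernel.add {X Y : 𝓢(ℂ, ℂ) → 𝓢(ℂ, ℂ) → ℂ} {F G : ℂ → ℂ → ℂ} (hF : HasKernel X F)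
    (hG : HasKernel Y G) :
    HasKernel (fun h g => X h g + Y h g) (fun z w => F z w + G z w) := by
  have e : ∀ (g : 𝓢(ℂ, ℂ)) z, ∫ w, g w * (F z w + G z w)
      = (∫ w, g w * F z w) + ∫ w, g w * G z w := by
    intro g z
    simp only [mul_add]
    exact integral_add (hF.integrable_right g z) (hG.integrable_right g z)
  refine ⟨fun g z => ?_, fun h g => ?_, fun h g => ?_⟩
  · simp only [mul_add]
    exact (hF.integrable_right g z).add (hG.integrable_right g z)
  · simp only [e, mul_add (conj _)]
    exact (hF.integrable_left h g).add (hG.integrable_left h g)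
  · simp only [e, mul_add (conj _)]
    rw [hF.eq_integral, hG.eq_integral,
      integral_add (hF.integrable_left h g) (hG.integrable_left h g)]

lemma HasKernel.const_mul {X : 𝓢(ℂ, ℂ) → 𝓢(ℂ, ℂ) → ℂ} {F : ℂ → ℂ → ℂ} (hF : HasKernel X F)
    (c : ℂ) : HasKernel (fun h g => c * X h g) (fun z w => c * F z w) := by
  have e : ∀ (g : 𝓢(ℂ, ℂ)) z, ∫ w, g w * (c * F z w) = c * ∫ w, g w * F z w := by
    intro g z
    rw [← integral_const_mul]
    exact integral_congr_ae (Eventually.of_forall fun w => by ring)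
  have e' : ∀ (h g : 𝓢(ℂ, ℂ)) z, conj (h z) * (c * ∫ w, g w * F z w)
      = c * (conj (h z) * ∫ w, g w * F z w) := fun h g z => by ring
  refine ⟨fun g z => ?_, fun h g => ?_, fun h g => ?_⟩
  · exact ((hF.integrable_right g z).const_mul c).congr (Eventually.of_forall fun w => by ring)
  · simp only [e, e']
    exact (hF.integrable_left h g).const_mul c
  · simp only [e, e', integral_const_mul]
    rw [hF.eq_integral]

lemma hasKernel_zero : HasKernel (fun _ _ => 0) (fun _ _ => 0) :=
  ⟨fun _ _ => by simp, fun _ _ => by simp, fun _ _ => by simp⟩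

/-- A family of forms, depending on `τ` and `s > 0`, has a kernel that is `ρ` times continuously
differentiable, with derivatives in `τ, z, w` of polynomial growth, and bounded derivatives in
`z`. -/
structure SmoothForm (ρ : ℕ) (X : ℝ → ℝ → 𝓢(ℂ, ℂ) → 𝓢(ℂ, ℂ) → ℂ)
    (F : ℝ × ℝ × ℂ × ℂ → ℂ) : Prop where
  contDiffOn : ContDiffOn ℝ ρ F {q | 0 < q.2.1}
  growth : ∀ s, 0 < s → ∃ N, 0 ≤ N ∧
    PolyGrowth ρ N fun q : ℝ × ℂ × ℂ => F (q.1, s, q.2.1, q.2.2)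
  bounded : ∀ τ s w, 0 < s → PolyGrowth ρ 0 fun z => F (τ, s, z, w)
  hasKernel : ∀ τ s, 0 < s → HasKernel (X τ s) fun z w => F (τ, s, z, w)

lemma smoothForm_zero : SmoothForm ρ (fun _ _ _ _ => 0) (fun _ => 0) :=
  ⟨contDiffOn_const, fun _ _ => ⟨0, le_rfl, PolyGrowth.const _ _⟩,
    fun _ _ _ _ => PolyGrowth.const _ _, fun _ _ _ => hasKernel_zero⟩

lemma SmoothForm.add {X Y : ℝ → ℝ → 𝓢(ℂ, ℂ) → 𝓢(ℂ, ℂ) → ℂ} {F G : ℝ × ℝ × ℂ × ℂ → ℂ}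
    (hF : SmoothForm ρ X F) (hG : SmoothForm ρ Y G) :
    SmoothForm ρ (fun τ s h g => X τ s h g + Y τ s h g) (fun q => F q + G q) := by
  refine ⟨hF.contDiffOn.add hG.contDiffOn, fun s hs => ?_, fun τ s w hs => ?_, fun τ s hs => ?_⟩
  · obtain ⟨N, h0, hN⟩ := hF.growth s hs
    obtain ⟨M, _, hM⟩ := hG.growth s hs
    exact ⟨max N M, le_max_of_le_left h0,
      (hN.mono (le_max_left _ _)).add (hM.mono (le_max_right _ _))⟩
  · exact (hF.bounded τ s w hs).add (hG.bounded τ s w hs)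
  · exact (hF.hasKernel τ s hs).add (hG.hasKernel τ s hs)

lemma polyGrowth_ofReal_pow (ρ l : ℕ) :
    ∃ N, 0 ≤ N ∧ PolyGrowth ρ N fun q : ℝ × ℂ × ℂ => (q.1 : ℂ) ^ l := by
  induction l with
  | zero => exact ⟨0, le_rfl, by simpa using PolyGrowth.const _ _⟩
  | succ l ih =>
    obtain ⟨N, h0, hN⟩ := ih
    have h1 : PolyGrowth ρ 1 fun q : ℝ × ℂ × ℂ => (q.1 : ℂ) :=
      PolyGrowth.of_hasFDerivAt_clm (Complex.ofRealCLM ∘L ContinuousLinearMap.fst ℝ ℝ (ℂ × ℂ)) ρ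
    refine ⟨N + 1, by omega, ?_⟩
    simp only [pow_succ]
    exact PolyGrowth.bilin (ContinuousLinearMap.mul ℝ ℂ) hN h1

lemma SmoothForm.pow_mul {X : ℝ → ℝ → 𝓢(ℂ, ℂ) → 𝓢(ℂ, ℂ) → ℂ} {F : ℝ × ℝ × ℂ × ℂ → ℂ}
    (hF : SmoothForm ρ X F) (l : ℕ) :
    SmoothForm ρ (fun τ s h g => (τ : ℂ) ^ l * X τ s h g) (fun q => (q.1 : ℂ) ^ l * F q) := by
  refine ⟨?_, fun s hs => ?_, fun τ s w hs => ?_, fun τ s hs => ?_⟩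
  · refine ContDiffOn.mul (ContDiff.contDiffOn ?_) hF.contDiffOn
    exact (Complex.ofRealCLM.contDiff.comp contDiff_fst).pow l
  · obtain ⟨N, h0, hN⟩ := hF.growth s hs
    obtain ⟨M, h1, hM⟩ := polyGrowth_ofReal_pow ρ l
    exact ⟨M + N, by omega, PolyGrowth.bilin (ContinuousLinearMap.mul ℝ ℂ) hM hN⟩
  · exact PolyGrowth.bilin (ContinuousLinearMap.mul ℝ ℂ) (PolyGrowth.const ρ ((τ : ℂ) ^ l))
      (hF.bounded τ s w hs)
  · exact (hF.hasKernel τ s hs).const_mul _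

lemma exists_smoothForm_list {ι : Type} {X : ι → ℝ → ℝ → 𝓢(ℂ, ℂ) → 𝓢(ℂ, ℂ) → ℂ} (L : List ι)
    (h : ∀ i ∈ L, ∃ F, SmoothForm ρ (X i) F) :
    ∃ F, SmoothForm ρ (fun τ s h g => (L.map fun i => X i τ s h g).sum) F := by
  induction L with
  | nil => exact ⟨_, smoothForm_zero⟩
  | cons i L ih =>
    obtain ⟨F, hF⟩ := h i List.mem_cons_self
    obtain ⟨G, hG⟩ := ih fun j hj => h j (List.mem_cons_of_mem _ hj)
    exact ⟨_, hF.add hG⟩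

lemma PolyGrowth.integrable_schwartz_mul {F : ℂ → ℂ} (hF : PolyGrowth 0 0 F) (g : 𝓢(ℂ, ℂ)) :
    Integrable fun w => g w * F w := by
  obtain ⟨C, hC, h⟩ := hF.norm_le
  have := g.integrable (μ := volume).bdd_mul (c := C) (f := F)
    hF.contDiff.continuous.aestronglyMeasurable (Eventually.of_forall fun w => by simpa using h w)
  exact this.congr (Eventually.of_forall fun w => mul_comm _ _)

/-- An operator between Fourier multipliers of negative order has a bounded continuous kernel. -/
lemma hasKernel_multS {k l : ℤ} {σ σ' : ℂ → ℂ} (hσ : σ ∈ Sym Real.pi k) (hk : k ≤ -4)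
    (hσ' : σ' ∈ Sym Real.pi l) (hl : l ≤ -4) (h2 : MemLp σ 2 (volume : Measure ℂ))
    (h2' : MemLp σ' 2 (volume : Measure ℂ)) (T : L2 →L[ℂ] L2) :
    HasKernel (fun h g => ⟪toL2 (multS σ h), T (toL2 (multS σ' g))⟫_ℂ)
      (fun z w => ⟪multKer h2 z, T (multKer h2' w)⟫_ℂ) := by
  have g1 := polyGrowth_multKer 0 hσ (by simpa using hk) h2
  have g2 := polyGrowth_multKer 0 hσ' (by simpa using hl) h2'
  have e1 : ∀ (g : 𝓢(ℂ, ℂ)) z, ∫ w, g w * ⟪multKer h2 z, T (multKer h2' w)⟫_ℂ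
      = ⟪multKer h2 z, T (toL2 (multS σ' g))⟫_ℂ := by
    intro g z
    rw [← ContinuousLinearMap.adjoint_inner_left, inner_multS hσ' h2']
    simp only [ContinuousLinearMap.adjoint_inner_left]
  have hc : ∀ v : L2, PolyGrowth 0 0 fun z => conj ⟪multKer h2 z, v⟫_ℂ := fun v =>
    (PolyGrowth.bilin innerL g1 (PolyGrowth.const 0 v)).clm_comp (Complex.conjCLE : ℂ →L[ℝ] ℂ)
  refine ⟨fun g z => ?_, fun h g => ?_, fun h g => ?_⟩
  · have h1 : PolyGrowth 0 0 fun w => T (multKer h2' w) := g2.clm_comp (T.restrictScalars ℝ)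
    exact PolyGrowth.integrable_schwartz_mul
      (PolyGrowth.bilin innerL (PolyGrowth.const 0 (multKer h2 z)) h1) g
  · simp only [e1]
    have := PolyGrowth.integrable_schwartz_mul (hc (T (toL2 (multS σ' g)))) h
    have h3 := (Complex.conjCLE : ℂ →L[ℝ] ℂ).integrable_comp this
    refine h3.congr (Eventually.of_forall fun z => ?_)
    change conj (h z * conj _) = _
    rw [map_mul, Complex.conj_conj]
  · simp only [e1]
    rw [← inner_conj_symm, inner_multS hσ h2, ← integral_conj]
    refine integral_congr_ae (Eventually.of_forall fun z => ?_)
    simp only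
    rw [map_mul, inner_conj_symm]

end Form

section Weighted

open SchwartzMap

variable {ρ : ℕ} {p : ℂ → ℝ} {η : ℝ} {d : ℕ}

lemma SmoothForm.congr {X Y : ℝ → ℝ → 𝓢(ℂ, ℂ) → 𝓢(ℂ, ℂ) → ℂ} {F : ℝ × ℝ × ℂ × ℂ → ℂ}
    (hF : SmoothForm ρ X F) (h : ∀ τ s, 0 < s → ∀ f g, X τ s f g = Y τ s f g) :
    SmoothForm ρ Y F :=
  ⟨hF.contDiffOn, hF.growth, hF.bounded, fun τ s hs => by
    have : Y τ s = X τ s := by ext f g; exact (h τ s hs f g).symm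
    rw [this]; exact hF.hasKernel τ s hs⟩

lemma exists_bcf_mul (hη : 0 < η) {k : ℤ} {q : ℂ → ℂ} (hq : q ∈ Sym η k) {n : ℕ} (hk : k ≤ n) :
    ∃ b : BoundedContinuousFunction ℂ ℂ, ∀ z, b z = (mu η z : ℂ) ^ n * q z := by
  obtain ⟨C, hC, h⟩ := exists_norm_le_of_mem_Sym hη (Sym_mono hk hq)
  refine ⟨bcf (fun z => (mu η z : ℂ) ^ n * q z)
    (((contDiff_mu η).continuous.pow n).mul (contDiff_of_mem_Sym hq).continuous) C fun z => ?_,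
    fun z => rfl⟩
  have hs : 0 < Real.sqrt (wt η z) := Real.sqrt_pos.2 (wt_pos η z)
  rw [norm_mul, norm_pow, Complex.norm_real, Real.norm_of_nonneg (mu_pos η z).le]
  calc _ ≤ mu η z ^ n * (C * Real.sqrt (wt η z) ^ (n : ℤ)) := by
        gcongr
        · exact pow_nonneg (mu_pos η z).le _
        · exact h z
    _ = C := by rw [mu, zpow_natCast, inv_pow]; field_simp

lemma exists_bcf_div (hη : 0 < η) {k : ℤ} {q : ℂ → ℂ} (hq : q ∈ Sym η k) {n : ℕ} (hk : k ≤ -n) :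
    ∃ b : BoundedContinuousFunction ℂ ℂ, ∀ z, q z = (mu η z : ℂ) ^ n * b z := by
  obtain ⟨C, hC, h⟩ := exists_norm_le_of_mem_Sym hη (Sym_mono hk hq)
  have h0 : ∀ z, (mu η z : ℂ) ≠ 0 := fun z => by exact_mod_cast (mu_pos η z).ne'
  refine ⟨bcf (fun z => ((mu η z : ℂ) ^ n)⁻¹ * q z)
    ((((contDiff_mu η).continuous.pow n).inv₀ fun z => pow_ne_zero n (h0 z)).mul
      (contDiff_of_mem_Sym hq).continuous) C fun z => ?_, fun z => ?_⟩
  · have hs : 0 < Real.sqrt (wt η z) := Real.sqrt_pos.2 (wt_pos η z)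
    rw [norm_mul, norm_inv, norm_pow, Complex.norm_real, Real.norm_of_nonneg (mu_pos η z).le]
    calc _ ≤ (mu η z ^ n)⁻¹ * (C * Real.sqrt (wt η z) ^ (-(n : ℤ))) := by
          gcongr
          · exact inv_nonneg.2 (pow_nonneg (mu_pos η z).le _)
          · exact h z
      _ = C := by rw [mu, zpow_neg, zpow_natCast, inv_pow, inv_inv]; field_simp
  · change q z = (mu η z : ℂ) ^ n * (((mu η z : ℂ) ^ n)⁻¹ * q z)
    rw [mul_inv_cancel_left₀ (pow_ne_zero n (h0 z))]

lemma mulOp_muB_pow_toL2 {k : ℤ} {q : ℂ → ℂ} (hq : q ∈ Sym η k) {n : ℕ}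
    {b : BoundedContinuousFunction ℂ ℂ} (hb : ∀ z, b z = (mu η z : ℂ) ^ n * q z) (f : 𝓢(ℂ, ℂ)) :
    (mulOp (muB η) ^ n) (toL2 (symS q f)) = mulOp b (toL2 f) := by
  refine Lp.ext ?_
  filter_upwards [coeFn_mulOp_muB_pow (η := η) n (toL2 (symS q f)), coeFn_mulOp b (toL2 f),
    coeFn_toL2 f, coeFn_toL2 (symS q f)] with z h1 h2 h3 h4
  rw [h1, h2, h3, h4, hb, symS_apply hq, mul_assoc]

lemma toL2_symS_eq {k : ℤ} {q : ℂ → ℂ} (hq : q ∈ Sym η k) {n : ℕ}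
    {b : BoundedContinuousFunction ℂ ℂ} (hb : ∀ z, q z = (mu η z : ℂ) ^ n * b z) (f : 𝓢(ℂ, ℂ)) :
    toL2 (symS q f) = (mulOp (muB η) ^ n) (mulOp b (toL2 f)) := by
  refine Lp.ext ?_
  filter_upwards [coeFn_mulOp_muB_pow (η := η) n (mulOp b (toL2 f)), coeFn_mulOp b (toL2 f),
    coeFn_toL2 f, coeFn_toL2 (symS q f)] with z h1 h2 h3 h4
  rw [h1, h2, h3, h4, symS_apply hq, hb, mul_assoc]

lemma isSelfAdjoint_mulOp_muB_pow (n : ℕ) : IsSelfAdjoint (mulOp (muB η) ^ n) := by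
  refine IsSelfAdjoint.pow ?_ n
  rw [IsSelfAdjoint, star_mulOp, star_muB]

lemma inner_mulOp_muB_pow_left (n : ℕ) (u v : L2) :
    ⟪(mulOp (muB η) ^ n) u, v⟫_ℂ = ⟪u, (mulOp (muB η) ^ n) v⟫_ℂ := by
  rw [← ContinuousLinearMap.adjoint_inner_right]
  rw [← ContinuousLinearMap.star_eq_adjoint, (isSelfAdjoint_mulOp_muB_pow n).star_eq]

/-- One term of the expansion: the weights are shifted through the heat operator, and the Fourier
multipliers on both sides provide the kernel and its derivatives. -/
lemma smoothForm_term (hη : 0 < η) {a M : ℕ} {j : ℤ} {B : ℝ × ℝ → (L2 →L[ℂ] L2)}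
    (hB1 : ContDiffOn ℝ ρ B {q | 0 < q.2})
    (hB2 : ∀ s, 0 < s → PolyGrowth ρ 0 fun τ => B (τ, s))
    (hB3 : ∀ τ s, 0 < s → heatPow j s (boxResolvent p τ) * mulOp (muB η) ^ (a + M)
      = mulOp (muB η) ^ a * B (τ, s))
    {k l m n : ℤ} {q q' σ σ' : ℂ → ℂ} (hq : q ∈ Sym η k) (hk : k ≤ a) (hq' : q' ∈ Sym η l)
    (hl : l ≤ -(a + M : ℕ)) (hσ : σ ∈ Sym Real.pi m) (hm : m ≤ -(ρ + 4))
    (hσ' : σ' ∈ Sym Real.pi n) (hn : n ≤ -(ρ + 4)) :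
    ∃ F, SmoothForm ρ (fun τ s h g => ⟪toL2 (symS q (multS σ h)),
      heatPow j s (boxResolvent p τ) (toL2 (symS q' (multS σ' g)))⟫_ℂ) F := by
  obtain ⟨b, hb⟩ := exists_bcf_mul hη hq hk
  obtain ⟨b', hb'⟩ := exists_bcf_div hη hq' hl
  have h2 := memLp_of_mem_Sym hσ (by omega)
  have h2' := memLp_of_mem_Sym hσ' (by omega)
  have g1 : PolyGrowth ρ 0 fun z => mulOp b (multKer h2 z) :=
    (polyGrowth_multKer ρ hσ hm h2).clm_comp ((mulOp b).restrictScalars ℝ)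
  have g2 : PolyGrowth ρ 0 fun z => mulOp b' (multKer h2' z) :=
    (polyGrowth_multKer ρ hσ' hn h2').clm_comp ((mulOp b').restrictScalars ℝ)
  refine ⟨fun x => innerL (mulOp b (multKer h2 x.2.2.1))
    (applyL (B (x.1, x.2.1)) (mulOp b' (multKer h2' x.2.2.2))), ?_, ?_, ?_, ?_⟩
  · have c1 : ContDiff ℝ ρ fun x : ℝ × ℝ × ℂ × ℂ => mulOp b (multKer h2 x.2.2.1) :=
      g1.contDiff.comp (by fun_prop)
    have c2 : ContDiff ℝ ρ fun x : ℝ × ℝ × ℂ × ℂ => mulOp b' (multKer h2' x.2.2.2) :=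
      g2.contDiff.comp (by fun_prop)
    have c3 : ContDiffOn ℝ ρ (fun x : ℝ × ℝ × ℂ × ℂ => B (x.1, x.2.1)) {q | 0 < q.2.1} :=
      hB1.comp (f := fun x : ℝ × ℝ × ℂ × ℂ => (x.1, x.2.1)) (by fun_prop) fun x hx => hx
    exact innerL.isBoundedBilinearMap.contDiff.comp_contDiffOn (c1.contDiffOn.prodMk
      (applyL.isBoundedBilinearMap.contDiff.comp_contDiffOn (c3.prodMk c2.contDiffOn)))
  · intro s hs
    refine ⟨0, le_rfl, ?_⟩
    have c1 : PolyGrowth ρ 0 fun x : ℝ × ℂ × ℂ => mulOp b (multKer h2 x.2.1) :=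
      g1.comp_clm le_rfl (ContinuousLinearMap.fst ℝ ℂ ℂ ∘L ContinuousLinearMap.snd ℝ ℝ (ℂ × ℂ))
    have c2 : PolyGrowth ρ 0 fun x : ℝ × ℂ × ℂ => mulOp b' (multKer h2' x.2.2) :=
      g2.comp_clm le_rfl (ContinuousLinearMap.snd ℝ ℂ ℂ ∘L ContinuousLinearMap.snd ℝ ℝ (ℂ × ℂ))
    have c3 : PolyGrowth ρ 0 fun x : ℝ × ℂ × ℂ => B (x.1, s) :=
      (hB2 s hs).comp_clm le_rfl (ContinuousLinearMap.fst ℝ ℝ (ℂ × ℂ))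
    exact PolyGrowth.bilin innerL c1 (PolyGrowth.bilin applyL c3 c2)
  · intro τ s w _
    exact PolyGrowth.bilin innerL g1
      (PolyGrowth.const ρ (applyL (B (τ, s)) (mulOp b' (multKer h2' w))))
  · intro τ s hs
    have := hasKernel_multS hσ (by omega) hσ' (by omega) h2 h2'
      (ContinuousLinearMap.adjoint (mulOp b) * B (τ, s) * mulOp b')
    simp only [mul_apply_eq_comp, ContinuousLinearMap.adjoint_inner_right] at this
    refine ⟨this.integrable_right, this.integrable_left, fun h g => ?_⟩
    refine Eq.trans ?_ (this.eq_integral h g)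
    rw [toL2_symS_eq hq' hb', ← mulOp_muB_pow_toL2 hq hb,
      inner_mulOp_muB_pow_left]
    have e := DFunLike.congr_fun (hB3 τ s hs) (mulOp b' (toL2 (multS σ' g)))
    rw [mul_apply_eq_comp, mul_apply_eq_comp] at e
    rw [e]

lemma inner_list_sum {E : Type*} [NormedAddCommGroup E] [InnerProductSpace ℂ E] {ι : Type*}
    (L : List ι) (f : ι → E) (x : E) :
    ⟪x, (L.map f).sum⟫_ℂ = (L.map fun i => ⟪x, f i⟫_ℂ).sum := by
  induction L with
  | nil => simp
  | cons i L ih => simp [ih]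

lemma list_sum_inner {E : Type*} [NormedAddCommGroup E] [InnerProductSpace ℂ E] {ι : Type*}
    (L : List ι) (f : ι → E) (x : E) :
    ⟪(L.map f).sum, x⟫_ℂ = (L.map fun i => ⟪f i, x⟫_ℂ).sum := by
  induction L with
  | nil => simp
  | cons i L ih => simp [ih]

lemma isSelfAdjoint_heatPow_box (j : ℤ) (s : ℝ) (τ : ℝ) :
    IsSelfAdjoint (heatPow j s (boxResolvent p τ)) := isSelfAdjoint_heatPow j s _

lemma inner_heatPow_left (j : ℤ) (s τ : ℝ) (u v : L2) :
    ⟪heatPow j s (boxResolvent p τ) u, v⟫_ℂ = ⟪u, heatPow j s (boxResolvent p τ) v⟫_ℂ := by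
  rw [← ContinuousLinearMap.adjoint_inner_right, ← ContinuousLinearMap.star_eq_adjoint,
    (isSelfAdjoint_heatPow_box j s τ).star_eq]

lemma exists_weighted_box (hη : 0 < η) (hp : toC p ∈ Sym η d) (h1 : η ≤ 1) (h2 : d * η ≤ 1)
    (r : ℕ) : ∃ M : ℕ, ∀ a : ℕ,
      (∀ j : ℤ, ∃ B : ℝ × ℝ → (L2 →L[ℂ] L2), ContDiffOn ℝ r B {q | 0 < q.2} ∧
        (∀ s, 0 < s → PolyGrowth r 0 fun τ => B (τ, s)) ∧
        ∀ τ s, 0 < s → heatPow j s (boxResolvent p τ) * mulOp (muB η) ^ (a + M)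
          = mulOp (muB η) ^ a * B (τ, s)) ∧
      ∃ j₀ : ℤ, ∀ j ≤ j₀, ∃ B : ℝ → C(Set.Icc (0 : ℝ) 1, L2 →L[ℂ] L2), ContDiff ℝ r B ∧
        ∀ (τ : ℝ) (s : Set.Icc (0 : ℝ) 1),
          heatPow j s (boxResolvent p τ) * mulOp (muB η) ^ (a + M) = mulOp (muB η) ^ a * B τ s := by
  obtain ⟨M, hM⟩ := exists_weighted_heatPow (S := weightedGraphs hη hp h1 h2) (Γ := graphZ p)
    (fun τ => rfl) rfl (μ := mulOp (muB η))
    (fun x => pair_ext (diagOp_fst _ _) ((diagOp_snd _ _).trans (map_zero _)))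
    (fun x => diagOp_fst _ _) r
  refine ⟨M, fun a => ⟨fun j => ?_, (hM a).2⟩⟩
  obtain ⟨B, hB1, hB2, hB3⟩ := (hM a).1 j
  refine ⟨B, hB1, fun s hs => ?_, hB3⟩
  obtain ⟨h3, C, hC, h4⟩ := hB2 s hs
  exact ⟨h3, C, hC, fun i hi τ => (h4 i hi τ).trans_eq (by simp)⟩

/-- The heat operators have smooth kernels in weighted spaces. The expansion `exists_rep` is applied
on both sides, with multipliers of order `-(ρ + 4)`; the number `N'` of weights on the right
compensates the orders of the functions on both sides and the loss `M`. -/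
theorem exists_smoothForm (hη : 0 < η) (hp : toC p ∈ Sym η d) (h1 : η ≤ 1) (h2 : d * η ≤ 1)
    (ρ N : ℕ) : ∃ (N' : ℕ) (F : ℝ × ℝ × ℂ × ℂ → ℂ), SmoothForm ρ (fun τ s h g =>
      ⟪toL2 (symS (fun z => (wt η z : ℂ) ^ N) h),
        heatOp p τ s (toL2 (symS (fun z => ((wt η z : ℂ)⁻¹) ^ N') g))⟫_ℂ) F := by
  set r := ρ + 4 with hr
  obtain ⟨M, hM⟩ := exists_weighted_box hη hp h1 h2 ρ
  set a := 2 * N + 2 * d * r with ha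
  set N' := d * r + a + M with hN'
  obtain ⟨L, hL, eL⟩ := exists_rep hp r (wt_pow_mem_Sym (η := η) N)
  obtain ⟨L', hL', eL'⟩ := exists_rep hp r (wt_inv_pow_mem_Sym (η := η) N')
  have key : ∃ F, SmoothForm ρ (fun τ s h g => (L'.map fun t' => (L.map fun t =>
      (τ : ℂ) ^ t'.l * ((τ : ℂ) ^ t.l * ⟪toL2 (symS t.q (multS t.σ h)),
        heatPow (t'.j + t.j) s (boxResolvent p τ) (toL2 (symS t'.q (multS t'.σ g)))⟫_ℂ)).sum).sum)
      F := by
    refine exists_smoothForm_list L' fun t' ht' => exists_smoothForm_list L fun t ht => ?_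
    obtain ⟨B, hB1, hB2, hB3⟩ := (hM a).1 (t'.j + t.j)
    obtain ⟨-, hq, hσ⟩ := hL t ht
    obtain ⟨-, hq', hσ'⟩ := hL' t' ht'
    have i1 : 2 * (N : ℤ) + 2 * d * (r : ℤ) ≤ (a : ℤ) := by rw [ha]; push_cast; omega
    have i2 : -(2 * (N' : ℤ)) + 2 * d * (r : ℤ) ≤ -((a + M : ℕ) : ℤ) := by
      rw [hN']; push_cast; nlinarith
    have i3 : -(r : ℤ) ≤ -(ρ + 4) := by rw [hr]; push_cast; omega
    obtain ⟨F, hF⟩ := smoothForm_term (p := p) hη hB1 hB2 hB3 hq i1 hq' i2 hσ i3 hσ' i3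
    exact ⟨_, (hF.pow_mul t.l).pow_mul t'.l⟩
  obtain ⟨F, hF⟩ := key
  refine ⟨N', F, hF.congr fun τ s hs h g => ?_⟩
  have e0 : heatOp p τ s = heatPow 0 s (boxResolvent p τ) := expOfResolvent_eq_heatPow _ _
  rw [e0, eL' τ 0 s g (Or.inl hs), inner_list_sum]
  refine congrArg List.sum (List.map_congr_left fun t' _ => ?_)
  rw [RepTerm.eval, inner_smul_right, ← inner_heatPow_left, eL _ _ _ _ (Or.inl hs), list_sum_inner,
    ← List.sum_map_mul_left]
  refine congrArg List.sum (List.map_congr_left fun t _ => ?_)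
  rw [RepTerm.eval, inner_smul_left, inner_heatPow_left, map_pow, Complex.conj_ofReal, zero_add]

end Weighted

/-! ### Integrals of functions of temperate growth against Schwartz functions -/

section Temperate

open SchwartzMap

variable {V : Type} [NormedAddCommGroup V] [NormedSpace ℝ V]
  {E : Type} [NormedAddCommGroup E] [NormedSpace ℝ E] [NormedSpace ℂ E]

lemma integrable_norm_mul_one_add_pow (f : 𝓢(ℂ, ℂ)) (k : ℕ) :
    Integrable fun ξ => ‖f ξ‖ * (1 + ‖ξ‖) ^ k := by
  have h := (symS (fun z => (wt 1 z : ℂ) ^ k) f).integrable (μ := volume)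
  refine (h.norm.const_mul (2 ^ k)).mono'
    (f.continuous.norm.mul (by fun_prop)).aestronglyMeasurable (Eventually.of_forall fun ξ => ?_)
  rw [Real.norm_of_nonneg (by positivity), symS_apply (wt_pow_mem_Sym k), norm_mul, norm_pow,
    Complex.norm_real, Real.norm_of_nonneg (wt_pos _ _).le]
  have h1 : 1 + ‖ξ‖ ≤ 2 * wt 1 ξ := by rw [wt]; nlinarith [sq_nonneg (‖ξ‖ - 1)]
  calc _ ≤ ‖f ξ‖ * (2 * wt 1 ξ) ^ k := by gcongr
    _ = _ := by rw [mul_pow]; ring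

lemma integrable_schwartz_smul (f : 𝓢(ℂ, ℂ)) {Y : ℂ → E} (hY : Continuous Y) {C : ℝ} {k : ℕ}
    (h : ∀ ξ, ‖Y ξ‖ ≤ C * (1 + ‖ξ‖) ^ k) : Integrable fun ξ => f ξ • Y ξ := by
  refine ((integrable_norm_mul_one_add_pow f k).const_mul C).mono'
    (f.continuous.smul hY).aestronglyMeasurable (Eventually.of_forall fun ξ => ?_)
  rw [norm_smul]
  calc _ ≤ ‖f ξ‖ * (C * (1 + ‖ξ‖) ^ k) := by gcongr; exact h ξ
    _ = _ := by ring

lemma one_add_norm_prod_pow_le {v v' : V} (hv : ‖v'‖ ≤ ‖v‖ + 1) (ξ : ℂ) (k : ℕ) :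
    (1 + ‖(v', ξ)‖) ^ k ≤ (2 + ‖v‖) ^ k * (1 + ‖ξ‖) ^ k := by
  rw [← mul_pow]
  gcongr
  have : ‖(v', ξ)‖ ≤ ‖v'‖ + ‖ξ‖ := by
    rw [Prod.norm_mk]
    exact max_le (le_add_of_nonneg_right (norm_nonneg _)) (le_add_of_nonneg_left (norm_nonneg _))
  nlinarith [norm_nonneg v, norm_nonneg ξ]

lemma integrable_mul_temperate (f : 𝓢(ℂ, ℂ)) {Y : V × ℂ → ℂ} (hY : Y.HasTemperateGrowth) (v : V) :
    Integrable fun ξ => f ξ * Y (v, ξ) := by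
  obtain ⟨k, C, h⟩ := hY.2 0
  simp only [norm_iteratedFDeriv_zero] at h
  have hC : 0 ≤ C := by
    have := (norm_nonneg _).trans (h (v, 0))
    exact nonneg_of_mul_nonneg_left this (by positivity)
  refine integrable_schwartz_smul f (Y := fun ξ => Y (v, ξ)) (C := C * (2 + ‖v‖) ^ k) (k := k)
    (hY.1.continuous.comp (by fun_prop)) fun ξ => ?_
  refine (h (v, ξ)).trans ?_
  rw [mul_assoc]
  gcongr
  exact one_add_norm_prod_pow_le (by linarith) ξ k

/-- Differentiation under the integral sign. -/
lemma hasFDerivAt_integral_temperate (f : 𝓢(ℂ, ℂ)) {Y : V × ℂ → ℂ} (hY : Y.HasTemperateGrowth)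
    (v : V) : Integrable (fun ξ => f ξ • (fderiv ℝ Y (v, ξ)).comp (ContinuousLinearMap.inl ℝ V ℂ)) ∧
      HasFDerivAt (fun v => ∫ ξ, f ξ * Y (v, ξ))
        (∫ ξ, f ξ • (fderiv ℝ Y (v, ξ)).comp (ContinuousLinearMap.inl ℝ V ℂ)) v := by
  obtain ⟨k, C, h⟩ := hY.2 1
  have h' : ∀ x, ‖fderiv ℝ Y x‖ ≤ C * (1 + ‖x‖) ^ k := fun x => by
    have := h x
    rwa [← norm_iteratedFDeriv_fderiv, norm_iteratedFDeriv_zero] at this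
  have hC : 0 ≤ C := by
    have := (norm_nonneg _).trans (h' (v, 0))
    exact nonneg_of_mul_nonneg_left this (by positivity)
  have hc : Continuous (fderiv ℝ Y) := hY.1.continuous_fderiv (by simp)
  have hb : ∀ (v' : V), ‖v'‖ ≤ ‖v‖ + 1 → ∀ ξ : ℂ,
      ‖(fderiv ℝ Y (v', ξ)).comp (ContinuousLinearMap.inl ℝ V ℂ)‖
        ≤ C * (2 + ‖v‖) ^ k * (1 + ‖ξ‖) ^ k := fun v' hv' ξ => by
    refine (ContinuousLinearMap.opNorm_comp_le _ _).trans ?_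
    calc _ ≤ C * (1 + ‖(v', ξ)‖) ^ k * 1 := by
          gcongr
          · exact h' _
          · exact ContinuousLinearMap.norm_inl_le_one ℝ V ℂ
      _ ≤ C * ((2 + ‖v‖) ^ k * (1 + ‖ξ‖) ^ k) * 1 := by
          gcongr; exact one_add_norm_prod_pow_le hv' ξ k
      _ = _ := by ring
  have hcc : ∀ v : V, Continuous fun ξ : ℂ =>
      (fderiv ℝ Y (v, ξ)).comp (ContinuousLinearMap.inl ℝ V ℂ) := fun v =>
    (hc.comp (by fun_prop)).clm_comp continuous_const
  have hI := integrable_schwartz_smul f (hcc v) fun ξ => hb v (by linarith) ξ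
  refine ⟨hI, ?_⟩
  refine hasFDerivAt_integral_of_dominated_of_fderiv_le (s := Metric.ball v 1)
    (bound := fun ξ => (C * (2 + ‖v‖) ^ k) * (‖f ξ‖ * (1 + ‖ξ‖) ^ k))
    (F' := fun v ξ => f ξ • (fderiv ℝ Y (v, ξ)).comp (ContinuousLinearMap.inl ℝ V ℂ))
    (Metric.ball_mem_nhds v one_pos)
    (Eventually.of_forall fun v => (integrable_mul_temperate f hY v).aestronglyMeasurable)
    (integrable_mul_temperate f hY v) hI.aestronglyMeasurable
    (Eventually.of_forall fun ξ v' hv' => ?_)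
    ((integrable_norm_mul_one_add_pow f k).const_mul _) (Eventually.of_forall fun ξ v' _ => ?_)
  · rw [norm_smul]
    have hn : ‖v'‖ ≤ ‖v‖ + 1 := by
      have h1 : ‖v' - v‖ < 1 := by rw [← dist_eq_norm]; exact hv'
      have h2 := norm_le_norm_add_norm_sub v v'
      rw [norm_sub_rev] at h2
      linarith
    calc _ ≤ ‖f ξ‖ * (C * (2 + ‖v‖) ^ k * (1 + ‖ξ‖) ^ k) := by gcongr; exact hb v' hn ξ
      _ = _ := by ring
  · have h1 : HasFDerivAt Y (fderiv ℝ Y (v', ξ)) (v', ξ) :=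
      (hY.1.differentiable (by simp) _).hasFDerivAt
    have h2 : HasFDerivAt (fun v : V => (v, ξ)) (ContinuousLinearMap.inl ℝ V ℂ) v' :=
      hasFDerivAt_prodMk_left v' ξ
    exact (h1.comp v' h2).const_mul (f ξ)

lemma fderiv_integral_temperate (f : 𝓢(ℂ, ℂ)) {Y : V × ℂ → ℂ} (hY : Y.HasTemperateGrowth)
    (v e : V) : fderiv ℝ (fun v => ∫ ξ, f ξ * Y (v, ξ)) v e
      = ∫ ξ, f ξ * fderiv ℝ Y (v, ξ) (e, 0) := by
  obtain ⟨hI, h⟩ := hasFDerivAt_integral_temperate f hY v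
  rw [h.fderiv, ContinuousLinearMap.integral_apply hI]
  rfl

lemma continuous_integral_temperate (f : 𝓢(ℂ, ℂ)) {Y : V × ℂ → ℂ} (hY : Y.HasTemperateGrowth) :
    Continuous fun v => ∫ ξ, f ξ * Y (v, ξ) :=
  continuous_iff_continuousAt.2 fun v => (hasFDerivAt_integral_temperate f hY v).2.continuousAt

lemma hasTemperateGrowth_fderiv_apply {F : Type} [NormedAddCommGroup F] [NormedSpace ℝ F]
    {Y : V → F} (hY : Y.HasTemperateGrowth) (e : V) :
    (fun x => fderiv ℝ Y x e).HasTemperateGrowth := by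
  have h : (fderiv ℝ Y).HasTemperateGrowth := by
    refine ⟨hY.1.fderiv_right (by simp), fun n => ?_⟩
    obtain ⟨k, C, h⟩ := hY.2 (n + 1)
    exact ⟨k, C, fun x => by rw [norm_iteratedFDeriv_fderiv]; exact h x⟩
  exact (ContinuousLinearMap.apply ℝ F e : (V →L[ℝ] F) →L[ℝ] F).hasTemperateGrowth.comp h

end Temperate

/-! ### Uniqueness of continuous kernels -/

section Unique

open SchwartzMap

lemma aeEq_of_integral_schwartz_mul {f f' : ℂ → ℂ} (hf : LocallyIntegrable f volume)
    (hf' : LocallyIntegrable f' volume)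
    (h : ∀ g : 𝓢(ℂ, ℂ), HasCompactSupport g → ∫ z, g z * f z = ∫ z, g z * f' z) :
    f =ᵐ[volume] f' := by
  have h0 : ∀ᵐ z ∂(volume : Measure ℂ), f z - f' z = 0 := by
    refine ae_eq_zero_of_integral_contDiff_smul_eq_zero (hf.sub hf') fun g hg hgc => ?_
    have hc1 : HasCompactSupport fun z => (g z : ℂ) := hgc.comp_left Complex.ofReal_zero
    have hc2 : ContDiff ℝ ∞ fun z => (g z : ℂ) := Complex.ofRealCLM.contDiff.comp hg
    have := h (hc1.toSchwartzMap hc2) hc1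
    have i1 := hf.integrable_smul_left_of_hasCompactSupport hg.continuous hgc
    have i2 := hf'.integrable_smul_left_of_hasCompactSupport hg.continuous hgc
    simp only [smul_sub]
    rw [integral_sub i1 i2, sub_eq_zero]
    simpa only [Complex.real_smul] using! this
  filter_upwards [h0] with z hz
  exact sub_eq_zero.1 hz

lemma eq_of_integral_schwartz_mul {f f' : ℂ → ℂ} (hf : Continuous f) (hf' : Continuous f')
    (h : ∀ g : 𝓢(ℂ, ℂ), HasCompactSupport g → ∫ z, g z * f z = ∫ z, g z * f' z) : f = f' :=
  (hf.ae_eq_iff_eq volume hf').1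
    (aeEq_of_integral_schwartz_mul hf.locallyIntegrable hf'.locallyIntegrable h)

lemma hasCompactSupport_conjS {g : 𝓢(ℂ, ℂ)} (hg : HasCompactSupport g) :
    HasCompactSupport (conjS g) :=
  HasCompactSupport.comp_left (g := fun z : ℂ => conj z) hg (map_zero _)

lemma continuous_integral_of_hasCompactSupport {K : ℂ → ℂ → ℂ}
    (hK : Continuous (Function.uncurry K)) {g : 𝓢(ℂ, ℂ)} (hg : HasCompactSupport g) :
    Continuous fun z => ∫ w, g w * K z w :=
  continuousOn_univ.1 (continuousOn_integral_of_compact_support (f := fun z w => g w * K z w) hg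
    ((g.continuous.comp continuous_snd).mul hK).continuousOn fun z w _ hw => by
      rw [image_eq_zero_of_notMem_tsupport hw, zero_mul])

/-- A continuous kernel is determined by its form on test functions. -/
lemma kernel_unique {K K' : ℂ → ℂ → ℂ} (hK : Continuous (Function.uncurry K))
    (hK' : Continuous (Function.uncurry K'))
    (h : ∀ f g : 𝓢(ℂ, ℂ), HasCompactSupport f → HasCompactSupport g →
      ∫ z, conj (f z) * ∫ w, g w * K z w = ∫ z, conj (f z) * ∫ w, g w * K' z w) : K = K' := by
  have h1 : ∀ g : 𝓢(ℂ, ℂ), HasCompactSupport g →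
      (fun z => ∫ w, g w * K z w) = fun z => ∫ w, g w * K' z w := fun g hg =>
    eq_of_integral_schwartz_mul (continuous_integral_of_hasCompactSupport hK hg)
      (continuous_integral_of_hasCompactSupport hK' hg) fun f hf => by
        have := h (conjS f) g (hasCompactSupport_conjS hf) hg
        simpa only [conjS_apply, Complex.conj_conj] using this
  ext1 z
  exact eq_of_integral_schwartz_mul (hK.comp (by fun_prop : Continuous fun w : ℂ => (z, w)))
    (hK'.comp (by fun_prop : Continuous fun w : ℂ => (z, w))) fun g hg => congrFun (h1 g hg) z

end Unique

/-! ### The heat kernel -/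

section Kernel

open SchwartzMap

variable {p : ℂ → ℝ} {η : ℝ} {d : ℕ}

/-- A constant `η` for which the weight varies sufficiently slowly. -/
lemma exists_params (hp : IsRealPolynomial p) :
    ∃ (η : ℝ) (d : ℕ), 0 < η ∧ η ≤ 1 ∧ d * η ≤ 1 ∧ toC p ∈ Sym η d := by
  obtain ⟨d, hd⟩ := exists_mem_Sym_of_isRealPolynomial hp
  refine ⟨((d : ℝ) + 1)⁻¹, d, by positivity,
    inv_le_one_of_one_le₀ (by linarith [d.cast_nonneg (α := ℝ)]),
    ?_, hd _⟩
  rw [← div_eq_mul_inv, div_le_one (by positivity)]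
  linarith

/-- A kernel family for the heat semigroups, with its regularity: it is smooth for `s > 0`, all its
derivatives in `(τ, z, w)` grow at most polynomially for fixed `s`, and it is a Schwartz function
of `z`. The kernel property is stated for Schwartz functions. -/
structure IsKernelFamily (p : ℂ → ℝ) (K : ℝ → ℝ → ℂ → ℂ → ℂ) : Prop where
  contDiffOn : ContDiffOn ℝ ∞ (fun q : ℝ × ℝ × ℂ × ℂ => K q.1 q.2.1 q.2.2.1 q.2.2.2) {q | 0 < q.2.1}
  temperate : ∀ s, 0 < s →
    Function.HasTemperateGrowth fun q : ℝ × ℂ × ℂ => K q.1 s q.2.1 q.2.2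
  schwartz : ∀ τ s w, 0 < s → ∃ f : 𝓢(ℂ, ℂ), ∀ z, f z = K τ s z w
  hasKernel : ∀ τ s, 0 < s → HasKernel (fun h g => ⟪toL2 h, heatOp p τ s (toL2 g)⟫_ℂ) (K τ s)

lemma wt_inv_mul_pow (N : ℕ) (z : ℂ) : ((wt η z : ℂ)⁻¹) ^ N * (wt η z : ℂ) ^ N = 1 := by
  have : (wt η z : ℂ) ≠ 0 := by exact_mod_cast (wt_pos η z).ne'
  rw [← mul_pow, inv_mul_cancel₀ this, one_pow]

lemma symS_wt_symS_wt_inv (N : ℕ) (f : 𝓢(ℂ, ℂ)) :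
    symS (fun z => (wt η z : ℂ) ^ N) (symS (fun z => ((wt η z : ℂ)⁻¹) ^ N) f) = f := by
  ext z
  rw [symS_apply (wt_pow_mem_Sym N), symS_apply (wt_inv_pow_mem_Sym N), ← mul_assoc,
    mul_comm (_ ^ N), wt_inv_mul_pow, one_mul]

lemma symS_wt_inv_symS_wt (N : ℕ) (f : 𝓢(ℂ, ℂ)) :
    symS (fun z => ((wt η z : ℂ)⁻¹) ^ N) (symS (fun z => (wt η z : ℂ) ^ N) f) = f := by
  ext z
  rw [symS_apply (wt_inv_pow_mem_Sym N), symS_apply (wt_pow_mem_Sym N), ← mul_assoc,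
    wt_inv_mul_pow, one_mul]

/-- Removal of the weights from a kernel. -/
lemma HasKernel.unweight {A : L2 →L[ℂ] L2} {N N' : ℕ} {F : ℂ → ℂ → ℂ}
    (hF : HasKernel (fun h g => ⟪toL2 (symS (fun z => (wt η z : ℂ) ^ N) h),
      A (toL2 (symS (fun z => ((wt η z : ℂ)⁻¹) ^ N') g))⟫_ℂ) F) :
    HasKernel (fun h g => ⟪toL2 h, A (toL2 g)⟫_ℂ)
      (fun z w => ((wt η z : ℂ)⁻¹) ^ N * ((wt η w : ℂ) ^ N' * F z w)) := by
  have e1 : ∀ (g : 𝓢(ℂ, ℂ)) z w, g w * (((wt η z : ℂ)⁻¹) ^ N * ((wt η w : ℂ) ^ N' * F z w))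
      = ((wt η z : ℂ)⁻¹) ^ N * (symS (fun z => (wt η z : ℂ) ^ N') g w * F z w) := fun g z w => by
    rw [symS_apply (wt_pow_mem_Sym N')]; ring
  have e2 : ∀ (h : 𝓢(ℂ, ℂ)) z (c : ℂ), conj (h z) * (((wt η z : ℂ)⁻¹) ^ N * c)
      = conj (symS (fun z => ((wt η z : ℂ)⁻¹) ^ N) h z) * c := fun h z c => by
    rw [symS_apply (wt_inv_pow_mem_Sym N), map_mul, map_pow, map_inv₀, Complex.conj_ofReal]; ring
  refine ⟨fun g z => ?_, fun h g => ?_, fun h g => ?_⟩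
  · simp only [e1]
    exact (hF.integrable_right _ z).const_mul _
  · simp only [e1, integral_const_mul, e2]
    exact hF.integrable_left _ _
  · simp only [e1, integral_const_mul, e2]
    rw [← hF.eq_integral, symS_wt_symS_wt_inv, symS_wt_inv_symS_wt]

/-- Functions of arbitrarily low order, with derivatives up to any order, are Schwartz functions. -/
lemma exists_schwartz_of_polyGrowth {f : ℂ → ℂ} (h : ∀ ρ N : ℕ, PolyGrowth ρ (-(2 * N : ℕ)) f) :
    ∃ g : 𝓢(ℂ, ℂ), ∀ z, g z = f z := by
  refine ⟨⟨f, contDiff_infty.2 fun ρ => (h ρ 0).contDiff, fun k n => ?_⟩, fun z => rfl⟩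
  obtain ⟨C, hC, hb⟩ := (h n k).bound
  refine ⟨C, fun x => ?_⟩
  have h0 : (0 : ℝ) < 1 + ‖x‖ := by positivity
  calc ‖x‖ ^ k * ‖iteratedFDeriv ℝ n f x‖
      ≤ (1 + ‖x‖) ^ (2 * k) * (C * (1 + ‖x‖) ^ (-((2 * k : ℕ) : ℤ))) := by
        gcongr
        · calc ‖x‖ ^ k ≤ (1 + ‖x‖) ^ k := by gcongr; linarith
            _ ≤ _ := pow_le_pow_right₀ (by linarith [norm_nonneg x]) (by omega)
        · exact hb n le_rfl x
    _ = C := by rw [zpow_neg, zpow_natCast]; field_simp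

/-- The kernels of all finite orders of smoothness and decay from `exists_smoothForm` agree. -/
theorem exists_isKernelFamily (hpoly : IsRealPolynomial p) : ∃ K, IsKernelFamily p K := by
  obtain ⟨η, d, hη, h1, h2, hp⟩ := exists_params hpoly
  choose N' F hF using fun ρ N => exists_smoothForm hη hp h1 h2 ρ N
  set G : ℕ → ℕ → ℝ × ℝ × ℂ × ℂ → ℂ := fun ρ N q =>
    ((wt η q.2.2.1 : ℂ)⁻¹) ^ N * ((wt η q.2.2.2 : ℂ) ^ N' ρ N * F ρ N q) with hG
  have hkerG : ∀ ρ N τ s, 0 < s → HasKernel (fun h g => ⟪toL2 h, heatOp p τ s (toL2 g)⟫_ℂ)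
      fun z w => G ρ N (τ, s, z, w) := fun ρ N τ s hs => ((hF ρ N).hasKernel τ s hs).unweight
  have c1 : ∀ ρ N : ℕ, ContDiff ℝ ρ fun z => ((wt η z : ℂ)⁻¹) ^ N := fun ρ N =>
    (contDiff_of_mem_Sym (wt_inv_pow_mem_Sym N)).of_le (by exact_mod_cast le_top)
  have c2 : ∀ ρ N : ℕ, ContDiff ℝ ρ fun z => (wt η z : ℂ) ^ N := fun ρ N =>
    (contDiff_of_mem_Sym (wt_pow_mem_Sym N)).of_le (by exact_mod_cast le_top)
  have hsmooth : ∀ ρ N : ℕ, ContDiffOn ℝ ρ (G ρ N) {q | 0 < q.2.1} := fun ρ N => by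
    have d1 : ContDiff ℝ ρ fun q : ℝ × ℝ × ℂ × ℂ => ((wt η q.2.2.1 : ℂ)⁻¹) ^ N :=
      (c1 ρ N).comp (by fun_prop : ContDiff ℝ ρ fun q : ℝ × ℝ × ℂ × ℂ => q.2.2.1)
    have d2 : ContDiff ℝ ρ fun q : ℝ × ℝ × ℂ × ℂ => (wt η q.2.2.2 : ℂ) ^ N' ρ N :=
      (c2 ρ _).comp (by fun_prop : ContDiff ℝ ρ fun q : ℝ × ℝ × ℂ × ℂ => q.2.2.2)
    exact d1.contDiffOn.mul (d2.contDiffOn.mul (hF ρ N).contDiffOn)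
  have hcont : ∀ ρ N τ s, 0 < s →
      Continuous (Function.uncurry fun z w => G ρ N (τ, s, z, w)) := fun ρ N τ s hs =>
    (hsmooth ρ N).continuousOn.comp_continuous
      (by fun_prop : Continuous fun x : ℂ × ℂ => (τ, s, x.1, x.2)) fun x => hs
  -- all these kernels agree, since they represent the same operator
  have heq : ∀ ρ N q, 0 < q.2.1 → G 0 0 q = G ρ N q := by
    rintro ρ N ⟨τ, s, z, w⟩ hs
    have := kernel_unique (hcont 0 0 τ s hs) (hcont ρ N τ s hs) fun f g _ _ => by
      rw [← (hkerG 0 0 τ s hs).eq_integral, ← (hkerG ρ N τ s hs).eq_integral]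
    exact congrFun (congrFun this z) w
  refine ⟨fun τ s z w => G 0 0 (τ, s, z, w), ?_, fun s hs => ?_, fun τ s w hs => ?_,
    fun τ s hs => hkerG 0 0 τ s hs⟩
  · exact contDiffOn_infty.2 fun ρ => (hsmooth ρ 0).congr fun q hq => heq ρ 0 q hq
  · refine hasTemperateGrowth_of_polyGrowth fun ρ => ?_
    obtain ⟨n, hn, hb⟩ := (hF ρ 0).growth s hs
    have e : (fun q : ℝ × ℂ × ℂ => G 0 0 (q.1, s, q.2.1, q.2.2))
        = fun q => (wt η q.2.2 : ℂ) ^ N' ρ 0 * F ρ 0 (q.1, s, q.2.1, q.2.2) := by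
      ext q
      rw [heq ρ 0 _ hs, hG]
      simp
    rw [e]
    have g1 := (polyGrowth_of_mem_Sym hη ρ (wt_pow_mem_Sym (η := η) (N' ρ 0))).comp_clm
      (by positivity)
      (ContinuousLinearMap.snd ℝ ℂ ℂ ∘L ContinuousLinearMap.snd ℝ ℝ (ℂ × ℂ))
    exact ⟨_, PolyGrowth.bilin (ContinuousLinearMap.mul ℝ ℂ) g1 hb⟩
  · refine exists_schwartz_of_polyGrowth fun ρ N => ?_
    have e : (fun z : ℂ => G 0 0 (τ, s, z, w))
        = fun z => ((wt η z : ℂ)⁻¹) ^ N * ((wt η w : ℂ) ^ N' ρ N * F ρ N (τ, s, z, w)) := by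
      ext z; rw [heq ρ N _ hs]
    rw [e]
    have g1 := polyGrowth_of_mem_Sym hη ρ (wt_inv_pow_mem_Sym (η := η) N)
    have g2 := PolyGrowth.bilin (ContinuousLinearMap.mul ℝ ℂ)
      (PolyGrowth.const ρ ((wt η w : ℂ) ^ N' ρ N)) ((hF ρ N).bounded τ s w hs)
    have g3 := PolyGrowth.bilin (ContinuousLinearMap.mul ℝ ℂ) g1 g2
    simpa using g3

variable {K : ℝ → ℝ → ℂ → ℂ → ℂ} {τ s : ℝ}

lemma IsKernelFamily.continuous (hK : IsKernelFamily p K) (hs : 0 < s) :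
    Continuous (Function.uncurry (K τ s)) :=
  (hK.temperate s hs).1.continuous.comp (by fun_prop : Continuous fun x : ℂ × ℂ => (τ, x.1, x.2))

lemma inner_heatOp_left (τ s : ℝ) (u v : L2) : ⟪heatOp p τ s u, v⟫_ℂ = ⟪u, heatOp p τ s v⟫_ℂ := by
  have e0 : heatOp p τ s = heatPow 0 s (boxResolvent p τ) := expOfResolvent_eq_heatPow _ _
  rw [e0, inner_heatPow_left]

/-- The heat kernel is Hermitian. -/
lemma IsKernelFamily.conj_symm (hK : IsKernelFamily p K) (hs : 0 < s) (z w : ℂ) :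
    K τ s w z = conj (K τ s z w) := by
  have hc := hK.continuous (τ := τ) hs
  have : K τ s = fun w z => conj (K τ s z w) := by
    refine kernel_unique hc (Complex.continuous_conj.comp (hc.comp continuous_swap))
      fun f g hf hg => ?_
    rw [← (hK.hasKernel τ s hs).eq_integral]
    simp only [← inner_heatOp_left]
    rw [← inner_conj_symm, (hK.hasKernel τ s hs).eq_integral, ← integral_conj]
    simp only [map_mul, Complex.conj_conj, ← integral_conj]
    simp only [← integral_const_mul]
    rw [integral_integral_swap_of_hasCompactSupport]
    · refine integral_congr_ae (Eventually.of_forall fun z => ?_)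
      refine integral_congr_ae (Eventually.of_forall fun w => ?_)
      simp only
      ring
    · have c : Continuous fun x : ℂ × ℂ => K τ s x.1 x.2 := hc
      exact (g.continuous.comp continuous_fst).mul
        ((Complex.continuous_conj.comp (f.continuous.comp continuous_snd)).mul
          (Complex.continuous_conj.comp c))
    · refine HasCompactSupport.intro (K := tsupport g ×ˢ tsupport f) (hg.prod hf) ?_
      rintro ⟨z, w⟩ hzw
      rw [Set.mem_prod, not_and_or] at hzw
      rcases hzw with h | h
      · simp [image_eq_zero_of_notMem_tsupport h]
      · simp [image_eq_zero_of_notMem_tsupport h]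
  exact congrFun (congrFun this w) z

lemma IsKernelFamily.schwartz_right (hK : IsKernelFamily p K) (hs : 0 < s) (z : ℂ) :
    ∃ f : 𝓢(ℂ, ℂ), ∀ w, f w = K τ s z w := by
  obtain ⟨f, hf⟩ := hK.schwartz τ s z hs
  exact ⟨conjS f, fun w => by rw [conjS_apply, hf, hK.conj_symm hs, Complex.conj_conj]⟩

lemma integrable_schwartz_mul_L2 (f : 𝓢(ℂ, ℂ)) (u : L2) : Integrable fun w => f w * u w := by
  refine (integrable_inner_mul (toL2 (conjS f)) u).congr ?_
  filter_upwards [coeFn_toL2 (conjS f)] with w h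
  rw [h, conjS_apply, Complex.conj_conj]

lemma integral_schwartz_mul_L2 (f : 𝓢(ℂ, ℂ)) (u : L2) :
    ∫ w, f w * u w = ⟪toL2 (conjS f), u⟫_ℂ := by
  rw [MeasureTheory.L2.inner_def]
  refine integral_congr_ae ?_
  filter_upwards [coeFn_toL2 (conjS f)] with w h
  rw [h, RCLike.inner_apply, conjS_apply, Complex.conj_conj, mul_comm]

lemma IsKernelFamily.heatOp_toL2 (hK : IsKernelFamily p K) (hs : 0 < s) (g : 𝓢(ℂ, ℂ)) :
    heatOp p τ s (toL2 g) =ᵐ[volume] fun z => ∫ w, K τ s z w * g w := by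
  have hc : Continuous fun z => ∫ w, g w * K τ s z w := by
    refine continuous_integral_temperate g (Y := fun x : ℂ × ℂ => K τ s x.1 x.2) ?_
    have h1 : Function.HasTemperateGrowth fun x : ℂ × ℂ => (τ, x.1, x.2) := by
      have : (fun x : ℂ × ℂ => (τ, x.1, x.2))
          = fun x => (τ, (0 : ℂ × ℂ)) + ContinuousLinearMap.inr ℝ ℝ (ℂ × ℂ) x := by
        ext x <;> simp
      rw [this]
      exact (Function.HasTemperateGrowth.const _).add
        (ContinuousLinearMap.hasTemperateGrowth _)
    exact (hK.temperate s hs).comp h1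
  have e : (fun z => ∫ w, K τ s z w * g w) = fun z => ∫ w, g w * K τ s z w := by
    simp only [mul_comm]
  rw [e]
  refine aeEq_of_integral_schwartz_mul ((Lp.memLp _).locallyIntegrable (by norm_num))
    hc.locallyIntegrable fun f hf => ?_
  rw [integral_schwartz_mul_L2, (hK.hasKernel τ s hs).eq_integral]
  simp only [conjS_apply, Complex.conj_conj]

lemma IsKernelFamily.isHeatKernel (hK : IsKernelFamily p K) (τ : ℝ) :
    IsHeatKernel p τ (K τ) := by
  refine ⟨?_, fun s hs f z => ?_, fun s hs f => ?_⟩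
  · exact hK.contDiffOn.continuousOn.comp
      (by fun_prop : Continuous fun q : ℝ × ℂ × ℂ => (τ, q.1, q.2.1, q.2.2)).continuousOn
      fun q hq => hq
  · obtain ⟨k, hk⟩ := hK.schwartz_right (τ := τ) hs z
    simpa only [hk] using integrable_schwartz_mul_L2 k f
  · choose k hk using fun z => hK.schwartz_right (τ := τ) hs z
    -- approximate by Schwartz functions, with convergence almost everywhere of the images
    obtain ⟨g, hg⟩ : ∃ g : ℕ → 𝓢(ℂ, ℂ), Tendsto (fun n => toL2 (g n)) atTop (𝓝 f) := by
      have hd : DenseRange (toL2 : 𝓢(ℂ, ℂ) → L2) :=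
        SchwartzMap.denseRange_toLpCLM ENNReal.ofNat_ne_top
      obtain ⟨x, hx, hxf⟩ := mem_closure_iff_seq_limit.1 (hd f)
      choose g hg using hx
      exact ⟨g, by simpa only [hg] using hxf⟩
    have h1 : Tendsto (fun n => heatOp p τ s (toL2 (g n))) atTop (𝓝 (heatOp p τ s f)) :=
      ((heatOp p τ s).continuous.tendsto f).comp hg
    obtain ⟨ns, hns, hae⟩ := (tendstoInMeasure_of_tendsto_Lp h1).exists_seq_tendsto_ae
    have h2 := ae_all_iff.2 fun n => hK.heatOp_toL2 (τ := τ) hs (g n)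
    filter_upwards [hae, h2] with z hz1 hz2
    simp only [hz2] at hz1
    refine tendsto_nhds_unique hz1 ?_
    have e1 : ∀ n, ∫ w, K τ s z w * g n w = ⟪toL2 (conjS (k z)), toL2 (g n)⟫_ℂ := fun n => by
      rw [inner_toL2]
      simp only [conjS_apply, Complex.conj_conj, hk, mul_comm]
    have e2 : ∫ w, K τ s z w * f w = ⟪toL2 (conjS (k z)), f⟫_ℂ := by
      rw [← integral_schwartz_mul_L2]
      simp only [hk]
    simp only [e1, e2]
    exact (tendsto_const_nhds.inner hg).comp hns.tendsto_atTop

lemma IsKernelFamily.eq_of_isHeatKernel (hK : IsKernelFamily p K) {K' : ℝ → ℂ → ℂ → ℂ}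
    (hK' : IsHeatKernel p τ K') (hs : 0 < s) : K' s = K τ s := by
  have hc : Continuous (Function.uncurry (K' s)) :=
    hK'.continuousOn.comp_continuous (by fun_prop : Continuous fun x : ℂ × ℂ => (s, x.1, x.2))
      fun x => hs
  refine kernel_unique hc (hK.continuous hs) fun f g hf hg => ?_
  rw [← (hK.hasKernel τ s hs).eq_integral, MeasureTheory.L2.inner_def]
  refine integral_congr_ae ?_
  filter_upwards [coeFn_toL2 f, hK'.represents s hs (toL2 g)] with z h1 h2
  rw [h1, h2, RCLike.inner_apply, mul_comm]
  congr 1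
  refine integral_congr_ae ?_
  filter_upwards [coeFn_toL2 g] with w h3
  rw [h3, mul_comm]

lemma IsKernelFamily.heatKernel_eq (hK : IsKernelFamily p K) (hs : 0 < s) :
    heatKernel p τ s = K τ s :=
  hK.eq_of_isHeatKernel (Classical.epsilon_spec ⟨_, hK.isHeatKernel τ⟩) hs

/-- The heat kernel is a kernel family. -/
theorem isKernelFamily_heatKernel (hpoly : IsRealPolynomial p) :
    IsKernelFamily p (heatKernel p) := by
  obtain ⟨K, hK⟩ := exists_isKernelFamily hpoly
  have e : ∀ τ s, 0 < s → heatKernel p τ s = K τ s := fun τ s hs => hK.heatKernel_eq hs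
  refine ⟨hK.contDiffOn.congr fun q hq => ?_, fun s hs => ?_, fun τ s w hs => ?_, fun τ s hs => ?_⟩
  · simp only [e _ _ hq]
  · simp only [e _ _ hs]; exact hK.temperate s hs
  · simp only [e _ _ hs]; exact hK.schwartz τ s w hs
  · simp only [e _ _ hs]; exact hK.hasKernel τ s hs

end Kernel

/-! ### Integrals of the heat kernel as time tends to zero -/

section Path

open SchwartzMap

variable {p : ℂ → ℝ} {η : ℝ} {d : ℕ}

/-- Families of Schwartz functions that are polynomial in the parameter. -/
noncomputable def polyFam : Submodule ℂ (ℝ → 𝓢(ℂ, ℂ)) :=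
  Submodule.span ℂ {ψ | ∃ (l : ℕ) (f : 𝓢(ℂ, ℂ)), ψ = fun t : ℝ => (t : ℂ) ^ l • f}

lemma polyFam_const (f : 𝓢(ℂ, ℂ)) : (fun _ => f) ∈ polyFam :=
  Submodule.subset_span ⟨0, f, by simp⟩

lemma polyFam_clm (T : 𝓢(ℂ, ℂ) →L[ℂ] 𝓢(ℂ, ℂ)) {ψ : ℝ → 𝓢(ℂ, ℂ)} (hψ : ψ ∈ polyFam) :
    (fun t => T (ψ t)) ∈ polyFam := by
  induction hψ using Submodule.span_induction with
  | mem ψ h =>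
    obtain ⟨l, f, rfl⟩ := h
    exact Submodule.subset_span ⟨l, T f, by simp⟩
  | zero => simpa using! polyFam_const 0
  | add ψ χ _ _ h1 h2 => simpa using! Submodule.add_mem _ h1 h2
  | smul c ψ _ h => simpa using! Submodule.smul_mem _ c h

lemma polyFam_smul {ψ : ℝ → 𝓢(ℂ, ℂ)} (hψ : ψ ∈ polyFam) :
    (fun t : ℝ => (t : ℂ) • ψ t) ∈ polyFam := by
  induction hψ using Submodule.span_induction with
  | mem ψ h =>
    obtain ⟨l, f, rfl⟩ := h
    exact Submodule.subset_span ⟨l + 1, f, by ext t : 1; simp only [smul_smul, pow_succ']⟩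
  | zero => simpa using! polyFam_const 0
  | add ψ χ _ _ h1 h2 => simpa using! Submodule.add_mem _ h1 h2
  | smul c ψ _ h =>
    have := Submodule.smul_mem _ c h
    refine (congrArg (· ∈ polyFam) (funext fun t => ?_)).mp this
    simp only [Pi.smul_apply]
    rw [smul_comm]

lemma polyFam_oneAddBoxS {ψ : ℝ → 𝓢(ℂ, ℂ)} (hψ : ψ ∈ polyFam) :
    (fun t => oneAddBoxS p t (ψ t)) ∈ polyFam := by
  have h1 : (fun t => opZS p t (ψ t)) ∈ polyFam := by
    simp only [opZS, dzS_eq]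
    exact Submodule.sub_mem _ (polyFam_clm _ hψ)
      (polyFam_smul (polyFam_clm (smulLeftCLM ℂ (dz (toC p))) hψ))
  have h2 : (fun t => opZbarS p t (opZS p t (ψ t))) ∈ polyFam := by
    simp only [opZbarS, dzbarS_eq]
    exact Submodule.add_mem _ (polyFam_clm _ h1)
      (polyFam_smul (polyFam_clm (smulLeftCLM ℂ (dzbar (toC p))) h1))
  exact Submodule.sub_mem _ hψ h2

lemma contDiff_toL2_polyFam {ψ : ℝ → 𝓢(ℂ, ℂ)} (hψ : ψ ∈ polyFam) :
    ContDiff ℝ ∞ fun t => toL2 (ψ t) := by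
  induction hψ using Submodule.span_induction with
  | mem ψ h =>
    obtain ⟨l, f, rfl⟩ := h
    simp only [map_smul]
    exact (Complex.ofRealCLM.contDiff.pow l).smul contDiff_const
  | zero => simpa using contDiff_const
  | add ψ χ _ _ h1 h2 => simpa using h1.add h2
  | smul c ψ _ h => simpa using h.const_smul c

lemma iterate_oneAddBoxS_mem_polyFam (f : 𝓢(ℂ, ℂ)) (L : ℕ) :
    (fun t => (oneAddBoxS p t)^[L] f) ∈ polyFam := by
  induction L with
  | zero => exact polyFam_const f
  | succ L ih =>
    simp only [Function.iterate_succ_apply']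
    exact polyFam_oneAddBoxS ih

lemma boxResolvent_pow_iterate (hp : toC p ∈ Sym η d) (t : ℝ) (f : 𝓢(ℂ, ℂ)) (L : ℕ) :
    (boxResolvent p t ^ L) (toL2 ((oneAddBoxS p t)^[L] f)) = toL2 f := by
  induction L with
  | zero => rfl
  | succ L ih =>
    rw [Function.iterate_succ_apply', pow_succ, mul_apply_eq_comp, boxResolvent_oneAddBoxS hp, ih]

lemma heatPow_neg_eq {t s : ℝ} (hs : 0 < s) (L : ℕ) :
    heatPow (-(L : ℤ)) s (boxResolvent p t) = heatOp p t s * boxResolvent p t ^ L := by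
  have e0 : heatOp p t s = heatPow 0 s (boxResolvent p t) := expOfResolvent_eq_heatPow _ _
  induction L with
  | zero => simp [e0]
  | succ L ih =>
    have := heatPow_succ_mul (G := graphZ p t) (j := -((L + 1 : ℕ) : ℤ)) (s := s) (Or.inl hs)
    rw [compress_graphZ] at this
    rw [← this, show -((L + 1 : ℕ) : ℤ) + 1 = -(L : ℤ) by push_cast; ring, ih, pow_succ, mul_assoc]

variable {E F : Type} [NormedAddCommGroup E] [NormedSpace ℝ E] [NormedAddCommGroup F]
  [NormedSpace ℝ F]

/-- The unit interval, as the range of the time variable. -/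
abbrev Time : Type := Set.Icc (0 : ℝ) 1

/-- Application of a linear map to the values of a continuous function. -/
noncomputable def pointwiseL : (E →L[ℝ] F) →L[ℝ] C(Time, E) →L[ℝ] C(Time, F) :=
  LinearMap.mkContinuous₂
    (LinearMap.mk₂ ℝ (fun (l : E →L[ℝ] F) (f : C(Time, E)) =>
        (⟨fun x => l (f x), l.continuous.comp f.continuous⟩ : C(Time, F)))
      (fun l l' f => by ext x; rfl) (fun c l f => by ext x; rfl)
      (fun l f f' => by ext x; simp) (fun c l f => by ext x; simp)) 1 fun l f => by
    rw [one_mul]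
    refine (ContinuousMap.norm_le _ (by positivity)).2 fun x => ?_
    exact (l.le_opNorm _).trans (by gcongr; exact f.norm_coe_le_norm x)

lemma pointwiseL_apply (l : E →L[ℝ] F) (f : C(Time, E)) (x : Time) :
    pointwiseL l f x = l (f x) := rfl

/-- One term in the expansion of the integrals against the heat kernel. -/
lemma exists_path_term {ρ : ℕ} {M : ℕ} {j : ℤ} {B : ℝ → C(Time, L2 →L[ℂ] L2)}
    (hη : 0 < η) (hB1 : ContDiff ℝ ρ B) (hB2 : ∀ τ (s : Time),
      heatPow j s (boxResolvent p τ) * mulOp (muB η) ^ M = B τ s)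
    {ψ : ℝ → L2} (hψ : ContDiff ℝ ρ ψ) {k n : ℤ} {q σ : ℂ → ℂ} (hq : q ∈ Sym η k)
    (hk : k ≤ -(M : ℤ)) (hσ : σ ∈ Sym Real.pi n) (hn : n ≤ -(ρ + 4)) (l : ℕ) :
    ∃ G : ℝ × ℂ → C(Time, ℂ), ContDiff ℝ ρ G ∧ ∀ (t : ℝ) (s : Time) (g : 𝓢(ℂ, ℂ)),
      Integrable (fun w => g w * G (t, w) s) ∧
      ∫ w, g w * G (t, w) s = ⟪ψ t, (t : ℂ) ^ l •
        heatPow j s (boxResolvent p t) (toL2 (symS q (multS σ g)))⟫_ℂ := by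
  obtain ⟨b, hb⟩ := exists_bcf_div hη hq hk
  have h2 := memLp_of_mem_Sym hσ (by omega)
  have g2 : PolyGrowth ρ 0 fun z => mulOp b (multKer h2 z) :=
    (polyGrowth_multKer ρ hσ hn h2).clm_comp ((mulOp b).restrictScalars ℝ)
  refine ⟨fun x => (x.1 : ℂ) ^ l • pointwiseL ((innerL (ψ x.1)).comp
    (applyL.flip (mulOp b (multKer h2 x.2)))) (B x.1), ?_, fun t s g => ?_⟩
  · have c1 : ContDiff ℝ ρ fun x : ℝ × ℂ => (x.1 : ℂ) ^ l :=
      (Complex.ofRealCLM.contDiff.comp contDiff_fst).pow l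
    have c2 : ContDiff ℝ ρ fun x : ℝ × ℂ => innerL (ψ x.1) :=
      innerL.contDiff.comp (hψ.comp contDiff_fst)
    have c3 : ContDiff ℝ ρ fun x : ℝ × ℂ => applyL.flip (mulOp b (multKer h2 x.2)) := by
      have c0 : ContDiff ℝ ρ (applyL.flip) := ContinuousLinearMap.contDiff _
      exact c0.comp (g2.contDiff.comp contDiff_snd)
    have c4 : ContDiff ℝ ρ fun x : ℝ × ℂ => B x.1 := hB1.comp contDiff_fst
    have c5 : ContDiff ℝ ρ (pointwiseL (E := L2 →L[ℂ] L2) (F := ℂ)) :=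
      ContinuousLinearMap.contDiff _
    exact c1.smul ((c5.comp (c2.clm_comp c3)).clm_apply c4)
  · have e : ∀ w, g w * (((t : ℂ) ^ l • pointwiseL ((innerL (ψ t)).comp
        (applyL.flip (mulOp b (multKer h2 w)))) (B t) : C(Time, ℂ)) s)
        = (t : ℂ) ^ l * (g w * ⟪ψ t, B t s (mulOp b (multKer h2 w))⟫_ℂ) := fun w => by
      rw [ContinuousMap.smul_apply, pointwiseL_apply, smul_eq_mul]
      change g w * ((t : ℂ) ^ l * ⟪ψ t, B t s (mulOp b (multKer h2 w))⟫_ℂ) = _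
      ring
    have hpg : PolyGrowth 0 0 fun w => ⟪ψ t, B t s (mulOp b (multKer h2 w))⟫_ℂ := by
      have g3 : PolyGrowth 0 0 fun z => B t s (mulOp b (multKer h2 z)) :=
        (polyGrowth_multKer 0 hσ (by push_cast; omega) h2).clm_comp
          ((B t s ∘L mulOp b).restrictScalars ℝ)
      exact PolyGrowth.bilin innerL (PolyGrowth.const 0 (ψ t)) g3
    refine ⟨?_, ?_⟩
    · simp only [e]
      exact (hpg.integrable_schwartz_mul g).const_mul _
    · simp only [e]
      rw [integral_const_mul, inner_smul_right]
      congr 1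
      have e2 : ∀ v : L2, ⟪ψ t, B t s (mulOp b v)⟫_ℂ
          = ⟪ContinuousLinearMap.adjoint (mulOp b)
            (ContinuousLinearMap.adjoint (B t s) (ψ t)), v⟫_ℂ :=
        fun v => by
          rw [ContinuousLinearMap.adjoint_inner_left, ContinuousLinearMap.adjoint_inner_left]
      simp only [e2]
      rw [← inner_multS hσ h2, ← e2, toL2_symS_eq hq hb, ← hB2 t s, mul_apply_eq_comp]

lemma exists_path_list {ρ : ℕ} {j : ℤ} {ψ : ℝ → L2} (L : List RepTerm)
    (h : ∀ x ∈ L, ∃ G : ℝ × ℂ → C(Time, ℂ), ContDiff ℝ ρ G ∧ ∀ (t : ℝ) (s : Time) (g : 𝓢(ℂ, ℂ)),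
      Integrable (fun w => g w * G (t, w) s) ∧
      ∫ w, g w * G (t, w) s = ⟪ψ t, x.eval p t j s g⟫_ℂ) :
    ∃ G : ℝ × ℂ → C(Time, ℂ), ContDiff ℝ ρ G ∧ ∀ (t : ℝ) (s : Time) (g : 𝓢(ℂ, ℂ)),
      Integrable (fun w => g w * G (t, w) s) ∧
      ∫ w, g w * G (t, w) s = ⟪ψ t, (L.map (RepTerm.eval p t j s g)).sum⟫_ℂ := by
  induction L with
  | nil => exact ⟨fun _ => 0, contDiff_const, fun t s g => ⟨by simp, by simp⟩⟩
  | cons x L ih =>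
    obtain ⟨G, hG1, hG2⟩ := h x List.mem_cons_self
    obtain ⟨G', hG1', hG2'⟩ := ih fun y hy => h y (List.mem_cons_of_mem _ hy)
    have e : ∀ (t : ℝ) (s : Time) (g : 𝓢(ℂ, ℂ)) w, g w * (G (t, w) + G' (t, w)) s
        = g w * G (t, w) s + g w * G' (t, w) s := fun t s g w => by
      rw [ContinuousMap.add_apply, mul_add]
    refine ⟨fun x => G x + G' x, hG1.add hG1', fun t s g => ?_⟩
    obtain ⟨i1, e1⟩ := hG2 t s g
    obtain ⟨i2, e2⟩ := hG2' t s g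
    simp only [e]
    exact ⟨i1.add i2, by rw [integral_add i1 i2, e1, e2, List.map_cons, List.sum_cons,
      inner_add_right]⟩

variable {K : ℝ → ℝ → ℂ → ℂ → ℂ}

lemma hasTemperateGrowth_affine {V W : Type} [NormedAddCommGroup V] [NormedSpace ℝ V]
    [NormedAddCommGroup W] [NormedSpace ℝ W] (L : V →L[ℝ] W) (c : W) :
    Function.HasTemperateGrowth fun x => c + L x :=
  (Function.HasTemperateGrowth.const c).add L.hasTemperateGrowth

lemma IsKernelFamily.continuous_integral_left (hK : IsKernelFamily p K) {t s : ℝ} (hs : 0 < s)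
    (f : 𝓢(ℂ, ℂ)) : Continuous fun w => ∫ ξ, f ξ * K t s ξ w := by
  refine continuous_integral_temperate f (Y := fun x : ℂ × ℂ => K t s x.2 x.1) ?_
  have h1 := hasTemperateGrowth_affine (ContinuousLinearMap.inr ℝ ℝ (ℂ × ℂ) ∘L
    (ContinuousLinearMap.snd ℝ ℂ ℂ).prod (ContinuousLinearMap.fst ℝ ℂ ℂ)) ((t, 0) : ℝ × ℂ × ℂ)
  have e : (fun x : ℂ × ℂ => K t s x.2 x.1) = (fun q : ℝ × ℂ × ℂ => K q.1 s q.2.1 q.2.2) ∘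
      fun x => ((t, 0) : ℝ × ℂ × ℂ) + (ContinuousLinearMap.inr ℝ ℝ (ℂ × ℂ) ∘L
        (ContinuousLinearMap.snd ℝ ℂ ℂ).prod (ContinuousLinearMap.fst ℝ ℂ ℂ)) x := by
    ext x; simp
  rw [e]
  exact (hK.temperate s hs).comp h1

/-- The case of finite differentiability. The operator `1 + □` is moved to the Schwartz function so
often that the Chebyshev series of the remaining operator `(1 + □)⁻ᵐ⁻¹ exp (-s □)` converges up to
`s = 0`. -/
lemma exists_path_finite (hpoly : IsRealPolynomial p) (hK : IsKernelFamily p K) (f : 𝓢(ℂ, ℂ))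
    (ρ : ℕ) : ∃ G : ℝ × ℂ → C(Time, ℂ), ContDiff ℝ ρ G ∧
      (∀ t w (s : Time), 0 < (s : ℝ) → G (t, w) s = ∫ ξ, f ξ * K t s ξ w) ∧
      ∀ t w, G (t, w) 0 = f w := by
  obtain ⟨η, d, hη, h1, h2, hp⟩ := exists_params hpoly
  set r := ρ + 4 with hr
  obtain ⟨M, hM⟩ := exists_weighted_box hη hp h1 h2 ρ
  obtain ⟨-, j₀, hj₀⟩ := hM 0
  set N := d * r + M with hN
  set m := r + j₀.natAbs with hm
  obtain ⟨L, hL, eL⟩ := exists_rep hp r (wt_inv_pow_mem_Sym (η := η) N)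
  -- enough powers of `1 + □` are moved to the Schwartz function
  set ψ : ℝ → 𝓢(ℂ, ℂ) := fun t => (oneAddBoxS p t)^[m + 1] (conjS f) with hψ
  have hψc : ContDiff ℝ ρ fun t => toL2 (ψ t) :=
    (contDiff_toL2_polyFam (iterate_oneAddBoxS_mem_polyFam (p := p) (conjS f) (m + 1))).of_le
      (by exact_mod_cast le_top)
  have adm : ∀ s : Time, Admissible (-((m + 1 : ℕ) : ℤ) + r) s := fun s =>
    Or.inr ⟨by push_cast; omega, s.2.1⟩
  obtain ⟨G, hG1, hG2⟩ := exists_path_list (p := p) (ρ := ρ) (j := -((m + 1 : ℕ) : ℤ))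
    (ψ := fun t => toL2 (ψ t)) L fun x hx => by
      obtain ⟨hj, hq, hσ⟩ := hL x hx
      obtain ⟨B, hB1, hB2⟩ := hj₀ (-((m + 1 : ℕ) : ℤ) + x.j) (by push_cast; omega)
      exact exists_path_term hη hB1 (fun τ s => by simpa using hB2 τ s) hψc hq
        (by rw [hN]; push_cast; nlinarith) hσ (by rw [hr]; push_cast; omega) x.l
  have key : ∀ (t : ℝ) (s : Time) (g : 𝓢(ℂ, ℂ)), ∫ w, g w * ((wt η w : ℂ) ^ N * G (t, w) s)
      = ⟪heatPow (-((m + 1 : ℕ) : ℤ)) s (boxResolvent p t) (toL2 (ψ t)), toL2 g⟫_ℂ := by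
    intro t s g
    have e : ∀ w, g w * ((wt η w : ℂ) ^ N * G (t, w) s)
        = symS (fun z => (wt η z : ℂ) ^ N) g w * G (t, w) s := fun w => by
      rw [symS_apply (wt_pow_mem_Sym N)]; ring
    simp only [e]
    rw [(hG2 t s _).2, ← eL t _ s _ (adm s), symS_wt_inv_symS_wt, inner_heatPow_left]
  have hcont : ∀ t (s : Time), Continuous fun w => (wt η w : ℂ) ^ N * G (t, w) s := fun t s => by
    refine (contDiff_of_mem_Sym (wt_pow_mem_Sym (η := η) N)).continuous.mul ?_
    exact (continuous_eval_const s).comp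
      (hG1.continuous.comp (by fun_prop : Continuous fun w : ℂ => (t, w)))
  refine ⟨fun x => (wt η x.2 : ℂ) ^ N • G x, ?_, fun t w s hs => ?_, fun t w => ?_⟩
  · have c : ContDiff ℝ ρ fun x : ℝ × ℂ => (wt η x.2 : ℂ) ^ N :=
      ((contDiff_of_mem_Sym (wt_pow_mem_Sym (η := η) N)).of_le (by exact_mod_cast le_top)).comp
      (contDiff_snd (𝕜 := ℝ) (E := ℝ) (F := ℂ) (n := ρ))
    exact c.smul hG1
  · refine congrFun (eq_of_integral_schwartz_mul (f := fun w => (wt η w : ℂ) ^ N * G (t, w) s)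
      (hcont t s) (hK.continuous_integral_left hs f) fun g hg => ?_) w
    rw [key, heatPow_neg_eq hs, mul_apply_eq_comp, hψ]
    simp only
    rw [boxResolvent_pow_iterate hp, ← inner_conj_symm, (hK.hasKernel t s hs).eq_integral,
      ← integral_conj]
    refine integral_congr_ae (Eventually.of_forall fun w => ?_)
    simp only
    rw [map_mul, Complex.conj_conj, ← integral_conj]
    congr 1
    refine integral_congr_ae (Eventually.of_forall fun ξ => ?_)
    simp only
    rw [map_mul, conjS_apply, Complex.conj_conj, ← hK.conj_symm hs]
  · refine congrFun (eq_of_integral_schwartz_mul (f := fun w => (wt η w : ℂ) ^ N * G (t, w) 0)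
      (hcont t 0) f.continuous fun g hg => ?_) w
    have e0 : heatPow (-((m + 1 : ℕ) : ℤ)) ((0 : Time) : ℝ) (boxResolvent p t)
        = boxResolvent p t ^ (m + 1) := heatPow_neg_zero (G := graphZ p t) m
    rw [key, e0, hψ]
    simp only
    rw [boxResolvent_pow_iterate hp, inner_toL2]
    simp only [conjS_apply, Complex.conj_conj]

/-- The integrals of the heat kernel against a Schwartz function are smooth in the other
variables, uniformly as time tends to zero, and tend to the function. -/
theorem exists_path (hpoly : IsRealPolynomial p) (hK : IsKernelFamily p K) (f : 𝓢(ℂ, ℂ)) :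
    ∃ G : ℝ × ℂ → C(Time, ℂ), ContDiff ℝ ∞ G ∧
      (∀ t w (s : Time), 0 < (s : ℝ) → G (t, w) s = ∫ ξ, f ξ * K t s ξ w) ∧
      ∀ t w, G (t, w) 0 = f w := by
  choose G h1 h2 h3 using exists_path_finite hpoly hK f
  refine ⟨G 0, contDiff_infty.2 fun ρ => ?_, h2 0, h3 0⟩
  have e : G 0 = G ρ := by
    ext ⟨t, w⟩ s
    rcases s.2.1.eq_or_lt with h | h
    · obtain rfl : s = 0 := Subtype.ext h.symm
      rw [h3, h3]
    · rw [h2 0 t w s h, h2 ρ t w s h]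
  rw [e]; exact h1 ρ

end Path

/-! ### The twist is a polynomial -/

section Twist

variable {p : ℂ → ℝ}

lemma dz_zero_fun : dz (0 : ℂ → ℂ) = 0 := by
  ext z
  exact (hasWirt_const (z := z) 0).dz

lemma dz_iterate_mem_Sym {η : ℝ} {k : ℤ} {q : ℂ → ℂ} (hq : q ∈ Sym η k) (j : ℕ) :
    dz^[j] q ∈ Sym η k := by
  induction j with
  | zero => exact hq
  | succ j ih => rw [Function.iterate_succ_apply']; exact (dz_dzbar_mem_Sym ih).1

lemma dz_add_of_mem {η : ℝ} {k l : ℤ} {q r : ℂ → ℂ} (hq : q ∈ Sym η k) (hr : r ∈ Sym η l) :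
    dz (q + r) = dz q + dz r := by
  ext z
  exact ((hasWirt_of_mem_Sym hq z).add (hasWirt_of_mem_Sym hr z)).dz

lemma dz_smul_of_mem {η : ℝ} {k : ℤ} {q : ℂ → ℂ} (hq : q ∈ Sym η k) (c : ℂ) :
    dz (c • q) = c • dz q := by
  ext z
  exact ((hasWirt_of_mem_Sym hq z).const_mul c).dz

/-- For `η = 0` the symbols are polynomials, so that high derivatives vanish. -/
lemma exists_dz_iterate_eq_zero {k : ℤ} {q : ℂ → ℂ} (hq : q ∈ Sym 0 k) :
    ∃ N, ∀ j, N ≤ j → dz^[j] q = 0 := by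
  have hz : ∀ j, dz^[j] (0 : ℂ → ℂ) = 0 := fun j => by
    induction j with
    | zero => rfl
    | succ j ih => rw [Function.iterate_succ_apply', ih, dz_zero_fun]
  suffices h : ∃ N, dz^[N] q = 0 by
    obtain ⟨N, hN⟩ := h
    refine ⟨N, fun j hj => ?_⟩
    obtain ⟨m, rfl⟩ := Nat.exists_eq_add_of_le hj
    rw [add_comm, Function.iterate_add_apply, hN, hz]
  have hadd : ∀ (N : ℕ) {k : ℤ} {q r : ℂ → ℂ}, q ∈ Sym 0 k → r ∈ Sym 0 k →
      dz^[N] (q + r) = dz^[N] q + dz^[N] r := fun N => by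
    intro k q r hq hr
    induction N with
    | zero => rfl
    | succ N ih =>
      rw [Function.iterate_succ_apply', Function.iterate_succ_apply', Function.iterate_succ_apply',
        ih, dz_add_of_mem (dz_iterate_mem_Sym hq N) (dz_iterate_mem_Sym hr N)]
  have hsmul : ∀ (N : ℕ) {k : ℤ} {q : ℂ → ℂ} (c : ℂ), q ∈ Sym 0 k →
      dz^[N] (c • q) = c • dz^[N] q := fun N => by
    intro k q c hq
    induction N with
    | zero => rfl
    | succ N ih =>
      rw [Function.iterate_succ_apply', Function.iterate_succ_apply', ih,
        dz_smul_of_mem (dz_iterate_mem_Sym hq N)]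
  induction hq using Submodule.span_induction with
  | mem q h =>
    obtain ⟨a, b, c, -, rfl⟩ := h
    refine ⟨a + 1, ?_⟩
    have hd : ∀ a, dz (symMon 0 a b c) = (a : ℂ) • symMon 0 (a - 1) b c := fun a => by
      ext z
      rw [(hasWirt_symMon a b c z).dz]
      simp
    induction a with
    | zero =>
      rw [zero_add, Function.iterate_one, hd]; simp
    | succ a ih =>
      rw [Function.iterate_succ_apply, hd, Nat.add_sub_cancel,
        hsmul (a + 1) (k := max k ((a : ℤ) + b - 2 * c)) _ (symMon_mem (le_max_right _ _)), ih,
        smul_zero]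
  | zero => exact ⟨0, rfl⟩
  | add q r hq hr h1 h2 =>
    obtain ⟨N, hN⟩ := h1
    obtain ⟨M, hM⟩ := h2
    refine ⟨N + M, ?_⟩
    rw [hadd _ hq hr]
    nth_rw 1 [add_comm N M]
    rw [Function.iterate_add_apply, Function.iterate_add_apply, hN, hM, hz, hz, add_zero]
  | smul c q hq h =>
    obtain ⟨N, hN⟩ := h
    exact ⟨N, by rw [hsmul N c hq, hN, smul_zero]⟩

/-- The span of the products `a(w) b(z)` of polynomials, that is, the polynomials on `ℂ × ℂ`. -/
noncomputable def polyTensor : Submodule ℂ (ℂ × ℂ → ℂ) :=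
  Submodule.span ℂ {f | ∃ (k l : ℤ) (a b : ℂ → ℂ), a ∈ Sym 0 k ∧ b ∈ Sym 0 l ∧
    f = fun x => a x.1 * b x.2}

lemma tensor_mem {k l : ℤ} {a b : ℂ → ℂ} (ha : a ∈ Sym 0 k) (hb : b ∈ Sym 0 l) :
    (fun x : ℂ × ℂ => a x.1 * b x.2) ∈ polyTensor :=
  Submodule.subset_span ⟨k, l, a, b, ha, hb, rfl⟩

lemma mul_mem_polyTensor {f g : ℂ × ℂ → ℂ} (hf : f ∈ polyTensor) (hg : g ∈ polyTensor) :
    f * g ∈ polyTensor := by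
  induction hf using Submodule.span_induction with
  | mem f hf =>
    obtain ⟨k, l, a, b, ha, hb, rfl⟩ := hf
    induction hg using Submodule.span_induction with
    | mem g hg =>
      obtain ⟨k', l', a', b', ha', hb', rfl⟩ := hg
      have := tensor_mem (Sym_mul ha ha') (Sym_mul hb hb')
      convert this using 1
      ext x; simp only [Pi.mul_apply]; ring
    | zero => rw [mul_zero]; exact Submodule.zero_mem _
    | add g g' _ _ h1 h2 => rw [mul_add]; exact Submodule.add_mem _ h1 h2
    | smul c g _ h => rw [mul_smul_comm]; exact Submodule.smul_mem _ _ h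
  | zero => rw [zero_mul]; exact Submodule.zero_mem _
  | add f f' _ _ h1 h2 => rw [add_mul]; exact Submodule.add_mem _ h1 h2
  | smul c f _ h => rw [smul_mul_assoc]; exact Submodule.smul_mem _ _ h

lemma conj_mem_polyTensor {f : ℂ × ℂ → ℂ} (hf : f ∈ polyTensor) :
    (fun x => conj (f x)) ∈ polyTensor := by
  induction hf using Submodule.span_induction with
  | mem f hf =>
    obtain ⟨k, l, a, b, ha, hb, rfl⟩ := hf
    simpa only [map_mul] using tensor_mem (conj_comp_mem_Sym ha) (conj_comp_mem_Sym hb)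
  | zero => simp only [Pi.zero_apply, map_zero]; exact Submodule.zero_mem polyTensor
  | add f g _ _ h1 h2 => simpa using! Submodule.add_mem _ h1 h2
  | smul c f _ h => simpa using! Submodule.smul_mem _ (conj c) h

lemma hasTemperateGrowth_of_mem_polyTensor {f : ℂ × ℂ → ℂ} (hf : f ∈ polyTensor) :
    f.HasTemperateGrowth := by
  induction hf using Submodule.span_induction with
  | mem f hf =>
    obtain ⟨k, l, a, b, ha, hb, rfl⟩ := hf
    exact ((hasTemperateGrowth_of_mem_Sym ha).comp
      (ContinuousLinearMap.fst ℝ ℂ ℂ).hasTemperateGrowth).mul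
      ((hasTemperateGrowth_of_mem_Sym hb).comp (ContinuousLinearMap.snd ℝ ℂ ℂ).hasTemperateGrowth)
  | zero => exact Function.HasTemperateGrowth.zero
  | add f g _ _ h1 h2 => exact h1.add h2
  | smul c f _ h => exact (Function.HasTemperateGrowth.const c).mul h

/-- The twist is a polynomial in both points, since the Taylor series of `p` terminates. -/
lemma twist_mem_polyTensor (hpoly : IsRealPolynomial p) :
    (fun x : ℂ × ℂ => (twist p x.1 x.2 : ℂ)) ∈ polyTensor := by
  obtain ⟨d, hd⟩ := exists_mem_Sym_of_isRealPolynomial hpoly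
  obtain ⟨N, hN⟩ := exists_dz_iterate_eq_zero (hd 0)
  set S : ℂ × ℂ → ℂ := ∑ j ∈ Finset.range N,
    (fun x : ℂ × ℂ => taylorCoeff p (j + 1) 0 x.2) * (fun x : ℂ × ℂ => x.1 - x.2) ^ (j + 1) with hS
  have hsub : (fun x : ℂ × ℂ => x.1 - x.2) ∈ polyTensor := by
    have h1 := tensor_mem (id_mem_Sym (η := 0)) one_mem_Sym
    have h2 := tensor_mem (one_mem_Sym (η := 0)) id_mem_Sym
    convert Submodule.sub_mem _ h1 h2 using 1
    ext x; simp
  have hone : (1 : ℂ × ℂ → ℂ) ∈ polyTensor := by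
    convert tensor_mem (one_mem_Sym (η := 0)) one_mem_Sym using 1
    ext x; simp
  have hpow : ∀ j : ℕ, (fun x : ℂ × ℂ => x.1 - x.2) ^ j ∈ polyTensor := fun j => by
    induction j with
    | zero => rwa [pow_zero]
    | succ j ih => rw [pow_succ]; exact mul_mem_polyTensor ih hsub
  have hSm : S ∈ polyTensor := by
    refine Submodule.sum_mem _ fun j _ => mul_mem_polyTensor ?_ (hpow _)
    have h := tensor_mem (one_mem_Sym (η := 0))
      (Submodule.smul_mem _ (1 / (((j + 1)! : ℂ) * (0 ! : ℂ))) (dz_iterate_mem_Sym (hd 0) (j + 1)))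
    convert h using 1
    ext x
    simp [taylorCoeff]
  have hSx : ∀ x : ℂ × ℂ, ∑' j : ℕ, taylorCoeff p (j + 1) 0 x.2 * (x.1 - x.2) ^ (j + 1) = S x := by
    intro x
    rw [tsum_eq_sum (s := Finset.range N)]
    · rw [hS, Finset.sum_apply]; rfl
    · intro j hj
      have : N ≤ j + 1 := by have := Finset.mem_range.not.1 hj; omega
      rw [taylorCoeff, Function.iterate_zero, id_eq, hN _ this]
      simp
  convert Submodule.smul_mem _ Complex.I (Submodule.sub_mem _ hSm (conj_mem_polyTensor hSm)) using 1
  ext x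
  rw [twist, hSx, Pi.smul_apply, Pi.sub_apply, smul_eq_mul, Complex.sub_conj]
  push_cast
  linear_combination (-2 * ((S x).im : ℂ)) * Complex.I_mul_I

lemma twist_self (w : ℂ) : twist p w w = 0 := by simp [twist]

lemma twistError_self (w z : ℂ) : twistError p w w z = 0 := by simp [twistError]

end Twist

/-! ### The operators `X^β` and `U^α` under the integral sign -/

section Words

open SchwartzMap

variable {p : ℂ → ℝ}

lemma hasTemperateGrowth_dp (hpoly : IsRealPolynomial p) :
    (dz (toC p)).HasTemperateGrowth ∧ (dzbar (toC p)).HasTemperateGrowth := by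
  obtain ⟨d, hd⟩ := exists_mem_Sym_of_isRealPolynomial hpoly
  exact ⟨hasTemperateGrowth_of_mem_Sym (dz_dzbar_mem_Sym (hd 0)).1,
    hasTemperateGrowth_of_mem_Sym (dz_dzbar_mem_Sym (hd 0)).2⟩

lemma fderiv_slice_left {Y : ℂ × ℂ → ℂ} (hY : Y.HasTemperateGrowth) (x : ℂ × ℂ) (v : ℂ) :
    fderiv ℝ (fun z => Y (z, x.2)) x.1 v = fderiv ℝ Y x (v, 0) := by
  have h1 : HasFDerivAt Y (fderiv ℝ Y x) (x.1, x.2) :=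
    (hY.1.differentiable (by simp) _).hasFDerivAt
  have h2 : HasFDerivAt (fun z : ℂ => (z, x.2)) (ContinuousLinearMap.inl ℝ ℂ ℂ) x.1 :=
    hasFDerivAt_prodMk_left x.1 x.2
  have h := (h1.comp x.1 h2).fderiv
  exact DFunLike.congr_fun h v

lemma fderiv_slice_right {Y : ℂ × ℂ → ℂ} (hY : Y.HasTemperateGrowth) (x : ℂ × ℂ) (v : ℂ) :
    fderiv ℝ (fun w => Y (x.1, w)) x.2 v = fderiv ℝ Y x (0, v) := by
  have h1 : HasFDerivAt Y (fderiv ℝ Y x) (x.1, x.2) :=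
    (hY.1.differentiable (by simp) _).hasFDerivAt
  have h2 : HasFDerivAt (fun w : ℂ => (x.1, w)) (ContinuousLinearMap.inr ℝ ℂ ℂ) x.2 :=
    hasFDerivAt_prodMk_right x.1 x.2
  have h := (h1.comp x.2 h2).fderiv
  exact DFunLike.congr_fun h v

lemma hasTemperateGrowth_comp_fst {q : ℂ → ℂ} (hq : q.HasTemperateGrowth) :
    Function.HasTemperateGrowth fun x : ℂ × ℂ => q x.1 :=
  hq.comp (ContinuousLinearMap.fst ℝ ℂ ℂ).hasTemperateGrowth

lemma hasTemperateGrowth_comp_snd {q : ℂ → ℂ} (hq : q.HasTemperateGrowth) :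
    Function.HasTemperateGrowth fun x : ℂ × ℂ => q x.2 :=
  hq.comp (ContinuousLinearMap.snd ℝ ℂ ℂ).hasTemperateGrowth

lemma hasTemperateGrowth_slice_left {Y : ℂ × ℂ → ℂ} (hY : Y.HasTemperateGrowth) (w : ℂ) :
    Function.HasTemperateGrowth fun z => Y (z, w) := by
  have h := hasTemperateGrowth_affine (ContinuousLinearMap.inl ℝ ℂ ℂ) ((0, w) : ℂ × ℂ)
  have e : (fun z => Y (z, w)) =
      Y ∘ fun z => ((0, w) : ℂ × ℂ) + ContinuousLinearMap.inl ℝ ℂ ℂ z := by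
    ext z; simp
  rw [e]
  exact hY.comp h

lemma hasTemperateGrowth_const_mul {V : Type} [NormedAddCommGroup V] [NormedSpace ℝ V] {Y : V → ℂ}
    (hY : Y.HasTemperateGrowth) (c : ℂ) : Function.HasTemperateGrowth fun x => c * Y x :=
  (Function.HasTemperateGrowth.const c).mul hY

lemma hasTemperateGrowth_X (hpoly : IsRealPolynomial p) (τ : ℝ) (L : Letter) {Y : ℂ × ℂ → ℂ}
    (hY : Y.HasTemperateGrowth) :
    Function.HasTemperateGrowth fun x : ℂ × ℂ => L.X p τ (fun z => Y (z, x.2)) x.1 := by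
  obtain ⟨h1, h2⟩ := hasTemperateGrowth_dp hpoly
  have d1 := hasTemperateGrowth_fderiv_apply hY (1, 0)
  have d2 := hasTemperateGrowth_fderiv_apply hY (Complex.I, 0)
  cases L with
  | Zbar =>
    simp only [Letter.X, opZbar, dzbar, fderiv_slice_left hY]
    exact (hasTemperateGrowth_const_mul (d1.add (hasTemperateGrowth_const_mul d2 _)) _).add
      ((hasTemperateGrowth_const_mul (hasTemperateGrowth_comp_fst h2) _).mul hY)
  | Z =>
    simp only [Letter.X, opZ, dz, fderiv_slice_left hY]
    exact (hasTemperateGrowth_const_mul (d1.sub (hasTemperateGrowth_const_mul d2 _)) _).sub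
      ((hasTemperateGrowth_const_mul (hasTemperateGrowth_comp_fst h1) _).mul hY)

lemma hasTemperateGrowth_U (hpoly : IsRealPolynomial p) (τ : ℝ) (L : Letter) {Y : ℂ × ℂ → ℂ}
    (hY : Y.HasTemperateGrowth) :
    Function.HasTemperateGrowth fun x : ℂ × ℂ => L.U p τ (fun w => Y (x.1, w)) x.2 := by
  obtain ⟨h1, h2⟩ := hasTemperateGrowth_dp hpoly
  have d1 := hasTemperateGrowth_fderiv_apply hY (0, 1)
  have d2 := hasTemperateGrowth_fderiv_apply hY (0, Complex.I)
  cases L with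
  | Zbar =>
    simp only [Letter.U, opWbar, dzbar, fderiv_slice_right hY]
    exact (hasTemperateGrowth_const_mul (d1.add (hasTemperateGrowth_const_mul d2 _)) _).sub
      ((hasTemperateGrowth_const_mul (hasTemperateGrowth_comp_snd h2) _).mul hY)
  | Z =>
    simp only [Letter.U, opW, dz, fderiv_slice_right hY]
    exact (hasTemperateGrowth_const_mul (d1.sub (hasTemperateGrowth_const_mul d2 _)) _).add
      ((hasTemperateGrowth_const_mul (hasTemperateGrowth_comp_snd h1) _).mul hY)

lemma hasTemperateGrowth_opX (hpoly : IsRealPolynomial p) (τ : ℝ) (β : List Letter) {Y : ℂ × ℂ → ℂ}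
    (hY : Y.HasTemperateGrowth) :
    Function.HasTemperateGrowth fun x : ℂ × ℂ => opX p τ β (fun z => Y (z, x.2)) x.1 := by
  induction β with
  | nil => exact hY
  | cons L β ih => exact hasTemperateGrowth_X hpoly τ L ih

lemma hasTemperateGrowth_swap {Y : ℂ × ℂ → ℂ} (hY : Y.HasTemperateGrowth) :
    Function.HasTemperateGrowth fun x : ℂ × ℂ => Y (x.2, x.1) :=
  hY.comp ((ContinuousLinearMap.snd ℝ ℂ ℂ).prod (ContinuousLinearMap.fst ℝ ℂ ℂ)).hasTemperateGrowth

lemma integrable_mul_slice (f : 𝓢(ℂ, ℂ)) {Y : ℂ × ℂ → ℂ} (hY : Y.HasTemperateGrowth) (w : ℂ) :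
    Integrable fun ξ => f ξ * Y (ξ, w) :=
  integrable_mul_temperate f (hasTemperateGrowth_swap hY) w

lemma fderiv_integral_slice (f : 𝓢(ℂ, ℂ)) {Y : ℂ × ℂ → ℂ} (hY : Y.HasTemperateGrowth) (w v : ℂ) :
    fderiv ℝ (fun w => ∫ ξ, f ξ * Y (ξ, w)) w v = ∫ ξ, f ξ * fderiv ℝ Y (ξ, w) (0, v) := by
  have hs := hasTemperateGrowth_swap hY
  refine (fderiv_integral_temperate f hs w v).trans ?_
  refine integral_congr_ae (Eventually.of_forall fun ξ => ?_)
  simp only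
  rw [← fderiv_slice_right hY (ξ, w) v, ← fderiv_slice_left hs (w, ξ) v]

lemma integral_combination {f₁ f₂ f₃ : ℂ → ℂ} (h₁ : Integrable f₁) (h₂ : Integrable f₂)
    (h₃ : Integrable f₃) (a b c : ℂ) :
    ∫ z, (a * f₁ z + b * f₂ z + c * f₃ z) = a * (∫ z, f₁ z) + b * (∫ z, f₂ z) + c * ∫ z, f₃ z := by
  have h : Integrable fun z => a * f₁ z + b * f₂ z := (h₁.const_mul a).add (h₂.const_mul b)
  rw [integral_add h (h₃.const_mul c), integral_add (h₁.const_mul a) (h₂.const_mul b),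
    integral_const_mul, integral_const_mul, integral_const_mul]

/-- Differentiation under the integral sign, for the operators in the second variable. -/
lemma U_integral (τ : ℝ) (L : Letter) (f : 𝓢(ℂ, ℂ)) {Y : ℂ × ℂ → ℂ}
    (hY : Y.HasTemperateGrowth) (w : ℂ) :
    L.U p τ (fun w => ∫ ξ, f ξ * Y (ξ, w)) w
      = ∫ ξ, f ξ * L.U p τ (fun w => Y (ξ, w)) w := by
  have i1 := integrable_mul_slice f (hasTemperateGrowth_fderiv_apply hY (0, 1)) w
  have i2 := integrable_mul_slice f (hasTemperateGrowth_fderiv_apply hY (0, Complex.I)) w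
  have i3 := integrable_mul_slice f hY w
  have e : ∀ ξ v, fderiv ℝ (fun w => Y (ξ, w)) w v = fderiv ℝ Y (ξ, w) (0, v) := fun ξ v =>
    fderiv_slice_right hY (ξ, w) v
  cases L with
  | Zbar =>
    simp only [Letter.U, opWbar, dzbar, e, fderiv_integral_slice f hY]
    have e2 : ∀ ξ, f ξ * (1 / 2 * (fderiv ℝ Y (ξ, w) (0, 1)
        + Complex.I * fderiv ℝ Y (ξ, w) (0, Complex.I))
        - τ * (1 / 2 * (fderiv ℝ (toC p) w 1 + Complex.I * fderiv ℝ (toC p) w Complex.I))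
          * Y (ξ, w))
        = 1 / 2 * (f ξ * fderiv ℝ Y (ξ, w) (0, 1))
          + 1 / 2 * Complex.I * (f ξ * fderiv ℝ Y (ξ, w) (0, Complex.I))
          + -(τ * (1 / 2 * (fderiv ℝ (toC p) w 1 + Complex.I * fderiv ℝ (toC p) w Complex.I)))
            * (f ξ * Y (ξ, w)) := fun ξ => by ring
    simp only [e2]
    rw [integral_combination i1 i2 i3]
    ring
  | Z =>
    simp only [Letter.U, opW, dz, e, fderiv_integral_slice f hY]
    have e2 : ∀ ξ, f ξ * (1 / 2 * (fderiv ℝ Y (ξ, w) (0, 1)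
        - Complex.I * fderiv ℝ Y (ξ, w) (0, Complex.I))
        + τ * (1 / 2 * (fderiv ℝ (toC p) w 1 - Complex.I * fderiv ℝ (toC p) w Complex.I))
          * Y (ξ, w))
        = 1 / 2 * (f ξ * fderiv ℝ Y (ξ, w) (0, 1))
          + -(1 / 2 * Complex.I) * (f ξ * fderiv ℝ Y (ξ, w) (0, Complex.I))
          + τ * (1 / 2 * (fderiv ℝ (toC p) w 1 - Complex.I * fderiv ℝ (toC p) w Complex.I))
            * (f ξ * Y (ξ, w)) := fun ξ => by ring
    simp only [e2]
    rw [integral_combination i1 i2 i3]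
    ring

lemma opU_integral (hpoly : IsRealPolynomial p) (τ : ℝ) (α : List Letter) (f : 𝓢(ℂ, ℂ))
    {Y : ℂ × ℂ → ℂ} (hY : Y.HasTemperateGrowth) (w : ℂ) :
    Integrable (fun ξ => f ξ * opU p τ α (fun w => Y (ξ, w)) w) ∧
    ∫ ξ, f ξ * opU p τ α (fun w => Y (ξ, w)) w = opU p τ α (fun w => ∫ ξ, f ξ * Y (ξ, w)) w := by
  induction α generalizing Y with
  | nil => exact ⟨integrable_mul_slice f hY w, rfl⟩
  | cons L α ih =>
    obtain ⟨h1, h2⟩ := ih (hasTemperateGrowth_U hpoly τ L hY)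
    refine ⟨h1, h2.trans ?_⟩
    simp only [← U_integral τ L f hY]
    rfl

lemma integral_mul_dz_temperate (f : 𝓢(ℂ, ℂ)) {y : ℂ → ℂ} (hy : y.HasTemperateGrowth) (v : ℂ) :
    ∫ z, f z * fderiv ℝ y z v = -∫ z, fderiv ℝ f z v * y z := by
  have hi : ∀ (f : 𝓢(ℂ, ℂ)) {y : ℂ → ℂ}, y.HasTemperateGrowth → Integrable fun z => f z * y z :=
    fun f y hy => integrable_mul_slice f (hasTemperateGrowth_comp_fst hy) 0
  refine integral_mul_fderiv_eq_neg_fderiv_mul_of_integrable ?_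
    (hi f (hasTemperateGrowth_fderiv_apply hy v)) (hi f hy) (fun x _ => f.differentiableAt)
    fun x _ => hy.1.differentiable (by simp) x
  have := hi (LineDeriv.lineDerivOp v f) hy
  simpa only [lineDerivOp_apply_eq_fderiv] using this

/-- Integration by parts for one letter: `-U` is the bilinear adjoint of `X`. -/
lemma exists_schwartz_U (hpoly : IsRealPolynomial p) (τ : ℝ) (L : Letter) (f : 𝓢(ℂ, ℂ)) :
    ∃ g : 𝓢(ℂ, ℂ), (∀ z, g z = L.U p τ f z) ∧ ∀ y : ℂ → ℂ, y.HasTemperateGrowth →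
      ∫ z, f z * L.X p τ y z = -∫ z, g z * y z := by
  obtain ⟨h1, h2⟩ := hasTemperateGrowth_dp hpoly
  have hi : ∀ (f : 𝓢(ℂ, ℂ)) {y : ℂ → ℂ}, y.HasTemperateGrowth → Integrable fun z => f z * y z :=
    fun f y hy => integrable_mul_slice f (hasTemperateGrowth_comp_fst hy) 0
  have hi' : ∀ (v : ℂ) {y : ℂ → ℂ}, y.HasTemperateGrowth →
      Integrable fun z => fderiv ℝ f z v * y z := fun v y hy => by
    have := hi (LineDeriv.lineDerivOp v f) hy
    simpa only [lineDerivOp_apply_eq_fderiv] using this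
  cases L with
  | Zbar =>
    refine ⟨dzbarS f - (τ : ℂ) • smulLeftCLM ℂ (dzbar (toC p)) f, fun z => ?_, fun y hy => ?_⟩
    · rw [sub_apply, smul_apply, dzbarS_apply, smulLeftCLM_apply_apply h2, Letter.U, opWbar,
        smul_eq_mul, smul_eq_mul, mul_assoc]
    · have e1 : ∀ z, f z * Letter.X p τ .Zbar y z
          = 1 / 2 * (f z * fderiv ℝ y z 1) + 1 / 2 * Complex.I * (f z * fderiv ℝ y z Complex.I)
            + τ * (f z * (dzbar (toC p) z * y z)) := fun z => by
        simp only [Letter.X, opZbar, dzbar]; ring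
      have e2 : ∀ z, (dzbarS f - (τ : ℂ) • smulLeftCLM ℂ (dzbar (toC p)) f : 𝓢(ℂ, ℂ)) z * y z
          = 1 / 2 * (fderiv ℝ f z 1 * y z) + 1 / 2 * Complex.I * (fderiv ℝ f z Complex.I * y z)
            + -τ * (f z * (dzbar (toC p) z * y z)) := fun z => by
        rw [sub_apply, smul_apply, dzbarS_apply, smulLeftCLM_apply_apply h2, smul_eq_mul,
          smul_eq_mul]
        simp only [dzbar]; ring
      have a1 := hi f (hasTemperateGrowth_fderiv_apply hy 1)
      have a2 := hi f (hasTemperateGrowth_fderiv_apply hy Complex.I)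
      have a3 : Integrable fun z => f z * (dzbar (toC p) z * y z) := hi f (h2.mul hy)
      simp only [e1, e2]
      rw [integral_combination a1 a2 a3, integral_combination (hi' 1 hy) (hi' Complex.I hy) a3,
        integral_mul_dz_temperate f hy, integral_mul_dz_temperate f hy]
      ring
  | Z =>
    refine ⟨dzS f + (τ : ℂ) • smulLeftCLM ℂ (dz (toC p)) f, fun z => ?_, fun y hy => ?_⟩
    · rw [add_apply, smul_apply, dzS_apply, smulLeftCLM_apply_apply h1, Letter.U, opW,
        smul_eq_mul, smul_eq_mul, mul_assoc]
    · have e1 : ∀ z, f z * Letter.X p τ .Z y z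
          = 1 / 2 * (f z * fderiv ℝ y z 1) + -(1 / 2 * Complex.I) * (f z * fderiv ℝ y z Complex.I)
            + -τ * (f z * (dz (toC p) z * y z)) := fun z => by
        simp only [Letter.X, opZ, dz]; ring
      have e2 : ∀ z, (dzS f + (τ : ℂ) • smulLeftCLM ℂ (dz (toC p)) f : 𝓢(ℂ, ℂ)) z * y z
          = 1 / 2 * (fderiv ℝ f z 1 * y z) + -(1 / 2 * Complex.I) * (fderiv ℝ f z Complex.I * y z)
            + τ * (f z * (dz (toC p) z * y z)) := fun z => by
        rw [add_apply, smul_apply, dzS_apply, smulLeftCLM_apply_apply h1, smul_eq_mul,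
          smul_eq_mul]
        simp only [dz]; ring
      have a1 := hi f (hasTemperateGrowth_fderiv_apply hy 1)
      have a2 := hi f (hasTemperateGrowth_fderiv_apply hy Complex.I)
      have a3 : Integrable fun z => f z * (dz (toC p) z * y z) := hi f (h1.mul hy)
      simp only [e1, e2]
      rw [integral_combination a1 a2 a3, integral_combination (hi' 1 hy) (hi' Complex.I hy) a3,
        integral_mul_dz_temperate f hy, integral_mul_dz_temperate f hy]
      ring

/-- Integration by parts: `X^β` is moved to the Schwartz function. The resulting function `g` does not
depend on `Y` or on the parameter `w`. -/
lemma exists_schwartz_opU (hpoly : IsRealPolynomial p) (τ : ℝ) (β : List Letter) (f : 𝓢(ℂ, ℂ)) :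
    ∃ g : 𝓢(ℂ, ℂ), ∀ Y : ℂ × ℂ → ℂ, Y.HasTemperateGrowth → ∀ w,
      ∫ z, f z * opX p τ β (fun z => Y (z, w)) z = (-1) ^ β.length * ∫ z, g z * Y (z, w) := by
  induction β generalizing f with
  | nil => exact ⟨f, fun Y _ w => by simp [opX]⟩
  | cons L β ih =>
    obtain ⟨f', -, hf'⟩ := exists_schwartz_U hpoly τ L f
    obtain ⟨g, hg⟩ := ih f'
    refine ⟨g, fun Y hY w => ?_⟩
    have h := hf' _ (hasTemperateGrowth_slice_left (hasTemperateGrowth_opX hpoly τ β hY) w)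
    refine Eq.trans h ?_
    simp only
    rw [hg Y hY w, List.length_cons, pow_succ]
    ring

lemma opU_zero (τ : ℝ) (α : List Letter) : opU p τ α (fun _ => 0) = fun _ => 0 := by
  induction α with
  | nil => rfl
  | cons L α ih =>
    have : L.U p τ (fun _ => 0) = fun _ => 0 := by
      ext z
      cases L <;> simp [Letter.U, opWbar, opW, dz, dzbar]
    change opU p τ α (L.U p τ fun _ => 0) = _
    rw [this, ih]

/-- The operators act on families of functions with values in the continuous functions of time. -/
lemma exists_opU_path (hpoly : IsRealPolynomial p) (τ : ℝ) (α : List Letter) {G : ℂ → C(Time, ℂ)}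
    (hG : ContDiff ℝ ∞ G) : ∃ G' : ℂ → C(Time, ℂ), ∀ s : Time,
      opU p τ α (fun w => G w s) = fun w => G' w s := by
  obtain ⟨d, hd⟩ := exists_mem_Sym_of_isRealPolynomial hpoly
  have c1 := contDiff_of_mem_Sym (dz_dzbar_mem_Sym (hd 0)).1
  have c2 := contDiff_of_mem_Sym (dz_dzbar_mem_Sym (hd 0)).2
  induction α generalizing G with
  | nil => exact ⟨G, fun s => rfl⟩
  | cons L α ih =>
    have hf : ∀ v : ℂ, ContDiff ℝ ∞ fun w => fderiv ℝ G w v := fun v =>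
      (hG.fderiv_right (by simp)).clm_apply contDiff_const
    have he : ∀ (s : Time) (w v : ℂ), fderiv ℝ (fun w => G w s) w v = fderiv ℝ G w v s := by
      intro s w v
      have h := (ContinuousMap.evalCLM ℝ s : C(Time, ℂ) →L[ℝ] ℂ).hasFDerivAt.comp w
        (hG.differentiable (by simp) w).hasFDerivAt
      exact DFunLike.congr_fun h.fderiv v
    obtain ⟨G', hG', hG''⟩ : ∃ G' : ℂ → C(Time, ℂ), ContDiff ℝ ∞ G' ∧
        ∀ s : Time, L.U p τ (fun w => G w s) = fun w => G' w s := by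
      cases L with
      | Zbar =>
        refine ⟨fun w => (1 / 2 : ℂ) • (fderiv ℝ G w 1 + Complex.I • fderiv ℝ G w Complex.I)
          - ((τ : ℂ) * dzbar (toC p) w) • G w, ?_, fun s => ?_⟩
        · exact (((hf 1).add ((hf _).const_smul _)).const_smul _).sub
            ((contDiff_const.mul c2).smul hG)
        · ext w
          simp only [Letter.U, opWbar, dzbar, he]
          simp
      | Z =>
        refine ⟨fun w => (1 / 2 : ℂ) • (fderiv ℝ G w 1 - Complex.I • fderiv ℝ G w Complex.I)
          + ((τ : ℂ) * dz (toC p) w) • G w, ?_, fun s => ?_⟩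
        · exact (((hf 1).sub ((hf _).const_smul _)).const_smul _).add
            ((contDiff_const.mul c1).smul hG)
        · ext w
          simp only [Letter.U, opW, dz, he]
          simp
    obtain ⟨G₂, h2⟩ := ih hG'
    refine ⟨G₂, fun s => ?_⟩
    change opU p τ α (L.U p τ fun w => G w s) = _
    rw [hG'', h2]

end Words

/-! ### Twisted derivatives and the initial trace -/

section Trace

open SchwartzMap

variable {p : ℂ → ℝ} {Y : ℝ → ℝ → ℂ → ℂ → ℂ} {v : ℂ}

/-- The family `Y s τ ξ w` of kernels is of temperate growth for `s > 0`, and its integrals in `ξ`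
against Schwartz functions `f` extend to `s = 0`, with the value `v f(w)`, as a smooth function of
`(τ, w)` with values in the continuous functions of time. For `v = 1` this says that `Y s τ` tends
to the Dirac kernel, with all derivatives in `(τ, w)`. -/
structure HasTrace (Y : ℝ → ℝ → ℂ → ℂ → ℂ) (v : ℂ) : Prop where
  temperate : ∀ s, 0 < s → Function.HasTemperateGrowth fun q : ℝ × ℂ × ℂ => Y s q.1 q.2.1 q.2.2
  exists_path : ∀ f : 𝓢(ℂ, ℂ), ∃ G : ℝ × ℂ → C(Time, ℂ), ContDiff ℝ ∞ G ∧
    (∀ t w (s : Time), 0 < (s : ℝ) → G (t, w) s = ∫ ξ, f ξ * Y s t ξ w) ∧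
    ∀ t w, G (t, w) 0 = v * f w

lemma deriv_eq_fderiv {F : ℝ → ℂ → ℂ → ℂ}
    (hF : Function.HasTemperateGrowth fun q : ℝ × ℂ × ℂ => F q.1 q.2.1 q.2.2) (q : ℝ × ℂ × ℂ) :
    deriv (fun t => F t q.2.1 q.2.2) q.1
      = fderiv ℝ (fun q : ℝ × ℂ × ℂ => F q.1 q.2.1 q.2.2) q (1, 0) := by
  have h1 : HasFDerivAt (fun q : ℝ × ℂ × ℂ => F q.1 q.2.1 q.2.2)
      (fderiv ℝ (fun q : ℝ × ℂ × ℂ => F q.1 q.2.1 q.2.2) q) (q.1, q.2) :=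
    (hF.1.differentiable (by simp) _).hasFDerivAt
  exact (h1.comp q.1 (hasFDerivAt_prodMk_left q.1 q.2)).hasDerivAt.deriv

lemma hasTemperateGrowth_opM (hpoly : IsRealPolynomial p) {F : ℝ → ℂ → ℂ → ℂ}
    (hF : Function.HasTemperateGrowth fun q : ℝ × ℂ × ℂ => F q.1 q.2.1 q.2.2) :
    Function.HasTemperateGrowth fun q : ℝ × ℂ × ℂ => opM p F q.1 q.2.1 q.2.2 := by
  have hT : Function.HasTemperateGrowth fun q : ℝ × ℂ × ℂ => (twist p q.2.2 q.2.1 : ℂ) :=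
    (hasTemperateGrowth_swap (hasTemperateGrowth_of_mem_polyTensor
      (twist_mem_polyTensor hpoly))).comp (ContinuousLinearMap.snd ℝ ℝ (ℂ × ℂ)).hasTemperateGrowth
  simp only [opM, deriv_eq_fderiv hF]
  exact (hasTemperateGrowth_fderiv_apply hF (1, 0)).sub ((hasTemperateGrowth_const_mul hT _).mul hF)

/-- The slice of a kernel at a fixed second point, with the integration variable last. -/
lemma hasTemperateGrowth_fix {F : ℝ → ℂ → ℂ → ℂ}
    (hF : Function.HasTemperateGrowth fun q : ℝ × ℂ × ℂ => F q.1 q.2.1 q.2.2) :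
    Function.HasTemperateGrowth fun x : (ℝ × ℂ) × ℂ => F x.1.1 x.2 x.1.2 :=
  hF.comp ((((ContinuousLinearMap.fst ℝ ℝ ℂ).comp (ContinuousLinearMap.fst ℝ (ℝ × ℂ) ℂ)).prod
    ((ContinuousLinearMap.snd ℝ (ℝ × ℂ) ℂ).prod
      ((ContinuousLinearMap.snd ℝ ℝ ℂ).comp (ContinuousLinearMap.fst ℝ (ℝ × ℂ) ℂ)))
    : (ℝ × ℂ) × ℂ →L[ℝ] ℝ × ℂ × ℂ)).hasTemperateGrowth

lemma hasTemperateGrowth_fix_time {F : ℝ → ℂ → ℂ → ℂ}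
    (hF : Function.HasTemperateGrowth fun q : ℝ × ℂ × ℂ => F q.1 q.2.1 q.2.2) (τ : ℝ) :
    Function.HasTemperateGrowth fun x : ℂ × ℂ => F τ x.1 x.2 := by
  have h := hasTemperateGrowth_affine (ContinuousLinearMap.inr ℝ ℝ (ℂ × ℂ)) ((τ, 0) : ℝ × ℂ × ℂ)
  have e : (fun x : ℂ × ℂ => F τ x.1 x.2) = (fun q : ℝ × ℂ × ℂ => F q.1 q.2.1 q.2.2) ∘
      fun x => ((τ, 0) : ℝ × ℂ × ℂ) + ContinuousLinearMap.inr ℝ ℝ (ℂ × ℂ) x := by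
    ext x; simp
  rw [e]
  exact hF.comp h

/-- Multiplication of the kernels by a polynomial in both variables. -/
lemma HasTrace.mul_polyTensor (h : HasTrace Y v) {T : ℂ × ℂ → ℂ} (hT : T ∈ polyTensor)
    (f : 𝓢(ℂ, ℂ)) : ∃ G : ℝ × ℂ → C(Time, ℂ), ContDiff ℝ ∞ G ∧
      (∀ t w (s : Time), 0 < (s : ℝ) → G (t, w) s = ∫ ξ, f ξ * (T (w, ξ) * Y s t ξ w)) ∧
      ∀ t w, G (t, w) 0 = T (w, w) * (v * f w) := by
  have hi : ∀ {T : ℂ × ℂ → ℂ}, T ∈ polyTensor → ∀ t w (s : Time), 0 < (s : ℝ) →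
      Integrable fun ξ => f ξ * (T (w, ξ) * Y s t ξ w) := fun {T} hT t w s hs =>
    integrable_mul_temperate f ((hasTemperateGrowth_of_mem_polyTensor hT).mul
      (hasTemperateGrowth_swap (hasTemperateGrowth_fix_time (h.temperate s hs) t))) w
  induction hT using Submodule.span_induction with
  | mem T hT =>
    obtain ⟨k, l, a, b, ha, hb, rfl⟩ := hT
    obtain ⟨G, h1, h2, h3⟩ := h.exists_path (symS b f)
    refine ⟨fun x => a x.2 • G x, ((contDiff_of_mem_Sym ha).comp contDiff_snd).smul h1,
      fun t w s hs => ?_, fun t w => ?_⟩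
    · rw [ContinuousMap.smul_apply, h2 t w s hs, smul_eq_mul, ← integral_const_mul]
      refine integral_congr_ae (Eventually.of_forall fun ξ => ?_)
      simp only
      rw [symS_apply hb]; ring
    · rw [ContinuousMap.smul_apply, h3, symS_apply hb, smul_eq_mul]; ring
  | zero => exact ⟨fun _ => 0, contDiff_const, fun t w s _ => by simp, fun t w => by simp⟩
  | add T T' hT hT' i1 i2 =>
    obtain ⟨G, h1, h2, h3⟩ := i1
    obtain ⟨G', h1', h2', h3'⟩ := i2
    refine ⟨fun x => G x + G' x, h1.add h1', fun t w s hs => ?_, fun t w => ?_⟩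
    · rw [ContinuousMap.add_apply, h2 t w s hs, h2' t w s hs,
        ← integral_add (hi hT t w s hs) (hi hT' t w s hs)]
      refine integral_congr_ae (Eventually.of_forall fun ξ => ?_)
      simp only [Pi.add_apply]; ring
    · rw [ContinuousMap.add_apply, h3, h3', Pi.add_apply]; ring
  | smul c T hT i =>
    obtain ⟨G, h1, h2, h3⟩ := i
    refine ⟨fun x => c • G x, h1.const_smul c, fun t w s hs => ?_, fun t w => ?_⟩
    · rw [ContinuousMap.smul_apply, h2 t w s hs, smul_eq_mul, ← integral_const_mul]
      refine integral_congr_ae (Eventually.of_forall fun ξ => ?_)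
      simp only [Pi.smul_apply, smul_eq_mul]; ring
    · rw [ContinuousMap.smul_apply, h3, Pi.smul_apply, smul_eq_mul, smul_eq_mul]; ring

/-- The twisted derivative of kernels with an initial trace has vanishing initial trace: the
trace `v f(w)` does not depend on `τ`, and the twist vanishes on the diagonal. -/
lemma HasTrace.opM (hpoly : IsRealPolynomial p) (h : HasTrace Y v) :
    HasTrace (fun s => opM p (Y s)) 0 := by
  refine ⟨fun s hs => hasTemperateGrowth_opM hpoly (h.temperate s hs), fun f => ?_⟩
  obtain ⟨G, h1, h2, h3⟩ := h.exists_path f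
  obtain ⟨G', h1', h2', h3'⟩ := h.mul_polyTensor (twist_mem_polyTensor hpoly) f
  have hd : ∀ t w (s : Time), fderiv ℝ G (t, w) (1, 0) s
      = fderiv ℝ (fun x => G x s) (t, w) (1, 0) := fun t w s => by
    have e := (ContinuousMap.evalCLM ℝ s : C(Time, ℂ) →L[ℝ] ℂ).hasFDerivAt.comp (t, w)
      (h1.differentiable (by simp) (t, w)).hasFDerivAt
    exact (DFunLike.congr_fun e.fderiv ((1, 0) : ℝ × ℂ)).symm
  refine ⟨fun x => fderiv ℝ G x (1, 0) - Complex.I • G' x, ?_, fun t w s hs => ?_, fun t w => ?_⟩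
  · exact ((h1.fderiv_right (by simp)).clm_apply contDiff_const).sub (h1'.const_smul _)
  · have hY := h.temperate s hs
    have hF := hasTemperateGrowth_fix hY
    have e1 : (fun x => G x s) = fun x : ℝ × ℂ => ∫ ξ, f ξ * Y s x.1 ξ x.2 :=
      funext fun x => h2 x.1 x.2 s hs
    have e2 : ∀ ξ, deriv (fun t => Y s t ξ w) t
        = fderiv ℝ (fun x : (ℝ × ℂ) × ℂ => Y s x.1.1 x.2 x.1.2) ((t, w), ξ) ((1, 0), 0) := by
      intro ξ
      have k1 := (hF.1.differentiable (by simp) ((t, w), ξ)).hasFDerivAt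
      have k2 : HasFDerivAt (fun t : ℝ => ((t, w), ξ))
          ((ContinuousLinearMap.inl ℝ (ℝ × ℂ) ℂ).comp (ContinuousLinearMap.inl ℝ ℝ ℂ)) t :=
        HasFDerivAt.comp (f := fun t : ℝ => (t, w)) (g := fun x : ℝ × ℂ => (x, ξ)) t
          (hasFDerivAt_prodMk_left (t, w) ξ) (hasFDerivAt_prodMk_left t w)
      exact (HasFDerivAt.comp t k1 k2).hasDerivAt.deriv
    rw [ContinuousMap.sub_apply, ContinuousMap.smul_apply, hd, e1, h2' t w s hs,
      fderiv_integral_temperate f hF, smul_eq_mul, ← integral_const_mul, ← integral_sub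
        (integrable_mul_temperate f (hasTemperateGrowth_fderiv_apply hF ((1, 0), 0)) (t, w))]
    · refine integral_congr_ae (Eventually.of_forall fun ξ => ?_)
      simp only [WeightedHeat.opM, e2]
      ring
    · exact (integrable_mul_temperate f
        ((hasTemperateGrowth_of_mem_polyTensor (twist_mem_polyTensor hpoly)).mul
          (hasTemperateGrowth_swap (hasTemperateGrowth_fix_time hY t))) w).const_mul _
  · have e1 : (fun x => G x 0) = fun x : ℝ × ℂ => v * f x.2 := funext fun x => h3 x.1 x.2
    have e2 : fderiv ℝ (fun x : ℝ × ℂ => v * f x.2) (t, w) (1, 0) = 0 := by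
      have k : HasFDerivAt (fun w => v * f w) (fderiv ℝ (fun w => v * f w) w) (t, w).2 :=
        (f.differentiableAt.const_mul v).hasFDerivAt
      have := (k.comp (t, w) hasFDerivAt_snd).fderiv
      refine (DFunLike.congr_fun this ((1, 0) : ℝ × ℂ)).trans ?_
      simp
    rw [ContinuousMap.sub_apply, ContinuousMap.smul_apply, hd, e1, e2, h3', twist_self]
    simp

lemma hasTrace_iterate_opM (hpoly : IsRealPolynomial p) (h : HasTrace Y v) {n : ℕ} (hn : 1 ≤ n) :
    HasTrace (fun s => (WeightedHeat.opM p)^[n] (Y s)) 0 := by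
  induction n, hn using Nat.le_induction with
  | base => exact h.opM hpoly
  | succ n _ ih =>
    simp only [Function.iterate_succ_apply']
    exact ih.opM hpoly

lemma IsKernelFamily.hasTrace {K : ℝ → ℝ → ℂ → ℂ → ℂ} (hpoly : IsRealPolynomial p)
    (hK : IsKernelFamily p K) : HasTrace (fun s t => K t s) 1 := by
  refine ⟨hK.temperate, fun f => ?_⟩
  obtain ⟨G, h1, h2, h3⟩ := WeightedHeat.exists_path hpoly hK f
  exact ⟨G, h1, h2, fun t w => by rw [h3, one_mul]⟩

/-- The integrals of `U^α_w X^β_ξ Y` against a Schwartz function converge absolutely, and tend to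
zero with time if the initial trace of `Y` vanishes. -/
lemma HasTrace.tendsto_integral (hpoly : IsRealPolynomial p) (h : HasTrace Y 0) (τ : ℝ)
    (α β : List Letter) (f : 𝓢(ℂ, ℂ)) (w : ℂ) :
    (∀ s, 0 < s → Integrable fun ξ =>
      f ξ * opU p τ α (fun w' => opX p τ β (fun ξ' => Y s τ ξ' w') ξ) w) ∧
    Tendsto (fun s => ∫ ξ, f ξ * opU p τ α (fun w' => opX p τ β (fun ξ' => Y s τ ξ' w') ξ) w)
      (𝓝[>] 0) (𝓝 0) := by
  have hX : ∀ s, 0 < s → Function.HasTemperateGrowth fun x : ℂ × ℂ =>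
      opX p τ β (fun ξ' => Y s τ ξ' x.2) x.1 := fun s hs =>
    hasTemperateGrowth_opX hpoly τ β (hasTemperateGrowth_fix_time (h.temperate s hs) τ)
  refine ⟨fun s hs => (opU_integral hpoly τ α f (hX s hs) w).1, ?_⟩
  -- `X^β` is moved to `f` by parts, and `U^α` is applied to the resulting path of functions of `w`
  obtain ⟨g, hg⟩ := exists_schwartz_opU hpoly τ β f
  obtain ⟨G, h1, h2, h3⟩ := h.exists_path g
  obtain ⟨G', hG'⟩ := exists_opU_path hpoly τ α (G := fun w => ((-1) ^ β.length : ℂ) • G (τ, w))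
    ((h1.comp (contDiff_const.prodMk contDiff_id)).const_smul _)
  have e0 : G' w 0 = 0 := by
    have := congrFun (hG' 0) w
    simp only [ContinuousMap.smul_apply, h3, zero_mul, smul_zero] at this
    rw [← this, opU_zero]
  have e1 : ∀ s : ℝ, ∀ hs : s ∈ Set.Ioc (0 : ℝ) 1,
      ∫ ξ, f ξ * opU p τ α (fun w' => opX p τ β (fun ξ' => Y s τ ξ' w') ξ) w
        = Set.IccExtend zero_le_one (G' w) s := fun s hs => by
    refine ((opU_integral hpoly τ α f (hX s hs.1) w).2).trans ?_
    rw [Set.IccExtend_of_mem _ _ ⟨hs.1.le, hs.2⟩,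
      ← congrFun (hG' (⟨s, hs.1.le, hs.2⟩ : Set.Icc (0 : ℝ) 1)) w]
    congr 1
    ext w'
    refine (hg (fun x => Y s τ x.1 x.2)
      (hasTemperateGrowth_fix_time (h.temperate s hs.1) τ) w').trans ?_
    rw [ContinuousMap.smul_apply, smul_eq_mul, h2 τ w' ⟨s, hs.1.le, hs.2⟩ hs.1]
  have hc : Continuous (Set.IccExtend (zero_le_one' ℝ) (G' w)) := (G' w).continuous.Icc_extend'
  have hl := (hc.tendsto 0).mono_left (nhdsWithin_le_nhds (s := Set.Ioi 0))
  have e2 : Set.IccExtend (zero_le_one' ℝ) (G' w) 0 = 0 := by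
    rw [Set.IccExtend_of_mem _ _ ⟨le_rfl, zero_le_one⟩]; exact e0
  rw [e2] at hl
  refine hl.congr' ?_
  filter_upwards [Ioc_mem_nhdsGT (zero_lt_one' ℝ)] with s hs using (e1 s hs).symm

end Trace

end WeightedHeat

theorem mainTheorem9 (p : ℂ → ℝ) (hpoly : WeightedHeat.IsRealPolynomial p)
    (hsub : WeightedHeat.IsSubharmonic p)
    (hnonharm : ¬ InnerProductSpace.HarmonicOnNhd p Set.univ) :
    (∀ τ : ℝ, WeightedHeat.IsHeatKernel p τ (WeightedHeat.heatKernel p τ)) ∧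
    ContDiffOn ℝ ∞
      (fun q : ℝ × ℝ × ℂ × ℂ => WeightedHeat.heatKernel p q.1 q.2.1 q.2.2.1 q.2.2.2)
      {q | 0 < q.2.1} ∧
    ∀ (τ : ℝ) (n : ℕ), 1 ≤ n → ∀ (α β : List WeightedHeat.Letter) (s : ℝ), 0 < s → ∀ z w : ℂ,
      (∀ ε : ℝ, 0 < ε →
        Integrable (fun ξ => WeightedHeat.limitIntegrand p τ n α β s z w ε ξ)) ∧
      Tendsto (fun ε : ℝ => ∫ ξ, WeightedHeat.limitIntegrand p τ n α β s z w ε ξ) (𝓝[>] 0)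
        (𝓝 ((-1) ^ β.length *
          WeightedHeat.opU p τ α (fun w' => WeightedHeat.limitBracket p τ n β s z w' w') w)) := by
  have hK := WeightedHeat.isKernelFamily_heatKernel hpoly
  refine ⟨fun τ => hK.isHeatKernel τ, hK.contDiffOn, fun τ n hn α β s hs z w => ?_⟩
  obtain ⟨f, hf⟩ := hK.schwartz_right (τ := τ) hs z
  obtain ⟨h1, h2⟩ := (WeightedHeat.hasTrace_iterate_opM hpoly
    (hK.hasTrace hpoly) hn).tendsto_integral hpoly τ α β f w
  simp only [hf] at h1 h2
  -- `r` vanishes on the diagonal and `n ≥ 1`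
  have e : (fun w' => WeightedHeat.limitBracket p τ n β s z w' w') = fun _ => 0 := by
    ext w'
    rw [WeightedHeat.limitBracket, WeightedHeat.twistError_self, Complex.ofReal_zero,
      zero_pow (by omega), zero_mul]
  rw [e, WeightedHeat.opU_zero, mul_zero]
  exact ⟨h1, h2⟩
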